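/- Let $T=(V,E)$ be a tree on $n\ge 1$ nodes with edge lengths $c\colon E\to\mathbb R_{\ge 0}$ and node weights $w\colon V\to\mathbb R_{\ge 0}$. A \emph{point} of $T$ is a node or an interior point of an edge, and $d$ denotes the distance in $T$ (the length of the unique path between two points); for a finite non-empty set $S$ of points put $d(u,S)=\min_{s\in S}d(u,s)$. For finite non-empty sets $X,Y$ of points let $$w(Y\prec X)=\sum\{\,w(u) : u\in V,\ d(u,Y)<d(u,X)\,\}.$$ Given a set $X$ of points of $T$, presented as a list of $p$ points with $1\le p\le n$, the \emph{discrete} $(1,X)$-medianoid problem asks for a node $y$ that maximizes $w(\{y\}\prec X)$ among all nodes, and the \emph{absolute} $(1,X)$-medianoid problem asks for a point $y$ (a node or an interior point of an edge) that maximizes $w(\{y\}\prec X)$ among all points of $T$. The points of $X$ may in both problems be nodes or interior points of edges. The discrete and the absolute $(1,X)$-medianoid problems on trees can both be solved in $O(n\log n)$ time. That is, for each of the two problems there are a single program of a real-number RAM and a function $t\colon\mathbb N\to\mathbb N$ with $t(n)=O(n\log n)$ as $n\to\infty$, such that, on every tree with $n$ nodes and every such list $X$, the program halts after at most $t(n)$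 steps and outputs an optimal location $y$ together with its value $w(\{y\}\prec X)$. Here the machine has finitely many variables and arrays of natural numbers (used as counters and addresses) and of real numbers. Each of the following takes one step: reading a constant or a variable, reading or writing a memory cell, the operations $+$, $-$ (truncated at $0$) and $\lfloor\cdot/2\rfloor$ on natural numbers, the operations $+,-,\times,/$ on real numbers, a comparison of two naturals or of two reals, and a branch. The input consists of $n$, $p$, the list of the $n-1$ edges (end nodes and lengths), the node weights, and the list of the points of $X$ (a node, or an edge together with the distance from its first end node). -/

import Mathlib

/-!
A real-number RAM, presented as a small structured programming language with a unit-cost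
step count, and the medianoid problem on edge- and node-weighted trees.
-/

namespace RealRAM

/-- The memory of the machine. Every program mentions only finitely many variables and arrays.
Index cells hold natural numbers, which serve as addresses and counters; real cells hold real
numbers. There is no conversion between the two sorts. -/
structure Store where
  idx : ℕ → ℕ
  real : ℕ → ℝ
  idxArr : ℕ → ℕ → ℕ
  realArr : ℕ → ℕ → ℝ

/-- Index expressions: literals, variables, memory access, `+`, truncated `-`, and halving. -/
inductive IExp where
  | lit (k : ℕ)
  | var (x : ℕ)
  | read (a : ℕ) (i : IExp)
  | add (e f : IExp)
  | sub (e f : IExp)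
  | half (e : IExp)

/-- Real expressions: literals, variables, memory access, and the operations `+ - * /`. -/
inductive RExp where
  | lit (k : ℕ)
  | var (x : ℕ)
  | read (a : ℕ) (i : IExp)
  | add (e f : RExp)
  | sub (e f : RExp)
  | mul (e f : RExp)
  | div (e f : RExp)

/-- Tests: comparisons of indices, comparisons of reals, and their Boolean combinations. -/
inductive Test where
  | idxLt (e f : IExp)
  | idxEq (e f : IExp)
  | realLt (e f : RExp)
  | realEq (e f : RExp)
  | not (b : Test)
  | and (b c : Test)

/-- Programs. -/
inductive Cmd where
  | skip
  | setIdx (x : ℕ) (e : IExp)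
  | setReal (x : ℕ) (e : RExp)
  | writeIdx (a : ℕ) (i : IExp) (e : IExp)
  | writeReal (a : ℕ) (i : IExp) (e : RExp)
  | seq (c d : Cmd)
  | ite (b : Test) (c d : Cmd)
  | loop (b : Test) (c : Cmd)

/-- The value of an index expression. -/
def IExp.eval (σ : Store) : IExp → ℕ
  | .lit k => k
  | .var x => σ.idx x
  | .read a i => σ.idxArr a (i.eval σ)
  | .add e f => e.eval σ + f.eval σ
  | .sub e f => e.eval σ - f.eval σ
  | .half e => e.eval σ / 2

/-- The number of elementary operations performed by evaluating an index expression. -/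
def IExp.cost : IExp → ℕ
  | .lit _ => 1
  | .var _ => 1
  | .read _ i => i.cost + 1
  | .add e f => e.cost + f.cost + 1
  | .sub e f => e.cost + f.cost + 1
  | .half e => e.cost + 1

/-- The value of a real expression. (Division by zero returns zero; a program can exclude this
case by a test.) -/
noncomputable def RExp.eval (σ : Store) : RExp → ℝ
  | .lit k => (k : ℝ)
  | .var x => σ.real x
  | .read a i => σ.realArr a (i.eval σ)
  | .add e f => e.eval σ + f.eval σ
  | .sub e f => e.eval σ - f.eval σ
  | .mul e f => e.eval σ * f.eval σ
  | .div e f => e.eval σ / f.eval σ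

/-- The number of elementary operations performed by evaluating a real expression. -/
def RExp.cost : RExp → ℕ
  | .lit _ => 1
  | .var _ => 1
  | .read _ i => i.cost + 1
  | .add e f => e.cost + f.cost + 1
  | .sub e f => e.cost + f.cost + 1
  | .mul e f => e.cost + f.cost + 1
  | .div e f => e.cost + f.cost + 1

/-- The test `b` succeeds in the store `σ`. -/
def Test.Holds (σ : Store) : Test → Prop
  | .idxLt e f => e.eval σ < f.eval σ
  | .idxEq e f => e.eval σ = f.eval σ
  | .realLt e f => e.eval σ < f.eval σ
  | .realEq e f => e.eval σ = f.eval σ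
  | .not b => ¬ b.Holds σ
  | .and b c => b.Holds σ ∧ c.Holds σ

/-- The number of elementary operations performed by a test. -/
def Test.cost : Test → ℕ
  | .idxLt e f => e.cost + f.cost + 1
  | .idxEq e f => e.cost + f.cost + 1
  | .realLt e f => e.cost + f.cost + 1
  | .realEq e f => e.cost + f.cost + 1
  | .not b => b.cost + 1
  | .and b c => b.cost + c.cost + 1

/-- `Exec c σ t τ`: started in the store `σ`, the program `c` halts after exactly `t` steps, in
the store `τ`. Each elementary operation, memory access, write and branch counts as one step. -/
inductive Exec : Cmd → Store → ℕ → Store → Prop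
  | skip (σ : Store) : Exec .skip σ 1 σ
  | setIdx (σ : Store) (x : ℕ) (e : IExp) :
      Exec (.setIdx x e) σ (e.cost + 1)
        { σ with idx := Function.update σ.idx x (e.eval σ) }
  | setReal (σ : Store) (x : ℕ) (e : RExp) :
      Exec (.setReal x e) σ (e.cost + 1)
        { σ with real := Function.update σ.real x (e.eval σ) }
  | writeIdx (σ : Store) (a : ℕ) (i e : IExp) :
      Exec (.writeIdx a i e) σ (i.cost + e.cost + 1)
        { σ with idxArr :=
            Function.update σ.idxArr a (Function.update (σ.idxArr a) (i.eval σ) (e.eval σ)) }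
  | writeReal (σ : Store) (a : ℕ) (i : IExp) (e : RExp) :
      Exec (.writeReal a i e) σ (i.cost + e.cost + 1)
        { σ with realArr :=
            Function.update σ.realArr a (Function.update (σ.realArr a) (i.eval σ) (e.eval σ)) }
  | seq {c d : Cmd} {σ τ υ : Store} {s t : ℕ} :
      Exec c σ s τ → Exec d τ t υ → Exec (.seq c d) σ (s + t) υ
  | iteTrue {b : Test} {c d : Cmd} {σ τ : Store} {t : ℕ} :
      b.Holds σ → Exec c σ t τ → Exec (.ite b c d) σ (b.cost + 1 + t) τ
  | iteFalse {b : Test} {c d : Cmd} {σ τ : Store} {t : ℕ} :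
      ¬ b.Holds σ → Exec d σ t τ → Exec (.ite b c d) σ (b.cost + 1 + t) τ
  | loopDone {b : Test} {c : Cmd} {σ : Store} :
      ¬ b.Holds σ → Exec (.loop b c) σ (b.cost + 1) σ
  | loopStep {b : Test} {c : Cmd} {σ τ υ : Store} {s t : ℕ} :
      b.Holds σ → Exec c σ s τ → Exec (.loop b c) τ t υ →
        Exec (.loop b c) σ (b.cost + 1 + s + t) υ

end RealRAM

namespace TreeLocation

/-- The simple graph on the nodes `0, …, n - 1` given by a list of node pairs. -/
def edgeListGraph {n m : ℕ} (src dst : Fin m → Fin n) : SimpleGraph (Fin n) :=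
  SimpleGraph.fromEdgeSet (Set.range fun e => s(src e, dst e))

/-- A tree on `n` nodes with non-negative edge lengths and non-negative node weights, given by
the list of its `n - 1` edges. (As the graph is a tree, the listed pairs are automatically
pairwise distinct as unordered pairs, and none of them is a loop.) -/
structure WeightedTree (n : ℕ) where
  src : Fin (n - 1) → Fin n
  dst : Fin (n - 1) → Fin n
  isTree : (edgeListGraph src dst).IsTree
  len : Fin (n - 1) → ℝ
  len_nonneg : ∀ e, 0 ≤ len e
  weight : Fin n → ℝ
  weight_nonneg : ∀ u, 0 ≤ weight u

namespace WeightedTree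

variable {n : ℕ} (T : WeightedTree n)

def graph : SimpleGraph (Fin n) := edgeListGraph T.src T.dst

/-- The unique path between two nodes. -/
noncomputable def path (u v : Fin n) : T.graph.Walk u v :=
  (SimpleGraph.IsTree.existsUnique_path T.isTree u v).choose

/-- The distance of two nodes: the total length of the edges on the path between them. -/
noncomputable def dist (u v : Fin n) : ℝ :=
  ∑ e : Fin (n - 1), if s(T.src e, T.dst e) ∈ (T.path u v).edges then T.len e else 0

/-- The points of the tree: its nodes, and the interior points of its edges. The point
`inner e t` lies on the edge `e` at distance `t` from the end node `T.src e`. -/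
inductive Point (T : WeightedTree n) : Type where
  | node (v : Fin n)
  | inner (e : Fin (n - 1)) (t : ℝ) (pos : 0 < t) (lt : t < T.len e)

/-- The distance of a node from a point. -/
noncomputable def pointDist (u : Fin n) : T.Point → ℝ
  | .node v => T.dist u v
  | .inner e t _ _ => min (T.dist u (T.src e) + t) (T.dist u (T.dst e) + (T.len e - t))

/-- The distance `d(u, S)` of a node from a (finite, non-empty) set of points. -/
noncomputable def setDist (u : Fin n) (S : Set T.Point) : ℝ :=
  sInf (T.pointDist u '' S)

open Classical in
/-- `w(Y ≺ X)`: the total weight of the nodes that are closer to `Y` than to `X`. -/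
noncomputable def gain (Y X : Set T.Point) : ℝ :=
  ∑ u : Fin n, if T.setDist u Y < T.setDist u X then T.weight u else 0

/-- `Y` is an optimal solution of the `(r, X)`-medianoid problem in which the points of `Y`
have to be chosen from the set `C` of candidate locations. -/
def IsMedianoid (C : Set T.Point) (r : ℕ) (X Y : Set T.Point) : Prop :=
  (Y ⊆ C ∧ Y.encard = r) ∧
    ∀ Y' : Set T.Point, Y' ⊆ C → Y'.encard = r → T.gain Y' X ≤ T.gain Y X

/-- Discrete problem: the candidate locations are the nodes. -/
def IsDiscreteMedianoid (r : ℕ) (X Y : Set T.Point) : Prop :=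
  T.IsMedianoid (Set.range Point.node) r X Y

/-- Absolute problem: the candidate locations are all nodes and interior points of edges. -/
def IsAbsoluteMedianoid (r : ℕ) (X Y : Set T.Point) : Prop :=
  T.IsMedianoid Set.univ r X Y

variable {T}

/-- A point is represented by a natural number and a real number: the node `v` by `(v, 0)`, and
the interior point at offset `t` on the edge `e` by `(n + e, t)`. -/
def Point.code : T.Point → ℕ
  | .node v => v
  | .inner e _ _ _ => n + e

/-- The real component of the representation of a point. -/
def Point.offset : T.Point → ℝ
  | .node _ => 0
  | .inner _ t _ _ => t

variable (T)

/-- The initial memory for the tree `T` and the points `x 0, …, x (p - 1)`: index variables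
`0` and `1` hold `n` and `p`; index arrays `0`, `1` hold the end nodes of the edges and real
array `0` their lengths; real array `1` holds the node weights; index array `2` and real array
`2` hold the representations of the points. All other cells are zero. -/
noncomputable def input {p : ℕ} (x : Fin p → T.Point) : RealRAM.Store where
  idx k := if k = 0 then n else if k = 1 then p else 0
  real _ := 0
  idxArr a i :=
    if a = 0 then (if h : i < n - 1 then (T.src ⟨i, h⟩ : ℕ) else 0)
    else if a = 1 then (if h : i < n - 1 then (T.dst ⟨i, h⟩ : ℕ) else 0)
    else if a = 2 then (if h : i < p then (x ⟨i, h⟩).code else 0)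
    else 0
  realArr a i :=
    if a = 0 then (if h : i < n - 1 then T.len ⟨i, h⟩ else 0)
    else if a = 1 then (if h : i < n then T.weight ⟨i, h⟩ else 0)
    else if a = 2 then (if h : i < p then (x ⟨i, h⟩).offset else 0)
    else 0

/-- The final memory `τ` reports the location `y` (in index variable `0` and real variable `0`)
and the value `g` (in real variable `1`). -/
def Reports (τ : RealRAM.Store) (y : T.Point) (g : ℝ) : Prop :=
  τ.idx 0 = y.code ∧ τ.real 0 = y.offset ∧ τ.real 1 = g

end WeightedTree

/-- The program `c` solves the `(1, X)`-medianoid problem on trees, with optimality of a solution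
understood as `Opt`, in at most `time n` steps: for every tree on `n` nodes and every non-empty
set `X` of points, given by a list of at most `n` points, it halts within this number of steps
and reports an optimal location `y` together with its value `w({y} ≺ X)`. -/
def SolvesMedianoid
    (Opt : ∀ {n : ℕ} (T : WeightedTree n), ℕ → Set T.Point → Set T.Point → Prop)
    (c : RealRAM.Cmd) (time : ℕ → ℕ) : Prop :=
  ∀ (n p : ℕ) (T : WeightedTree n) (x : Fin p → T.Point), 1 ≤ p → p ≤ n →
    ∃ (t : ℕ) (τ : RealRAM.Store) (y : T.Point),
      RealRAM.Exec c (T.input x) t τ ∧ t ≤ time n ∧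
      T.Reports τ y (T.gain {y} (Set.range x)) ∧ Opt T 1 (Set.range x) {y}

end TreeLocation

/-! Root the tree at the node `0` and let `r v` be the distance of the node `v` from `X`. A location
`y` wins the node `v` if `d v y < r v`, and its value is the total weight of the nodes won. It
suffices to find `n` candidates among which there is an optimal location, and to evaluate all of
them in time `O(n log n)`.

Candidates. In the discrete problem they are the nodes. In the absolute problem each node `u`
contributes the highest location on its path to the root that is still closer to `u` than `r u`. As
the inequality is strict, such a location lies infinitesimally below a point at height `H` above a
node `a`; its position is an element of `Lex (ℝ × ℝ)`. Given any location `y`, choose `u` among the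
nodes that it wins with `d u 0 - r u` maximal, so that the upward reach of `u` ends lowest. Moving
`y` up to the candidate of `u` loses no won node: nodes below the candidate reach at least as high
as `u` does, and all others come closer (`RootedMetric.exists_candidate`). In the end the
infinitesimal is replaced by a real number smaller than every positive slack (`locDist_lt_of_wins`).

Evaluation. The candidate `(a, H)` wins `v` if `d a v ± H - r v < 0`, where the sign depends on
whether `v` lies below `a`. This is a sum of a distance, a term of the candidate and a term of the
node, called the pair key. If an edge separates the two, the pair key splits into a function of the
one and a function of the other (`RootedMetric.pairKey_eq`), so the pairs across an edge are
accounted for by one sweep over two sorted lists (`ListCmd.sweep_runs`).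

The edges are processed by tree contraction. The candidates are inserted as copies of nodes into a
binary tree with `3 * n` nodes (`Binary`). Every contracted cluster carries its items in the order
of the keys with respect to its own node and in that with respect to the parent. Raking a leaf into
its parent, or compressing a parent with a single child into that child, changes the reference node
by a constant offset for each of the merged clusters, so the new orders arise by merging
(`Conf.Valid.rake`, `Conf.Valid.compress`). A maximal family of contractions, none of which uses the
result of another, costs linear time and leaves at most `12 / 13` of the nodes
(`Conf.Valid.card_le_of_exhausted`). Hence there are `O(log n)` rounds
(`ContractCmd.contract_runs`).

Preparation. The tree is rooted by eliminating leaves, the distances `r v` arise from relaxing all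
edges upwards and then downwards, and the candidates are found by binary lifting in `O(n log n)`
steps.

The programs are verified with Hoare-style rules for `Runs`, weakest preconditions of loop-free
code, and a frame property for everything to which a program does not assign. -/

namespace RealRAM

/-! ### Verification rules for programs of the machine -/

namespace Store

/-- Assignment to an index variable. -/
def setI (σ : Store) (x v : ℕ) : Store := { σ with idx := Function.update σ.idx x v }

/-- Assignment to a real variable. -/
noncomputable def setR (σ : Store) (x : ℕ) (v : ℝ) : Store :=
  { σ with real := Function.update σ.real x v }

/-- Writing a cell of an index array. -/
def setIA (σ : Store) (a i v : ℕ) : Store :=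
  { σ with idxArr := Function.update σ.idxArr a (Function.update (σ.idxArr a) i v) }

/-- Writing a cell of a real array. -/
noncomputable def setRA (σ : Store) (a i : ℕ) (v : ℝ) : Store :=
  { σ with realArr := Function.update σ.realArr a (Function.update (σ.realArr a) i v) }

variable (σ : Store) (x a i y v : ℕ) (w : ℝ)

@[simp] theorem setI_idx : (σ.setI x v).idx y = if y = x then v else σ.idx y := by
  simp [setI, Function.update_apply]
@[simp] theorem setI_real : (σ.setI x v).real = σ.real := rfl
@[simp] theorem setI_idxArr : (σ.setI x v).idxArr = σ.idxArr := rfl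
@[simp] theorem setI_realArr : (σ.setI x v).realArr = σ.realArr := rfl
@[simp] theorem setR_idx : (σ.setR x w).idx = σ.idx := rfl
@[simp] theorem setR_real : (σ.setR x w).real y = if y = x then w else σ.real y := by
  simp [setR, Function.update_apply]
@[simp] theorem setR_idxArr : (σ.setR x w).idxArr = σ.idxArr := rfl
@[simp] theorem setR_realArr : (σ.setR x w).realArr = σ.realArr := rfl
@[simp] theorem setIA_idx : (σ.setIA a i v).idx = σ.idx := rfl
@[simp] theorem setIA_real : (σ.setIA a i v).real = σ.real := rfl
@[simp] theorem setIA_idxArr : (σ.setIA a i v).idxArr y =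
    if y = a then Function.update (σ.idxArr a) i v else σ.idxArr y := by
  simp [setIA, Function.update_apply]
@[simp] theorem setIA_realArr : (σ.setIA a i v).realArr = σ.realArr := rfl
@[simp] theorem setRA_idx : (σ.setRA a i w).idx = σ.idx := rfl
@[simp] theorem setRA_real : (σ.setRA a i w).real = σ.real := rfl
@[simp] theorem setRA_idxArr : (σ.setRA a i w).idxArr = σ.idxArr := rfl
@[simp] theorem setRA_realArr : (σ.setRA a i w).realArr y =
    if y = a then Function.update (σ.realArr a) i w else σ.realArr y := by
  simp [setRA, Function.update_apply]

end Store

infixr:35 " ;; " => Cmd.seq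

/-- Started in `σ`, the program halts within `t` steps in a store that satisfies `Q`. -/
def Runs (c : Cmd) (σ : Store) (t : ℕ) (Q : Store → Prop) : Prop :=
  ∃ s τ, Exec c σ s τ ∧ s ≤ t ∧ Q τ

theorem Runs.mono {c : Cmd} {σ : Store} {t t' : ℕ} {Q Q' : Store → Prop} (h : Runs c σ t Q)
    (ht : t ≤ t') (hQ : ∀ τ, Q τ → Q' τ) : Runs c σ t' Q' := by
  obtain ⟨s, τ, h1, h2, h3⟩ := h
  exact ⟨s, τ, h1, h2.trans ht, hQ _ h3⟩

theorem Runs.seq {c d : Cmd} {σ : Store} {t t' : ℕ} {Q R : Store → Prop} (h : Runs c σ t R)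
    (h' : ∀ τ, R τ → Runs d τ t' Q) : Runs (c ;; d) σ (t + t') Q := by
  obtain ⟨s, τ, h1, h2, h3⟩ := h
  obtain ⟨s', υ, h4, h5, h6⟩ := h' τ h3
  exact ⟨s + s', υ, Exec.seq h1 h4, by omega, h6⟩

theorem Runs.ite {b : Test} {c d : Cmd} {σ : Store} {t : ℕ} {Q : Store → Prop}
    (h : b.Holds σ → Runs c σ t Q) (h' : ¬ b.Holds σ → Runs d σ t Q) :
    Runs (.ite b c d) σ (b.cost + 1 + t) Q := by
  by_cases hb : b.Holds σ
  · obtain ⟨s, τ, h1, h2, h3⟩ := h hb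
    exact ⟨_, τ, Exec.iteTrue hb h1, by omega, h3⟩
  · obtain ⟨s, τ, h1, h2, h3⟩ := h' hb
    exact ⟨_, τ, Exec.iteFalse hb h1, by omega, h3⟩

/-- The loop rule; the potential `Φ` of the ghost state bounds the remaining running time. -/
theorem Runs.loop {G : Type*} {b : Test} {c : Cmd} (I : G → Store → Prop) (Φ : G → ℕ)
    (step : ∀ g σ, I g σ → b.Holds σ →
      ∃ t, Runs c σ t fun τ => ∃ g', I g' τ ∧ Φ g' + t + b.cost + 1 ≤ Φ g) :
    ∀ g σ, I g σ → Runs (.loop b c) σ (Φ g + b.cost + 1) fun τ => ∃ g', I g' τ ∧ ¬ b.Holds τ := by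
  intro g
  induction hn : Φ g using Nat.strong_induction_on generalizing g with
  | _ n ih =>
    intro σ hI
    subst hn
    by_cases hb : b.Holds σ
    · obtain ⟨t, s, τ, h1, h2, g', h3, h4⟩ := step g σ hI hb
      obtain ⟨s', υ, h5, h6, h7⟩ := ih (Φ g') (by omega) g' rfl τ h3
      exact ⟨_, υ, Exec.loopStep hb h1 h5, by omega, h7⟩
    · exact ⟨_, σ, Exec.loopDone hb, by omega, g, hI, hb⟩

/-- The loop rule with a uniform bound for the body. -/
theorem Runs.loop_const {G : Type*} {b : Test} {c : Cmd} (I : G → Store → Prop) (μ : G → ℕ)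
    (T : ℕ) (step : ∀ g σ, I g σ → b.Holds σ →
      Runs c σ T fun τ => ∃ g', I g' τ ∧ μ g' < μ g) (g : G) (σ : Store) (h : I g σ) :
    Runs (.loop b c) σ ((T + b.cost + 1) * μ g + b.cost + 1)
      fun τ => ∃ g', I g' τ ∧ ¬ b.Holds τ := by
  refine Runs.loop I (fun g => (T + b.cost + 1) * μ g) (fun g σ hI hb => ⟨T, ?_⟩) g σ h
  refine (step g σ hI hb).mono le_rfl fun τ ⟨g', h1, h2⟩ => ⟨g', h1, ?_⟩
  calc (T + b.cost + 1) * μ g' + T + b.cost + 1 = (T + b.cost + 1) * (μ g' + 1) := by ring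
    _ ≤ _ := Nat.mul_le_mul_left _ h2

/-- The weakest precondition of a loop-free program. -/
def Cmd.wp : Cmd → (Store → Prop) → Store → Prop
  | .skip, Q, σ => Q σ
  | .setIdx x e, Q, σ => Q (σ.setI x (e.eval σ))
  | .setReal x e, Q, σ => Q (σ.setR x (e.eval σ))
  | .writeIdx a i e, Q, σ => Q (σ.setIA a (i.eval σ) (e.eval σ))
  | .writeReal a i e, Q, σ => Q (σ.setRA a (i.eval σ) (e.eval σ))
  | .seq c d, Q, σ => c.wp (d.wp Q) σ
  | .ite b c d, Q, σ => (b.Holds σ → c.wp Q σ) ∧ (¬ b.Holds σ → d.wp Q σ)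
  | .loop _ _, _, _ => False

/-- A bound for the running time of a loop-free program. -/
def Cmd.bound : Cmd → ℕ
  | .skip => 1
  | .setIdx _ e => e.cost + 1
  | .setReal _ e => e.cost + 1
  | .writeIdx _ i e => i.cost + e.cost + 1
  | .writeReal _ i e => i.cost + e.cost + 1
  | .seq c d => c.bound + d.bound
  -- The sum of both branches instead of the maximum: cruder, but free of case distinctions.
  | .ite b c d => b.cost + 1 + (c.bound + d.bound)
  -- Immaterial, since `Cmd.wp` is `False` for loops.
  | .loop _ _ => 0

/-- Loop-free code is verified by symbolic execution: `simp` unfolds `wp`, and the time bound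
becomes arithmetic with the computable number `bound`. -/
theorem Runs.of_wp {c : Cmd} : ∀ {σ : Store} {Q : Store → Prop}, c.wp Q σ →
    Runs c σ c.bound Q := by
  induction c with
  | skip => exact fun {σ Q} h => ⟨1, σ, Exec.skip σ, le_rfl, h⟩
  | setIdx x e => exact fun {σ Q} h => ⟨_, _, Exec.setIdx σ x e, le_rfl, h⟩
  | setReal x e => exact fun {σ Q} h => ⟨_, _, Exec.setReal σ x e, le_rfl, h⟩
  | writeIdx a i e => exact fun {σ Q} h => ⟨_, _, Exec.writeIdx σ a i e, le_rfl, h⟩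
  | writeReal a i e => exact fun {σ Q} h => ⟨_, _, Exec.writeReal σ a i e, le_rfl, h⟩
  | seq c d hc hd => exact fun {σ Q} h => (hc h).seq fun τ hτ => hd hτ
  | ite b c d hc hd =>
    exact fun {σ Q} h => Runs.ite (fun hb => (hc (h.1 hb)).mono (by omega) fun _ => id)
      fun hb => (hd (h.2 hb)).mono (by omega) fun _ => id
  | loop b c => exact fun {σ Q} h => h.elim

theorem Runs.of_wp' {c : Cmd} {σ : Store} {Q : Store → Prop} {t : ℕ} (h : c.wp Q σ)
    (ht : c.bound ≤ t) : Runs c σ t Q :=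
  (Runs.of_wp h).mono ht fun _ => id

theorem Runs.wp_seq {c d : Cmd} {σ : Store} {Q : Store → Prop} {t s : ℕ}
    (h : c.wp (fun τ => Runs d τ t Q) σ) (hs : c.bound ≤ s) : Runs (c ;; d) σ (s + t) Q :=
  (Runs.of_wp' h hs).seq fun _ => id

/-- Run the body for `x = 0, 1, …, m - 1`. -/
def Cmd.forUp (x : ℕ) (m : IExp) (c : Cmd) : Cmd :=
  .setIdx x (.lit 0) ;;
    .loop (.idxLt (.var x) m) (c ;; .setIdx x (.add (.var x) (.lit 1)))

/-- Run the body for `x = m - 1, …, 1, 0`. -/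
def Cmd.forDown (x : ℕ) (m : IExp) (c : Cmd) : Cmd :=
  .setIdx x m ;;
    .loop (.idxLt (.lit 0) (.var x)) (.setIdx x (.sub (.var x) (.lit 1)) ;; c)

/-- `m` is evaluated anew before every round, so `hm` demands that the invariant fixes its value.
The body has to leave the counter at `k`; `I (k + 1)` refers to the store after the increment. The
factor `M + 1` also pays for the initialization and the last test. -/
theorem Runs.forUp {x : ℕ} {m : IExp} {c : Cmd} (M T : ℕ) (I : ℕ → Store → Prop)
    (hm : ∀ k τ, τ.idx x = k → I k τ → m.eval τ = M)
    (step : ∀ k τ, k < M → τ.idx x = k → I k τ →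
      Runs c τ T fun υ => υ.idx x = k ∧ I (k + 1) (υ.setI x (k + 1)))
    (σ : Store) (h : I 0 (σ.setI x 0)) :
    Runs (.forUp x m c) σ ((T + m.cost + 10) * (M + 1)) (I M) := by
  have key := Runs.loop_const (b := .idxLt (.var x) m)
    (c := c ;; .setIdx x (.add (.var x) (.lit 1)))
    (fun k τ => τ.idx x = k ∧ k ≤ M ∧ I k τ) (fun k => M - k) (T + 4) (by
      rintro _ τ ⟨rfl, h1, h2⟩ hb
      have hM := hm _ τ rfl h2
      have hlt : τ.idx x < M := by simpa [Test.Holds, IExp.eval, hM] using hb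
      refine (step _ τ hlt rfl h2).seq fun υ ⟨h3, h4⟩ => ?_
      refine (Runs.of_wp (Q := fun τ' => ∃ k', (τ'.idx x = k' ∧ k' ≤ M ∧ I k' τ') ∧
        M - k' < M - τ.idx x) ?_).mono (by simp [Cmd.bound, IExp.cost]) fun _ => id
      simp only [Cmd.wp, IExp.eval, h3]
      exact ⟨_, ⟨by simp, hlt, h4⟩, by omega⟩) 0 (σ.setI x 0) (by simpa using h)
  refine Runs.mono (Runs.seq (R := fun τ => τ = σ.setI x 0) (t := 2)
    ⟨2, _, Exec.setIdx σ x (.lit 0), le_rfl, rfl⟩ fun τ hτ => by subst hτ; exact key) ?_ ?_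
  · simp only [Test.cost, IExp.cost, Nat.sub_zero]
    nlinarith
  · rintro τ ⟨_, ⟨rfl, h1, h2⟩, hb⟩
    have hM := hm _ τ rfl h2
    have : τ.idx x = M := by
      simp only [Test.Holds, IExp.eval, hM] at hb
      omega
    rwa [this] at h2

/-- Here `m` is evaluated only once, in `σ`. The counter is decremented before the body, so `I (k +
1)` is assumed for the store with the counter set back to `k + 1`. -/
theorem Runs.forDown {x : ℕ} {m : IExp} {c : Cmd} (M T : ℕ) (I : ℕ → Store → Prop)
    (σ : Store) (hm : m.eval σ = M)
    (step : ∀ k τ, k < M → τ.idx x = k → I (k + 1) (τ.setI x (k + 1)) →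
      Runs c τ T fun υ => υ.idx x = k ∧ I k υ)
    (h : I M (σ.setI x M)) :
    Runs (.forDown x m c) σ ((T + m.cost + 10) * (M + 1)) (I 0) := by
  have key := Runs.loop_const (b := .idxLt (.lit 0) (.var x))
    (c := .setIdx x (.sub (.var x) (.lit 1)) ;; c)
    (fun k τ => τ.idx x = k ∧ k ≤ M ∧ I k τ) id (4 + T) (by
      rintro _ τ ⟨rfl, h1, h2⟩ hb
      obtain ⟨k, hk⟩ : ∃ k, τ.idx x = k + 1 := Nat.exists_eq_succ_of_ne_zero (by
        simp only [Test.Holds, IExp.eval] at hb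
        omega)
      refine Runs.seq (R := fun υ => υ = τ.setI x k) (t := 4)
        ⟨4, _, Exec.setIdx τ x _, le_rfl, by simp [Store.setI, IExp.eval, hk]⟩ fun υ hυ => ?_
      refine (step k υ (by omega) (by simp [hυ]) ?_).mono le_rfl ?_
      · subst hυ
        rw [hk] at h2
        convert h2 using 1
        have : Function.update τ.idx x (k + 1) = τ.idx := by
          rw [← hk]; exact Function.update_eq_self x τ.idx
        simp [Store.setI, this]
      · rintro υ' ⟨h3, h4⟩
        refine ⟨k, ⟨h3, by omega, h4⟩, ?_⟩
        rw [id, id, hk]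
        omega) M (σ.setI x M) (by simpa using h)
  refine Runs.mono (Runs.seq (R := fun τ => τ = σ.setI x M) (t := m.cost + 1)
    ⟨m.cost + 1, _, Exec.setIdx σ x m, le_rfl, by simp [Store.setI, hm]⟩
    fun τ hτ => by subst hτ; exact key) ?_ ?_
  · simp only [Test.cost, IExp.cost, id]
    nlinarith
  · rintro τ ⟨_, ⟨rfl, h1, h2⟩, hb⟩
    have : τ.idx x = 0 := by
      simp only [Test.Holds, IExp.eval] at hb
      omega
    rwa [this] at h2

/-! ### Frames: what a program leaves unchanged -/

/-- The program may assign to the variable or array `x` of the given kind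
(`0`: index variable, `1`: real variable, `2`: index array, `3`: real array). -/
def Cmd.touches : Cmd → ℕ → ℕ → Bool
  | .skip, _, _ => false
  | .setIdx y _, k, x => k == 0 && x == y
  | .setReal y _, k, x => k == 1 && x == y
  | .writeIdx y _ _, k, x => k == 2 && x == y
  | .writeReal y _ _, k, x => k == 3 && x == y
  | .seq c d, k, x => c.touches k x || d.touches k x
  | .ite _ c d, k, x => c.touches k x || d.touches k x
  | .loop _ c, k, x => c.touches k x

/-- The stores agree on everything to which the program cannot assign. -/
structure Frame (c : Cmd) (σ τ : Store) : Prop where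
  idx : ∀ x, c.touches 0 x = false → τ.idx x = σ.idx x
  real : ∀ x, c.touches 1 x = false → τ.real x = σ.real x
  idxArr : ∀ x, c.touches 2 x = false → τ.idxArr x = σ.idxArr x
  realArr : ∀ x, c.touches 3 x = false → τ.realArr x = σ.realArr x

/-- Only what is named in the program text is ever written. Since `touches` computes, the side
conditions of later uses mostly hold by `rfl`, and invariants need not mention unrelated memory. -/
theorem Exec.frame {c : Cmd} {σ τ : Store} {t : ℕ} (h : Exec c σ t τ) : Frame c σ τ := by
  induction h with
  | skip σ => exact ⟨fun _ _ => rfl, fun _ _ => rfl, fun _ _ => rfl, fun _ _ => rfl⟩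
  | setIdx σ x e =>
    exact ⟨fun y h => by simp_all [Cmd.touches], fun _ _ => rfl,
      fun _ _ => rfl, fun _ _ => rfl⟩
  | setReal σ x e =>
    exact ⟨fun _ _ => rfl, fun y h => by simp_all [Cmd.touches],
      fun _ _ => rfl, fun _ _ => rfl⟩
  | writeIdx σ a i e =>
    exact ⟨fun _ _ => rfl, fun _ _ => rfl,
      fun y h => by simp_all [Cmd.touches], fun _ _ => rfl⟩
  | writeReal σ a i e =>
    exact ⟨fun _ _ => rfl, fun _ _ => rfl, fun _ _ => rfl,
      fun y h => by simp_all [Cmd.touches]⟩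
  | seq _ _ h1 h2 =>
    constructor <;> intro x hx <;> simp only [Cmd.touches, Bool.or_eq_false_iff] at hx
    · rw [h2.idx x hx.2, h1.idx x hx.1]
    · rw [h2.real x hx.2, h1.real x hx.1]
    · rw [h2.idxArr x hx.2, h1.idxArr x hx.1]
    · rw [h2.realArr x hx.2, h1.realArr x hx.1]
  | iteTrue _ _ h1 =>
    constructor <;> intro x hx <;> simp only [Cmd.touches, Bool.or_eq_false_iff] at hx
    exacts [h1.idx x hx.1, h1.real x hx.1, h1.idxArr x hx.1, h1.realArr x hx.1]
  | iteFalse _ _ h1 =>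
    constructor <;> intro x hx <;> simp only [Cmd.touches, Bool.or_eq_false_iff] at hx
    exacts [h1.idx x hx.2, h1.real x hx.2, h1.idxArr x hx.2, h1.realArr x hx.2]
  | loopDone _ => exact ⟨fun _ _ => rfl, fun _ _ => rfl, fun _ _ => rfl, fun _ _ => rfl⟩
  | loopStep _ _ _ h1 h2 =>
    constructor <;> intro x hx
    · rw [h2.idx x hx, h1.idx x hx]
    · rw [h2.real x hx, h1.real x hx]
    · rw [h2.idxArr x hx, h1.idxArr x hx]
    · rw [h2.realArr x hx, h1.realArr x hx]

theorem Runs.frame {c : Cmd} {σ : Store} {t : ℕ} {Q : Store → Prop} (h : Runs c σ t Q) :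
    Runs c σ t fun τ => Q τ ∧ Frame c σ τ := by
  obtain ⟨s, τ, h1, h2, h3⟩ := h
  exact ⟨s, τ, h1, h2, h3, h1.frame⟩

end RealRAM

/-! ### Rooted trees given by a parent function -/

namespace TreeLocation

/-- The nodes below `v` (including `v`) in the rooted forest with the parent function `par`. -/
def Sub (par : ℕ → ℕ) (v : ℕ) : Set ℕ := {u | ∃ k : ℕ, par^[k] u = v}

section Sub

variable {par : ℕ → ℕ} {u v w : ℕ}

theorem mem_sub_self (v : ℕ) : v ∈ Sub par v := ⟨0, rfl⟩

theorem mem_sub_par (v : ℕ) : v ∈ Sub par (par v) := ⟨1, rfl⟩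

theorem mem_sub_trans (h : u ∈ Sub par v) (h' : v ∈ Sub par w) : u ∈ Sub par w := by
  obtain ⟨k, rfl⟩ := h
  obtain ⟨l, rfl⟩ := h'
  exact ⟨l + k, Function.iterate_add_apply par l k u⟩

theorem mem_sub_of_par (h : par u ∈ Sub par v) : u ∈ Sub par v :=
  mem_sub_trans (mem_sub_par u) h

theorem par_mem_sub (h : u ∈ Sub par v) (hne : u ≠ v) : par u ∈ Sub par v := by
  obtain ⟨k, hk⟩ := h
  cases k with
  | zero => exact absurd hk hne
  | succ k => exact ⟨k, hk⟩

/-- Both `v` and `w` are iterates of `par` at `u`, so one of them is an iterate at the other. -/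
theorem sub_comparable (h : u ∈ Sub par v) (h' : u ∈ Sub par w) :
    v ∈ Sub par w ∨ w ∈ Sub par v := by
  obtain ⟨k, rfl⟩ := h
  obtain ⟨l, rfl⟩ := h'
  rcases le_total k l with hkl | hkl
  · exact Or.inl ⟨l - k, by rw [← Function.iterate_add_apply, Nat.sub_add_cancel hkl]⟩
  · exact Or.inr ⟨k - l, by rw [← Function.iterate_add_apply, Nat.sub_add_cancel hkl]⟩

/-- Induction along the path from a node up to `v`. -/
theorem sub_induction {p : ℕ → Prop} (h : u ∈ Sub par v) (base : p v)
    (step : ∀ x, x ∈ Sub par v → x ≠ v → p (par x) → p x) : p u := by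
  obtain ⟨k, hk⟩ := h
  induction k generalizing u with
  | zero => exact (show u = v from hk) ▸ base
  | succ k ih =>
    by_cases hu : u = v
    · exact hu ▸ base
    · exact step u ⟨k + 1, hk⟩ hu (ih hk)

/-- If `u` lies in a subtree to which `w` does not belong, then `u` is below `w` if and only if
the parent of the top of the subtree is. -/
theorem mem_sub_iff_par (huv : u ∈ Sub par v) (hwv : w ∉ Sub par v) :
    u ∈ Sub par w ↔ par v ∈ Sub par w := by
  constructor
  · intro huw
    rcases sub_comparable huv huw with e | e
    · exact par_mem_sub e fun e' => hwv (e' ▸ mem_sub_self _)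
    · exact absurd e hwv
  · exact fun e => mem_sub_trans huv (mem_sub_of_par e)

end Sub

/-- A tree on `0, …, N - 1` with root `ρ` and parent function `par`, whose path metric for the
lengths `len` of the edges from the nodes to their parents is `d`. -/
structure RootedMetric (N ρ : ℕ) (par : ℕ → ℕ) (len : ℕ → ℝ) (d : ℕ → ℕ → ℝ) : Prop where
  root_lt : ρ < N
  par_lt : ∀ v < N, par v < N
  par_root : par ρ = ρ
  rank : ∃ lev : ℕ → ℕ, ∀ v < N, v ≠ ρ → lev (par v) < lev v
  self : ∀ u < N, d u u = 0
  symm : ∀ u < N, ∀ v < N, d u v = d v u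
  up : ∀ u < N, ∀ v < N, v ∉ Sub par u → d u v = len u + d (par u) v

namespace RootedMetric

variable {N ρ : ℕ} {par : ℕ → ℕ} {len : ℕ → ℝ} {d : ℕ → ℕ → ℝ} (h : RootedMetric N ρ par len d)
  {c i j s u v : ℕ}

include h

theorem iterate_root (k : ℕ) : par^[k] ρ = ρ := by
  induction k with
  | zero => rfl
  | succ k ih => rw [Function.iterate_succ_apply, h.par_root, ih]

theorem root_mem_sub (hv : ρ ∈ Sub par v) : v = ρ := by
  obtain ⟨k, hk⟩ := hv
  rw [h.iterate_root] at hk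
  exact hk.symm

theorem sub_lt (hu : u < N) (huv : u ∈ Sub par v) : v < N := by
  obtain ⟨k, hk⟩ := huv
  induction k generalizing u with
  | zero => exact (show u = v from hk) ▸ hu
  | succ k ih => exact ih (h.par_lt u hu) hk

theorem mem_sub_root (hu : u < N) : u ∈ Sub par ρ := by
  obtain ⟨lev, hlev⟩ := h.rank
  induction hn : lev u using Nat.strong_induction_on generalizing u with
  | _ n ih =>
    by_cases hr : u = ρ
    · exact hr ▸ mem_sub_self _
    · exact mem_sub_of_par (ih _ (hn ▸ hlev u hu hr) (h.par_lt u hu) rfl)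

/-- The level drops strictly at every step towards the root. The bound `u < N` is needed since
nothing is known about the level outside the tree. -/
theorem sub_rank {lev : ℕ → ℕ} (hlev : ∀ v < N, v ≠ ρ → lev (par v) < lev v) (hu : u < N)
    (huv : u ∈ Sub par v) : u = v ∨ lev v < lev u := by
  refine sub_induction (p := fun x => x < N → x = v ∨ lev v < lev x) huv (fun _ => Or.inl rfl)
    (fun x hx hne ih hxN => Or.inr ?_) hu
  have hxr : x ≠ ρ := fun e => hne (by subst e; exact (h.root_mem_sub hx).symm)
  have := hlev x hxN hxr
  rcases ih (h.par_lt x hxN) with e | e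
  · rwa [← e]
  · omega

theorem sub_antisymm (hu : u < N) (huv : u ∈ Sub par v) (hvu : v ∈ Sub par u) : u = v := by
  obtain ⟨lev, hlev⟩ := h.rank
  rcases h.sub_rank hlev hu huv with e | e
  · exact e
  · rcases h.sub_rank hlev (h.sub_lt hu huv) hvu with e' | e'
    · exact e'.symm
    · omega

/-- A node below `c` is `c` itself or has a larger level, whereas the level of `par c` is smaller.
-/
theorem par_notMem_sub (hc : c < N) (hr : c ≠ ρ) : par c ∉ Sub par c := by
  obtain ⟨lev, hlev⟩ := h.rank
  intro hm
  have := hlev c hc hr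
  rcases h.sub_rank hlev (h.par_lt c hc) hm with e | e
  · rw [e] at this; omega
  · omega

/-- Two different nodes with the same parent have disjoint subtrees. -/
theorem sub_disjoint {c' : ℕ} (hc : c < N) (hc' : c' < N) (hr : c ≠ ρ) (hr' : c' ≠ ρ)
    (hp : par c = par c') (hne : c ≠ c') (hi : i ∈ Sub par c) : i ∉ Sub par c' := by
  intro hi'
  rcases sub_comparable hi hi' with e | e
  · exact h.par_notMem_sub hc' hr' (hp ▸ par_mem_sub e hne)
  · exact h.par_notMem_sub hc hr (hp ▸ par_mem_sub e hne.symm)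

/-- Paths that leave a subtree pass the parent of its top. -/
theorem sep (hc : c ≠ ρ) (hi : i < N) (hj : j < N) (hic : i ∈ Sub par c)
    (hjc : j ∉ Sub par c) : d i j = d i (par c) + d (par c) j := by
  have hcN := h.sub_lt hi hic
  have hp := h.par_lt c hcN
  have hpc := h.par_notMem_sub hcN hc
  refine sub_induction (p := fun x => x < N → d x j = d x (par c) + d (par c) j) hic
    (fun _ => ?_) (fun x hx hne ih hxN => ?_) hi
  · rw [h.up c hcN j hj hjc, h.up c hcN _ hp hpc, h.self _ hp, add_zero]
  · rw [h.up x hxN j hj fun e => hjc (mem_sub_trans e hx),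
      h.up x hxN _ hp fun e => hpc (mem_sub_trans e hx), ih (h.par_lt x hxN), add_assoc]

end RootedMetric

/-! ### Keys of items and of pairs of items -/

/-- Real numbers with an infinitesimal part. -/
abbrev Key : Type := Lex (ℝ × ℝ)

/-- A real number as a key. -/
def Key.ofReal (x : ℝ) : Key := toLex (x, 0)

theorem Key.ofReal_add (x y : ℝ) : Key.ofReal (x + y) = Key.ofReal x + Key.ofReal y := by
  rw [Key.ofReal, Key.ofReal, Key.ofReal, ← toLex_add, Prod.mk_add_mk, add_zero]

open Classical in
/-- The part of a key that depends on whether a path from `i` to `j` leaves `i` downwards. -/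
noncomputable def side (par : ℕ → ℕ) (α β : ℕ → Key) (i j : ℕ) : Key :=
  if j ∈ Sub par i then α i else β i

/-- The key of `i` with respect to the node `s`. -/
noncomputable def key (par : ℕ → ℕ) (d : ℕ → ℕ → ℝ) (α β : ℕ → Key) (i s : ℕ) : Key :=
  Key.ofReal (d i s) + side par α β i s

/-- The key of the pair of `i` and `j`. -/
noncomputable def pairKey (par : ℕ → ℕ) (d : ℕ → ℕ → ℝ) (α β : ℕ → Key) (i j : ℕ) : Key :=
  Key.ofReal (d i j) + side par α β i j + side par α β j i

namespace RootedMetric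

variable {N ρ : ℕ} {par : ℕ → ℕ} {len : ℕ → ℝ} {d : ℕ → ℕ → ℝ} (h : RootedMetric N ρ par len d)
  {c c' i j s u v : ℕ} {α β : ℕ → Key}

include h

theorem pairKey_comm (hi : i < N) (hj : j < N) :
    pairKey par d α β i j = pairKey par d α β j i := by
  simp only [pairKey, h.symm i hi j hj]
  abel

/-- The nodes `i` and `j` lie on different sides of the edge above `c`. The path from `i` leaves `i`
upwards, whether it leads to `j` or to `par c`; and `i` is below `j` if and only if `par c` is. So
the pair key is a function of `i` plus a function of `j`, and negative pairs can be found from two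
sorted lists. -/
theorem pairKey_eq (hc : c ≠ ρ) (hi : i < N) (hj : j < N) (hic : i ∈ Sub par c)
    (hjc : j ∉ Sub par c) :
    pairKey par d α β i j = key par d α β i (par c) + key par d α β j (par c) := by
  have hcN := h.sub_lt hi hic
  have h1 : side par α β i j = side par α β i (par c) := by
    rw [side, side, if_neg fun e => hjc (mem_sub_trans e hic),
      if_neg fun e => h.par_notMem_sub hcN hc (mem_sub_trans e hic)]
  have h2 : side par α β j i = side par α β j (par c) := by
    have := mem_sub_iff_par hic hjc
    by_cases e : i ∈ Sub par j
    · rw [side, side, if_pos e, if_pos (this.1 e)]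
    · rw [side, side, if_neg e, if_neg (mt this.2 e)]
  rw [pairKey, key, key, h.sep hc hi hj hic hjc, h1, h2, Key.ofReal_add,
    h.symm j hj _ (h.par_lt c hcN)]
  abel

/-- Seen from an item below `c`, both `par c` and `par c'` are reached upwards, so the side term
stays and the key grows by an amount that is the same for all items below `c`. A sorted list of them
stays sorted. -/
theorem key_above (hc : c ≠ ρ) (hc' : c' ≠ ρ) (hi : i < N) (hic : i ∈ Sub par c)
    (hcc : par c ∈ Sub par c') :
    key par d α β i (par c') = key par d α β i (par c) + Key.ofReal (d (par c) (par c')) := by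
  have hcN := h.sub_lt hi hic
  have hpN := h.par_lt c hcN
  have hc'N := h.sub_lt hpN hcc
  have h0 : par c' ∉ Sub par c := fun e =>
    h.par_notMem_sub hc'N hc' (mem_sub_trans (mem_sub_trans e (mem_sub_par c)) hcc)
  rw [key, key, h.sep hc hi (h.par_lt c' hc'N) hic h0, Key.ofReal_add, side, side,
    if_neg fun e => h0 (mem_sub_trans e hic),
    if_neg fun e => h.par_notMem_sub hcN hc (mem_sub_trans e hic)]
  abel

/-- The counterpart for items outside the subtree of `c`, when the reference node moves from `par c`
down into that subtree: again the offset does not depend on the item. -/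
theorem key_below (hc : c ≠ ρ) (hi : i < N) (hv : v < N) (hic : i ∉ Sub par c)
    (hvc : v ∈ Sub par c) :
    key par d α β i v = key par d α β i (par c) + Key.ofReal (d v (par c)) := by
  have hcN := h.sub_lt hv hvc
  have h2 : side par α β i v = side par α β i (par c) := by
    have := mem_sub_iff_par hvc hic
    by_cases e : v ∈ Sub par i
    · rw [side, side, if_pos e, if_pos (this.1 e)]
    · rw [side, side, if_neg e, if_neg (mt this.2 e)]
  rw [key, key, h2, h.symm i hi v hv, h.sep hc hv hi hvc hic, Key.ofReal_add,
    h.symm i hi _ (h.par_lt c hcN)]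
  abel

end RootedMetric

end TreeLocation

/-! ### Stages of a tree contraction -/

namespace TreeLocation

/-- A stage of the contraction of a tree. Every alive node `v` carries a cluster of original
nodes, listed by `la v` in the order of the keys with respect to `v` and by `lb v` in the order
of the keys with respect to the parent of `v`. The cluster hangs below the edge above `cut v` of
the original tree. -/
structure Conf where
  alive : Finset ℕ
  par : ℕ → ℕ
  len : ℕ → ℝ
  cnt : ℕ → ℕ
  cut : ℕ → ℕ
  bot : ℕ → Key
  top : ℕ → Key
  la : ℕ → List ℕ
  lb : ℕ → List ℕ
  gain : ℕ → ℝ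

open Classical in
/-- The weight that `j` contributes to the gain of `i`. -/
noncomputable def contrib (par : ℕ → ℕ) (d : ℕ → ℕ → ℝ) (α β : ℕ → Key) (wt : ℕ → ℝ)
    (i j : ℕ) : ℝ :=
  if j ≠ i ∧ pairKey par d α β i j < 0 then wt j else 0

open Classical in
/-- The total weight of those items of a list whose keys, added to `x`, are negative. -/
noncomputable def crossSum (k : ℕ → Key) (wt : ℕ → ℝ) (l : List ℕ) (x : Key) : ℝ :=
  (l.map fun j => if k j + x < 0 then wt j else 0).sum

/-- The stage represents the tree with the parent function `spar`. -/
structure Conf.Valid (C : Conf) (N ρ : ℕ) (spar : ℕ → ℕ) (d : ℕ → ℕ → ℝ) (α β : ℕ → Key)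
    (wt : ℕ → ℝ) : Prop where
  root_mem : ρ ∈ C.alive
  par_mem : ∀ v ∈ C.alive, v ≠ ρ → C.par v ∈ C.alive
  cut_ne : ∀ v ∈ C.alive, v ≠ ρ → C.cut v ≠ ρ
  par_cut : ∀ v ∈ C.alive, v ≠ ρ → spar (C.cut v) = C.par v
  inside : ∀ v ∈ C.alive, v ≠ ρ → ∀ i ∈ C.la v, i ∈ Sub spar (C.cut v)
  outside : ∀ v ∈ C.alive, v ≠ ρ → ∀ i ∈ C.la (C.par v), i ∉ Sub spar (C.cut v)
  cut_inj : ∀ v ∈ C.alive, v ≠ ρ → ∀ v' ∈ C.alive, v' ≠ ρ → C.cut v = C.cut v' → v = v'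
  self_mem : ∀ v ∈ C.alive, v ∈ C.la v
  cover : ∀ i < N, ∃ v ∈ C.alive, i ∈ C.la v
  disj : ∀ v ∈ C.alive, ∀ v' ∈ C.alive, ∀ i, i ∈ C.la v → i ∈ C.la v' → v = v'
  la_lt : ∀ v ∈ C.alive, ∀ i ∈ C.la v, i < N
  nodup : ∀ v ∈ C.alive, (C.la v).Nodup
  perm : ∀ v ∈ C.alive, (C.la v).Perm (C.lb v)
  bot_eq : ∀ v ∈ C.alive, ∀ i ∈ C.la v, C.bot i = key spar d α β i v
  top_eq : ∀ v ∈ C.alive, v ≠ ρ → ∀ i ∈ C.la v, C.top i = key spar d α β i (C.par v)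
  len_eq : ∀ v ∈ C.alive, v ≠ ρ → C.len v = d v (C.par v)
  la_sorted : ∀ v ∈ C.alive, (C.la v).Pairwise fun i j => C.bot i ≤ C.bot j
  lb_sorted : ∀ v ∈ C.alive, (C.lb v).Pairwise fun i j => C.top i ≤ C.top j
  gain_eq : ∀ v ∈ C.alive, ∀ i ∈ C.la v,
    C.gain i = ((C.la v).map (contrib spar d α β wt i)).sum
  cnt_eq : ∀ v ∈ C.alive, C.cnt v = (C.alive.filter fun c => c ≠ ρ ∧ C.par c = v).card
  cnt_le : ∀ v ∈ C.alive, C.cnt v ≤ 2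

/-- The gains after accounting for the pairs of a node in the cluster of `v` and a node in the
cluster of its parent `p`. -/
structure Conf.CrossGain (C : Conf) (wt : ℕ → ℝ) (v p : ℕ) (G : ℕ → ℝ) : Prop where
  lower : ∀ i ∈ C.la v, G i = C.gain i + crossSum C.bot wt (C.la p) (C.top i)
  upper : ∀ i ∈ C.la p, G i = C.gain i + crossSum C.top wt (C.la v) (C.bot i)
  other : ∀ i, i ∉ C.la v → i ∉ C.la p → G i = C.gain i

/-- Contract the leaf `v` into its parent `p`. -/
noncomputable def Conf.rake (C : Conf) (v p : ℕ) (A B : List ℕ) (G : ℕ → ℝ) : Conf where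
  alive := C.alive.erase v
  par := C.par
  len := C.len
  cnt := Function.update C.cnt p (C.cnt p - 1)
  cut := C.cut
  -- With respect to `p`, the items of `v` have their old top keys. If `p` is the root, the new top
  -- keys are meaningless; `Conf.Valid` claims nothing about them.
  bot i := if i ∈ C.la v then C.top i else C.bot i
  top i := if i ∈ C.la v then C.top i + Key.ofReal (C.len p) else C.top i
  la := Function.update C.la p A
  lb := Function.update C.lb p B
  gain := G

/-- Contract the parent `p` of `v`, which has no other children, into `v`. -/
noncomputable def Conf.compress (C : Conf) (v p : ℕ) (A B : List ℕ) (G : ℕ → ℝ) : Conf where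
  alive := C.alive.erase p
  par := Function.update C.par v (C.par p)
  len := Function.update C.len v (C.len v + C.len p)
  -- `v` keeps its own children, and the parent of `p` gets `v` in place of `p`.
  cnt := C.cnt
  cut := Function.update C.cut v (C.cut p)
  bot i := if i ∈ C.la p then C.bot i + Key.ofReal (C.len v) else C.bot i
  top i := if i ∈ C.la v then C.top i + Key.ofReal (C.len p) else C.top i
  la := Function.update C.la v A
  lb := Function.update C.lb v B
  gain := G

namespace Conf.Valid

variable {C : Conf} {N ρ : ℕ} {spar : ℕ → ℕ} {slen : ℕ → ℝ} {d : ℕ → ℕ → ℝ} {α β : ℕ → Key}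
  {wt : ℕ → ℝ} (hC : C.Valid N ρ spar d α β wt) (h : RootedMetric N ρ spar slen d)
  {v p : ℕ} {A B : List ℕ} {G : ℕ → ℝ}

include hC

theorem alive_lt (hv : v ∈ C.alive) : v < N := hC.la_lt v hv v (hC.self_mem v hv)

theorem par_ne (hv : v ∈ C.alive) (hr : v ≠ ρ) : C.par v ≠ v := by
  intro e
  refine hC.outside v hv hr v ?_ (hC.inside v hv hr v (hC.self_mem v hv))
  rw [e]
  exact hC.self_mem v hv

theorem mem_lb (hv : v ∈ C.alive) {i : ℕ} : i ∈ C.lb v ↔ i ∈ C.la v :=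
  (hC.perm v hv).mem_iff.symm

theorem disj' (hv : v ∈ C.alive) (hp : p ∈ C.alive) (hne : v ≠ p) {i : ℕ} (hi : i ∈ C.la v) :
    i ∉ C.la p :=
  fun e => hne (hC.disj v hv p hp i hi e)

/-- When only the root is left, the gains are complete. -/
theorem gain_final (ha : C.alive = {ρ}) {i : ℕ} (hi : i < N) :
    C.gain i = ∑ j ∈ Finset.range N, contrib spar d α β wt i j := by
  have hmem : ∀ i < N, i ∈ C.la ρ := by
    intro i hi
    obtain ⟨v, hv, hiv⟩ := hC.cover i hi
    rw [ha, Finset.mem_singleton] at hv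
    exact hv ▸ hiv
  rw [hC.gain_eq ρ hC.root_mem i (hmem i hi)]
  rw [← List.sum_toFinset _ (hC.nodup ρ hC.root_mem)]
  congr 1
  ext j
  simp only [List.mem_toFinset, Finset.mem_range]
  exact ⟨hC.la_lt ρ hC.root_mem j, hmem j⟩

include h

/-- The edge above `cut v` separates the cluster of `v` from that of its parent, so the pair key is
a top key of the one plus a bottom key of the other. The clusters are disjoint, which takes care of
the condition `j ≠ i` in `contrib`. The same holds for `contrib_upper`. -/
theorem contrib_lower (hv : v ∈ C.alive) (hr : v ≠ ρ) {i j : ℕ} (hi : i ∈ C.la v)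
    (hj : j ∈ C.la (C.par v)) : contrib spar d α β wt i j =
      if C.bot j + C.top i < 0 then wt j else 0 := by
  have hp := hC.par_mem v hv hr
  have hne : j ≠ i := by
    rintro rfl
    exact hC.disj' hv hp (hC.par_ne hv hr).symm hi hj
  rw [contrib, h.pairKey_eq (hC.cut_ne v hv hr) (hC.la_lt v hv i hi) (hC.la_lt _ hp j hj)
    (hC.inside v hv hr i hi) (hC.outside v hv hr j hj), hC.par_cut v hv hr,
    ← hC.top_eq v hv hr i hi, ← hC.bot_eq _ hp j hj, add_comm]
  simp [hne]

theorem contrib_upper (hv : v ∈ C.alive) (hr : v ≠ ρ) {i j : ℕ} (hi : i ∈ C.la v)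
    (hj : j ∈ C.la (C.par v)) : contrib spar d α β wt j i =
      if C.top i + C.bot j < 0 then wt i else 0 := by
  have hp := hC.par_mem v hv hr
  have hne : i ≠ j := by
    rintro rfl
    exact hC.disj' hv hp (hC.par_ne hv hr).symm hi hj
  rw [contrib, h.pairKey_comm (hC.la_lt _ hp j hj) (hC.la_lt v hv i hi),
    h.pairKey_eq (hC.cut_ne v hv hr) (hC.la_lt v hv i hi) (hC.la_lt _ hp j hj)
    (hC.inside v hv hr i hi) (hC.outside v hv hr j hj), hC.par_cut v hv hr,
    ← hC.top_eq v hv hr i hi, ← hC.bot_eq _ hp j hj]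
  simp [hne]

/-- The gains within the union of the clusters of `v` and of its parent. -/
theorem gain_union (hv : v ∈ C.alive) (hr : v ≠ ρ) (hG : C.CrossGain wt v (C.par v) G)
    (hA : A.Perm (C.la v ++ C.la (C.par v))) {i : ℕ} (hi : i ∈ A) :
    G i = (A.map (contrib spar d α β wt i)).sum := by
  have hp := hC.par_mem v hv hr
  rw [(hA.map _).sum_eq, List.map_append, List.sum_append]
  rcases List.mem_append.1 (hA.mem_iff.1 hi) with hi | hi
  · rw [hG.lower i hi, hC.gain_eq v hv i hi, crossSum]
    congr 2
    exact List.map_congr_left fun j hj => (hC.contrib_lower h hv hr hi hj).symm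
  · rw [hG.upper i hi, hC.gain_eq _ hp i hi, crossSum, add_comm]
    congr 2
    exact List.map_congr_left fun j hj => (hC.contrib_upper h hv hr hj hi).symm

/-- An instance of `RootedMetric.key_above` for the cuts of `v` and of its parent: all items in the
cluster of `v` pay the length of the edge above the parent. -/
theorem top_above (hv : v ∈ C.alive) (hr : v ≠ ρ) (hpr : C.par v ≠ ρ) {i : ℕ}
    (hi : i ∈ C.la v) : C.top i + Key.ofReal (C.len (C.par v)) =
      key spar d α β i (C.par (C.par v)) := by
  have hp := hC.par_mem v hv hr
  have hin := hC.inside _ hp hpr _ (hC.self_mem _ hp)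
  rw [← hC.par_cut _ hp hpr, h.key_above (hC.cut_ne v hv hr) (hC.cut_ne _ hp hpr)
    (hC.la_lt v hv i hi) (hC.inside v hv hr i hi) (by rwa [hC.par_cut v hv hr]),
    hC.par_cut v hv hr, hC.par_cut _ hp hpr, hC.top_eq v hv hr i hi, hC.len_eq _ hp hpr]

/-- Apart from the new keys, for which the offsets were computed above, the point is that the
enlarged cluster of the parent stays inside its own cut and outside the cuts of the remaining
children. -/
theorem rake (hv : v ∈ C.alive) (hr : v ≠ ρ) (hcnt : C.cnt v = 0)
    (hG : C.CrossGain wt v (C.par v) G)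
    (hA : A.Perm (C.la v ++ C.la (C.par v))) (hB : B.Perm (C.lb v ++ C.lb (C.par v)))
    (hAs : A.Pairwise fun i j => (C.rake v (C.par v) A B G).bot i ≤
      (C.rake v (C.par v) A B G).bot j)
    (hBs : B.Pairwise fun i j => (C.rake v (C.par v) A B G).top i ≤
      (C.rake v (C.par v) A B G).top j) :
    (C.rake v (C.par v) A B G).Valid N ρ spar d α β wt := by
  have hp := hC.par_mem v hv hr
  have hpv := hC.par_ne hv hr
  -- Without children of `v`, no parent pointer becomes dangling.
  have hleaf : ∀ x ∈ C.alive, x ≠ ρ → C.par x ≠ v := by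
    intro x hx hxr e
    have := hC.cnt_eq v hv
    rw [hcnt, eq_comm, Finset.card_eq_zero] at this
    exact (Finset.notMem_empty x) (this ▸ Finset.mem_filter.2 ⟨hx, hxr, e⟩)
  have hla : ∀ x, x ≠ C.par v → (C.rake v (C.par v) A B G).la x = C.la x := fun x hx => by
    simp [Conf.rake, hx]
  have hlb : ∀ x, x ≠ C.par v → (C.rake v (C.par v) A B G).lb x = C.lb x := fun x hx => by
    simp [Conf.rake, hx]
  have hlap : (C.rake v (C.par v) A B G).la (C.par v) = A := by simp [Conf.rake]
  have hlbp : (C.rake v (C.par v) A B G).lb (C.par v) = B := by simp [Conf.rake]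
  have hmA : ∀ i, i ∈ A ↔ i ∈ C.la v ∨ i ∈ C.la (C.par v) := fun i => by
    rw [hA.mem_iff, List.mem_append]
  have hal : ∀ x, x ∈ (C.rake v (C.par v) A B G).alive ↔ x ≠ v ∧ x ∈ C.alive := fun x => by
    simp [Conf.rake]
  have hbot : ∀ x ∈ C.alive, x ≠ v → ∀ i ∈ C.la x,
      (C.rake v (C.par v) A B G).bot i = C.bot i := fun x hx hxv i hi => by
    simp [Conf.rake, hC.disj' hx hv hxv hi]
  have htop : ∀ x ∈ C.alive, x ≠ v → ∀ i ∈ C.la x,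
      (C.rake v (C.par v) A B G).top i = C.top i := fun x hx hxv i hi => by
    simp [Conf.rake, hC.disj' hx hv hxv hi]
  have hmem : ∀ x ∈ C.alive, x ≠ v → ∀ i, i ∈ (C.rake v (C.par v) A B G).la x →
      i ∈ C.la x ∨ x = C.par v ∧ i ∈ C.la v := by
    intro x hx hxv i hi
    by_cases e : x = C.par v
    · rw [e, hlap, hmA] at hi
      rcases hi with hi | hi
      · exact Or.inr ⟨e, hi⟩
      · exact Or.inl (e ▸ hi)
    · rw [hla x e] at hi
      exact Or.inl hi
  have hmem' : ∀ x i, i ∈ C.la x → i ∈ (C.rake v (C.par v) A B G).la x := by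
    intro x i hi
    by_cases e : x = C.par v
    · rw [e, hlap, hmA]
      exact Or.inr (e ▸ hi)
    · rwa [hla x e]
  constructor
  · exact (hal _).2 ⟨hr.symm, hC.root_mem⟩
  · exact fun x hx hxr => (hal _).2 ⟨hleaf x ((hal x).1 hx).2 hxr, hC.par_mem x ((hal x).1 hx).2 hxr⟩
  · exact fun x hx => hC.cut_ne x ((hal x).1 hx).2
  · exact fun x hx => hC.par_cut x ((hal x).1 hx).2
  · intro x hx hxr i hi
    obtain ⟨hxv, hx⟩ := (hal x).1 hx
    rcases hmem x hx hxv i hi with hi | ⟨rfl, hi'⟩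
    · exact hC.inside x hx hxr i hi
    -- The cluster of `v` is below `cut v`, whose parent is `C.par v`, which in turn is below its
    -- own cut.
    · have h1 := hC.inside v hv hr i hi'
      have h2 := hC.inside _ hp hxr _ (hC.self_mem _ hp)
      exact mem_sub_trans (mem_sub_trans h1 (mem_sub_par _)) (by rwa [hC.par_cut v hv hr])
  · intro x hx hxr i hi
    obtain ⟨hxv, hx⟩ := (hal x).1 hx
    have hpx := hC.par_mem x hx hxr
    rcases hmem _ hpx (hleaf x hx hxr) i hi with hi | ⟨e, hi⟩
    · exact hC.outside x hx hxr i hi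
    -- `x` is a sibling of `v`. Their cuts are different by `cut_inj` and have the same parent in
    -- the original tree, so the subtrees of the cuts are disjoint.
    · have hvN := h.sub_lt (hC.alive_lt hv) (hC.inside v hv hr v (hC.self_mem v hv))
      have hxN := h.sub_lt (hC.alive_lt hx) (hC.inside x hx hxr x (hC.self_mem x hx))
      refine h.sub_disjoint hvN hxN (hC.cut_ne v hv hr) (hC.cut_ne x hx hxr) ?_ (fun e' => hxv
        (hC.cut_inj v hv hr x hx hxr e').symm) (hC.inside v hv hr i hi)
      exact (hC.par_cut v hv hr).trans (e.symm.trans (hC.par_cut x hx hxr).symm)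
  · exact fun x hx hxr y hy hyr => hC.cut_inj x ((hal x).1 hx).2 hxr y ((hal y).1 hy).2 hyr
  · exact fun x hx => hmem' x x (hC.self_mem x ((hal x).1 hx).2)
  · intro i hi
    obtain ⟨x, hx, hxi⟩ := hC.cover i hi
    by_cases e : x = v
    · exact ⟨C.par v, (hal _).2 ⟨hpv, hp⟩, by rw [hlap, hmA]; exact Or.inl (e ▸ hxi)⟩
    · exact ⟨x, (hal _).2 ⟨e, hx⟩, hmem' x i hxi⟩
  · intro x hx y hy i hix hiy
    obtain ⟨hxv, hx⟩ := (hal x).1 hx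
    obtain ⟨hyv, hy⟩ := (hal y).1 hy
    rcases hmem x hx hxv i hix with h1 | ⟨h1, h1'⟩ <;> rcases hmem y hy hyv i hiy with h2 | ⟨h2, h2'⟩
    · exact hC.disj x hx y hy i h1 h2
    · exact absurd (hC.disj x hx v hv i h1 h2') hxv
    · exact absurd (hC.disj y hy v hv i h2 h1') hyv
    · rw [h1, h2]
  · intro x hx i hi
    obtain ⟨hxv, hx⟩ := (hal x).1 hx
    rcases hmem x hx hxv i hi with hi | ⟨_, hi⟩
    · exact hC.la_lt x hx i hi
    · exact hC.la_lt v hv i hi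
  · intro x hx
    obtain ⟨hxv, hx⟩ := (hal x).1 hx
    by_cases e : x = C.par v
    · rw [e, hlap, hA.nodup_iff, List.nodup_append']
      exact ⟨hC.nodup v hv, hC.nodup _ hp, fun i hi => hC.disj' hv hp hpv.symm hi⟩
    · rw [hla x e]
      exact hC.nodup x hx
  · intro x hx
    obtain ⟨hxv, hx⟩ := (hal x).1 hx
    by_cases e : x = C.par v
    · rw [e, hlap, hlbp]
      exact hA.trans (((hC.perm v hv).append (hC.perm _ hp)).trans hB.symm)
    · rw [hla x e, hlb x e]
      exact hC.perm x hx
  · intro x hx i hi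
    obtain ⟨hxv, hx⟩ := (hal x).1 hx
    rcases hmem x hx hxv i hi with hi | ⟨rfl, hi'⟩
    · rw [hbot x hx hxv i hi, hC.bot_eq x hx i hi]
    · rw [← hC.top_eq v hv hr i hi']
      simp [Conf.rake, hi']
  · intro x hx hxr i hi
    obtain ⟨hxv, hx⟩ := (hal x).1 hx
    rcases hmem x hx hxv i hi with hi | ⟨rfl, hi'⟩
    · rw [htop x hx hxv i hi, hC.top_eq x hx hxr i hi]
      rfl
    · have := hC.top_above h hv hr hxr hi'
      simpa [Conf.rake, hi'] using this
  · exact fun x hx => hC.len_eq x ((hal x).1 hx).2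
  · intro x hx
    obtain ⟨hxv, hx⟩ := (hal x).1 hx
    by_cases e : x = C.par v
    · rw [e, hlap]
      exact hAs
    · rw [hla x e]
      refine (hC.la_sorted x hx).imp_of_mem fun {i j} hi hj hij => ?_
      rwa [hbot x hx hxv i hi, hbot x hx hxv j hj]
  · intro x hx
    obtain ⟨hxv, hx⟩ := (hal x).1 hx
    by_cases e : x = C.par v
    · rw [e, hlbp]
      exact hBs
    · rw [hlb x e]
      refine (hC.lb_sorted x hx).imp_of_mem fun {i j} hi hj hij => ?_
      rwa [htop x hx hxv i ((hC.mem_lb hx).1 hi), htop x hx hxv j ((hC.mem_lb hx).1 hj)]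
  · intro x hx i hi
    obtain ⟨hxv, hx⟩ := (hal x).1 hx
    by_cases e : x = C.par v
    · rw [e, hlap] at hi ⊢
      exact hC.gain_union h hv hr hG hA hi
    · rw [hla x e] at hi ⊢
      rw [← hC.gain_eq x hx i hi]
      exact hG.other i (hC.disj' hx hv hxv hi) (hC.disj' hx hp e hi)
  · intro x hx
    obtain ⟨hxv, hx⟩ := (hal x).1 hx
    have h1 : (C.rake v (C.par v) A B G).alive.filter (fun c => c ≠ ρ ∧ C.par c = x) =
        (C.alive.filter fun c => c ≠ ρ ∧ C.par c = x).erase v := by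
      rw [Conf.rake, Finset.filter_erase]
    by_cases e : x = C.par v
    · subst e
      rw [show (C.rake v (C.par v) A B G).par = C.par from rfl, h1, Finset.card_erase_of_mem
        (Finset.mem_filter.2 ⟨hv, hr, rfl⟩), ← hC.cnt_eq _ hx]
      simp [Conf.rake]
    · rw [show (C.rake v (C.par v) A B G).par = C.par from rfl, h1, Finset.erase_eq_of_notMem
        (fun e' => e (Finset.mem_filter.1 e').2.2.symm), ← hC.cnt_eq x hx]
      simp [Conf.rake, e]
  · intro x hx
    have := hC.cnt_le x ((hal x).1 hx).2
    have h2 := hC.cnt_le _ hp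
    simp only [Conf.rake, Function.update_apply]
    split_ifs <;> omega

/-- `v` is the only child of `p`, so nothing else refers to `p`, and `v` takes over the parent and
the cut of `p`. The items of `p` get keys with respect to the lower node `v`, those of `v` get top
keys with respect to the parent of `p`. -/
theorem compress (hv : v ∈ C.alive) (hr : v ≠ ρ) (hpr : C.par v ≠ ρ) (hcnt : C.cnt (C.par v) = 1)
    (hG : C.CrossGain wt v (C.par v) G)
    (hA : A.Perm (C.la v ++ C.la (C.par v))) (hB : B.Perm (C.lb v ++ C.lb (C.par v)))
    (hAs : A.Pairwise fun i j => (C.compress v (C.par v) A B G).bot i ≤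
      (C.compress v (C.par v) A B G).bot j)
    (hBs : B.Pairwise fun i j => (C.compress v (C.par v) A B G).top i ≤
      (C.compress v (C.par v) A B G).top j) :
    (C.compress v (C.par v) A B G).Valid N ρ spar d α β wt := by
  have hp := hC.par_mem v hv hr
  have hpv := hC.par_ne hv hr
  have hq := hC.par_mem _ hp hpr
  have hqp := hC.par_ne hp hpr
  have honly : ∀ x ∈ C.alive, x ≠ ρ → C.par x = C.par v → x = v := by
    intro x hx hxr e
    have := hC.cnt_eq _ hp
    rw [hcnt, eq_comm, Finset.card_eq_one] at this
    obtain ⟨y, hy⟩ := this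
    have h1 : x = y := Finset.mem_singleton.1 (hy ▸ Finset.mem_filter.2 ⟨hx, hxr, e⟩)
    have h2 : v = y := Finset.mem_singleton.1 (hy ▸ Finset.mem_filter.2 ⟨hv, hr, rfl⟩)
    rw [h1, h2]
  have hpin : C.par v ∈ Sub spar (C.cut (C.par v)) := hC.inside _ hp hpr _ (hC.self_mem _ hp)
  have hsub : ∀ i, i ∈ Sub spar (C.cut v) → i ∈ Sub spar (C.cut (C.par v)) := fun i hi =>
    mem_sub_trans (mem_sub_trans hi (mem_sub_par _)) (by rwa [hC.par_cut v hv hr])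
  have hqv : C.par (C.par v) ≠ v := by
    intro e
    refine hC.outside _ hp hpr v (by rw [e]; exact hC.self_mem v hv) ?_
    exact hsub v (hC.inside v hv hr v (hC.self_mem v hv))
  have hla : ∀ x, x ≠ v → (C.compress v (C.par v) A B G).la x = C.la x := fun x hx => by
    simp [Conf.compress, hx]
  have hlb : ∀ x, x ≠ v → (C.compress v (C.par v) A B G).lb x = C.lb x := fun x hx => by
    simp [Conf.compress, hx]
  have hlav : (C.compress v (C.par v) A B G).la v = A := by simp [Conf.compress]
  have hlbv : (C.compress v (C.par v) A B G).lb v = B := by simp [Conf.compress]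
  have hpar : ∀ x, x ≠ v → (C.compress v (C.par v) A B G).par x = C.par x := fun x hx => by
    simp [Conf.compress, hx]
  have hparv : (C.compress v (C.par v) A B G).par v = C.par (C.par v) := by simp [Conf.compress]
  have hcut : ∀ x, x ≠ v → (C.compress v (C.par v) A B G).cut x = C.cut x := fun x hx => by
    simp [Conf.compress, hx]
  have hcutv : (C.compress v (C.par v) A B G).cut v = C.cut (C.par v) := by simp [Conf.compress]
  have hmA : ∀ i, i ∈ A ↔ i ∈ C.la v ∨ i ∈ C.la (C.par v) := fun i => by
    rw [hA.mem_iff, List.mem_append]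
  have hal : ∀ x, x ∈ (C.compress v (C.par v) A B G).alive ↔ x ≠ C.par v ∧ x ∈ C.alive :=
    fun x => by simp [Conf.compress]
  have hbot : ∀ x ∈ C.alive, x ≠ C.par v → ∀ i ∈ C.la x,
      (C.compress v (C.par v) A B G).bot i = C.bot i := fun x hx hxv i hi => by
    simp [Conf.compress, hC.disj' hx hp hxv hi]
  have htop : ∀ x ∈ C.alive, x ≠ v → ∀ i ∈ C.la x,
      (C.compress v (C.par v) A B G).top i = C.top i := fun x hx hxv i hi => by
    simp [Conf.compress, hC.disj' hx hv hxv hi]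
  have hmem : ∀ x i, i ∈ (C.compress v (C.par v) A B G).la x →
      i ∈ C.la x ∨ x = v ∧ i ∈ C.la (C.par v) := by
    intro x i hi
    by_cases e : x = v
    · rw [e, hlav, hmA] at hi
      rcases hi with hi | hi
      · exact Or.inl (e ▸ hi)
      · exact Or.inr ⟨e, hi⟩
    · rw [hla x e] at hi
      exact Or.inl hi
  have hmem' : ∀ x i, i ∈ C.la x → i ∈ (C.compress v (C.par v) A B G).la x := by
    intro x i hi
    by_cases e : x = v
    · rw [e, hlav, hmA]
      exact Or.inl (e ▸ hi)
    · rwa [hla x e]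
  constructor
  · exact (hal _).2 ⟨hpr.symm, hC.root_mem⟩
  · intro x hx hxr
    obtain ⟨hxp, hx⟩ := (hal x).1 hx
    by_cases e : x = v
    · rw [e, hparv]
      exact (hal _).2 ⟨hqp, hq⟩
    · rw [hpar x e]
      exact (hal _).2 ⟨fun e' => e (honly x hx hxr e'), hC.par_mem x hx hxr⟩
  · intro x hx hxr
    obtain ⟨hxp, hx⟩ := (hal x).1 hx
    by_cases e : x = v
    · rw [e, hcutv]
      exact hC.cut_ne _ hp hpr
    · rw [hcut x e]
      exact hC.cut_ne x hx hxr
  · intro x hx hxr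
    obtain ⟨hxp, hx⟩ := (hal x).1 hx
    by_cases e : x = v
    · rw [e, hcutv, hparv]
      exact hC.par_cut _ hp hpr
    · rw [hcut x e, hpar x e]
      exact hC.par_cut x hx hxr
  · intro x hx hxr i hi
    obtain ⟨hxp, hx⟩ := (hal x).1 hx
    rcases hmem x i hi with hi' | ⟨e, hi'⟩
    · by_cases e : x = v
      · rw [e, hcutv]
        exact hsub i (hC.inside v hv hr i (e ▸ hi'))
      · rw [hcut x e]
        exact hC.inside x hx hxr i hi'
    · rw [e, hcutv]
      exact hC.inside _ hp hpr i hi'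
  · intro x hx hxr i hi
    obtain ⟨hxp, hx⟩ := (hal x).1 hx
    by_cases e : x = v
    · rw [e, hparv, hla _ hqv] at hi
      rw [e, hcutv]
      exact hC.outside _ hp hpr i hi
    · rw [hpar x e] at hi
      rw [hcut x e]
      rcases hmem _ i hi with hi' | ⟨e', hi'⟩
      · exact hC.outside x hx hxr i hi'
      -- `x` is a child of `v`, so the subtree of its cut is contained in that of the old cut of
      -- `v`, which the items of `p` avoid.
      · intro hin
        refine hC.outside v hv hr i hi' (mem_sub_trans (mem_sub_trans hin (mem_sub_par _)) ?_)
        rw [hC.par_cut x hx hxr, e']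
        exact hC.inside v hv hr v (hC.self_mem v hv)
  · intro x hx hxr y hy hyr hxy
    obtain ⟨hxp, hx⟩ := (hal x).1 hx
    obtain ⟨hyp, hy⟩ := (hal y).1 hy
    by_cases ex : x = v <;> by_cases ey : y = v
    · rw [ex, ey]
    · rw [ex, hcutv, hcut y ey] at hxy
      exact absurd (hC.cut_inj _ hp hpr y hy hyr hxy).symm hyp
    · rw [ey, hcutv, hcut x ex] at hxy
      exact absurd (hC.cut_inj x hx hxr _ hp hpr hxy) hxp
    · rw [hcut x ex, hcut y ey] at hxy
      exact hC.cut_inj x hx hxr y hy hyr hxy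
  · exact fun x hx => hmem' x x (hC.self_mem x ((hal x).1 hx).2)
  · intro i hi
    obtain ⟨x, hx, hxi⟩ := hC.cover i hi
    by_cases e : x = C.par v
    · exact ⟨v, (hal _).2 ⟨hpv.symm, hv⟩, by rw [hlav, hmA]; exact Or.inr (e ▸ hxi)⟩
    · exact ⟨x, (hal _).2 ⟨e, hx⟩, hmem' x i hxi⟩
  · intro x hx y hy i hix hiy
    obtain ⟨hxv, hx⟩ := (hal x).1 hx
    obtain ⟨hyv, hy⟩ := (hal y).1 hy
    rcases hmem x i hix with h1 | ⟨h1, h1'⟩ <;> rcases hmem y i hiy with h2 | ⟨h2, h2'⟩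
    · exact hC.disj x hx y hy i h1 h2
    · exact absurd (hC.disj x hx _ hp i h1 h2') hxv
    · exact absurd (hC.disj y hy _ hp i h2 h1') hyv
    · rw [h1, h2]
  · intro x hx i hi
    obtain ⟨hxv, hx⟩ := (hal x).1 hx
    rcases hmem x i hi with hi | ⟨_, hi⟩
    · exact hC.la_lt x hx i hi
    · exact hC.la_lt _ hp i hi
  · intro x hx
    obtain ⟨hxv, hx⟩ := (hal x).1 hx
    by_cases e : x = v
    · rw [e, hlav, hA.nodup_iff, List.nodup_append']
      exact ⟨hC.nodup v hv, hC.nodup _ hp, fun i hi => hC.disj' hv hp hpv.symm hi⟩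
    · rw [hla x e]
      exact hC.nodup x hx
  · intro x hx
    obtain ⟨hxv, hx⟩ := (hal x).1 hx
    by_cases e : x = v
    · rw [e, hlav, hlbv]
      exact hA.trans (((hC.perm v hv).append (hC.perm _ hp)).trans hB.symm)
    · rw [hla x e, hlb x e]
      exact hC.perm x hx
  · intro x hx i hi
    obtain ⟨hxv, hx⟩ := (hal x).1 hx
    rcases hmem x i hi with hi | ⟨e, hi⟩
    · rw [hbot x hx hxv i hi, hC.bot_eq x hx i hi]
    · have h1 : (C.compress v (C.par v) A B G).bot i = C.bot i + Key.ofReal (C.len v) := by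
        simp [Conf.compress, hi]
      rw [h1, e, h.key_below (hC.cut_ne v hv hr) (hC.la_lt _ hp i hi) (hC.alive_lt hv)
        (hC.outside v hv hr i hi) (hC.inside v hv hr v (hC.self_mem v hv)), hC.par_cut v hv hr,
        hC.bot_eq _ hp i hi, hC.len_eq v hv hr]
  · intro x hx hxr i hi
    obtain ⟨hxv, hx⟩ := (hal x).1 hx
    by_cases e : x = v
    · rw [e, hparv]
      rw [e, hlav, hmA] at hi
      rcases hi with hi | hi
      · rw [← hC.top_above h hv hr hpr hi]
        simp [Conf.compress, hi]
      · rw [htop _ hp hpv i hi]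
        exact hC.top_eq _ hp hpr i hi
    · rw [hla x e] at hi
      rw [htop x hx e i hi, hpar x e]
      exact hC.top_eq x hx hxr i hi
  · intro x hx hxr
    obtain ⟨hxv, hx⟩ := (hal x).1 hx
    by_cases e : x = v
    · have hin := hC.inside v hv hr v (hC.self_mem v hv)
      have hcN := h.sub_lt (hC.alive_lt hv) hin
      have hout : C.par (C.par v) ∉ Sub spar (C.cut v) := fun e' =>
        hC.outside _ hp hpr _ (hC.self_mem _ hq) (hsub _ e')
      rw [e, hparv, h.sep (hC.cut_ne v hv hr) (hC.alive_lt hv) (hC.alive_lt hq) hin hout,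
        hC.par_cut v hv hr, ← hC.len_eq v hv hr, ← hC.len_eq _ hp hpr]
      simp [Conf.compress]
    · rw [hpar x e, ← hC.len_eq x hx hxr]
      simp [Conf.compress, e]
  · intro x hx
    obtain ⟨hxv, hx⟩ := (hal x).1 hx
    by_cases e : x = v
    · rw [e, hlav]
      exact hAs
    · rw [hla x e]
      refine (hC.la_sorted x hx).imp_of_mem fun {i j} hi hj hij => ?_
      rwa [hbot x hx hxv i hi, hbot x hx hxv j hj]
  · intro x hx
    obtain ⟨hxv, hx⟩ := (hal x).1 hx
    by_cases e : x = v
    · rw [e, hlbv]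
      exact hBs
    · rw [hlb x e]
      refine (hC.lb_sorted x hx).imp_of_mem fun {i j} hi hj hij => ?_
      rwa [htop x hx e i ((hC.mem_lb hx).1 hi), htop x hx e j ((hC.mem_lb hx).1 hj)]
  · intro x hx i hi
    obtain ⟨hxv, hx⟩ := (hal x).1 hx
    by_cases e : x = v
    · rw [e, hlav] at hi ⊢
      exact hC.gain_union h hv hr hG hA hi
    · rw [hla x e] at hi ⊢
      rw [← hC.gain_eq x hx i hi]
      exact hG.other i (hC.disj' hx hv e hi) (hC.disj' hx hp hxv hi)
  · intro x hx
    obtain ⟨hxv, hx⟩ := (hal x).1 hx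
    refine (hC.cnt_eq x hx).trans ?_
    -- Among the children of a remaining node, `p` is replaced by `v`.
    refine Finset.card_bij' (fun c _ => if c = C.par v then v else c)
      (fun c _ => if c = v ∧ x = C.par (C.par v) then C.par v else c) ?_ ?_ ?_ ?_
    · intro c hc
      obtain ⟨hc, hcr, hcx⟩ := Finset.mem_filter.1 hc
      refine Finset.mem_filter.2 ?_
      split_ifs with e
      · exact ⟨(hal _).2 ⟨hpv.symm, hv⟩, hr, by rw [hparv, ← hcx, e]⟩
      · have : c ≠ v := fun e' => hxv (by rw [← hcx, e'])
        exact ⟨(hal _).2 ⟨e, hc⟩, hcr, by rw [hpar c this, hcx]⟩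
    · intro c hc
      obtain ⟨hc, hcr, hcx⟩ := Finset.mem_filter.1 hc
      obtain ⟨hcv, hc⟩ := (hal c).1 hc
      refine Finset.mem_filter.2 ?_
      split_ifs with e
      · exact ⟨hp, hpr, e.2.symm⟩
      · by_cases e' : c = v
        · rw [e', hparv] at hcx
          exact absurd ⟨e', hcx.symm⟩ e
        · rw [hpar c e'] at hcx
          exact ⟨hc, hcr, hcx⟩
    · intro c hc
      obtain ⟨hc, hcr, hcx⟩ := Finset.mem_filter.1 hc
      by_cases e : c = C.par v
      · subst e
        simp [hcx]
      · have : c ≠ v := fun e' => hxv (by rw [← hcx, e'])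
        simp [e, this]
    · intro c hc
      obtain ⟨hc, hcr, hcx⟩ := Finset.mem_filter.1 hc
      obtain ⟨hcv, hc⟩ := (hal c).1 hc
      by_cases e : c = v
      · rw [e, hparv] at hcx
        simp [e, hcx]
      · simp [e, hcv]
  · exact fun x hx => hC.cnt_le x ((hal x).1 hx).2

end Conf.Valid

end TreeLocation

/-! ### The first stage, and the progress made by a maximal set of contractions -/

namespace TreeLocation

/-- The first stage: every node is alive and forms a cluster of its own. -/
noncomputable def Conf.init (N : ℕ) (par : ℕ → ℕ) (len : ℕ → ℝ) (cnt : ℕ → ℕ) (α β : ℕ → Key) :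
    Conf where
  alive := Finset.range N
  par := par
  len := len
  cnt := cnt
  cut := id
  bot := α
  top i := β i + Key.ofReal (len i)
  la v := [v]
  lb v := [v]
  gain _ := 0

/-- With clusters of one node every node is its own cut. A node is below itself, so its bottom key
is `α`; its parent is not, so its top key is `β` plus the length. No pair has been counted yet, in
accordance with the exclusion of `j = i` in `contrib`. -/
theorem Conf.init_valid {N ρ : ℕ} {par : ℕ → ℕ} {len : ℕ → ℝ} {d : ℕ → ℕ → ℝ} {cnt : ℕ → ℕ}
    {α β : ℕ → Key} {wt : ℕ → ℝ} (h : RootedMetric N ρ par len d)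
    (hcnt : ∀ v < N, cnt v = ((Finset.range N).filter fun c => c ≠ ρ ∧ par c = v).card)
    (hle : ∀ v < N, cnt v ≤ 2) : (Conf.init N par len cnt α β).Valid N ρ par d α β wt := by
  have hlt : ∀ v, v ∈ (Conf.init N par len cnt α β).alive → v < N := fun v hv => by
    simpa [Conf.init] using hv
  have hpar : ∀ v < N, v ≠ ρ → par v ∉ Sub par v := fun v hv hr => h.par_notMem_sub hv hr
  constructor
  · simpa [Conf.init] using h.root_lt
  · intro v hv _
    simpa [Conf.init] using h.par_lt v (hlt v hv)
  · exact fun v _ hr => hr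
  · exact fun v _ _ => rfl
  · intro v _ _ i hi
    obtain rfl : i = v := by simpa [Conf.init] using hi
    exact mem_sub_self _
  · intro v hv hr i hi
    obtain rfl : i = par v := by simpa [Conf.init] using hi
    exact hpar v (hlt v hv) hr
  · exact fun v _ _ v' _ _ e => e
  · exact fun v _ => by simp [Conf.init]
  · exact fun i hi => ⟨i, by simpa [Conf.init] using hi, by simp [Conf.init]⟩
  · intro v _ v' _ i hi hi'
    simp only [Conf.init, List.mem_singleton] at hi hi'
    rw [← hi, ← hi']
  · intro v hv i hi
    obtain rfl : i = v := by simpa [Conf.init] using hi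
    exact hlt _ hv
  · exact fun v _ => by simp [Conf.init]
  · exact fun v _ => List.Perm.refl _
  · intro v hv i hi
    obtain rfl : i = v := by simpa [Conf.init] using hi
    rw [key, h.self _ (hlt _ hv), side, if_pos (mem_sub_self _)]
    exact (zero_add _).symm
  · intro v hv hr i hi
    obtain rfl : i = v := by simpa [Conf.init] using hi
    have hv := hlt _ hv
    have hp := h.par_lt _ hv
    change β i + Key.ofReal (len i) = key par d α β i (par i)
    rw [key, side, if_neg (hpar i hv hr), h.up i hv _ hp (hpar i hv hr), h.self _ hp, add_zero,
      add_comm]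
  · intro v hv hr
    have hv := hlt _ hv
    have hp := h.par_lt _ hv
    change len v = d v (par v)
    rw [h.up v hv _ hp (hpar v hv hr), h.self _ hp, add_zero]
  · exact fun v _ => List.pairwise_singleton _ _
  · exact fun v _ => List.pairwise_singleton _ _
  · intro v _ i hi
    obtain rfl : i = v := by simpa [Conf.init] using hi
    simp [Conf.init, contrib]
  · exact fun v hv => hcnt v (hlt v hv)
  · exact fun v hv => hle v (hlt v hv)

/-- No unmarked node can be contracted with an unmarked parent. -/
def Conf.Exhausted (C : Conf) (ρ : ℕ) (M : Finset ℕ) (v : ℕ) : Prop :=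
  v ≠ ρ → v ∉ M → C.par v ∈ M ∨ C.cnt v ≠ 0 ∧ (C.cnt (C.par v) ≠ 1 ∨ C.par v = ρ)

namespace Conf.Valid

variable {C : Conf} {N ρ : ℕ} {spar : ℕ → ℕ} {slen : ℕ → ℝ} {d : ℕ → ℕ → ℝ} {α β : ℕ → Key}
  {wt : ℕ → ℝ}

/-- Some node other than the root is a leaf. -/
theorem exists_leaf (hC : C.Valid N ρ spar d α β wt) (h : RootedMetric N ρ spar slen d)
    (h2 : 2 ≤ C.alive.card) : ∃ v ∈ C.alive, v ≠ ρ ∧ C.cnt v = 0 := by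
  obtain ⟨lev, hlev⟩ := h.rank
  have hne : (C.alive.erase ρ).Nonempty := by
    rw [← Finset.card_pos, Finset.card_erase_of_mem hC.root_mem]
    omega
  -- A node of maximal level in the original tree: a child `c` of it would be below `cut c`, whose
  -- parent is `v`, and hence would have a larger level.
  obtain ⟨v, hv, hmax⟩ := Finset.exists_max_image _ lev hne
  obtain ⟨hr, hv⟩ := Finset.mem_erase.1 hv
  refine ⟨v, hv, hr, ?_⟩
  rw [hC.cnt_eq v hv, Finset.card_eq_zero, Finset.filter_eq_empty_iff]
  rintro c hc ⟨hcr, rfl⟩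
  have hin := hC.inside c hc hcr c (hC.self_mem c hc)
  have hcN := hC.alive_lt hc
  have h1 := hlev _ (h.sub_lt hcN hin) (hC.cut_ne c hc hcr)
  rw [hC.par_cut c hc hcr] at h1
  have h3 := hmax c (Finset.mem_erase.2 ⟨hcr, hc⟩)
  rcases h.sub_rank hlev hcN hin with e | e
  · rw [← e] at h1
    omega
  · omega

/-- Counting the nodes other than the root by their parents gives the sum of the numbers of
children, each of which is `0`, `1` or `2`. So leaves outnumber branching nodes by one. -/
theorem card_leaves (hC : C.Valid N ρ spar d α β wt) :
    (C.alive.filter fun v => C.cnt v = 2).card + 1 =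
      (C.alive.filter fun v => C.cnt v = 0).card := by
  have h1 : (C.alive.erase ρ).card = ∑ v ∈ C.alive, C.cnt v := by
    rw [Finset.card_eq_sum_card_fiberwise (f := C.par) (t := C.alive) fun v hv => by
      obtain ⟨hr, hv⟩ := Finset.mem_erase.1 hv
      exact hC.par_mem v hv hr]
    refine Finset.sum_congr rfl fun v hv => ?_
    rw [hC.cnt_eq v hv]
    congr 1
    ext c
    simp only [Finset.mem_filter, Finset.mem_erase]
    tauto
  have h2 : ∑ v ∈ C.alive, (C.cnt v + if C.cnt v = 0 then 1 else 0) =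
      ∑ v ∈ C.alive, (1 + if C.cnt v = 2 then 1 else 0) := by
    refine Finset.sum_congr rfl fun v hv => ?_
    have := hC.cnt_le v hv
    split_ifs <;> omega
  rw [Finset.sum_add_distrib, Finset.sum_add_distrib, ← h1, ← Finset.card_filter,
    ← Finset.card_filter, Finset.card_erase_of_mem hC.root_mem] at h2
  have := Finset.card_pos.2 ⟨ρ, hC.root_mem⟩
  simp only [Finset.sum_const, smul_eq_mul, mul_one] at h2
  omega

/-- A maximal set of contractions contracts a constant fraction of the tree. -/
theorem card_le_of_exhausted (hC : C.Valid N ρ spar d α β wt) (h : RootedMetric N ρ spar slen d)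
    {M : Finset ℕ} (hM : M ⊆ C.alive) (hE : ∀ v ∈ C.alive, C.Exhausted ρ M v)
    (h2 : 2 ≤ C.alive.card + M.card) : C.alive.card + M.card ≤ 13 * M.card := by
  -- Without marks, a leaf other than the root could have been raked.
  have hM1 : 1 ≤ M.card := by
    by_contra hcon
    have h0 : M.card = 0 := by omega
    obtain ⟨v, hv, hr, hv0⟩ := hC.exists_leaf h (by omega)
    rw [Finset.card_eq_zero] at h0
    rcases hE v hv hr (by simp [h0]) with e | e
    · simp [h0] at e
    · exact e.1 hv0
  set ch : ℕ → Finset ℕ := fun p => C.alive.filter fun c => c ≠ ρ ∧ C.par c = p with hch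
  have hch2 : ∀ p ∈ C.alive, (ch p).card ≤ 2 := fun p hp => by
    rw [← hC.cnt_eq p hp]
    exact hC.cnt_le p hp
  set U := M.biUnion ch with hU
  set B := C.alive.filter fun v => C.cnt v = 2 with hB
  set L := C.alive.filter fun v => C.cnt v = 0 with hL
  have hUc : U.card ≤ M.card * 2 :=
    Finset.card_biUnion_le_card_mul _ _ _ fun p hp => hch2 p (hM hp)
  have hmemU : ∀ v ∈ C.alive, v ≠ ρ → C.par v ∈ M → v ∈ U := fun v hv hr hp =>
    Finset.mem_biUnion.2 ⟨_, hp, Finset.mem_filter.2 ⟨hv, hr, rfl⟩⟩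
  have hLc : L.card ≤ M.card + U.card + 1 := by
    have : L ⊆ (M ∪ U) ∪ {ρ} := by
      intro v hv
      obtain ⟨hv, hv0⟩ := Finset.mem_filter.1 hv
      simp only [Finset.mem_union, Finset.mem_singleton]
      by_cases hr : v = ρ
      · exact Or.inr hr
      · by_cases hvM : v ∈ M
        · exact Or.inl (Or.inl hvM)
        · rcases hE v hv hr hvM with e | e
          · exact Or.inl (Or.inr (hmemU v hv hr e))
          · exact absurd hv0 e.1
    refine (Finset.card_le_card this).trans ((Finset.card_union_le _ _).trans ?_)
    exact Nat.add_le_add (Finset.card_union_le _ _) (by simp)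
  have hBc : B.card + 1 = L.card := hC.card_leaves
  have hBU : (B.biUnion ch).card ≤ B.card * 2 :=
    Finset.card_biUnion_le_card_mul _ _ _ fun p hp => hch2 p (Finset.mem_filter.1 hp).1
  -- Let `m` be the number of marks. At most `2 * m` nodes have a marked parent. A leaf is marked,
  -- has a marked parent or is the root, so there are at most `3 * m + 1` leaves and `3 * m`
  -- branching nodes. Every remaining node is the root, a child of the root or a child of a
  -- branching node. In total `m + 2 * m + 6 * m + 2 + 1 ≤ 12 * m` nodes are alive.
  have hall : C.alive ⊆ (((M ∪ U) ∪ B.biUnion ch) ∪ ch ρ) ∪ {ρ} := by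
    intro v hv
    simp only [Finset.mem_union, Finset.mem_singleton]
    by_cases hr : v = ρ
    · exact Or.inr hr
    · by_cases hvM : v ∈ M
      · exact Or.inl (Or.inl (Or.inl (Or.inl hvM)))
      · have hvch : v ∈ ch (C.par v) := Finset.mem_filter.2 ⟨hv, hr, rfl⟩
        rcases hE v hv hr hvM with e | ⟨-, e | e⟩
        · exact Or.inl (Or.inl (Or.inl (Or.inr (hmemU v hv hr e))))
        · refine Or.inl (Or.inl (Or.inr (Finset.mem_biUnion.2 ⟨_, Finset.mem_filter.2
            ⟨hC.par_mem v hv hr, ?_⟩, hvch⟩)))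
          have h3 := hC.cnt_le _ (hC.par_mem v hv hr)
          have h4 : 0 < C.cnt (C.par v) := by
            rw [hC.cnt_eq _ (hC.par_mem v hv hr)]
            exact Finset.card_pos.2 ⟨v, hvch⟩
          omega
        · exact Or.inl (Or.inr (e ▸ hvch))
  have h5 := Finset.card_le_card hall
  have h6 := Finset.card_union_le (((M ∪ U) ∪ B.biUnion ch) ∪ ch ρ) {ρ}
  have h7 := Finset.card_union_le ((M ∪ U) ∪ B.biUnion ch) (ch ρ)
  have h8 := Finset.card_union_le (M ∪ U) (B.biUnion ch)
  have h9 := Finset.card_union_le M U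
  have h10 := hch2 ρ hC.root_mem
  rw [Finset.card_singleton] at h6
  omega

end Conf.Valid

end TreeLocation

/-! ### Linked lists in memory -/

namespace RealRAM

open TreeLocation

/-- Disjunction of tests. -/
def Test.or (b c : Test) : Test := .not (.and (.not b) (.not c))

@[simp] theorem Test.holds_or {σ : Store} {b c : Test} :
    (b.or c).Holds σ ↔ b.Holds σ ∨ c.Holds σ := by
  simp only [Test.or, Test.Holds]
  tauto

/-- Starting from the address `h`, the pointers `nxt` run through the list `l` and end in `z`. -/
def IsList (z : ℕ) (nxt : ℕ → ℕ) : ℕ → List ℕ → Prop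
  | h, [] => h = z
  | h, x :: xs => h = x ∧ x ≠ z ∧ IsList z nxt (nxt x) xs

theorem IsList.congr {z : ℕ} {nxt nxt' : ℕ → ℕ} {h : ℕ} {l : List ℕ} (H : IsList z nxt h l)
    (e : ∀ x ∈ l, nxt' x = nxt x) : IsList z nxt' h l := by
  induction l generalizing h with
  | nil => exact H
  | cons x xs ih =>
    refine ⟨H.1, H.2.1, ?_⟩
    rw [e x (List.mem_cons_self ..)]
    exact ih H.2.2 fun y hy => e y (List.mem_cons_of_mem _ hy)

theorem IsList.update {z : ℕ} {nxt : ℕ → ℕ} {h : ℕ} {l : List ℕ} (H : IsList z nxt h l) {x : ℕ}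
    (hx : x ∉ l) (v : ℕ) : IsList z (Function.update nxt x v) h l :=
  H.congr fun y hy => by
    rw [Function.update_of_ne]
    rintro rfl
    exact hx hy

theorem IsList.eq_nil {z : ℕ} {nxt : ℕ → ℕ} {l : List ℕ} (H : IsList z nxt z l) : l = [] := by
  cases l with
  | nil => rfl
  | cons x xs => exact absurd H.1.symm H.2.1

theorem IsList.eq_cons {z : ℕ} {nxt : ℕ → ℕ} {h : ℕ} {l : List ℕ} (H : IsList z nxt h l)
    (hz : h ≠ z) : ∃ xs, l = h :: xs ∧ IsList z nxt (nxt h) xs := by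
  cases l with
  | nil => exact absurd H hz
  | cons x xs =>
    obtain ⟨rfl, -, H⟩ := H
    exact ⟨xs, rfl, H⟩

/-- The key stored in the cells `i` of the real arrays `X` and `E`. -/
noncomputable def Store.key (σ : Store) (X E i : ℕ) : Key :=
  toLex (σ.realArr X i, σ.realArr E i)

theorem Store.key_lt {σ : Store} {X E i j : ℕ} : σ.key X E i < σ.key X E j ↔
    σ.realArr X i < σ.realArr X j ∨
      σ.realArr X i = σ.realArr X j ∧ σ.realArr E i < σ.realArr E j := by
  rw [Store.key, Store.key, Prod.Lex.toLex_lt_toLex]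

theorem Store.key_add_neg {σ : Store} {X E X' E' i j : ℕ} : σ.key X E i + σ.key X' E' j < 0 ↔
    σ.realArr X i + σ.realArr X' j < 0 ∨
      σ.realArr X i + σ.realArr X' j = 0 ∧ σ.realArr E i + σ.realArr E' j < 0 := by
  rw [Store.key, Store.key, ← toLex_add, Prod.mk_add_mk,
    show (0 : Key) = toLex ((0 : ℝ), (0 : ℝ)) from rfl, Prod.Lex.toLex_lt_toLex]

namespace ListCmd

/-- Reverse the list with the pointers `nx` that starts at index variable `20`, writing the
pointers of the reversed list, which starts at index variable `22`, to `tn`. -/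
def reverse (nx tn : ℕ) : Cmd :=
  .setIdx 22 (.var 2) ;;
  .loop (.not (.idxEq (.var 20) (.var 2)))
    (.setIdx 23 (.read nx (.var 20)) ;; .writeIdx tn (.var 20) (.var 22) ;;
      .setIdx 22 (.var 20) ;; .setIdx 20 (.var 23))

/-- The ghost state consists of the reversed part and the rest of the list. The arrays `nx` and `tn`
may coincide. -/
theorem reverse_runs {nx tn N : ℕ} {σ : Store} {l : List ℕ} (hN : σ.idx 2 = N)
    (hl : IsList N (σ.idxArr nx) (σ.idx 20) l) (hnd : l.Nodup) :
    Runs (reverse nx tn) σ (30 * (l.length + 1)) fun τ =>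
      IsList N (τ.idxArr tn) (τ.idx 22) l.reverse ∧
      ∀ x ∉ l, τ.idxArr tn x = σ.idxArr tn x := by
  have key := Runs.loop_const (b := .not (.idxEq (.var 20) (.var 2)))
    (c := .setIdx 23 (.read nx (.var 20)) ;; .writeIdx tn (.var 20) (.var 22) ;;
      .setIdx 22 (.var 20) ;; .setIdx 20 (.var 23))
    (fun (g : List ℕ × List ℕ) τ => τ.idx 2 = N ∧ IsList N (τ.idxArr nx) (τ.idx 20) g.2 ∧
      IsList N (τ.idxArr tn) (τ.idx 22) g.1 ∧ g.1.reverse ++ g.2 = l ∧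
      (∀ x ∉ l, τ.idxArr tn x = σ.idxArr tn x)) (fun g => g.2.length) 10 (by
    rintro ⟨a, r⟩ τ ⟨h2, hr, ha, hl', hx⟩ hb
    simp only at hr ha hl'
    obtain ⟨xs, rfl, hxs⟩ := hr.eq_cons (by simpa [Test.Holds, IExp.eval, h2] using hb)
    rw [← hl', List.nodup_append', List.nodup_cons] at hnd
    have hia : τ.idx 20 ∉ a := fun e => hnd.2.2 (List.mem_reverse.2 e) (by simp)
    refine Runs.of_wp' ?_ (by simp [Cmd.bound, IExp.cost])
    simp only [Cmd.wp, IExp.eval]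
    refine ⟨(τ.idx 20 :: a, xs), ⟨by simpa using h2, ?_, ?_, ?_, ?_⟩, by simp⟩
    · simp only [Store.setI_idx, Store.setI_idxArr, Store.setIA_idxArr]
      norm_num
      -- For `nx = tn` the list is reversed in place: the successor was saved before its cell was
      -- overwritten, and that cell does not occur in the rest of the list.
      split_ifs with e
      · subst e
        exact hxs.update hnd.2.1.1 _
      · exact hxs
    · simp only [Store.setI_idx, Store.setI_idxArr, Store.setIA_idxArr]
      norm_num
      refine ⟨rfl, by simpa [Test.Holds, IExp.eval, h2] using hb, ?_⟩
      rw [Function.update_self]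
      exact ha.update hia _
    · simpa using hl'
    · intro x hxl
      have : x ≠ τ.idx 20 := by
        rintro rfl
        exact hxl (hl' ▸ by simp)
      simpa [this, Function.update_of_ne this] using hx x hxl)
  refine ((Runs.of_wp (c := .setIdx 22 (.var 2))
    (Q := fun τ => τ = σ.setI 22 (σ.idx 2)) rfl).seq fun τ hτ =>
      key ([], l) τ ?_).mono ?_ ?_
  · subst hτ
    exact ⟨by simpa using hN, by simpa using hl, by simpa [IsList] using hN, rfl, fun _ _ => rfl⟩
  · simp only [Cmd.bound, Test.cost, IExp.cost]
    omega
  · rintro τ ⟨⟨a, r⟩, ⟨h2, hr, ha, hl', hx⟩, hb⟩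
    simp only [Test.Holds, IExp.eval, not_not] at hb hr ha hl'
    rw [hb, h2] at hr
    rw [hr.eq_nil, List.append_nil] at hl'
    rw [← hl', List.reverse_reverse, hl']
    exact ⟨ha, hx⟩

/-- Run the body for the elements of the list with the pointers `nx` that starts at the index
variable `20`. -/
def forList (nx : ℕ) (c : Cmd) : Cmd :=
  .loop (.not (.idxEq (.var 20) (.var 2))) (c ;; .setIdx 20 (.read nx (.var 20)))

/-- The body must not touch the cursor, the end mark or the pointers. The argument of the invariant
is the list of the items still to be visited; it must not depend on the cursor, which advances after
the body. -/
theorem forList_runs {nx N T : ℕ} {c : Cmd} {σ : Store} {l : List ℕ} (I : List ℕ → Store → Prop)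
    (hN : σ.idx 2 = N) (hl : IsList N (σ.idxArr nx) (σ.idx 20) l)
    (h20 : c.touches 0 20 = false) (h2 : c.touches 0 2 = false) (hnx : c.touches 2 nx = false)
    (hI : ∀ r τ v, I r τ → I r (τ.setI 20 v)) (h : I l σ)
    (step : ∀ x r τ, x ∉ r → I (x :: r) τ → τ.idx 20 = x → Runs c τ T (I r)) (hnd : l.Nodup) :
    Runs (forList nx c) σ ((T + 10) * (l.length + 1)) (I []) := by
  have key := Runs.loop_const (b := .not (.idxEq (.var 20) (.var 2)))
    (c := c ;; .setIdx 20 (.read nx (.var 20)))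
    (fun (r : List ℕ) τ => τ.idx 2 = N ∧ IsList N (τ.idxArr nx) (τ.idx 20) r ∧ r.Nodup ∧ I r τ)
    (fun r => r.length) (T + 3) (by
    rintro r τ ⟨h2', hr, hrn, hI'⟩ hb
    obtain ⟨xs, rfl, hxs⟩ := hr.eq_cons (by simpa [Test.Holds, IExp.eval, h2'] using hb)
    rw [List.nodup_cons] at hrn
    refine (step _ xs τ hrn.1 hI' rfl).frame.seq fun υ ⟨hυ, hf⟩ => ?_
    refine Runs.of_wp' ?_ (by simp [Cmd.bound, IExp.cost])
    simp only [Cmd.wp, IExp.eval]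
    refine ⟨xs, ⟨?_, ?_, hrn.2, hI _ _ _ hυ⟩, by simp⟩
    · simpa [hf.idx 2 h2] using h2'
    · simpa [hf.idx 20 h20, hf.idxArr nx hnx] using hxs)
  refine (key l σ ⟨hN, hl, hnd, h⟩).mono ?_ ?_
  · simp only [Test.cost, IExp.cost]
    nlinarith
  · rintro τ ⟨r, ⟨h2', hr, -, hI'⟩, hb⟩
    simp only [Test.Holds, IExp.eval, not_not] at hb
    rw [hb, h2'] at hr
    rwa [hr.eq_nil] at hI'

/-- Add the real variable `10` to the cells of the real array `X` along a list. -/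
def shift (nx X : ℕ) : Cmd :=
  forList nx (.writeReal X (.var 20) (.add (.read X (.var 20)) (.var 10)))

theorem shift_runs {nx X N : ℕ} {σ : Store} {l : List ℕ} (hN : σ.idx 2 = N)
    (hl : IsList N (σ.idxArr nx) (σ.idx 20) l) (hnd : l.Nodup) :
    Runs (shift nx X) σ (20 * (l.length + 1)) fun τ =>
      ∀ x, τ.realArr X x = if x ∈ l then σ.realArr X x + σ.real 10 else σ.realArr X x := by
  refine (forList_runs (T := 7) (fun r τ => τ.real 10 = σ.real 10 ∧ r ⊆ l ∧ ∀ x, τ.realArr X x =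
    if x ∈ l ∧ x ∉ r then σ.realArr X x + σ.real 10 else σ.realArr X x) hN hl rfl rfl rfl
    (fun r τ v h => h) ⟨rfl, List.Subset.refl _, fun x => by simp⟩ ?_ hnd).mono (by omega)
    fun τ h => by simpa using h.2.2
  rintro x r τ hx ⟨h1, h2, h3⟩ rfl
  refine Runs.of_wp' ?_ (by simp [Cmd.bound, IExp.cost, RExp.cost])
  simp only [Cmd.wp, IExp.eval, RExp.eval]
  refine ⟨h1, fun y hy => h2 (List.mem_cons_of_mem _ hy), fun y => ?_⟩
  simp only [Store.setRA_realArr, if_true]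
  by_cases hy : y = τ.idx 20
  · subst hy
    rw [Function.update_self, h3, h1, if_neg (by simp), if_pos ⟨h2 (by simp), hx⟩]
  · rw [Function.update_of_ne hy, h3]
    simp [hy]

/-- Copy the pointers `nb` and the keys `xb`, `eb` along a list to `na`, `xa`, `ea`. -/
def copy (nb na xb xa eb ea : ℕ) : Cmd :=
  forList nb (.writeIdx na (.var 20) (.read nb (.var 20)) ;;
    .writeReal xa (.var 20) (.read xb (.var 20)) ;; .writeReal ea (.var 20) (.read eb (.var 20)))

theorem copy_runs {nb na xb xa eb ea N : ℕ} {σ : Store} {l : List ℕ} (hN : σ.idx 2 = N)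
    (hl : IsList N (σ.idxArr nb) (σ.idx 20) l) (hnd : l.Nodup) (hn : nb ≠ na) (h1 : xb ≠ xa)
    (h2 : xb ≠ ea) (h3 : eb ≠ xa) (h4 : eb ≠ ea) (h5 : xa ≠ ea) :
    Runs (copy nb na xb xa eb ea) σ (30 * (l.length + 1)) fun τ => ∀ x,
      τ.idxArr na x = (if x ∈ l then σ.idxArr nb x else σ.idxArr na x) ∧
      τ.realArr xa x = (if x ∈ l then σ.realArr xb x else σ.realArr xa x) ∧
      τ.realArr ea x = (if x ∈ l then σ.realArr eb x else σ.realArr ea x) := by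
  refine (forList_runs (T := 20) (fun r τ => τ.idxArr nb = σ.idxArr nb ∧
    τ.realArr xb = σ.realArr xb ∧ τ.realArr eb = σ.realArr eb ∧ r ⊆ l ∧ ∀ x,
      τ.idxArr na x = (if x ∈ l ∧ x ∉ r then σ.idxArr nb x else σ.idxArr na x) ∧
      τ.realArr xa x = (if x ∈ l ∧ x ∉ r then σ.realArr xb x else σ.realArr xa x) ∧
      τ.realArr ea x = (if x ∈ l ∧ x ∉ r then σ.realArr eb x else σ.realArr ea x)) hN hl rfl rfl
      (by simp [Cmd.touches, hn]) (fun r τ v h => h)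
      ⟨rfl, rfl, rfl, List.Subset.refl _, fun x => by simp⟩ ?_ hnd).mono (by omega)
    fun τ h => by simpa using h.2.2.2.2
  rintro x r τ hx ⟨e1, e2, e3, hr, e4⟩ rfl
  refine Runs.of_wp' ?_ (by simp [Cmd.bound, IExp.cost, RExp.cost])
  simp only [Cmd.wp, IExp.eval, RExp.eval]
  refine ⟨by simp [hn, e1], by simp [h1, h2, e2], by simp [h3, h4, e3],
    fun y hy => hr (List.mem_cons_of_mem _ hy), fun y => ?_⟩
  simp only [Store.setRA_realArr, Store.setIA_realArr, Store.setRA_idxArr, Store.setIA_idxArr,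
    Store.setRA_idx, Store.setIA_idx, if_true, h5, h5.symm, h3, if_false, e1, e2, e3]
  have hxl : τ.idx 20 ∈ l := hr (by simp)
  obtain ⟨e5, e6, e7⟩ := e4 y
  by_cases hy : y = τ.idx 20
  · subst hy
    simp only [Function.update_self, if_pos (show τ.idx 20 ∈ l ∧ τ.idx 20 ∉ r from ⟨hxl, hx⟩),
      and_self]
  · simp only [Function.update_of_ne hy, e5, e6, e7, List.mem_cons, hy, false_or, and_self]

end ListCmd

end RealRAM

/-! ### Merging and sweeping sorted lists -/

namespace RealRAM

open TreeLocation

namespace ListCmd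

/-- The key of the item in index variable `x` is less than that of the item in `y`. -/
def keyLt (X E x y : ℕ) : Test :=
  .or (.realLt (.read X (.var x)) (.read X (.var y)))
    (.and (.realEq (.read X (.var x)) (.read X (.var y)))
      (.realLt (.read E (.var x)) (.read E (.var y))))

theorem holds_keyLt {X E x y : ℕ} {σ : Store} :
    (keyLt X E x y).Holds σ ↔ σ.key X E (σ.idx x) < σ.key X E (σ.idx y) := by
  rw [Store.key_lt, keyLt, Test.holds_or]
  rfl

/-- The sum of the keys of the items in index variables `x` and `y` is negative. -/
def keyNeg (X E x X' E' y : ℕ) : Test :=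
  .or (.realLt (.add (.read X (.var x)) (.read X' (.var y))) (.lit 0))
    (.and (.realEq (.add (.read X (.var x)) (.read X' (.var y))) (.lit 0))
      (.realLt (.add (.read E (.var x)) (.read E' (.var y))) (.lit 0)))

theorem holds_keyNeg {X E x X' E' y : ℕ} {σ : Store} :
    (keyNeg X E x X' E' y).Holds σ ↔ σ.key X E (σ.idx x) + σ.key X' E' (σ.idx y) < 0 := by
  rw [Store.key_add_neg, keyNeg, Test.holds_or]
  simp [Test.Holds, RExp.eval, IExp.eval]

/-- Merge the sorted lists that start at index variables `20` and `21` into a list in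
descending order that starts at index variable `22`. -/
def mergeRev (nx X E : ℕ) : Cmd :=
  .setIdx 22 (.var 2) ;;
  .loop (.or (.not (.idxEq (.var 20) (.var 2))) (.not (.idxEq (.var 21) (.var 2))))
    (.ite (.or (.idxEq (.var 21) (.var 2))
        (.and (.not (.idxEq (.var 20) (.var 2))) (.not (keyLt X E 21 20))))
      (.setIdx 23 (.var 20) ;; .setIdx 20 (.read nx (.var 20)))
      (.setIdx 23 (.var 21) ;; .setIdx 21 (.read nx (.var 21))) ;;
    .writeIdx nx (.var 23) (.var 22) ;; .setIdx 22 (.var 23))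

/-- The invariant of merging: `a` is the merged part, `l` and `r` are still to be merged. -/
structure MergeInv (N nx : ℕ) (k : ℕ → Key) (l₀ : List ℕ) (σ₀ : Store)
    (g : List ℕ × List ℕ × List ℕ) (τ : Store) : Prop where
  nil : τ.idx 2 = N
  real : τ.realArr = σ₀.realArr
  acc : IsList N (τ.idxArr nx) (τ.idx 22) g.1
  left : IsList N (τ.idxArr nx) (τ.idx 20) g.2.1
  right : IsList N (τ.idxArr nx) (τ.idx 21) g.2.2
  perm : (g.1 ++ (g.2.1 ++ g.2.2)).Perm l₀
  sorted : (g.1.reverse ++ g.2.1).Pairwise fun i j => k i ≤ k j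
  sorted' : (g.1.reverse ++ g.2.2).Pairwise fun i j => k i ≤ k j
  other : ∀ x ∉ l₀, τ.idxArr nx x = σ₀.idxArr nx x

/-- The smaller head is pushed to the front of the accumulated list, which therefore is descending;
no pointer to a last cell has to be kept. Sortedness of the reversed accumulated list followed by
either of the two rests is all that has to be maintained. -/
theorem mergeRev_runs {nx X E N : ℕ} {σ : Store} {l r : List ℕ} (hN : σ.idx 2 = N)
    (hl : IsList N (σ.idxArr nx) (σ.idx 20) l) (hr : IsList N (σ.idxArr nx) (σ.idx 21) r)
    (hnd : (l ++ r).Nodup) (hls : l.Pairwise fun i j => σ.key X E i ≤ σ.key X E j)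
    (hrs : r.Pairwise fun i j => σ.key X E i ≤ σ.key X E j) :
    Runs (mergeRev nx X E) σ (120 * (l.length + r.length + 1)) fun τ => ∃ a,
      IsList N (τ.idxArr nx) (τ.idx 22) a ∧ a.Perm (l ++ r) ∧
      a.reverse.Pairwise (fun i j => σ.key X E i ≤ σ.key X E j) ∧
      (∀ x ∉ l ++ r, τ.idxArr nx x = σ.idxArr nx x) ∧ τ.idx 2 = N := by
  have key := Runs.loop_const
    (b := .or (.not (.idxEq (.var 20) (.var 2))) (.not (.idxEq (.var 21) (.var 2))))
    (c := .ite (.or (.idxEq (.var 21) (.var 2))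
        (.and (.not (.idxEq (.var 20) (.var 2))) (.not (keyLt X E 21 20))))
      (.setIdx 23 (.var 20) ;; .setIdx 20 (.read nx (.var 20)))
      (.setIdx 23 (.var 21) ;; .setIdx 21 (.read nx (.var 21))) ;;
    .writeIdx nx (.var 23) (.var 22) ;; .setIdx 22 (.var 23))
    (MergeInv N nx (σ.key X E) (l ++ r) σ) (fun g => g.2.1.length + g.2.2.length) 90 (by
    rintro ⟨a, l', r'⟩ τ ⟨h2, hre, ha, hl', hr', hp, hs, hs', ho⟩ hb
    simp only at ha hl' hr' hp hs hs'
    simp only [Test.holds_or, Test.Holds, IExp.eval, h2] at hb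
    have hnd' := hp.nodup_iff.2 hnd
    have hkey : τ.key X E = σ.key X E := by
      funext i
      simp [Store.key, hre]
    refine Runs.of_wp' ?_ (by
      simp [Cmd.bound, IExp.cost, RExp.cost, Test.cost, Test.or, keyLt])
    simp only [Cmd.wp, IExp.eval, Test.holds_or, Test.Holds, holds_keyLt, h2, hkey]
    constructor
    · intro hpick
      have h20 : τ.idx 20 ≠ N := by
        rcases hpick with e | e
        · rcases hb with e' | e'
          · exact e'
          · exact absurd e e'
        · exact e.1
      obtain ⟨xs, rfl, hxs⟩ := hl'.eq_cons h20
      -- The chosen head is at most the other head, by the test, and at most everything behind it,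
      -- by sortedness.
      have hsmall : ∀ y ∈ r', σ.key X E (τ.idx 20) ≤ σ.key X E y := by
        intro y hy
        rcases hpick with e | e
        · rw [e] at hr'
          rw [hr'.eq_nil] at hy
          exact absurd hy List.not_mem_nil
        · have hne : τ.idx 21 ≠ N := by
            intro e'
            rw [e'] at hr'
            rw [hr'.eq_nil] at hy
            exact absurd hy List.not_mem_nil
          obtain ⟨ys, rfl, -⟩ := hr'.eq_cons hne
          refine (not_lt.1 e.2).trans ?_
          rcases List.mem_cons.1 hy with rfl | hy
          · exact le_rfl
          · exact List.rel_of_pairwise_cons (List.pairwise_append.1 hs').2.1 hy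
      have hmem : τ.idx 20 ∈ l ++ r := hp.mem_iff.1 (by simp)
      have hd : τ.idx 20 ∉ a ∧ τ.idx 20 ∉ xs ∧ τ.idx 20 ∉ r' := by
        simp only [List.nodup_append', List.nodup_cons, List.disjoint_cons_right,
          List.disjoint_append_right, List.cons_append,
          List.mem_append] at hnd'
        tauto
      refine ⟨(τ.idx 20 :: a, xs, r'), ⟨?_, hre, ?_, ?_, ?_, ?_, ?_, ?_, ?_⟩, by simp⟩
      · simpa using h2
      · simp only [Store.setI_idx, Store.setI_idxArr, Store.setIA_idxArr, if_true]
        exact ⟨rfl, h20, by simpa using ha.update hd.1 _⟩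
      · simpa using hxs.update hd.2.1 _
      · simpa using hr'.update hd.2.2 _
      · refine List.Perm.trans ?_ hp
        simpa using (List.perm_middle (a := τ.idx 20) (l₁ := a) (l₂ := xs ++ r')).symm
      · simpa using hs
      · rw [List.pairwise_append] at hs hs' ⊢
        refine ⟨?_, hs'.2.1, ?_⟩
        · rw [List.reverse_cons, List.pairwise_append]
          exact ⟨hs.1, by simp, fun i hi j hj => hs.2.2 i hi j (by simp_all)⟩
        · intro i hi j hj
          rw [List.reverse_cons, List.mem_append, List.mem_singleton] at hi
          rcases hi with hi | rfl
          · exact hs'.2.2 i hi j hj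
          · exact hsmall j hj
      · intro x hx
        have : x ≠ τ.idx 20 := fun e => hx (e ▸ hmem)
        simpa [Function.update_of_ne this] using ho x hx
    · intro hpick
      rw [not_or, not_and, not_not] at hpick
      obtain ⟨ys, rfl, hys⟩ := hr'.eq_cons hpick.1
      have hsmall : ∀ y ∈ l', σ.key X E (τ.idx 21) ≤ σ.key X E y := by
        intro y hy
        have hne : τ.idx 20 ≠ N := by
          intro e'
          rw [e'] at hl'
          rw [hl'.eq_nil] at hy
          exact absurd hy List.not_mem_nil
        obtain ⟨xs, rfl, -⟩ := hl'.eq_cons hne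
        refine (hpick.2 hne).le.trans ?_
        rcases List.mem_cons.1 hy with rfl | hy
        · exact le_rfl
        · exact List.rel_of_pairwise_cons (List.pairwise_append.1 hs).2.1 hy
      have hmem : τ.idx 21 ∈ l ++ r := hp.mem_iff.1 (by simp)
      have hd : τ.idx 21 ∉ a ∧ τ.idx 21 ∉ l' ∧ τ.idx 21 ∉ ys := by
        simp only [List.nodup_append', List.nodup_cons, List.disjoint_cons_right,
          List.disjoint_append_right] at hnd'
        tauto
      refine ⟨(τ.idx 21 :: a, l', ys), ⟨?_, hre, ?_, ?_, ?_, ?_, ?_, ?_, ?_⟩, by simp⟩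
      · simpa using h2
      · simp only [Store.setI_idx, Store.setI_idxArr, Store.setIA_idxArr, if_true]
        exact ⟨rfl, hpick.1, by simpa using ha.update hd.1 _⟩
      · simpa using hl'.update hd.2.1 _
      · simpa using hys.update hd.2.2 _
      · refine List.Perm.trans ?_ hp
        simpa using (List.perm_middle (a := τ.idx 21) (l₁ := a ++ l') (l₂ := ys)).symm
      · rw [List.pairwise_append] at hs hs' ⊢
        refine ⟨?_, hs.2.1, ?_⟩
        · rw [List.reverse_cons, List.pairwise_append]
          exact ⟨hs'.1, by simp, fun i hi j hj => hs'.2.2 i hi j (by simp_all)⟩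
        · intro i hi j hj
          rw [List.reverse_cons, List.mem_append, List.mem_singleton] at hi
          rcases hi with hi | rfl
          · exact hs.2.2 i hi j hj
          · exact hsmall j hj
      · simpa using hs'
      · intro x hx
        have : x ≠ τ.idx 21 := fun e => hx (e ▸ hmem)
        simpa [Function.update_of_ne this] using ho x hx)
  refine ((Runs.of_wp (c := .setIdx 22 (.var 2))
    (Q := fun τ => τ = σ.setI 22 (σ.idx 2)) rfl).seq fun τ hτ =>
      key ([], l, r) τ ?_).mono ?_ ?_
  · subst hτ
    exact ⟨by simpa using hN, rfl, by simpa [IsList] using hN, by simpa using hl,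
      by simpa using hr, List.Perm.refl _, by simpa using hls, by simpa using hrs,
      fun _ _ => rfl⟩
  · simp only [Cmd.bound, Test.cost, IExp.cost, Test.or]
    omega
  · rintro τ ⟨⟨a, l', r'⟩, ⟨h2, hre, ha, hl', hr', hp, hs, hs', ho⟩, hb⟩
    simp only [Test.holds_or, Test.Holds, IExp.eval, h2, not_or, not_not] at hb
    simp only at hl' hr' hp hs ha
    rw [hb.1] at hl'
    rw [hb.2] at hr'
    rw [hl'.eq_nil, hr'.eq_nil] at hp
    rw [hl'.eq_nil] at hs
    exact ⟨a, ha, by simpa using hp, by simpa using hs, ho, h2⟩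

/-- Merge the sorted lists that start at index variables `20` and `21` into a sorted list that
starts at index variable `22`. -/
def merge (nx X E : ℕ) : Cmd :=
  mergeRev nx X E ;; .setIdx 20 (.var 22) ;; reverse nx nx

theorem merge_runs {nx X E N : ℕ} {σ : Store} {l r : List ℕ} (hN : σ.idx 2 = N)
    (hl : IsList N (σ.idxArr nx) (σ.idx 20) l) (hr : IsList N (σ.idxArr nx) (σ.idx 21) r)
    (hnd : (l ++ r).Nodup) (hls : l.Pairwise fun i j => σ.key X E i ≤ σ.key X E j)
    (hrs : r.Pairwise fun i j => σ.key X E i ≤ σ.key X E j) :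
    Runs (merge nx X E) σ (200 * (l.length + r.length + 1)) fun τ => ∃ a,
      IsList N (τ.idxArr nx) (τ.idx 22) a ∧ a.Perm (l ++ r) ∧
      a.Pairwise (fun i j => σ.key X E i ≤ σ.key X E j) ∧
      (∀ x ∉ l ++ r, τ.idxArr nx x = σ.idxArr nx x) := by
  refine ((mergeRev_runs hN hl hr hnd hls hrs).seq (t' := 2 + 30 * (l.length + r.length + 1))
    fun τ ⟨a, ha, hp, hs, ho, h2⟩ => ?_).mono (by omega) fun _ h => h
  refine (Runs.of_wp (c := .setIdx 20 (.var 22))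
    (Q := fun υ => υ = τ.setI 20 (τ.idx 22)) rfl).seq fun υ hυ => ?_
  subst hυ
  refine (reverse_runs (N := N) (l := a) (by simpa using h2) (by simpa using ha)
    (hp.nodup_iff.2 hnd)).mono ?_ ?_
  · rw [hp.length_eq, List.length_append]
  · rintro υ ⟨h3, h4⟩
    refine ⟨a.reverse, h3, (List.reverse_perm a).trans hp, hs, fun x hx => ?_⟩
    rw [h4 x fun e => hx (hp.mem_iff.1 e)]
    exact ho x hx

/-- Add to the entries of the real array `15` along the descending list that starts at index
variable `21` the total weight (real array `14`) of those items of the ascending list that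
starts at index variable `20` whose keys have a negative sum with the key of the entry. -/
def sweep (nx X E ny X' E' : ℕ) : Cmd :=
  .setReal 11 (.lit 0) ;;
  .loop (.not (.idxEq (.var 21) (.var 2)))
    (.ite (.and (.not (.idxEq (.var 20) (.var 2))) (keyNeg X E 20 X' E' 21))
      (.setReal 11 (.add (.var 11) (.read 14 (.var 20))) ;; .setIdx 20 (.read nx (.var 20)))
      (.writeReal 15 (.var 21) (.add (.read 15 (.var 21)) (.var 11)) ;;
        .setIdx 21 (.read ny (.var 21))))

/-- The invariant of `sweep`: the parts `a` of `l` and `b` of `r` have been processed. -/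
structure SweepInv (N nx ny : ℕ) (k k' : ℕ → Key) (l r : List ℕ) (σ₀ : Store)
    (g : (List ℕ × List ℕ) × (List ℕ × List ℕ)) (τ : Store) : Prop where
  nil : τ.idx 2 = N
  arr : τ.idxArr = σ₀.idxArr
  real : ∀ x, x ≠ 15 → τ.realArr x = σ₀.realArr x
  left : IsList N (τ.idxArr nx) (τ.idx 20) g.1.2
  right : IsList N (τ.idxArr ny) (τ.idx 21) g.2.2
  eql : g.1.1 ++ g.1.2 = l
  eqr : g.2.1 ++ g.2.2 = r
  acc : τ.real 11 = (g.1.1.map (σ₀.realArr 14)).sum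
  neg : ∀ i ∈ g.1.1, ∀ j ∈ g.2.2, k i + k' j < 0
  done : ∀ j ∈ g.2.1, τ.realArr 15 j = σ₀.realArr 15 j + crossSum k (σ₀.realArr 14) l (k' j)
  other : ∀ j ∉ g.2.1, τ.realArr 15 j = σ₀.realArr 15 j

/-- As the keys in `r` decrease, more and more items of `l` have a negative sum with the current
entry, and these items form a prefix of `l`. Both cursors only move forward, so the time is linear
although each entry receives the weight of a whole prefix. -/
theorem sweep_runs {nx X E ny X' E' N : ℕ} {σ : Store} {l r : List ℕ} (hN : σ.idx 2 = N)
    (hl : IsList N (σ.idxArr nx) (σ.idx 20) l) (hr : IsList N (σ.idxArr ny) (σ.idx 21) r)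
    (hls : l.Pairwise fun i j => σ.key X E i ≤ σ.key X E j)
    (hrs : r.Pairwise fun i j => σ.key X' E' j ≤ σ.key X' E' i) (hnd : r.Nodup)
    (hX : X ≠ 15) (hE : E ≠ 15) (hX' : X' ≠ 15) (hE' : E' ≠ 15) :
    Runs (sweep nx X E ny X' E') σ (90 * (l.length + r.length + 1)) fun τ =>
      (∀ j ∈ r, τ.realArr 15 j = σ.realArr 15 j +
        crossSum (σ.key X E) (σ.realArr 14) l (σ.key X' E' j)) ∧
      ∀ j ∉ r, τ.realArr 15 j = σ.realArr 15 j := by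
  have key := Runs.loop_const (b := .not (.idxEq (.var 21) (.var 2)))
    (c := .ite (.and (.not (.idxEq (.var 20) (.var 2))) (keyNeg X E 20 X' E' 21))
      (.setReal 11 (.add (.var 11) (.read 14 (.var 20))) ;; .setIdx 20 (.read nx (.var 20)))
      (.writeReal 15 (.var 21) (.add (.read 15 (.var 21)) (.var 11)) ;;
        .setIdx 21 (.read ny (.var 21))))
    (SweepInv N nx ny (σ.key X E) (σ.key X' E') l r σ)
    (fun g => g.1.2.length + g.2.2.length) 70 (by
    rintro ⟨⟨a, l'⟩, ⟨b, r'⟩⟩ τ ⟨h2, har, hre, hl', hr', el, er, hacc, hneg, hdone, ho⟩ hb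
    simp only at hl' hr' el er hacc hneg hdone ho
    simp only [Test.Holds, IExp.eval, h2] at hb
    obtain ⟨ys, rfl, hys⟩ := hr'.eq_cons hb
    have hkey : τ.key X E = σ.key X E := by
      funext i
      simp [Store.key, hre X hX, hre E hE]
    have hkey' : τ.key X' E' = σ.key X' E' := by
      funext i
      simp [Store.key, hre X' hX', hre E' hE']
    refine Runs.of_wp' ?_ (by
      simp [Cmd.bound, IExp.cost, RExp.cost, Test.cost, Test.or, keyNeg])
    simp only [Cmd.wp, IExp.eval, RExp.eval, Test.Holds, holds_keyNeg, h2, hkey, hkey']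
    constructor
    · rintro ⟨h20, hlt⟩
      obtain ⟨xs, rfl, hxs⟩ := hl'.eq_cons h20
      refine ⟨((a ++ [τ.idx 20], xs), (b, τ.idx 21 :: ys)), ⟨by simpa using h2, har, hre,
        by simpa using hxs, by simpa using hr', by simpa using el, er, ?_, ?_, hdone, ho⟩,
        by simp⟩
      · simp [hacc, hre 14 (by norm_num)]
      · intro i hi j hj
        rw [List.mem_append, List.mem_singleton] at hi
        rcases hi with hi | rfl
        · exact hneg i hi j hj
        · rcases List.mem_cons.1 hj with rfl | hj
          · exact hlt
          -- Later entries of `r` have keys that are not larger, so a negative sum stays negative.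
          · refine lt_of_le_of_lt (add_le_add_right ?_ _) hlt
            rw [← er] at hrs
            exact List.rel_of_pairwise_cons (List.pairwise_append.1 hrs).2.1 hj
    · intro hne_all
      rw [not_and] at hne_all
      have hjb : τ.idx 21 ∉ b := by
        rw [← er, List.nodup_append', List.disjoint_cons_right] at hnd
        exact hnd.2.2.1
      -- The prefix contributes fully, by `neg`. The head of the rest has just failed the test, and
      -- by sortedness so would all items behind it.
      have hsum : τ.real 11 = crossSum (σ.key X E) (σ.realArr 14) l
          (σ.key X' E' (τ.idx 21)) := by
        rw [crossSum, ← el, List.map_append, List.sum_append, hacc]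
        have h1 : (l'.map fun j => if σ.key X E j + σ.key X' E' (τ.idx 21) < 0
            then σ.realArr 14 j else 0) = l'.map fun _ => 0 := by
          refine List.map_congr_left fun j hj => if_neg ?_
          have hne : τ.idx 20 ≠ N := by
            intro e'
            rw [e'] at hl'
            rw [hl'.eq_nil] at hj
            exact absurd hj List.not_mem_nil
          obtain ⟨xs, rfl, -⟩ := hl'.eq_cons hne
          have h3 := hne_all hne
          rw [not_lt] at h3 ⊢
          refine h3.trans (add_le_add_left ?_ _)
          rcases List.mem_cons.1 hj with rfl | hj
          · exact le_rfl
          · rw [← el] at hls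
            exact List.rel_of_pairwise_cons (List.pairwise_append.1 hls).2.1 hj
        rw [h1]
        simp only [List.map_const', List.sum_replicate, smul_zero, add_zero]
        congr 1
        exact List.map_congr_left fun i hi => (if_pos (hneg i hi _ (by simp))).symm
      refine ⟨((a, l'), (b ++ [τ.idx 21], ys)), ⟨by simpa using h2, har, ?_,
        by simpa using hl', by simpa using hys, el, by simpa using er, hacc,
        fun i hi j hj => hneg i hi j (List.mem_cons_of_mem _ hj), ?_, ?_⟩, by simp⟩
      · intro x hx
        simpa [hx] using hre x hx
      · intro j hj
        simp only [Store.setI_realArr, Store.setRA_realArr, if_true]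
        by_cases e : j = τ.idx 21
        · rw [e, Function.update_self, ho _ hjb, hsum]
        · rw [Function.update_of_ne e]
          exact hdone j (by simpa [e] using hj)
      · intro j hj
        have hj : j ∉ b ∧ j ≠ τ.idx 21 := by simpa using hj
        simp only [Store.setI_realArr, Store.setRA_realArr, if_true]
        rw [Function.update_of_ne hj.2]
        exact ho j hj.1)
  refine ((Runs.of_wp (c := .setReal 11 (.lit 0))
    (Q := fun τ => τ = σ.setR 11 ((0 : ℕ) : ℝ)) rfl).seq fun τ hτ =>
      key (([], l), ([], r)) τ ?_).mono ?_ ?_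
  · subst hτ
    exact ⟨hN, rfl, fun _ _ => rfl, hl, hr, rfl, rfl, by simp, by simp, by simp, fun _ _ => rfl⟩
  · simp only [Cmd.bound, Test.cost, IExp.cost, RExp.cost]
    omega
  · rintro τ ⟨⟨⟨a, l'⟩, ⟨b, r'⟩⟩, ⟨h2, har, hre, hl', hr', el, er, hacc, hneg, hdone, ho⟩, hb⟩
    simp only [Test.Holds, IExp.eval, not_not, h2] at hb hr' er
    rw [hb] at hr'
    rw [hr'.eq_nil, List.append_nil] at er
    subst er
    exact ⟨hdone, ho⟩

end ListCmd

end RealRAM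

/-! ### Stages in memory: accounting for pairs and joining lists -/

namespace RealRAM

open TreeLocation

/-- The memory holds the stage `C` of a contraction. Index arrays: `11` parents, `12` numbers of
children, `13`, `14` heads and `15`, `16` pointers of the lists, `20` removed nodes; real arrays:
`9` lengths, `10`, `11` and `12`, `13` keys, `14` weights, `15` gains. -/
structure Rep (N : ℕ) (wt : ℕ → ℝ) (C : Conf) (σ : Store) : Prop where
  nil : σ.idx 2 = N
  par : σ.idxArr 11 = C.par
  cnt : σ.idxArr 12 = C.cnt
  len : σ.realArr 9 = C.len
  bot : σ.key 10 11 = C.bot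
  top : σ.key 12 13 = C.top
  la : ∀ v ∈ C.alive, IsList N (σ.idxArr 15) (σ.idxArr 13 v) (C.la v)
  lb : ∀ v ∈ C.alive, IsList N (σ.idxArr 16) (σ.idxArr 14 v) (C.lb v)
  wt : σ.realArr 14 = wt
  gain : σ.realArr 15 = C.gain
  dead : ∀ v < N, σ.idxArr 20 v = 0 ↔ v ∈ C.alive

namespace ContractCmd

open ListCmd

/-- Account in the gains of the items of the list with the head in cell `v` of the index array
`hb` for the items of the list with the head in cell `p` of the index array `ha`. -/
def halfCross (v p ha nx X E hb ny X' E' : ℕ) : Cmd :=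
  .setIdx 20 (.read hb (.var v)) ;; reverse ny 17 ;; .setIdx 21 (.var 22) ;;
  .setIdx 20 (.read ha (.var p)) ;; sweep nx X E 17 X' E'

/-- `sweep` wants one list in descending order. The pointers of the reversed list go to the scratch
array `17`, so the ascending list remains intact. -/
theorem halfCross_runs {N v p ha nx X E hb ny X' E' : ℕ} {σ : Store} {l r : List ℕ}
    (hN : σ.idx 2 = N) (hl : IsList N (σ.idxArr nx) (σ.idxArr ha (σ.idx p)) l)
    (hr : IsList N (σ.idxArr ny) (σ.idxArr hb (σ.idx v)) r)
    (hls : l.Pairwise fun i j => σ.key X E i ≤ σ.key X E j)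
    (hrs : r.Pairwise fun i j => σ.key X' E' i ≤ σ.key X' E' j) (hnd : r.Nodup)
    (hp : p = 24 ∨ p = 25)
    (hX : X ≠ 15) (hE : E ≠ 15) (hX' : X' ≠ 15) (hE' : E' ≠ 15) (hnx : nx ≠ 17)
    (hha : ha ≠ 17) :
    Runs (halfCross v p ha nx X E hb ny X' E') σ (150 * (l.length + r.length + 1)) fun τ =>
      ((∀ j ∈ r, τ.realArr 15 j = σ.realArr 15 j +
        crossSum (σ.key X E) (σ.realArr 14) l (σ.key X' E' j)) ∧
      ∀ j ∉ r, τ.realArr 15 j = σ.realArr 15 j) := by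
  refine Runs.mono (t := 3 + (30 * (r.length + 1) + (2 + (3 + 90 * (l.length + r.length + 1)))))
    ?_ (by omega) fun _ h => h
  refine Runs.wp_seq ?_ le_rfl
  change Runs _ (σ.setI 20 (σ.idxArr hb (σ.idx v))) _ _
  refine (reverse_runs (N := N) (l := r) (by simpa using hN) (by simpa using hr) hnd).frame.seq ?_
  rintro τ ⟨⟨h1, h2⟩, hf⟩
  have h2' : τ.idx 2 = N := by rw [hf.idx 2 rfl]; simpa using hN
  have hpv : τ.idx p = σ.idx p := by
    rcases hp with rfl | rfl <;> rw [hf.idx _ rfl] <;> simp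
  have hreal : τ.realArr = σ.realArr := funext fun a => by rw [hf.realArr a rfl]; rfl
  have hnx' : τ.idxArr nx = σ.idxArr nx := by
    rw [hf.idxArr nx (by simp [reverse, Cmd.touches, hnx])]; rfl
  have hha' : τ.idxArr ha = σ.idxArr ha := by
    rw [hf.idxArr ha (by simp [reverse, Cmd.touches, hha])]; rfl
  refine Runs.wp_seq ?_ le_rfl
  refine Runs.wp_seq ?_ le_rfl
  have hp21 : p ≠ 21 := by omega
  simp only [Cmd.wp, IExp.eval, Store.setI_idx, Store.setI_idxArr, if_neg hp21, hpv, hha']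
  have hkey : ∀ X E, Store.key ((τ.setI 21 (τ.idx 22)).setI 20 (σ.idxArr ha (σ.idx p))) X E =
      σ.key X E := by
    intro X E
    funext i
    simp [Store.key, hreal]
  refine (sweep_runs (N := N) (l := l) (r := r.reverse) (by simpa using h2') ?_
    (by simpa using h1) ?_ ?_ (List.nodup_reverse.2 hnd) hX hE hX' hE').mono (by simp) ?_
  · simpa [hnx'] using hl
  · rwa [hkey]
  · rw [hkey, List.pairwise_reverse]
    exact hrs
  · rintro υ ⟨h3, h4⟩
    rw [hkey, hkey] at h3
    simp only [Store.setI_realArr, hreal, List.mem_reverse] at h3 h4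
    exact ⟨h3, h4⟩

/-- Account for the pairs of an item in the cluster of `v` (index variable `24`) and an item in
the cluster of its parent `p` (index variable `25`). -/
def cross : Cmd :=
  halfCross 24 25 13 15 10 11 14 16 12 13 ;; halfCross 25 24 14 16 12 13 13 15 10 11

/-- The first pass changes only gains in the cluster of `v`, the second only gains in the cluster of
`p`, and both read nothing but keys, weights and lists. As the clusters are disjoint, the passes do
not interfere. -/
theorem cross_runs {N ρ : ℕ} {spar : ℕ → ℕ} {d : ℕ → ℕ → ℝ} {α β : ℕ → Key} {wt : ℕ → ℝ}
    {C : Conf} {σ : Store} {v p : ℕ} (hC : C.Valid N ρ spar d α β wt) (hR : Rep N wt C σ)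
    (hv : v ∈ C.alive) (hp : p ∈ C.alive) (hne : v ≠ p) (h24 : σ.idx 24 = v)
    (h25 : σ.idx 25 = p) :
    Runs cross σ (300 * ((C.la v).length + (C.la p).length + 1)) fun τ =>
      C.CrossGain wt v p (τ.realArr 15) := by
  have hlv := (hC.perm v hv).length_eq
  refine Runs.mono (t := 150 * ((C.la p).length + (C.lb v).length + 1) +
    150 * ((C.lb v).length + (C.la p).length + 1)) ?_ (by omega) fun _ h => h
  refine (halfCross_runs (N := N) (l := C.la p) (r := C.lb v) hR.nil
    (by rw [h25]; exact hR.la p hp) (by rw [h24]; exact hR.lb v hv)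
    (by rw [hR.bot]; exact hC.la_sorted p hp) (by rw [hR.top]; exact hC.lb_sorted v hv)
    ((hC.perm v hv).nodup_iff.1 (hC.nodup v hv)) (by norm_num) (by norm_num) (by norm_num)
    (by norm_num) (by norm_num) (by norm_num) (by norm_num)).frame.seq ?_
  rintro τ ⟨⟨h1, h2⟩, hf⟩
  have hb : τ.key 10 11 = σ.key 10 11 := by
    funext i
    simp only [Store.key, hf.realArr 10 rfl, hf.realArr 11 rfl]
  have ht : τ.key 12 13 = σ.key 12 13 := by
    funext i
    simp only [Store.key, hf.realArr 12 rfl, hf.realArr 13 rfl]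
  refine (halfCross_runs (N := N) (l := C.lb v) (r := C.la p) ((hf.idx 2 rfl).trans hR.nil)
    (by rw [hf.idx 24 rfl, hf.idxArr 14 rfl, hf.idxArr 16 rfl, h24]; exact hR.lb v hv)
    (by rw [hf.idx 25 rfl, hf.idxArr 13 rfl, hf.idxArr 15 rfl, h25]; exact hR.la p hp)
    (by rw [ht, hR.top]; exact hC.lb_sorted v hv) (by rw [hb, hR.bot]; exact hC.la_sorted p hp)
    (hC.nodup p hp) (by norm_num) (by norm_num) (by norm_num)
    (by norm_num) (by norm_num) (by norm_num) (by norm_num)).mono le_rfl ?_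
  rintro υ ⟨h3, h4⟩
  rw [hb, ht, hf.realArr 14 rfl, hR.bot, hR.top, hR.wt] at h3
  rw [hR.bot, hR.top, hR.wt, hR.gain] at h1
  rw [hR.gain] at h2
  refine ⟨fun i hi => ?_, fun i hi => ?_, fun i hi hi' => ?_⟩
  · rw [h4 i (hC.disj' hv hp hne hi)]
    exact h1 i ((hC.mem_lb hv).2 hi)
  · rw [h3 i hi, h2 i (fun e => hC.disj' hp hv hne.symm hi ((hC.mem_lb hv).1 e))]
    congr 1
    exact ((hC.perm v hv).symm.map _).sum_eq
  · rw [h4 i hi', h2 i (fun e => hi ((hC.mem_lb hv).1 e))]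

/-- Merge the lists with the heads in the cells `v` and `p` (index variables `24`, `25`) of the
index array `nh`; the new head goes to cell `t` (index variable `26`). -/
def join (nh nx X E : ℕ) : Cmd :=
  .setIdx 20 (.read nh (.var 24)) ;; .setIdx 21 (.read nh (.var 25)) ;; merge nx X E ;;
  .writeIdx nh (.var 26) (.var 22)

theorem join_runs {nh nx X E N : ℕ} {σ : Store} {l r : List ℕ} (hN : σ.idx 2 = N)
    (hl : IsList N (σ.idxArr nx) (σ.idxArr nh (σ.idx 24)) l)
    (hr : IsList N (σ.idxArr nx) (σ.idxArr nh (σ.idx 25)) r)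
    (hnd : (l ++ r).Nodup) (hls : l.Pairwise fun i j => σ.key X E i ≤ σ.key X E j)
    (hrs : r.Pairwise fun i j => σ.key X E i ≤ σ.key X E j) (hne : nx ≠ nh) :
    Runs (join nh nx X E) σ (220 * (l.length + r.length + 1)) fun τ => ∃ a,
      IsList N (τ.idxArr nx) (τ.idxArr nh (σ.idx 26)) a ∧ a.Perm (l ++ r) ∧
      a.Pairwise (fun i j => σ.key X E i ≤ σ.key X E j) ∧
      (∀ x ∉ l ++ r, τ.idxArr nx x = σ.idxArr nx x) ∧
      ∀ x ≠ σ.idx 26, τ.idxArr nh x = σ.idxArr nh x := by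
  refine Runs.mono (t := 3 + (3 + (200 * (l.length + r.length + 1) + 3)))
    ?_ (by omega) fun _ h => h
  refine Runs.wp_seq ?_ le_rfl
  refine Runs.wp_seq ?_ le_rfl
  change Runs _ ((σ.setI 20 (σ.idxArr nh (σ.idx 24))).setI 21 (σ.idxArr nh (σ.idx 25))) _ _
  have hkey : Store.key ((σ.setI 20 (σ.idxArr nh (σ.idx 24))).setI 21
    (σ.idxArr nh (σ.idx 25))) X E = σ.key X E := rfl
  refine (merge_runs (N := N) (l := l) (r := r) (by simpa using hN) (by simpa using hl)
    (by simpa using hr) hnd (by rwa [hkey]) (by rwa [hkey])).frame.seq ?_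
  rintro τ ⟨⟨a, h1, h2, h3, h4⟩, hf⟩
  have h26 : τ.idx 26 = σ.idx 26 := (hf.idx 26 rfl).trans (by simp)
  have hnh : τ.idxArr nh = σ.idxArr nh :=
    hf.idxArr nh (by simp [merge, mergeRev, reverse, Cmd.touches, hne.symm])
  refine Runs.of_wp' ?_ (by simp [Cmd.bound, IExp.cost])
  simp only [Cmd.wp, IExp.eval, h26]
  refine ⟨a, by simpa [hne] using h1, h2, h3, by simpa [hne] using h4, fun x hx => ?_⟩
  simp [Function.update_of_ne hx, hnh]

end ContractCmd

end RealRAM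

/-! ### Rake and compress in memory -/

namespace RealRAM

open TreeLocation

namespace ContractCmd

open ListCmd

/-- Merge both lists of `v` and `p` (index variables `24`, `25`) into lists of `t` (index variable
`26`). -/
def joinBoth : Cmd := join 13 15 10 11 ;; join 14 16 12 13

/-- The list `l` need not be `C.la v`: before a rake the bottom list of `v` is replaced by its top
list, a permutation of the same items. The pointers of all other clusters survive since the lists
are disjoint. -/
theorem joinBoth_runs {N ρ : ℕ} {spar : ℕ → ℕ} {d : ℕ → ℕ → ℝ} {α β : ℕ → Key} {wt : ℕ → ℝ}
    {C : Conf} {σ : Store} {v p t : ℕ} {l : List ℕ} (hC : C.Valid N ρ spar d α β wt)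
    (hv : v ∈ C.alive) (hp : p ∈ C.alive) (hne : v ≠ p) (hN : σ.idx 2 = N) (h24 : σ.idx 24 = v)
    (h25 : σ.idx 25 = p) (h26 : σ.idx 26 = t) (ht : t = v ∨ t = p)
    (hl : IsList N (σ.idxArr 15) (σ.idxArr 13 v) l) (hlp : l.Perm (C.la v))
    (hla : ∀ x ∈ C.alive, x ≠ v → IsList N (σ.idxArr 15) (σ.idxArr 13 x) (C.la x))
    (hlb : ∀ x ∈ C.alive, IsList N (σ.idxArr 16) (σ.idxArr 14 x) (C.lb x))
    (hls : l.Pairwise fun i j => σ.key 10 11 i ≤ σ.key 10 11 j)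
    (hps : (C.la p).Pairwise fun i j => σ.key 10 11 i ≤ σ.key 10 11 j)
    (hls' : (C.lb v).Pairwise fun i j => σ.key 12 13 i ≤ σ.key 12 13 j)
    (hps' : (C.lb p).Pairwise fun i j => σ.key 12 13 i ≤ σ.key 12 13 j) :
    Runs joinBoth σ (440 * ((C.la v).length + (C.la p).length + 1)) fun τ => ∃ A B,
      A.Perm (C.la v ++ C.la p) ∧ B.Perm (C.lb v ++ C.lb p) ∧
      (A.Pairwise fun i j => σ.key 10 11 i ≤ σ.key 10 11 j) ∧
      (B.Pairwise fun i j => σ.key 12 13 i ≤ σ.key 12 13 j) ∧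
      IsList N (τ.idxArr 15) (τ.idxArr 13 t) A ∧ IsList N (τ.idxArr 16) (τ.idxArr 14 t) B ∧
      ∀ x ∈ C.alive, x ≠ v → x ≠ p → IsList N (τ.idxArr 15) (τ.idxArr 13 x) (C.la x) ∧
        IsList N (τ.idxArr 16) (τ.idxArr 14 x) (C.lb x) := by
  have hnd : (l ++ C.la p).Nodup := by
    rw [List.nodup_append']
    exact ⟨hlp.nodup_iff.2 (hC.nodup v hv), hC.nodup p hp, fun i hi =>
      hC.disj' hv hp hne (hlp.mem_iff.1 hi)⟩
  have hnd' : (C.lb v ++ C.lb p).Nodup := by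
    rw [List.nodup_append']
    exact ⟨(hC.perm v hv).nodup_iff.1 (hC.nodup v hv), (hC.perm p hp).nodup_iff.1 (hC.nodup p hp),
      fun i hi hi' => hC.disj' hv hp hne ((hC.mem_lb hv).1 hi) ((hC.mem_lb hp).1 hi')⟩
  have e1 := hlp.length_eq
  have e2 := (hC.perm v hv).length_eq
  have e3 := (hC.perm p hp).length_eq
  refine Runs.mono (t := 220 * (l.length + (C.la p).length + 1) +
    220 * ((C.lb v).length + (C.lb p).length + 1)) ?_ (by omega) fun _ h => h
  refine (join_runs (N := N) (l := l) (r := C.la p) hN (by rwa [h24])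
    (by rw [h25]; exact hla p hp hne.symm) hnd hls hps (by norm_num)).frame.seq ?_
  rintro τ ⟨⟨A, hA, hAp, hAs, hAo, hAo'⟩, hf⟩
  rw [h26] at hA hAo'
  have hk : τ.key 12 13 = σ.key 12 13 := by
    funext i
    simp only [Store.key, hf.realArr 12 rfl, hf.realArr 13 rfl]
  have f24 := (hf.idx 24 rfl).trans h24
  have f25 := (hf.idx 25 rfl).trans h25
  have f26 := (hf.idx 26 rfl).trans h26
  refine (join_runs (N := N) (l := C.lb v) (r := C.lb p) ((hf.idx 2 rfl).trans hN)
    (by rw [f24, hf.idxArr 16 rfl, hf.idxArr 14 rfl]; exact hlb v hv)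
    (by rw [f25, hf.idxArr 16 rfl, hf.idxArr 14 rfl]; exact hlb p hp) hnd' (by rwa [hk])
    (by rwa [hk]) (by norm_num)).frame.mono le_rfl ?_
  rintro υ ⟨⟨B, hB, hBp, hBs, hBo, hBo'⟩, hg⟩
  rw [f26] at hB hBo'
  rw [hk] at hBs
  refine ⟨A, B, hAp.trans (hlp.append_right _), hBp, hAs, hBs, ?_, hB, fun x hx hxv hxp => ?_⟩
  · rwa [hg.idxArr 15 rfl, hg.idxArr 13 rfl]
  · have hxt : x ≠ t := by rcases ht with rfl | rfl <;> assumption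
    rw [hg.idxArr 15 rfl, hg.idxArr 13 rfl, hAo' x hxt, hBo' x hxt, hf.idxArr 14 rfl]
    refine ⟨(hla x hx hxv).congr fun i hi => hAo i ?_, ((hlb x hx).congr fun i hi => ?_)⟩
    · rw [List.mem_append, not_or, hlp.mem_iff]
      exact ⟨hC.disj' hx hv hxv hi, hC.disj' hx hp hxp hi⟩
    · rw [hC.mem_lb hx] at hi
      rw [hBo i, hf.idxArr 16 rfl]
      rw [List.mem_append, not_or, hC.mem_lb hv, hC.mem_lb hp]
      exact ⟨hC.disj' hx hv hxv hi, hC.disj' hx hp hxp hi⟩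

/-- Contract the leaf `v` (index variable `24`) into its parent `p` (index variable `25`). -/
def rake : Cmd :=
  cross ;; .setIdx 20 (.read 14 (.var 24)) ;; copy 16 15 12 10 13 11 ;;
  (.writeIdx 13 (.var 24) (.read 14 (.var 24)) ;; .setReal 10 (.read 9 (.var 25)) ;;
    .setIdx 20 (.read 14 (.var 24))) ;; shift 16 12 ;;
  .setIdx 26 (.var 25) ;; joinBoth ;;
  .writeIdx 12 (.var 25) (.sub (.read 12 (.var 25)) (.lit 1)) ;; .writeIdx 20 (.var 24) (.lit 1)

theorem key_shift {σ τ : Store} {X E : ℕ} {l : List ℕ} {δ : ℝ}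
    (h : ∀ x, τ.realArr X x = if x ∈ l then σ.realArr X x + δ else σ.realArr X x)
    (hE : τ.realArr E = σ.realArr E) :
    τ.key X E = fun i => if i ∈ l then σ.key X E i + Key.ofReal δ else σ.key X E i := by
  funext i
  simp only [Store.key, h, hE, Key.ofReal]
  split_ifs
  · rw [← toLex_add, Prod.mk_add_mk, add_zero]
  · rfl

/-- The new reference node for the items of `v` is the old parent, so their old top keys, already
sorted in `C.lb v`, become bottom keys by mere copying. The new top keys differ from the old ones by
the constant `C.len p`. Both orders are thus available and only have to be merged with those of `p`.
-/
theorem rake_runs {N ρ : ℕ} {spar : ℕ → ℕ} {d : ℕ → ℕ → ℝ} {α β : ℕ → Key} {wt : ℕ → ℝ}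
    {C : Conf} {σ : Store} {v p : ℕ} (hC : C.Valid N ρ spar d α β wt) (hR : Rep N wt C σ)
    (hv : v ∈ C.alive) (hp : p ∈ C.alive) (hne : v ≠ p) (h24 : σ.idx 24 = v)
    (h25 : σ.idx 25 = p) :
    Runs rake σ (1000 * ((C.la v).length + (C.la p).length + 1)) fun τ => ∃ A B G,
      C.CrossGain wt v p G ∧ A.Perm (C.la v ++ C.la p) ∧ B.Perm (C.lb v ++ C.lb p) ∧
      (A.Pairwise fun i j => (C.rake v p A B G).bot i ≤ (C.rake v p A B G).bot j) ∧
      (B.Pairwise fun i j => (C.rake v p A B G).top i ≤ (C.rake v p A B G).top j) ∧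
      Rep N wt (C.rake v p A B G) τ := by
  have e2 := (hC.perm v hv).length_eq
  have hndb := (hC.perm v hv).nodup_iff.1 (hC.nodup v hv)
  have hmb : ∀ i, i ∈ C.lb v ↔ i ∈ C.la v := fun i => hC.mem_lb hv
  refine Runs.mono (t := 300 * ((C.la v).length + (C.la p).length + 1) + (3 +
    (30 * ((C.lb v).length + 1) + (20 + (20 * ((C.lb v).length + 1) + (2 +
    (440 * ((C.la v).length + (C.la p).length + 1) + 20))))))) ?_ (by omega) fun _ h => h
  refine (cross_runs hC hR hv hp hne h24 h25).frame.seq ?_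
  rintro τ ⟨hG, hf⟩
  have f24 := (hf.idx 24 rfl).trans h24
  have f25 := (hf.idx 25 rfl).trans h25
  have f2 := (hf.idx 2 rfl).trans hR.nil
  refine Runs.wp_seq ?_ le_rfl
  simp only [Cmd.wp, IExp.eval, f24]
  refine (copy_runs (N := N) (l := C.lb v) (by simpa using f2)
    (by simpa [hf.idxArr 16 rfl, hf.idxArr 14 rfl] using hR.lb v hv) hndb (by norm_num)
    (by norm_num) (by norm_num) (by norm_num) (by norm_num) (by norm_num)).frame.seq ?_
  rintro υ ⟨hcopy, hg⟩
  -- The assignment to variable `20` before the loop is absorbed, since the loop touches this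
  -- variable anyway.
  have hg' : Frame (copy 16 15 12 10 13 11) τ υ := by
    refine ⟨fun x hx => ?_, hg.real, hg.idxArr, hg.realArr⟩
    have h20 : x ≠ 20 := by
      rintro rfl
      exact absurd hx (by decide)
    simpa [h20] using hg.idx x hx
  simp only [Store.setI_idxArr, Store.setI_realArr] at hcopy
  refine Runs.wp_seq ?_ (by simp [Cmd.bound, IExp.cost, RExp.cost])
  simp only [Cmd.wp, IExp.eval, RExp.eval]
  simp only [Store.setIA_idx, Store.setIA_realArr, Store.setR_idx, Store.setR_idxArr,
    Store.setIA_idxArr, (hg'.idx 24 rfl).trans f24, (hg'.idx 25 rfl).trans f25]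
  generalize hω : Store.setI (Store.setR _ _ _) _ _ = ω
  have g24 : ω.idx 24 = v := by subst hω; simp [hg'.idx 24 rfl, f24]
  have g25 : ω.idx 25 = p := by subst hω; simp [hg'.idx 25 rfl, f25]
  have g2 : ω.idx 2 = N := by subst hω; simp [hg'.idx 2 rfl, f2]
  have g20 : ω.idx 20 = σ.idxArr 14 v := by
    subst hω; simp [hg'.idxArr 14 rfl, hf.idxArr 14 rfl]
  have g10 : ω.real 10 = C.len p := by
    subst hω; simp [hg'.realArr 9 rfl, hf.realArr 9 rfl, hR.len]
  have gia : ∀ a, a ≠ 13 → ω.idxArr a = υ.idxArr a := fun a ha => by subst hω; simp [ha]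
  have gi13 : ω.idxArr 13 = Function.update (σ.idxArr 13) v (σ.idxArr 14 v) := by
    subst hω
    simp [hg'.idxArr 14 rfl, hf.idxArr 14 rfl, hg'.idxArr 13 rfl, hf.idxArr 13 rfl]
  have gra : ω.realArr = υ.realArr := by subst hω; simp
  clear hω
  refine (shift_runs (N := N) (l := C.lb v) g2 (by
    rw [g20, gia 16 (by norm_num), hg'.idxArr 16 rfl, hf.idxArr 16 rfl]
    exact hR.lb v hv) hndb).frame.seq ?_
  rintro χ ⟨hshift, hh⟩
  rw [g10, gra, hg'.realArr 12 rfl, hf.realArr 12 rfl] at hshift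
  refine Runs.wp_seq ?_ le_rfl
  simp only [Cmd.wp, IExp.eval, hh.idx 25 rfl, g25]
  have hbot : Store.key (χ.setI 26 p) 10 11 = fun i => if i ∈ C.la v then C.top i else C.bot i := by
    funext i
    simp only [Store.key, Store.setI_realArr, hh.realArr 10 rfl, hh.realArr 11 rfl, gra,
      (hcopy i).2.1, (hcopy i).2.2, hmb, ← hR.bot, ← hR.top, hf.realArr 10 rfl, hf.realArr 11 rfl,
      hf.realArr 12 rfl, hf.realArr 13 rfl]
    split_ifs <;> rfl
  have htop : Store.key (χ.setI 26 p) 12 13 = fun i => if i ∈ C.la v then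
      C.top i + Key.ofReal (C.len p) else C.top i := by
    have := key_shift (τ := χ) (E := 13) hshift (by
      rw [hh.realArr 13 rfl, gra, hg'.realArr 13 rfl, hf.realArr 13 rfl])
    rw [hR.top] at this
    change χ.key 12 13 = _
    simpa only [hmb] using this
  refine (joinBoth_runs (N := N) (t := p) (l := C.lb v) hC hv hp hne
    (by simpa [hh.idx 2 rfl] using g2) (by simpa [hh.idx 24 rfl] using g24)
    (by simpa [hh.idx 25 rfl] using g25) (by simp) (Or.inr rfl) ?_ (hC.perm v hv).symm ?_ ?_ ?_
    ?_ ?_ ?_).frame.seq ?_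
  · rw [Store.setI_idxArr, hh.idxArr 15 rfl, hh.idxArr 13 rfl, gi13, gia 15 (by norm_num),
      Function.update_self]
    refine (hR.lb v hv).congr fun i hi => ?_
    rw [(hcopy i).1, if_pos hi, hf.idxArr 16 rfl]
  · intro x hx hxv
    rw [Store.setI_idxArr, hh.idxArr 15 rfl, hh.idxArr 13 rfl, gi13, gia 15 (by norm_num),
      Function.update_of_ne hxv]
    refine (hR.la x hx).congr fun i hi => ?_
    rw [(hcopy i).1, if_neg (fun e => hC.disj' hx hv hxv hi ((hmb i).1 e)), hf.idxArr 15 rfl]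
  · intro x hx
    rw [Store.setI_idxArr, hh.idxArr 16 rfl, hh.idxArr 14 rfl, gia 14 (by norm_num),
      gia 16 (by norm_num), hg'.idxArr 16 rfl, hg'.idxArr 14 rfl, hf.idxArr 16 rfl,
      hf.idxArr 14 rfl]
    exact hR.lb x hx
  · rw [hbot]
    refine (hC.lb_sorted v hv).imp_of_mem fun {i j} hi hj hij => ?_
    simpa only [if_pos ((hmb i).1 hi), if_pos ((hmb j).1 hj)] using hij
  · rw [hbot]
    refine (hC.la_sorted p hp).imp_of_mem fun {i j} hi hj hij => ?_
    simpa only [if_neg (hC.disj' hp hv hne.symm hi), if_neg (hC.disj' hp hv hne.symm hj)] using hij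
  · rw [htop]
    refine (hC.lb_sorted v hv).imp_of_mem fun {i j} hi hj hij => ?_
    simpa only [if_pos ((hmb i).1 hi), if_pos ((hmb j).1 hj)] using add_le_add_left hij _
  · rw [htop]
    refine (hC.lb_sorted p hp).imp_of_mem fun {i j} hi hj hij => ?_
    rw [hC.mem_lb hp] at hi hj
    simpa only [if_neg (hC.disj' hp hv hne.symm hi), if_neg (hC.disj' hp hv hne.symm hj)] using hij
  rintro ψ ⟨⟨A, B, hA, hB, hAs, hBs, hAl, hBl, ho⟩, hk⟩
  refine Runs.of_wp' ?_ (by simp [Cmd.bound, IExp.cost])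
  simp only [Cmd.wp, IExp.eval]
  have k24 : ψ.idx 24 = v := by rw [hk.idx 24 rfl]; simpa [hh.idx 24 rfl] using g24
  have k25 : ψ.idx 25 = p := by rw [hk.idx 25 rfl]; simpa [hh.idx 25 rfl] using g25
  have kia : ∀ a, joinBoth.touches 2 a = false → (shift 16 12).touches 2 a = false → a ≠ 13 →
      (copy 16 15 12 10 13 11).touches 2 a = false → cross.touches 2 a = false →
      ψ.idxArr a = σ.idxArr a := fun a h1 h2 h3 h4 h5 => by
    rw [hk.idxArr a h1, Store.setI_idxArr, hh.idxArr a h2, gia a h3, hg'.idxArr a h4,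
      hf.idxArr a h5]
  have kra : ∀ a, joinBoth.touches 3 a = false → ψ.realArr a = χ.realArr a := fun a h1 => by
    rw [hk.realArr a h1, Store.setI_realArr]
  have k12 := kia 12 rfl rfl (by norm_num) rfl rfl
  have k20 := kia 20 rfl rfl (by norm_num) rfl rfl
  rw [hbot] at hAs
  rw [htop] at hBs
  refine ⟨A, B, τ.realArr 15, hG, hA, hB, hAs, hBs, ?_⟩
  simp only [Store.setIA_idx, k24, k25]
  constructor
  · simpa [hk.idx 2 rfl, hh.idx 2 rfl] using g2
  · simp [kia 11 rfl rfl (by norm_num) rfl rfl, hR.par, Conf.rake]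
  · simp [k12, hR.cnt, Conf.rake]
  · simp [kra 9 rfl, hh.realArr 9 rfl, gra, hg'.realArr 9 rfl, hf.realArr 9 rfl, hR.len, Conf.rake]
  · refine Eq.trans ?_ hbot
    funext i
    simp [Store.key, kra 10 rfl, kra 11 rfl]
  · refine Eq.trans ?_ htop
    funext i
    simp [Store.key, kra 12 rfl, kra 13 rfl]
  · intro x hx
    obtain ⟨hxv, hx⟩ := Finset.mem_erase.1 hx
    by_cases e : x = p
    · subst e
      simpa [Conf.rake] using hAl
    · simpa [Conf.rake, e] using (ho x hx hxv e).1
  · intro x hx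
    obtain ⟨hxv, hx⟩ := Finset.mem_erase.1 hx
    by_cases e : x = p
    · subst e
      simpa [Conf.rake] using hBl
    · simpa [Conf.rake, e] using (ho x hx hxv e).2
  · simp [kra 14 rfl, hh.realArr 14 rfl, gra, hg'.realArr 14 rfl, hf.realArr 14 rfl, hR.wt]
  · simp [kra 15 rfl, hh.realArr 15 rfl, gra, hg'.realArr 15 rfl, Conf.rake]
  · intro x hx
    simp only [Store.setIA_idxArr, k20, if_true, Conf.rake, Finset.mem_erase]
    by_cases e : x = v
    · simp [e]
    · simpa [e, k20] using hR.dead x hx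

/-- Contract the parent `p` (index variable `25`) of `v` (index variable `24`), which has no other
children, into `v`. -/
def compress : Cmd :=
  cross ;; (.setReal 10 (.read 9 (.var 24)) ;; .setIdx 20 (.read 13 (.var 25))) ;; shift 15 10 ;;
  (.setReal 10 (.read 9 (.var 25)) ;; .setIdx 20 (.read 14 (.var 24))) ;; shift 16 12 ;;
  .setIdx 26 (.var 24) ;; joinBoth ;;
  .writeIdx 11 (.var 24) (.read 11 (.var 25)) ;;
  .writeReal 9 (.var 24) (.add (.read 9 (.var 24)) (.read 9 (.var 25))) ;;
  .writeIdx 20 (.var 25) (.lit 1)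

/-- The bottom keys of the items of `p` grow by `C.len v` and the top keys of the items of `v` by
`C.len p`; the other keys stay. Constant offsets keep all four lists sorted. -/
theorem compress_runs {N ρ : ℕ} {spar : ℕ → ℕ} {d : ℕ → ℕ → ℝ} {α β : ℕ → Key} {wt : ℕ → ℝ}
    {C : Conf} {σ : Store} {v p : ℕ} (hC : C.Valid N ρ spar d α β wt) (hR : Rep N wt C σ)
    (hv : v ∈ C.alive) (hp : p ∈ C.alive) (hne : v ≠ p) (h24 : σ.idx 24 = v)
    (h25 : σ.idx 25 = p) :
    Runs compress σ (1000 * ((C.la v).length + (C.la p).length + 1)) fun τ => ∃ A B G,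
      C.CrossGain wt v p G ∧ A.Perm (C.la v ++ C.la p) ∧ B.Perm (C.lb v ++ C.lb p) ∧
      (A.Pairwise fun i j => (C.compress v p A B G).bot i ≤ (C.compress v p A B G).bot j) ∧
      (B.Pairwise fun i j => (C.compress v p A B G).top i ≤ (C.compress v p A B G).top j) ∧
      Rep N wt (C.compress v p A B G) τ := by
  have e2 := (hC.perm v hv).length_eq
  have hndb := (hC.perm v hv).nodup_iff.1 (hC.nodup v hv)
  have hmb : ∀ i, i ∈ C.lb v ↔ i ∈ C.la v := fun i => hC.mem_lb hv
  refine Runs.mono (t := 300 * ((C.la v).length + (C.la p).length + 1) + (20 +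
    (20 * ((C.la p).length + 1) + (20 + (20 * ((C.lb v).length + 1) + (2 +
    (440 * ((C.la v).length + (C.la p).length + 1) + 30))))))) ?_ (by omega) fun _ h => h
  refine (cross_runs hC hR hv hp hne h24 h25).frame.seq ?_
  rintro τ ⟨hG, hf⟩
  have f24 := (hf.idx 24 rfl).trans h24
  have f25 := (hf.idx 25 rfl).trans h25
  have f2 := (hf.idx 2 rfl).trans hR.nil
  refine Runs.wp_seq ?_ (by simp [Cmd.bound, IExp.cost, RExp.cost])
  simp only [Cmd.wp, IExp.eval, RExp.eval, Store.setR_idx, Store.setR_idxArr, f24, f25]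
  refine (shift_runs (N := N) (l := C.la p) (by simpa using f2)
    (by simpa [hf.idxArr 13 rfl, hf.idxArr 15 rfl] using hR.la p hp) (hC.nodup p hp)).frame.seq ?_
  rintro υ ⟨hshift, hg⟩
  -- The assignment appended to the program only makes the frame forget real variable `10`, which
  -- was set before the shift.
  have hg' : Frame (shift 15 10 ;; .setReal 10 (.lit 0)) τ υ := by
    refine ⟨fun x hx => ?_, fun x hx => ?_, fun x hx => ?_, fun x hx => ?_⟩ <;>
      simp only [Cmd.touches, Bool.or_eq_false_iff] at hx
    · have h20 : x ≠ 20 := by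
        rintro rfl
        exact absurd hx.1 (by decide)
      simpa [h20] using hg.idx x hx.1
    · have h10 : x ≠ 10 := by
        rintro rfl
        exact absurd hx.2 (by decide)
      simpa [h10] using hg.real x hx.1
    · exact hg.idxArr x hx.1
    · exact hg.realArr x hx.1
  simp only [Store.setI_real, Store.setI_realArr, Store.setR_real, Store.setR_realArr, if_true,
    hf.realArr 9 rfl, hf.realArr 10 rfl, hR.len] at hshift
  refine Runs.wp_seq ?_ (by simp [Cmd.bound, IExp.cost, RExp.cost])
  simp only [Cmd.wp, IExp.eval, RExp.eval, Store.setR_idx, Store.setR_idxArr,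
    (hg'.idx 24 rfl).trans f24, (hg'.idx 25 rfl).trans f25]
  refine (shift_runs (N := N) (l := C.lb v) (by simpa [hg'.idx 2 rfl] using f2)
    (by simpa [hf.idxArr 14 rfl, hf.idxArr 16 rfl, hg'.idxArr 14 rfl, hg'.idxArr 16 rfl]
      using hR.lb v hv) hndb).frame.seq ?_
  rintro χ ⟨hshift', hh⟩
  have hh' : Frame (shift 16 12 ;; .setReal 10 (.lit 0)) υ χ := by
    refine ⟨fun x hx => ?_, fun x hx => ?_, fun x hx => ?_, fun x hx => ?_⟩ <;>
      simp only [Cmd.touches, Bool.or_eq_false_iff] at hx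
    · have h20 : x ≠ 20 := by
        rintro rfl
        exact absurd hx.1 (by decide)
      simpa [h20] using hh.idx x hx.1
    · have h10 : x ≠ 10 := by
        rintro rfl
        exact absurd hx.2 (by decide)
      simpa [h10] using hh.real x hx.1
    · exact hh.idxArr x hx.1
    · exact hh.realArr x hx.1
  simp only [Store.setI_real, Store.setI_realArr, Store.setR_real, Store.setR_realArr, if_true,
    hg'.realArr 9 rfl, hg'.realArr 12 rfl, hf.realArr 9 rfl, hf.realArr 12 rfl, hR.len] at hshift'
  refine Runs.wp_seq ?_ le_rfl
  have k24 : χ.idx 24 = v := by rw [hh'.idx 24 rfl, hg'.idx 24 rfl, f24]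
  have k25 : χ.idx 25 = p := by rw [hh'.idx 25 rfl, hg'.idx 25 rfl, f25]
  have k2 : χ.idx 2 = N := by rw [hh'.idx 2 rfl, hg'.idx 2 rfl, f2]
  have kia : ∀ a, (shift 16 12).touches 2 a = false → (shift 15 10).touches 2 a = false →
      cross.touches 2 a = false → χ.idxArr a = σ.idxArr a := fun a h1 h2 h3 => by
    rw [hh.idxArr a h1, Store.setI_idxArr, Store.setR_idxArr, hg.idxArr a h2, Store.setI_idxArr,
      Store.setR_idxArr, hf.idxArr a h3]
  have kra : ∀ a, (shift 16 12).touches 3 a = false → (shift 15 10).touches 3 a = false →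
      cross.touches 3 a = false → χ.realArr a = σ.realArr a := fun a h1 h2 h3 => by
    rw [hh.realArr a h1, Store.setI_realArr, Store.setR_realArr, hg.realArr a h2,
      Store.setI_realArr, Store.setR_realArr, hf.realArr a h3]
  simp only [Cmd.wp, IExp.eval, k24]
  have hbot : Store.key (χ.setI 26 v) 10 11 = fun i => if i ∈ C.la p then
      C.bot i + Key.ofReal (C.len v) else C.bot i := by
    have := key_shift (σ := σ) (τ := χ) (X := 10) (E := 11) (l := C.la p) (δ := C.len v)
      (fun x => by rw [hh'.realArr 10 rfl, hshift x]) (kra 11 rfl rfl rfl)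
    rw [hR.bot] at this
    exact this
  have htop : Store.key (χ.setI 26 v) 12 13 = fun i => if i ∈ C.la v then
      C.top i + Key.ofReal (C.len p) else C.top i := by
    have := key_shift (σ := σ) (τ := χ) (X := 12) (E := 13) (l := C.lb v) (δ := C.len p)
      hshift' (kra 13 rfl rfl rfl)
    rw [hR.top] at this
    change χ.key 12 13 = _
    simpa only [hmb] using this
  refine (joinBoth_runs (N := N) (t := v) (l := C.la v) hC hv hp hne
    (by simpa using k2) (by simpa using k24)
    (by simpa using k25) (by simp) (Or.inl rfl) ?_ (List.Perm.refl _) ?_ ?_ ?_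
    ?_ ?_ ?_).frame.seq ?_
  · rw [Store.setI_idxArr, kia 15 rfl rfl rfl, kia 13 rfl rfl rfl]
    exact hR.la v hv
  · intro x hx _
    rw [Store.setI_idxArr, kia 15 rfl rfl rfl, kia 13 rfl rfl rfl]
    exact hR.la x hx
  · intro x hx
    rw [Store.setI_idxArr, kia 16 rfl rfl rfl, kia 14 rfl rfl rfl]
    exact hR.lb x hx
  · rw [hbot]
    refine (hC.la_sorted v hv).imp_of_mem fun {i j} hi hj hij => ?_
    simpa only [if_neg (hC.disj' hv hp hne hi), if_neg (hC.disj' hv hp hne hj)] using hij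
  · rw [hbot]
    refine (hC.la_sorted p hp).imp_of_mem fun {i j} hi hj hij => ?_
    simpa only [if_pos hi, if_pos hj] using add_le_add_left hij _
  · rw [htop]
    refine (hC.lb_sorted v hv).imp_of_mem fun {i j} hi hj hij => ?_
    simpa only [if_pos ((hmb i).1 hi), if_pos ((hmb j).1 hj)] using add_le_add_left hij _
  · rw [htop]
    refine (hC.lb_sorted p hp).imp_of_mem fun {i j} hi hj hij => ?_
    rw [hC.mem_lb hp] at hi hj
    simpa only [if_neg (hC.disj' hp hv hne.symm hi), if_neg (hC.disj' hp hv hne.symm hj)] using hij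
  rintro ψ ⟨⟨A, B, hA, hB, hAs, hBs, hAl, hBl, ho⟩, hk⟩
  refine Runs.of_wp' ?_ (by simp [Cmd.bound, IExp.cost, RExp.cost])
  simp only [Cmd.wp, IExp.eval, RExp.eval]
  have m24 : ψ.idx 24 = v := by rw [hk.idx 24 rfl]; simpa using k24
  have m25 : ψ.idx 25 = p := by rw [hk.idx 25 rfl]; simpa using k25
  have mia : ∀ a, joinBoth.touches 2 a = false → ψ.idxArr a = χ.idxArr a := fun a h1 => by
    rw [hk.idxArr a h1, Store.setI_idxArr]
  have mra : ∀ a, joinBoth.touches 3 a = false → ψ.realArr a = χ.realArr a := fun a h1 => by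
    rw [hk.realArr a h1, Store.setI_realArr]
  rw [hbot] at hAs
  rw [htop] at hBs
  refine ⟨A, B, τ.realArr 15, hG, hA, hB, hAs, hBs, ?_⟩
  simp only [Store.setIA_idx, Store.setRA_idx, m24, m25]
  constructor
  · simpa [hk.idx 2 rfl] using k2
  · simp [mia 11 rfl, kia 11 rfl rfl rfl, hR.par, Conf.compress]
  · simp [mia 12 rfl, kia 12 rfl rfl rfl, hR.cnt, Conf.compress]
  · simp [mra 9 rfl, kra 9 rfl rfl rfl, hR.len, Conf.compress]
  · refine Eq.trans ?_ hbot
    funext i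
    simp [Store.key, mra 10 rfl, mra 11 rfl]
  · refine Eq.trans ?_ htop
    funext i
    simp [Store.key, mra 12 rfl, mra 13 rfl]
  · intro x hx
    obtain ⟨hxp, hx⟩ := Finset.mem_erase.1 hx
    by_cases e : x = v
    · subst e
      simpa [Conf.compress] using hAl
    · simpa [Conf.compress, e] using (ho x hx e hxp).1
  · intro x hx
    obtain ⟨hxp, hx⟩ := Finset.mem_erase.1 hx
    by_cases e : x = v
    · subst e
      simpa [Conf.compress] using hBl
    · simpa [Conf.compress, e] using (ho x hx e hxp).2
  · simp [mra 14 rfl, kra 14 rfl rfl rfl, hR.wt]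
  · simp [mra 15 rfl, hh'.realArr 15 rfl, hg'.realArr 15 rfl, Conf.compress]
  · intro x hx
    simp only [Store.setIA_idxArr, Store.setRA_idxArr, mia 20 rfl, kia 20 rfl rfl rfl, if_true,
      Conf.compress, Finset.mem_erase]
    by_cases e : x = p
    · simp [e]
    · simpa [e, mia 20 rfl, kia 20 rfl rfl rfl] using hR.dead x hx

end ContractCmd

end RealRAM

/-! ### One scan over the alive nodes -/

namespace TreeLocation

namespace Conf

variable {C : Conf} {ρ : ℕ} {M : Finset ℕ} {v x : ℕ} {A B : List ℕ} {G : ℕ → ℝ}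

/-- Only the number of children of `C.par v` changes, and this node is marked now; so every node to
which the change matters is marked or has a marked parent. -/
theorem Exhausted.rake (h : C.Exhausted ρ M x) :
    (C.rake v (C.par v) A B G).Exhausted ρ (insert (C.par v) M) x := by
  intro hr hx
  rw [Finset.mem_insert, not_or] at hx
  simp only [Conf.rake, Finset.mem_insert]
  rcases h hr hx.2 with e | ⟨e1, e2⟩
  · exact Or.inl (Or.inr e)
  · by_cases e : C.par x = C.par v
    · exact Or.inl (Or.inl e)
    · exact Or.inr ⟨by rwa [Function.update_of_ne hx.1], by rwa [Function.update_of_ne e]⟩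

/-- Only `v` gets a new parent, and `v` is marked now. -/
theorem Exhausted.compress (h : C.Exhausted ρ M x) :
    (C.compress v (C.par v) A B G).Exhausted ρ (insert v M) x := by
  intro hr hx
  rw [Finset.mem_insert, not_or] at hx
  simp only [Conf.compress, Finset.mem_insert, Function.update_of_ne hx.1]
  rcases h hr hx.2 with e | e
  · exact Or.inl (Or.inr e)
  · exact Or.inr e

/-- The clusters are disjoint lists without repetitions of numbers below `N`. -/
theorem Valid.sum_length_le {N : ℕ} {spar : ℕ → ℕ} {d : ℕ → ℕ → ℝ} {α β : ℕ → Key}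
    {wt : ℕ → ℝ} (hC : C.Valid N ρ spar d α β wt) : ∑ v ∈ C.alive, (C.la v).length ≤ N := by
  calc ∑ v ∈ C.alive, (C.la v).length = ∑ v ∈ C.alive, (C.la v).toFinset.card :=
        Finset.sum_congr rfl fun v hv => (List.toFinset_card_of_nodup (hC.nodup v hv)).symm
    _ = (C.alive.biUnion fun v => (C.la v).toFinset).card := by
        rw [Finset.card_biUnion]
        intro v hv v' hv' hne
        rw [Function.onFun, Finset.disjoint_left]
        intro i hi hi'
        exact hne (hC.disj v hv v' hv' i (List.mem_toFinset.1 hi) (List.mem_toFinset.1 hi'))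
    _ ≤ (Finset.range N).card := by
        refine Finset.card_le_card fun i hi => ?_
        obtain ⟨v, hv, hi⟩ := Finset.mem_biUnion.1 hi
        exact Finset.mem_range.2 (hC.la_lt v hv i (List.mem_toFinset.1 hi))
    _ = N := Finset.card_range N

end Conf

end TreeLocation

namespace RealRAM

open TreeLocation

namespace ContractCmd

/-- Contract the node in cell `28` of the list of alive nodes with its parent, if possible. -/
def scanStep : Cmd :=
  (.setIdx 24 (.read 18 (.var 28)) ;; .setIdx 25 (.read 11 (.var 24))) ;;
  .ite (.and (.and (.not (.idxEq (.var 24) (.var 29))) (.idxEq (.read 20 (.var 24)) (.lit 0)))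
      (.and (.idxEq (.read 19 (.var 24)) (.lit 0)) (.idxEq (.read 19 (.var 25)) (.lit 0))))
    (.ite (.idxEq (.read 12 (.var 24)) (.lit 0))
      (rake ;; .writeIdx 19 (.var 25) (.lit 1))
      (.ite (.and (.idxEq (.read 12 (.var 25)) (.lit 1)) (.not (.idxEq (.var 25) (.var 29))))
        (compress ;; .writeIdx 19 (.var 24) (.lit 1))
        .skip))
    .skip

/-- Go through the list of the alive nodes. -/
def scan : Cmd :=
  .setIdx 28 (.lit 0) ;;
  .loop (.idxLt (.var 28) (.var 27)) (scanStep ;; .setIdx 28 (.add (.var 28) (.lit 1)))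

/-- The invariant of a scan of the list `al` of length `m`: `k` entries have been processed, and
the nodes in `M` are results of a contraction. -/
structure ScanInv (N ρ : ℕ) (spar : ℕ → ℕ) (d : ℕ → ℕ → ℝ) (α β : ℕ → Key) (wt : ℕ → ℝ)
    (m : ℕ) (al : ℕ → ℕ) (k : ℕ) (C : Conf) (M : Finset ℕ) (σ : Store) : Prop where
  valid : C.Valid N ρ spar d α β wt
  rep : Rep N wt C σ
  count : σ.idx 27 = m
  root : σ.idx 29 = ρ
  list : σ.idxArr 18 = al
  list_lt : ∀ i < m, al i < N
  mem_list : ∀ v ∈ C.alive, ∃ i < m, al i = v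
  mark : ∀ v ∈ C.alive, σ.idxArr 19 v = 0 ↔ v ∉ M
  marked : M ⊆ C.alive
  card : C.alive.card + M.card = m
  le : k ≤ m
  exhausted : ∀ j < k, al j ∈ C.alive → C.Exhausted ρ M (al j)

/-- The potential of a scan. -/
def scanPot (m k : ℕ) (C : Conf) (M : Finset ℕ) : ℕ :=
  1100 * (m - k) + 1000 * ∑ v ∈ C.alive \ M, (C.la v).length

/-- A contraction takes time proportional to the sizes of the two clusters, neither of which is
marked before, while the resulting cluster is. So every item pays for at most one merge during a
scan. This is the reason for the marks: without them a large cluster could be merged with many small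
ones in a single round. -/
theorem scanStep_runs {N ρ : ℕ} {spar : ℕ → ℕ} {slen : ℕ → ℝ} {d : ℕ → ℕ → ℝ} {α β : ℕ → Key}
    {wt : ℕ → ℝ} {m : ℕ} {al : ℕ → ℕ} {k : ℕ} {C : Conf} {M : Finset ℕ} {σ : Store}
    (h : RootedMetric N ρ spar slen d) (hI : ScanInv N ρ spar d α β wt m al k C M σ)
    (hk : k < m) (h28 : σ.idx 28 = k) :
    ∃ t, Runs scanStep σ t fun τ => ∃ C' M', ScanInv N ρ spar d α β wt m al (k + 1) C' M' τ ∧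
      scanPot m (k + 1) C' M' + t + 20 ≤ scanPot m k C M := by
  have hstep : ∀ x j, j < k + 1 → x = al j → x ≠ al k → j < k := by
    intro x j hj e e'
    rcases Nat.lt_succ_iff_lt_or_eq.1 hj with h | rfl
    · exact h
    · exact absurd e e'
  have hpot : scanPot m (k + 1) C M + 1100 = scanPot m k C M := by
    unfold scanPot
    omega
  obtain ⟨hC, hR, h27, h29, hal, hlt, hmem, hmark, hM, hcard, hle, hE⟩ := hI
  -- the state after loading `v` and `p`
  set v := al k with hv
  set τ := (σ.setI 24 v).setI 25 (C.par v) with hτ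
  have hRτ : Rep N wt C τ := by
    constructor
    · simpa [hτ] using hR.nil
    all_goals
      first
      | exact hR.par | exact hR.cnt | exact hR.len | exact hR.bot | exact hR.top | exact hR.la
      | exact hR.lb | exact hR.wt | exact hR.gain | exact hR.dead
  have ht24 : τ.idx 24 = v := by simp [hτ]
  have ht25 : τ.idx 25 = C.par v := by simp [hτ]
  have ht29 : τ.idx 29 = ρ := by simp [hτ, h29]
  have ht27 : τ.idx 27 = m := by simp [hτ, h27]
  -- nothing happens
  have hnop : (v ∈ C.alive → C.Exhausted ρ M v) →
      ScanInv N ρ spar d α β wt m al (k + 1) C M τ := fun hEv =>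
    ⟨hC, hRτ, ht27, ht29, hal, hlt, hmem, hmark, hM, hcard, hk, fun j hj hja => by
      by_cases e : al j = v
      · rw [e]
        exact hEv (e ▸ hja)
      · exact hE j (hstep _ j hj rfl e) hja⟩
  have hload : ∀ {c : Cmd} {t : ℕ} {Q : Store → Prop}, Runs c τ t Q →
      Runs ((.setIdx 24 (.read 18 (.var 28)) ;; .setIdx 25 (.read 11 (.var 24))) ;; c)
        σ (6 + t) Q := fun {c t Q} hc => by
    refine Runs.wp_seq ?_ (by simp [Cmd.bound, IExp.cost])
    simp only [Cmd.wp, IExp.eval, h28, hal, Store.setI_idxArr, Store.setI_idx, if_true, hR.par]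
    exact hc
  unfold scanStep
  by_cases hg : (v ≠ ρ ∧ v ∈ C.alive) ∧ v ∉ M ∧ C.par v ∉ M
  · obtain ⟨⟨hr, hva⟩, hvM, hpM⟩ := hg
    have hpa := hC.par_mem v hva hr
    have hpv := hC.par_ne hva hr
    have hguard : Test.Holds τ (.and (.and (.not (.idxEq (.var 24) (.var 29)))
        (.idxEq (.read 20 (.var 24)) (.lit 0)))
        (.and (.idxEq (.read 19 (.var 24)) (.lit 0)) (.idxEq (.read 19 (.var 25)) (.lit 0)))) := by
      simp only [Test.Holds, IExp.eval, ht24, ht25, ht29]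
      exact ⟨⟨hr, (hR.dead v (hlt k hk)).2 hva⟩, (hmark v hva).2 hvM, (hmark _ hpa).2 hpM⟩
    -- The two merged clusters drop out of the potential, which releases the time of the merge.
    have hsum : ∀ (C' : Conf) (M' : Finset ℕ), C'.alive \ M' = ((C.alive \ M).erase v).erase (C.par v) →
        (∀ x, x ≠ v → x ≠ C.par v → C'.la x = C.la x) →
        ∑ x ∈ C'.alive \ M', (C'.la x).length + (C.la v).length + (C.la (C.par v)).length =
          ∑ x ∈ C.alive \ M, (C.la x).length := by
      intro C' M' h1 h2
      rw [h1, ← Finset.sum_erase_add _ _ (Finset.mem_sdiff.2 ⟨hva, hvM⟩),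
        ← Finset.sum_erase_add ((C.alive \ M).erase v) _ (Finset.mem_erase.2 ⟨hpv,
          Finset.mem_sdiff.2 ⟨hpa, hpM⟩⟩)]
      rw [Finset.sum_congr rfl fun x hx => by
        obtain ⟨e1, e2⟩ := Finset.mem_erase.1 hx
        rw [h2 x (Finset.mem_erase.1 e2).1 e1]]
      ring
    by_cases hcnt : C.cnt v = 0
    · refine ⟨6 + (30 + 1 + (6 + 1 + (1000 * ((C.la v).length + (C.la (C.par v)).length + 1) + 3))),
        hload ?_⟩
      refine (Runs.ite (t := 6 + 1 +
        (1000 * ((C.la v).length + (C.la (C.par v)).length + 1) + 3)) (fun _ => ?_)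
        fun e => absurd hguard e).mono (by simp [Test.cost, IExp.cost]) fun _ h => h
      refine (Runs.ite (t := 1000 * ((C.la v).length + (C.la (C.par v)).length + 1) + 3)
        (fun _ => ?_) fun e => absurd (by simpa [Test.Holds, IExp.eval, ht24, hRτ.cnt] using hcnt)
          e).mono (by simp [Test.cost, IExp.cost]) fun _ h => h
      refine (rake_runs hC hRτ hva hpa hpv.symm ht24 ht25).frame.seq ?_
      rintro υ ⟨⟨A, B, G, hG, hA, hB, hAs, hBs, hRυ⟩, hf⟩
      refine Runs.of_wp' ?_ (by simp [Cmd.bound, IExp.cost])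
      simp only [Cmd.wp, IExp.eval, hf.idx 25 rfl, ht25]
      have hC' := hC.rake h hva hr hcnt hG hA hB hAs hBs
      have hal' : ∀ x, x ∈ (C.rake v (C.par v) A B G).alive ↔ x ≠ v ∧ x ∈ C.alive := fun x => by
        simp [Conf.rake]
      have hcard' : (C.rake v (C.par v) A B G).alive.card + 1 = C.alive.card :=
        Finset.card_erase_add_one hva
      refine ⟨C.rake v (C.par v) A B G, insert (C.par v) M, ⟨hC', ?_, ?_, ?_, ?_, hlt, ?_, ?_, ?_,
        ?_, hk, ?_⟩, ?_⟩
      · exact ⟨hRυ.nil, hRυ.par, hRυ.cnt, hRυ.len, hRυ.bot, hRυ.top, hRυ.la, hRυ.lb, hRυ.wt,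
          hRυ.gain, hRυ.dead⟩
      · exact (hf.idx 27 rfl).trans ht27
      · exact (hf.idx 29 rfl).trans ht29
      · exact (hf.idxArr 18 rfl).trans hal
      · exact fun x hx => hmem x ((hal' x).1 hx).2
      · intro x hx
        simp only [Store.setIA_idxArr, if_true, Finset.mem_insert, not_or]
        by_cases e : x = C.par v
        · simp [e]
        · rw [Function.update_of_ne e, hf.idxArr 19 rfl]
          have := hmark x ((hal' x).1 hx).2
          simpa [hτ, e] using this
      · intro x hx
        rcases Finset.mem_insert.1 hx with rfl | hx
        · exact (hal' _).2 ⟨hpv, hpa⟩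
        · exact (hal' _).2 ⟨fun e => hvM (e ▸ hx), hM hx⟩
      · rw [Finset.card_insert_of_notMem hpM]
        omega
      -- The current entry `v` is dead after the rake, so only earlier entries matter.
      · intro j hj hja
        obtain ⟨e, hja⟩ := (hal' _).1 hja
        exact (hE j (hstep _ j hj rfl e) hja).rake
      · have := hsum (C.rake v (C.par v) A B G) (insert (C.par v) M) (by
          ext x
          simp only [Finset.mem_sdiff, Finset.mem_insert, Finset.mem_erase, hal']
          tauto) (fun x h1 h2 => by simp [Conf.rake, h2])
        unfold scanPot
        omega
    · by_cases hcp : C.cnt (C.par v) = 1 ∧ C.par v ≠ ρ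
      · refine ⟨6 + (30 + 1 + (6 + 1 + (12 + 1 +
          (1000 * ((C.la v).length + (C.la (C.par v)).length + 1) + 3)))), hload ?_⟩
        refine (Runs.ite (t := 6 + 1 + (12 + 1 +
          (1000 * ((C.la v).length + (C.la (C.par v)).length + 1) + 3))) (fun _ => ?_)
          fun e => absurd hguard e).mono (by simp [Test.cost, IExp.cost]) fun _ h => h
        refine (Runs.ite (t := 12 + 1 +
          (1000 * ((C.la v).length + (C.la (C.par v)).length + 1) + 3))
          (fun e => absurd (by simpa [Test.Holds, IExp.eval, ht24, hRτ.cnt] using e) hcnt)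
          fun _ => ?_).mono (by simp [Test.cost, IExp.cost]) fun _ h => h
        refine (Runs.ite (t := 1000 * ((C.la v).length + (C.la (C.par v)).length + 1) + 3)
          (fun _ => ?_) fun e => absurd (by
            simpa [Test.Holds, IExp.eval, ht25, ht29, hRτ.cnt] using hcp) e).mono
            (by simp [Test.cost, IExp.cost]) fun _ h => h
        refine (compress_runs hC hRτ hva hpa hpv.symm ht24 ht25).frame.seq ?_
        rintro υ ⟨⟨A, B, G, hG, hA, hB, hAs, hBs, hRυ⟩, hf⟩
        refine Runs.of_wp' ?_ (by simp [Cmd.bound, IExp.cost])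
        simp only [Cmd.wp, IExp.eval, hf.idx 24 rfl, ht24]
        have hC' := hC.compress h hva hr hcp.2 hcp.1 hG hA hB hAs hBs
        have hal' : ∀ x, x ∈ (C.compress v (C.par v) A B G).alive ↔ x ≠ C.par v ∧ x ∈ C.alive :=
          fun x => by simp [Conf.compress]
        have hcard' : (C.compress v (C.par v) A B G).alive.card + 1 = C.alive.card :=
          Finset.card_erase_add_one hpa
        refine ⟨C.compress v (C.par v) A B G, insert v M, ⟨hC', ?_, ?_, ?_, ?_, hlt, ?_, ?_, ?_,
          ?_, hk, ?_⟩, ?_⟩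
        · exact ⟨hRυ.nil, hRυ.par, hRυ.cnt, hRυ.len, hRυ.bot, hRυ.top, hRυ.la, hRυ.lb, hRυ.wt,
            hRυ.gain, hRυ.dead⟩
        · exact (hf.idx 27 rfl).trans ht27
        · exact (hf.idx 29 rfl).trans ht29
        · exact (hf.idxArr 18 rfl).trans hal
        · exact fun x hx => hmem x ((hal' x).1 hx).2
        · intro x hx
          simp only [Store.setIA_idxArr, if_true, Finset.mem_insert, not_or]
          by_cases e : x = v
          · simp [e]
          · rw [Function.update_of_ne e, hf.idxArr 19 rfl]
            have := hmark x ((hal' x).1 hx).2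
            simpa [hτ, e] using this
        · intro x hx
          rcases Finset.mem_insert.1 hx with rfl | hx
          · exact (hal' _).2 ⟨hpv.symm, hva⟩
          · exact (hal' _).2 ⟨fun e => hpM (e ▸ hx), hM hx⟩
        · rw [Finset.card_insert_of_notMem hvM]
          omega
        · intro j hj hja
          obtain ⟨-, hja⟩ := (hal' _).1 hja
          by_cases e : al j = v
          · intro _ hm
            exact absurd (Finset.mem_insert.2 (Or.inl e)) hm
          · exact (hE j (hstep _ j hj rfl e) hja).compress
        · have := hsum (C.compress v (C.par v) A B G) (insert v M) (by
            ext x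
            simp only [Finset.mem_sdiff, Finset.mem_insert, Finset.mem_erase, hal']
            tauto) (fun x h1 h2 => by simp [Conf.compress, h1])
          unfold scanPot
          omega
      · refine ⟨6 + (30 + 1 + (6 + 1 + (12 + 1 + 1))), hload ?_⟩
        refine (Runs.ite (t := 6 + 1 + (12 + 1 + 1)) (fun _ => ?_)
          fun e => absurd hguard e).mono (by simp [Test.cost, IExp.cost]) fun _ h => h
        refine (Runs.ite (t := 12 + 1 + 1)
          (fun e => absurd (by simpa [Test.Holds, IExp.eval, ht24, hRτ.cnt] using e) hcnt)
          fun _ => ?_).mono (by simp [Test.cost, IExp.cost]) fun _ h => h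
        refine (Runs.ite (t := 1)
          (fun e => absurd (by simpa [Test.Holds, IExp.eval, ht25, ht29, hRτ.cnt] using e) hcp)
          fun _ => ?_).mono (by simp [Test.cost, IExp.cost]) fun _ h => h
        refine Runs.of_wp' (c := .skip) ?_ le_rfl
        refine ⟨C, M, hnop fun _ _ _ => Or.inr ⟨hcnt, ?_⟩, by omega⟩
        by_contra hcon
        push Not at hcon
        exact hcp hcon
  · refine ⟨6 + (30 + 1 + 1), hload ?_⟩
    refine (Runs.ite (t := 1) (fun e => absurd ?_ hg)
      fun _ => ?_).mono (by simp [Test.cost, IExp.cost]) fun _ h => h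
    · simp only [Test.Holds, IExp.eval, ht24, ht25, ht29] at e
      obtain ⟨⟨e1, e2⟩, e3, e4⟩ := e
      have hva := (hR.dead v (hlt k hk)).1 e2
      exact ⟨⟨e1, hva⟩, (hmark v hva).1 e3, (hmark _ (hC.par_mem v hva e1)).1 e4⟩
    · refine Runs.of_wp' (c := .skip) ?_ le_rfl
      refine ⟨C, M, hnop fun hva hr hvM => Or.inl ?_, by omega⟩
      by_contra hcon
      exact hg ⟨⟨hr, hva⟩, hvM, hcon⟩

end ContractCmd

end RealRAM

/-! ### Rounds of contraction -/

namespace RealRAM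

open TreeLocation

namespace ContractCmd

variable {N ρ : ℕ} {spar : ℕ → ℕ} {slen : ℕ → ℝ} {d : ℕ → ℕ → ℝ} {α β : ℕ → Key}
  {wt : ℕ → ℝ}

theorem _root_.RealRAM.Rep.congr {C : Conf} {σ τ : Store} (h : Rep N wt C σ)
    (h2 : τ.idx 2 = σ.idx 2)
    (hA : ∀ a, a ≠ 18 → a ≠ 19 → τ.idxArr a = σ.idxArr a) (hR : τ.realArr = σ.realArr) :
    Rep N wt C τ := by
  have hk : ∀ X E, τ.key X E = σ.key X E := fun X E => by
    unfold Store.key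
    rw [hR]
  constructor
  · rw [h2, h.nil]
  · rw [hA 11 (by decide) (by decide), h.par]
  · rw [hA 12 (by decide) (by decide), h.cnt]
  · rw [hR, h.len]
  · rw [hk, h.bot]
  · rw [hk, h.top]
  · rw [hA 15 (by decide) (by decide), hA 13 (by decide) (by decide)]
    exact h.la
  · rw [hA 16 (by decide) (by decide), hA 14 (by decide) (by decide)]
    exact h.lb
  · rw [hR, h.wt]
  · rw [hR, h.gain]
  · rw [hA 20 (by decide) (by decide)]
    exact h.dead

theorem ScanInv.setI_idx {m : ℕ} {al : ℕ → ℕ} {k : ℕ} {C : Conf} {M : Finset ℕ} {σ : Store}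
    (h : ScanInv N ρ spar d α β wt m al k C M σ) (j : ℕ) :
    ScanInv N ρ spar d α β wt m al k C M (σ.setI 28 j) :=
  ⟨h.valid, h.rep.congr (by simp) (fun _ _ _ => rfl) rfl, by simp [h.count], by simp [h.root],
    h.list, h.list_lt, h.mem_list, h.mark, h.marked, h.card, h.le, h.exhausted⟩

theorem scan_runs {m : ℕ} {al : ℕ → ℕ} {C : Conf} {σ : Store}
    (h : RootedMetric N ρ spar slen d) (hI : ScanInv N ρ spar d α β wt m al 0 C ∅ σ) :
    Runs scan σ (2100 * N + 10) fun τ =>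
      ∃ C' M', ScanInv N ρ spar d α β wt m al m C' M' τ := by
  have hm : m ≤ N := by
    have h1 := hI.card
    have h2 : C.alive.card ≤ (Finset.range N).card :=
      Finset.card_le_card fun v hv => Finset.mem_range.2 (hI.valid.alive_lt hv)
    simp only [Finset.card_empty, add_zero, Finset.card_range] at h1 h2
    omega
  have key := Runs.loop (b := .idxLt (.var 28) (.var 27))
    (c := scanStep ;; .setIdx 28 (.add (.var 28) (.lit 1)))
    (fun (g : ℕ × Conf × Finset ℕ) σ => σ.idx 28 = g.1 ∧
      ScanInv N ρ spar d α β wt m al g.1 g.2.1 g.2.2 σ) (fun g => scanPot m g.1 g.2.1 g.2.2)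
    (fun ⟨k, C, M⟩ σ ⟨h28, hI⟩ hb => by
      simp only [Test.Holds, IExp.eval, h28, hI.count] at hb
      obtain ⟨t, ht⟩ := scanStep_runs h hI hb h28
      refine ⟨t + 5, ht.frame.seq ?_⟩
      rintro τ ⟨⟨C', M', hI', hp⟩, hf⟩
      refine Runs.of_wp' ?_ (by simp [Cmd.bound, IExp.cost])
      simp only [Cmd.wp, IExp.eval]
      refine ⟨(k + 1, C', M'), ⟨by simp [hf.idx 28 rfl, h28], hI'.setI_idx _⟩, ?_⟩
      change scanPot m (k + 1) C' M' + t + 20 ≤ scanPot m k C M at hp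
      change scanPot m (k + 1) C' M' + (t + 5) + (1 + 1 + 1) + 1 ≤ scanPot m k C M
      omega) (0, C, ∅) (σ.setI 28 0) ⟨by simp, hI.setI_idx _⟩
  refine Runs.mono (Runs.wp_seq (s := 2) (by simp only [Cmd.wp, IExp.eval]; exact key)
    (by simp [Cmd.bound, IExp.cost])) ?_ ?_
  -- `1100` steps for each of the at most `N` entries, and `1000` for each of the at most `N` items.
  · have h1 := hI.valid.sum_length_le
    simp only [scanPot, Test.cost, IExp.cost, Finset.sdiff_empty]
    omega
  · rintro τ ⟨⟨k, C', M'⟩, ⟨h28, hI'⟩, hb⟩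
    simp only [Test.Holds, IExp.eval, h28, hI'.count] at hb
    have : k = m := le_antisymm hI'.le (by simpa using hb)
    exact ⟨C', M', this ▸ hI'⟩

/-- The array `18` lists the alive nodes, none of which is marked. -/
structure RoundInv (N ρ : ℕ) (spar : ℕ → ℕ) (d : ℕ → ℕ → ℝ) (α β : ℕ → Key) (wt : ℕ → ℝ)
    (C : Conf) (σ : Store) : Prop where
  valid : C.Valid N ρ spar d α β wt
  rep : Rep N wt C σ
  count : σ.idx 27 = C.alive.card
  root : σ.idx 29 = ρ
  image : (Finset.range C.alive.card).image (σ.idxArr 18) = C.alive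
  mark : ∀ v ∈ C.alive, σ.idxArr 19 v = 0

/-- Remove the dead nodes from the list, and all marks. -/
def compact : Cmd :=
  .setIdx 30 (.lit 0) ;;
  Cmd.forUp 28 (.var 27)
    (.setIdx 24 (.read 18 (.var 28)) ;;
      .ite (.idxEq (.read 20 (.var 24)) (.lit 0))
        (.writeIdx 18 (.var 30) (.var 24) ;; .writeIdx 19 (.var 24) (.lit 0) ;;
          .setIdx 30 (.add (.var 30) (.lit 1)))
        .skip) ;;
  .setIdx 27 (.var 30)

theorem compact_runs {m : ℕ} {al : ℕ → ℕ} {C : Conf} {M : Finset ℕ} {σ : Store}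
    (hI : ScanInv N ρ spar d α β wt m al m C M σ) (hal : Set.InjOn al (Finset.range m)) :
    Runs compact σ (50 * (m + 1)) (RoundInv N ρ spar d α β wt C) := by
  set F : ℕ → Finset ℕ := fun k => (Finset.range k).filter fun i => al i ∈ C.alive with hF
  have key := Runs.forUp (x := 28) (m := .var 27)
    (c := .setIdx 24 (.read 18 (.var 28)) ;;
      .ite (.idxEq (.read 20 (.var 24)) (.lit 0))
        (.writeIdx 18 (.var 30) (.var 24) ;; .writeIdx 19 (.var 24) (.lit 0) ;;
          .setIdx 30 (.add (.var 30) (.lit 1)))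
        .skip) m 25
    (fun k τ => Rep N wt C τ ∧ τ.idx 27 = m ∧ τ.idx 29 = ρ ∧ τ.idx 30 = (F k).card ∧
      (∀ i, k ≤ i → τ.idxArr 18 i = al i) ∧
      (Finset.range (F k).card).image (τ.idxArr 18) = (F k).image al ∧
      (∀ i ∈ F k, τ.idxArr 19 (al i) = 0))
    (fun k τ _ h => h.2.1) (fun k τ hk h28 ⟨hR, h27, h29, h30, h1, h2, h3⟩ => by
      -- The list is compacted in place: writing happens at position `(F k).card`, which never
      -- overtakes the reading position `k`.
      have hFk : (F k).card ≤ k := (Finset.card_filter_le _ _).trans (by simp)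
      refine Runs.of_wp' ?_ (by simp [Cmd.bound, IExp.cost, Test.cost])
      simp only [Cmd.wp, IExp.eval, h28, h1 k le_rfl, Test.Holds, Store.setI_idx,
        Store.setI_idxArr, if_true, Store.setIA_idx, hR.dead _ (hI.list_lt k hk), h30]
      simp only [show ((30 : ℕ) = 24) = False by simp, show ((28 : ℕ) = 24) = False by simp,
        if_false]
      refine ⟨fun ha => ?_, fun ha => ?_⟩
      · have hFs : F (k + 1) = insert k (F k) := by
          simp only [hF, Finset.range_add_one, Finset.filter_insert, if_pos ha]
        have hkF : k ∉ F k := by simp [hF]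
        have hc : (F (k + 1)).card = (F k).card + 1 := by
          rw [hFs, Finset.card_insert_of_notMem hkF]
        refine ⟨by simp, ?_, by simp [h27], by simp [h29], by simp [hc], ?_, ?_, ?_⟩
        · refine hR.congr (by simp) (fun a e1 e2 => ?_) rfl
          simp [e1, e2]
        · intro i hi
          simp only [Store.setI_idxArr, Store.setIA_idxArr, if_true,
            show ((18 : ℕ) = 19) = False by simp, if_false]
          rw [Function.update_of_ne (by omega)]
          exact h1 i (by omega)
        · simp only [Store.setI_idxArr, Store.setIA_idxArr, if_true,
            show ((18 : ℕ) = 19) = False by simp, if_false]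
          rw [hc, Finset.range_add_one, Finset.image_insert, Function.update_self, hFs,
            Finset.image_insert, ← h2]
          congr 1
          refine Finset.image_congr fun i hi => ?_
          rw [Function.update_of_ne]
          exact (Finset.mem_range.1 hi).ne
        · intro i hi
          simp only [Store.setI_idxArr, Store.setIA_idxArr, if_true,
            show ((19 : ℕ) = 18) = False by simp, if_false]
          by_cases e : al i = al k
          · rw [e, Function.update_self]
          · rw [Function.update_of_ne e]
            refine h3 i ?_
            rw [hFs] at hi
            exact (Finset.mem_insert.1 hi).resolve_left fun e' => e (e' ▸ rfl)
      · have hFs : F (k + 1) = F k := by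
          simp only [hF, Finset.range_add_one, Finset.filter_insert, if_neg ha]
        rw [hFs]
        refine ⟨by simp, ?_, by simp [h27], by simp [h29], by simp, ?_, h2, h3⟩
        · exact hR.congr (by simp) (fun a e1 e2 => rfl) rfl
        · exact fun i hi => h1 i (by omega))
    (σ.setI 30 0)
    ⟨hI.rep.congr (by simp) (fun _ _ _ => rfl) rfl, by simp [hI.count], by simp [hI.root],
      by simp [hF], fun i _ => congrFun hI.list i, by simp [hF], by simp [hF]⟩
  have hFm : (F m).image al = C.alive := by
    ext v
    simp only [hF, Finset.mem_image, Finset.mem_filter, Finset.mem_range]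
    constructor
    · rintro ⟨i, ⟨-, h⟩, rfl⟩
      exact h
    · intro hv
      obtain ⟨i, hi, rfl⟩ := hI.mem_list v hv
      exact ⟨i, ⟨hi, hv⟩, rfl⟩
  have hFc : (F m).card = C.alive.card := by
    rw [← hFm, Finset.card_image_of_injOn]
    exact hal.mono (Finset.coe_subset.2 (Finset.filter_subset _ _))
  refine Runs.mono (Runs.wp_seq (s := 2) (t := (25 + 1 + 10) * (m + 1) + 2) ?_
    (by simp [Cmd.bound, IExp.cost])) (by omega) fun _ h => h
  simp only [Cmd.wp, IExp.eval]
  refine key.seq ?_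
  rintro τ ⟨hR, h27, h29, h30, h1, h2, h3⟩
  refine Runs.of_wp' ?_ (by simp [Cmd.bound, IExp.cost])
  simp only [Cmd.wp, IExp.eval]
  refine ⟨hI.valid, hR.congr (by simp) (fun _ _ _ => rfl) rfl, by simp [h30, hFc], by simp [h29],
    ?_, ?_⟩
  · rw [Store.setI_idxArr, ← hFc, h2, hFm]
  · intro v hv
    rw [← hFm] at hv
    obtain ⟨i, hi, rfl⟩ := Finset.mem_image.1 hv
    exact h3 i hi

/-- Contract the tree to its root. -/
def contract : Cmd := .loop (.idxLt (.lit 1) (.var 27)) (scan ;; compact)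

/-- `log (12 / 13) ≤ -1 / 13`, so `13 * log` drops by at least one, and its floor is a strictly
decreasing measure. -/
theorem log_decrease {m m' : ℕ} (h1 : 1 ≤ m') (h : 13 * m' ≤ 12 * m) :
    ⌊13 * Real.log m'⌋₊ < ⌊13 * Real.log m⌋₊ := by
  have hm' : (0 : ℝ) < m' := by exact_mod_cast h1
  have h2 : (m' : ℝ) ≤ 12 / 13 * m := by
    have : (13 : ℝ) * m' ≤ 12 * m := by exact_mod_cast h
    linarith
  have hm : (0 : ℝ) < m := by linarith
  have h3 : Real.log m' ≤ Real.log (12 / 13) + Real.log m := by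
    rw [← Real.log_mul (by norm_num) hm.ne']
    exact Real.log_le_log hm' h2
  have h4 : Real.log (12 / 13) ≤ 12 / 13 - 1 := Real.log_le_sub_one_of_pos (by norm_num)
  have h5 : 0 ≤ Real.log m' := Real.log_nonneg (by exact_mod_cast h1)
  rw [Nat.lt_iff_add_one_le, ← Nat.floor_add_one (by positivity)]
  exact Nat.floor_le_floor (by linarith)

/-- Each round takes linear time, and the floor of `13 * log` of the number of alive nodes bounds
the number of rounds. When only the root is alive, its cluster contains all items and the gains are
complete. -/
theorem contract_runs {C : Conf} {σ : Store} (h : RootedMetric N ρ spar slen d)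
    (hI : RoundInv N ρ spar d α β wt C σ) :
    Runs contract σ ((2200 * (N + 1) + 4) * ⌊13 * Real.log N⌋₊ + 4) fun τ =>
      ∀ i < N, τ.realArr 15 i = ∑ j ∈ Finset.range N, contrib spar d α β wt i j := by
  have hle : ∀ {C : Conf}, C.Valid N ρ spar d α β wt → C.alive.card ≤ N := fun {C} hC => by
    have : C.alive.card ≤ (Finset.range N).card :=
      Finset.card_le_card fun v hv => Finset.mem_range.2 (hC.alive_lt hv)
    simpa using this
  have key := Runs.loop_const (b := .idxLt (.lit 1) (.var 27)) (c := scan ;; compact)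
    (fun (C : Conf) σ => RoundInv N ρ spar d α β wt C σ)
    (fun C => ⌊13 * Real.log (C.alive.card : ℕ)⌋₊) (2200 * (N + 1)) (fun C σ hI hb => by
      simp only [Test.Holds, IExp.eval, hI.count] at hb
      have hN := hle hI.valid
      have hS : ScanInv N ρ spar d α β wt C.alive.card (σ.idxArr 18) 0 C ∅ σ :=
        ⟨hI.valid, hI.rep, hI.count, hI.root, rfl, fun i hi => hI.valid.alive_lt (by
            rw [← hI.image]
            exact Finset.mem_image_of_mem _ (Finset.mem_range.2 hi)), fun v hv => by
          rw [← hI.image] at hv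
          obtain ⟨i, hi, e⟩ := Finset.mem_image.1 hv
          exact ⟨i, Finset.mem_range.1 hi, e⟩, fun v hv => by simp [hI.mark v hv], by simp,
          by simp, by omega, fun j hj => absurd hj (by omega)⟩
      have hinj : Set.InjOn (σ.idxArr 18) (Finset.range C.alive.card) := by
        rw [← Finset.card_image_iff, hI.image, Finset.card_range]
      refine ((scan_runs h hS).seq (t' := 50 * (C.alive.card + 1)) fun τ => ?_).mono (by omega)
        fun _ h => h
      rintro ⟨C', M', hS'⟩
      refine (compact_runs hS' hinj).mono le_rfl fun υ hυ => ⟨C', hυ, ?_⟩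
      have hE := hS'.valid.card_le_of_exhausted h hS'.marked (fun v hv => by
        obtain ⟨i, hi, rfl⟩ := hS'.mem_list v hv
        exact hS'.exhausted i hi hv) (by rw [hS'.card]; omega)
      have := hS'.card
      exact log_decrease (Finset.card_pos.2 ⟨ρ, hS'.valid.root_mem⟩) (by omega)) C σ hI
  refine key.mono ?_ ?_
  · simp only [Test.cost, IExp.cost]
    have : ⌊13 * Real.log (C.alive.card : ℕ)⌋₊ ≤ ⌊13 * Real.log N⌋₊ := by
      refine Nat.floor_le_floor ?_
      have h1 := hle hI.valid
      have h2 : 0 < C.alive.card := Finset.card_pos.2 ⟨ρ, hI.valid.root_mem⟩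
      have := Real.log_le_log (x := (C.alive.card : ℝ)) (y := N) (by exact_mod_cast h2)
        (by exact_mod_cast h1)
      linarith
    exact Nat.add_le_add_right (Nat.mul_le_mul le_rfl this) 4
  · rintro τ ⟨C', hI', hb⟩ i hi
    simp only [Test.Holds, IExp.eval, hI'.count] at hb
    rw [hI'.rep.gain]
    refine hI'.valid.gain_final ?_ hi
    refine (Finset.eq_of_subset_of_card_le (Finset.singleton_subset_iff.2 hI'.valid.root_mem)
      ?_).symm
    simpa using hb

end ContractCmd

end RealRAM

/-! ### The weighted tree as a rooted metric -/

namespace TreeLocation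

namespace WeightedTree

open SimpleGraph

variable {n : ℕ} (T : WeightedTree n)

theorem graph_isTree : T.graph.IsTree := T.isTree

theorem path_isPath (u v : Fin n) : (T.path u v).IsPath :=
  (SimpleGraph.IsTree.existsUnique_path T.isTree u v).choose_spec.1

theorem path_unique {u v : Fin n} {p : T.graph.Walk u v} (hp : p.IsPath) : T.path u v = p :=
  ((SimpleGraph.IsTree.existsUnique_path T.isTree u v).choose_spec.2 p hp).symm

theorem path_self (u : Fin n) : T.path u u = .nil := T.path_unique .nil

theorem path_cons {u v w : Fin n} (h : T.graph.Adj u w) (hu : u ∉ (T.path w v).support) :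
    T.path u v = .cons h (T.path w v) :=
  T.path_unique ((Walk.cons_isPath_iff h _).2 ⟨T.path_isPath w v, hu⟩)

theorem path_comm (u v : Fin n) : T.path v u = (T.path u v).reverse :=
  T.path_unique (T.path_isPath u v).reverse

theorem path_adj {u w : Fin n} (h : T.graph.Adj u w) : T.path u w = .cons h .nil := by
  have := T.path_cons (v := w) h (by simp [path_self, h.ne])
  rwa [path_self] at this

theorem dist_self (u : Fin n) : T.dist u u = 0 := by simp [dist, path_self]

theorem dist_comm (u v : Fin n) : T.dist u v = T.dist v u := by
  simp only [dist, T.path_comm u v, Walk.edges_reverse, List.mem_reverse]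

theorem dist_nonneg (u v : Fin n) : 0 ≤ T.dist u v :=
  Finset.sum_nonneg fun e _ => by
    split_ifs
    exacts [T.len_nonneg e, le_rfl]

theorem dist_le_sum (u v : Fin n) : T.dist u v ≤ ∑ e, T.len e :=
  Finset.sum_le_sum fun e _ => by
    split_ifs
    exacts [le_rfl, T.len_nonneg e]

/-- The edge from `u` to `w` does not occur on a path that avoids `u`, so no edge is counted twice.
-/
theorem dist_cons {u v w : Fin n} (h : T.graph.Adj u w) (hu : u ∉ (T.path w v).support) :
    T.dist u v = T.dist u w + T.dist w v := by
  have hp := T.path_cons h hu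
  have hnd : s(u, w) ∉ (T.path w v).edges := fun e => hu (Walk.fst_mem_support_of_mem_edges _ e)
  simp only [dist, hp, T.path_adj h, ← Finset.sum_add_distrib]
  refine Finset.sum_congr rfl fun e _ => ?_
  simp only [Walk.edges_cons, Walk.edges_nil, List.mem_cons, List.not_mem_nil, or_false]
  by_cases e1 : s(T.src e, T.dst e) = s(u, w)
  · rw [e1]
    simp [hnd]
  · simp [e1]

/-- A tree on `n` nodes has `n - 1` edges, all of which occur among the `n - 1` listed pairs. So the
list has no repetitions, and every listed pair is an edge, in particular not a loop. -/
theorem edge_data : (Function.Injective fun e => s(T.src e, T.dst e)) ∧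
    ∀ e, T.src e ≠ T.dst e := by
  classical
  have h1 := T.graph_isTree.card_edgeFinset
  have h2 : T.graph.edgeFinset ⊆ Finset.univ.image fun e => s(T.src e, T.dst e) := by
    intro z hz
    rw [mem_edgeFinset, graph, edgeListGraph, edgeSet_fromEdgeSet] at hz
    obtain ⟨e, he⟩ := hz.1
    exact Finset.mem_image.2 ⟨e, Finset.mem_univ _, he⟩
  have h3 : (Finset.univ.image fun e => s(T.src e, T.dst e)).card ≤ n - 1 :=
    Finset.card_image_le.trans (by simp)
  rw [Fintype.card_fin] at h1
  have h4 := Finset.eq_of_subset_of_card_le h2 (by omega)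
  constructor
  · rw [← Set.injOn_univ, ← Finset.coe_univ, ← Finset.card_image_iff, ← h4, Finset.card_univ,
      Fintype.card_fin]
    omega
  · intro e he
    have : s(T.src e, T.dst e) ∈ T.graph.edgeFinset := by
      rw [h4]
      exact Finset.mem_image_of_mem _ (Finset.mem_univ e)
    rw [mem_edgeFinset, mem_edgeSet] at this
    exact this.ne he

theorem adj_iff {u v : Fin n} : T.graph.Adj u v ↔ ∃ e, s(T.src e, T.dst e) = s(u, v) := by
  rw [graph, edgeListGraph, fromEdgeSet_adj]
  constructor
  · rintro ⟨⟨e, he⟩, -⟩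
    exact ⟨e, he⟩
  · rintro ⟨e, he⟩
    refine ⟨⟨e, he⟩, ?_⟩
    rintro rfl
    have := T.edge_data.2 e
    rcases Sym2.eq_iff.1 he with ⟨h1, h2⟩ | ⟨h1, h2⟩ <;> exact this (h1.trans h2.symm)

theorem dist_edge (e : Fin (n - 1)) : T.dist (T.src e) (T.dst e) = T.len e := by
  have h : T.graph.Adj (T.src e) (T.dst e) := T.adj_iff.2 ⟨e, rfl⟩
  rw [dist, T.path_adj h, Finset.sum_eq_single e]
  · simp
  · intro e' _ hne
    simp only [Walk.edges_cons, Walk.edges_nil, List.mem_cons, List.not_mem_nil, or_false,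
      ite_eq_right_iff]
    exact fun h => absurd (T.edge_data.1 h) hne
  · simp

/-- The neighbour of `u` on the path to `z`. -/
noncomputable def next (z u : Fin n) : Fin n := (T.path u z).snd

theorem next_self (z : Fin n) : T.next z z = z := by rw [next, path_self]; rfl

theorem path_next {z u : Fin n} (hu : u ≠ z) : ∃ h : T.graph.Adj u (T.next z u),
    T.path u z = .cons h (T.path (T.next z u) z) := by
  have key : ∀ p : T.graph.Walk u z, p.IsPath → ∃ h : T.graph.Adj u p.snd,
      p = .cons h (T.path p.snd z) := by
    intro p hp
    cases p with
    | nil => exact absurd rfl hu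
    | cons h q =>
      rw [Walk.snd_cons]
      exact ⟨h, by rw [T.path_unique (p := q) hp.of_cons]⟩
  exact key _ (T.path_isPath u z)

theorem adj_next {z u : Fin n} (hu : u ≠ z) : T.graph.Adj u (T.next z u) := (T.path_next hu).1

theorem length_next {z u : Fin n} (hu : u ≠ z) :
    (T.path (T.next z u) z).length < (T.path u z).length := by
  obtain ⟨h, e⟩ := T.path_next hu
  rw [e, Walk.length_cons]
  omega

/-- If `v` is on the path from `u` to `z`, it is the second node there, the graph being acyclic.
Otherwise this path extended by `v` is the path from `v`. -/
theorem next_of_adj {z u v : Fin n} (h : T.graph.Adj u v) :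
    u ≠ z ∧ T.next z u = v ∨ v ≠ z ∧ T.next z v = u := by
  by_cases hv : v ∈ (T.path u z).support
  · refine Or.inl ⟨?_, ((T.graph_isTree.2).eq_snd_of_adj_start (T.path_isPath u z) h hv).symm⟩
    rintro rfl
    rw [path_self, Walk.support_nil, List.mem_singleton] at hv
    exact h.ne hv.symm
  · refine Or.inr ⟨?_, ?_⟩
    · rintro rfl
      exact hv (Walk.end_mem_support _)
    · rw [next, T.path_cons h.symm hv, Walk.snd_cons]

/-- The parent of a node in the tree rooted at the node `0`. -/
noncomputable def par (v : ℕ) : ℕ :=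
  if h : v < n then (T.next ⟨0, by omega⟩ ⟨v, h⟩ : ℕ) else 0

/-- The distance of two nodes given by their numbers. -/
noncomputable def ndist (u v : ℕ) : ℝ :=
  if h : u < n ∧ v < n then T.dist ⟨u, h.1⟩ ⟨v, h.2⟩ else 0

/-- The length of the edge from a node to its parent. -/
noncomputable def lenUp (v : ℕ) : ℝ := T.ndist v (T.par v)

variable {T} {u v w : ℕ}

theorem par_eq (hv : v < n) : T.par v = (T.next ⟨0, by omega⟩ ⟨v, hv⟩ : ℕ) := dif_pos hv

theorem par_lt (hv : v < n) : T.par v < n := by rw [par_eq hv]; exact Fin.is_lt _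

theorem fin_par (hv : v < n) : (⟨T.par v, par_lt hv⟩ : Fin n) = T.next ⟨0, by omega⟩ ⟨v, hv⟩ :=
  Fin.ext (par_eq hv)

theorem par_zero : T.par 0 = 0 := by
  by_cases h : 0 < n
  · rw [par_eq h, next_self]
  · rw [par, dif_neg h]

theorem ndist_eq (hu : u < n) (hv : v < n) : T.ndist u v = T.dist ⟨u, hu⟩ ⟨v, hv⟩ :=
  dif_pos ⟨hu, hv⟩

theorem ndist_fin (u v : Fin n) : T.ndist u v = T.dist u v := ndist_eq u.2 v.2

theorem ndist_nonneg : 0 ≤ T.ndist u v := by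
  rw [ndist]
  split_ifs
  exacts [T.dist_nonneg _ _, le_rfl]

theorem ndist_comm : T.ndist u v = T.ndist v u := by
  by_cases h : u < n ∧ v < n
  · rw [ndist_eq h.1 h.2, ndist_eq h.2 h.1, T.dist_comm]
  · rw [ndist, dif_neg h, ndist, dif_neg fun h' => h h'.symm]

theorem ndist_self : T.ndist u u = 0 := by
  by_cases h : u < n
  · rw [ndist_eq h h, T.dist_self]
  · rw [ndist, dif_neg fun h' => h h'.1]

theorem lenUp_nonneg : 0 ≤ T.lenUp v := ndist_nonneg

variable (T) in
/-- The number of edges on the path from a node to the root. -/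
noncomputable def lev (v : ℕ) : ℕ :=
  if h : v < n then (T.path ⟨v, h⟩ ⟨0, by omega⟩).length else 0

theorem lev_lt (hv : v < n) : T.lev v < n := by
  rw [lev, dif_pos hv]
  simpa using (T.path_isPath ⟨v, hv⟩ ⟨0, by omega⟩).length_lt

theorem lev_par (hv : v < n) (h0 : v ≠ 0) : T.lev (T.par v) < T.lev v := by
  rw [lev, dif_pos (par_lt hv), lev, dif_pos hv, fin_par hv]
  exact T.length_next fun e => h0 (by simpa using e)

theorem par_ne (hv : v < n) (h0 : v ≠ 0) : T.par v ≠ v := fun e => by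
  have := lev_par (T := T) hv h0
  rw [e] at this
  omega

/-- The nodes on a path that avoids the parent of its starting node are below the latter. -/
theorem mem_sub_of_path (hn : 0 < n) {a b : Fin n} (p : T.graph.Walk a b) (hp : p.IsPath)
    (h : T.next ⟨0, hn⟩ a ∉ p.support) : (b : ℕ) ∈ Sub T.par a := by
  induction p with
  | nil => exact mem_sub_self _
  | @cons a c b hac q ih =>
    rw [Walk.support_cons, List.mem_cons, not_or] at h
    rw [Walk.cons_isPath_iff] at hp
    rcases T.next_of_adj (z := ⟨0, hn⟩) hac with ⟨-, e⟩ | ⟨-, e⟩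
    · exact absurd (e ▸ Walk.start_mem_support q) h.2
    · refine mem_sub_trans (ih hp.1 (e ▸ hp.2)) ?_
      have : T.par c = a := by rw [par_eq c.2]; exact congrArg Fin.val e
      exact this ▸ mem_sub_par (c : ℕ)

/-- Only `up` needs an argument: if `v` is not below `u`, then the path from the parent of `u` to
`v` avoids `u`, so that it can be extended by the edge above `u`. -/
theorem rootedMetric (T : WeightedTree n) (hn : 0 < n) :
    RootedMetric n 0 T.par T.lenUp T.ndist where
  root_lt := hn
  par_lt v hv := par_lt hv
  par_root := par_zero
  rank := ⟨T.lev, fun v hv h0 => lev_par hv h0⟩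
  self u hu := ndist_self
  symm u hu v hv := ndist_comm
  up u hu v hv hs := by
    -- If `u` were the root, every node would be below it.
    have h0 : (⟨u, hu⟩ : Fin n) ≠ ⟨0, hn⟩ := by
      intro e
      have e : u = 0 := by simpa using e
      subst e
      refine hs ?_
      induction hk : T.lev v using Nat.strong_induction_on generalizing v with
      | _ k ih =>
        by_cases h : v = 0
        · exact h ▸ mem_sub_self _
        · by_contra hcon
          refine hcon (mem_sub_of_par (ih _ (hk ▸ lev_par hv h) _ (par_lt hv)
            (fun e => hcon (mem_sub_of_par e)) rfl))
    have hadj := T.adj_next h0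
    -- Otherwise the part of the path from `u` onwards would not return to the parent of `u`, where
    -- the path started, and thus `v` would be below `u`.
    have hmem : (⟨u, hu⟩ : Fin n) ∉ (T.path (T.next ⟨0, hn⟩ ⟨u, hu⟩) ⟨v, hv⟩).support := by
      intro hm
      refine hs (mem_sub_of_path hn ((T.path _ _).dropUntil _ hm)
        ((T.path_isPath _ _).dropUntil hm) fun hm' => ?_)
      have h1 := T.path_isPath (T.next ⟨0, hn⟩ ⟨u, hu⟩) ⟨v, hv⟩
      have h2 := (T.path (T.next ⟨0, hn⟩ ⟨u, hu⟩) ⟨v, hv⟩).take_spec hm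
      rw [← h2, Walk.isPath_def, Walk.support_append] at h1
      have h3 := List.disjoint_of_nodup_append h1
      refine h3 (Walk.start_mem_support _) ?_
      rw [← Walk.cons_tail_support, List.mem_cons] at hm'
      exact hm'.resolve_left hadj.ne.symm
    rw [lenUp, ndist_eq hu hv, ndist_eq hu (par_lt hu), ndist_eq (par_lt hu) hv, fin_par hu]
    exact T.dist_cons hadj hmem

end WeightedTree

end TreeLocation

/-! ### Candidate locations for the absolute problem -/

namespace TreeLocation

theorem Key.neg_iff {x y : ℝ} : (toLex (x, y) : Key) < 0 ↔ x < 0 ∨ x = 0 ∧ y < 0 :=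
  Prod.Lex.lt_iff

namespace RootedMetric

variable {N ρ : ℕ} {par : ℕ → ℕ} {len : ℕ → ℝ} {d : ℕ → ℕ → ℝ} (h : RootedMetric N ρ par len d)
  {a c x y u v : ℕ}

include h

/-- Paths that leave a subtree pass its top. -/
theorem through (hx : x < N) (hy : y < N) (hxa : x ∈ Sub par a) (hya : y ∉ Sub par a) :
    d x y = d x a + d a y := by
  have ha := h.sub_lt hx hxa
  refine sub_induction (p := fun x => x < N → d x y = d x a + d a y) hxa (fun _ => ?_)
    (fun x hx hne ih hxN => ?_) hx
  · rw [h.self a ha, zero_add]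
  · rw [h.up x hxN y hy fun e => hya (mem_sub_trans e hx), h.up x hxN a ha fun e =>
      hne (h.sub_antisymm hxN hx e), ih (h.par_lt x hxN), add_assoc]

theorem to_par (hx : x < N) (hxa : x ∈ Sub par a) (ha : a ≠ ρ) :
    d x (par a) = d x a + len a := by
  have haN := h.sub_lt hx hxa
  have hp := h.par_notMem_sub haN ha
  rw [h.through hx (h.par_lt a haN) hxa hp, h.up a haN _ (h.par_lt a haN) hp,
    h.self _ (h.par_lt a haN), add_zero]

end RootedMetric

open Classical in
/-- The distance of the node `v` from the location at height `s` above the node `c`. -/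
noncomputable def locDist (par : ℕ → ℕ) (d : ℕ → ℕ → ℝ) (c : ℕ) (s : ℝ) (v : ℕ) : ℝ :=
  if v ∈ Sub par c then d c v + s else d c v - s

open Classical in
/-- The node `v` is closer than `r v` to the location at the height `H`, up to an infinitesimal
multiple `E`, above the node `a`. -/
def Wins (par : ℕ → ℕ) (d : ℕ → ℕ → ℝ) (r : ℕ → ℝ) (a : ℕ) (H E : ℝ) (v : ℕ) : Prop :=
  Key.ofReal (d a v) + (if v ∈ Sub par a then toLex (H, E) else -toLex (H, E)) +
    -Key.ofReal (r v) < 0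

/-- The candidate location for `u`: the highest point that is closer to `u` than `r u` and lies
on the path from `u` to the root. -/
structure IsCandidate (par : ℕ → ℕ) (d : ℕ → ℕ → ℝ) (r : ℕ → ℝ) (u a : ℕ) (H E : ℝ) : Prop where
  mem : u ∈ Sub par a
  inner : a ≠ 0 → 0 < r u → H = r u - d u a ∧ E = -1 ∧ r u ≤ d u (par a) ∧ 0 < H
  outer : a = 0 ∨ r u ≤ 0 → H = 0 ∧ E = 0
  close : 0 < r u → d u a < r u

section Wins

variable {par : ℕ → ℕ} {d : ℕ → ℕ → ℝ} {r : ℕ → ℝ} {a v : ℕ} {H : ℝ}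

theorem wins_zero : Wins par d r a 0 0 v ↔ d a v < r v := by
  have h0 : (toLex ((0 : ℝ), (0 : ℝ)) : Key) = 0 := rfl
  rw [Wins, h0, neg_zero, ite_self, add_zero]
  change (toLex (d a v + -r v, (0 : ℝ) + -0) : Key) < 0 ↔ _
  rw [Key.neg_iff]
  constructor
  · rintro (h | ⟨-, h⟩)
    · linarith
    · simp at h
  · exact fun h => Or.inl (by linarith)

/-- The infinitesimal `-1` places the location slightly below height `H`. For nodes below `a` this
turns the strict inequality into a weak one; for all others, in `wins_notMem`, it moves the location
away and the inequality stays strict. -/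
theorem wins_mem (hv : v ∈ Sub par a) : Wins par d r a H (-1) v ↔ d a v + H ≤ r v := by
  rw [Wins, if_pos hv]
  change (toLex (d a v + H + -r v, (0 : ℝ) + -1 + -0) : Key) < 0 ↔ _
  rw [Key.neg_iff]
  constructor
  · rintro (h | ⟨h, -⟩) <;> linarith
  · intro h
    rcases h.lt_or_eq with h | h
    · exact Or.inl (by linarith)
    · exact Or.inr ⟨by linarith, by norm_num⟩

theorem wins_notMem (hv : v ∉ Sub par a) : Wins par d r a H (-1) v ↔ d a v - H < r v := by
  rw [Wins, if_neg hv]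
  change (toLex (d a v + -H + -r v, (0 : ℝ) + -(-1) + -0) : Key) < 0 ↔ _
  rw [Key.neg_iff]
  constructor
  · rintro (h | ⟨-, h⟩)
    · linarith
    · norm_num at h
  · exact fun h => Or.inl (by linarith)

/-- A location slightly below a candidate is closer than `r v` to all nodes `v` for which the
candidate wins. -/
theorem locDist_lt_of_wins {ε : ℝ} (hε : 0 < ε) (hs : d a v - H < r v → ε < r v - d a v + H)
    (h : Wins par d r a H (-1) v) : locDist par d a (H - ε) v < r v := by
  unfold locDist
  split_ifs with hv
  · rw [wins_mem hv] at h
    linarith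
  · rw [wins_notMem hv] at h
    linarith [hs h]

end Wins

/-- Every location is dominated by a candidate. -/
theorem RootedMetric.exists_candidate {n : ℕ} {par : ℕ → ℕ} {len : ℕ → ℝ} {d : ℕ → ℕ → ℝ}
    (h : RootedMetric n 0 par len d) (hd : ∀ u v, 0 ≤ d u v) {r : ℕ → ℝ} {A : ℕ → ℕ}
    {H E : ℕ → ℝ} (hA : ∀ u < n, IsCandidate par d r u (A u) (H u) (E u)) {c : ℕ} (hc : c < n)
    {s : ℝ} (hs : 0 ≤ s) (hs' : s = 0 ∨ c ≠ 0 ∧ s ≤ len c) :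
    ∃ u < n, ∀ v < n, locDist par d c s v < r v → Wins par d r (A u) (H u) (E u) v := by
  classical
  set U := (Finset.range n).filter fun v => locDist par d c s v < r v with hU
  by_cases hne : U.Nonempty
  swap
  · refine ⟨0, h.root_lt, fun v hv hlt => absurd ⟨v, ?_⟩ hne⟩
    simp [hU, hv, hlt]
  -- `d v 0 - r v` is the depth at which the upward reach of `v` ends. The won node with the lowest
  -- end is the one whose candidate serves all the others.
  obtain ⟨u, hu, hmax⟩ := Finset.exists_max_image U (fun v => d v 0 - r v) hne
  rw [hU, Finset.mem_filter, Finset.mem_range] at hu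
  obtain ⟨huN, hu⟩ := hu
  refine ⟨u, huN, fun v hv hlt => ?_⟩
  have hmaxv := hmax v (by simp [hU, hv, hlt])
  -- leaving the subtree of `c` upwards
  have hleave : ∀ x < n, x ∉ Sub par c → d (par c) x ≤ locDist par d c s x := by
    intro x hx hxc
    have hcx := h.up c hc x hx hxc
    rw [locDist, if_neg hxc, hcx]
    rcases hs' with rfl | ⟨hc0, hsl⟩
    · have := h.up c hc (par c) (h.par_lt c hc) (h.par_notMem_sub hc fun e => hxc
        (e ▸ h.mem_sub_root hx))
      rw [h.self _ (h.par_lt c hc)] at this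
      linarith [hd c (par c)]
    · linarith
  have hru : 0 < r u := by
    refine lt_of_le_of_lt ?_ hu
    by_cases huc : u ∈ Sub par c
    · rw [locDist, if_pos huc]
      linarith [hd c u]
    · exact (hd _ _).trans (hleave u huN huc)
  have hC := hA u huN
  set a := A u
  have haN := h.sub_lt huN hC.mem
  -- The candidate is the root itself: the depth of `u` is less than `r u`, and by maximality the
  -- same holds for every won node.
  by_cases ha : a = 0
  · obtain ⟨h1, h2⟩ := hC.outer (Or.inl ha)
    rw [h1, h2, wins_zero]
    have h3 := hC.close hru
    rw [ha] at h3 ⊢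
    rw [h.symm 0 h.root_lt v hv]
    linarith
  · obtain ⟨h1, h2, h3, h4⟩ := hC.inner ha hru
    -- Outside the subtree of `a`, a location is separated from `u` by the parent of `a`, hence at
    -- distance at least `r u` from `u`, and would not win it.
    have hca : c ∈ Sub par a := by
      by_contra hca
      refine absurd hu (not_lt.2 ?_)
      have hua : ∀ x < n, x ∉ Sub par a → r u ≤ d x u := by
        intro x hx hxa
        rw [h.symm x hx u huN, h.sep ha huN hx hC.mem hxa]
        linarith [hd (par a) x]
      by_cases huc : u ∈ Sub par c
      · rw [locDist, if_pos huc]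
        linarith [hua c hc hca]
      · refine (hua _ (h.par_lt c hc) ?_).trans (hleave u huN huc)
        exact fun e => hca (mem_sub_of_par e)
    rw [h2]
    -- Nodes below `a` reach up to the candidate by maximality of `u`. All other nodes are above or
    -- beside it, so going up to the candidate from the given location, which is not higher, brings
    -- them closer.
    by_cases hva : v ∈ Sub par a
    · rw [wins_mem hva, h1]
      have hv0 : ∀ x < n, x ∈ Sub par a → d x 0 = d x a + d a 0 := fun x hx hxa =>
        h.through hx h.root_lt hxa fun e => ha (h.root_mem_sub e)
      rw [hv0 v hv hva, hv0 u huN hC.mem] at hmaxv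
      rw [h.symm a haN v hv]
      linarith
    · rw [wins_notMem hva]
      refine lt_of_le_of_lt ?_ hlt
      have hvc : v ∉ Sub par c := fun e => hva (mem_sub_trans e hca)
      by_cases hac : c = a
      · rw [locDist, if_neg hvc, hac]
        have : s < H u := by
          rw [locDist, if_pos (hac ▸ hC.mem), hac, h.symm a haN u huN] at hu
          linarith
        linarith
      · have := h.through (h.par_lt c hc) hv (par_mem_sub hca hac) hva
        linarith [hleave v hv hvc, hd (par c) a]

namespace WeightedTree

variable {n : ℕ} (T : WeightedTree n)

/-- The first end node of an edge. -/
def nsrc (e : ℕ) : ℕ := if h : e < n - 1 then (T.src ⟨e, h⟩ : ℕ) else 0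

/-- The second end node of an edge. -/
def ndst (e : ℕ) : ℕ := if h : e < n - 1 then (T.dst ⟨e, h⟩ : ℕ) else 0

/-- The length of an edge. -/
def nlen (e : ℕ) : ℝ := if h : e < n - 1 then T.len ⟨e, h⟩ else 0

/-- The weight of a node. -/
def nweight (v : ℕ) : ℝ := if h : v < n then T.weight ⟨v, h⟩ else 0

theorem exists_edge {v : ℕ} (hv : v < n ∧ v ≠ 0) : ∃ e : Fin (n - 1),
    s(T.src e, T.dst e) = s(⟨v, hv.1⟩, T.next ⟨0, by omega⟩ ⟨v, hv.1⟩) :=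
  T.adj_iff.1 (T.adj_next fun e => hv.2 (by simpa using e))

open Classical in
/-- The edge from a node to its parent. -/
noncomputable def edge (v : ℕ) : ℕ :=
  if h : v < n ∧ v ≠ 0 then ((T.exists_edge h).choose : ℕ) else 0

variable {T} {u v : ℕ}

theorem edge_lt (hv : v < n) (h0 : v ≠ 0) : T.edge v < n - 1 := by
  rw [edge, dif_pos ⟨hv, h0⟩]
  exact Fin.is_lt _

theorem edge_spec (hv : v < n) (h0 : v ≠ 0) :
    s(T.src ⟨T.edge v, edge_lt hv h0⟩, T.dst ⟨T.edge v, edge_lt hv h0⟩) =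
      s(⟨v, hv⟩, ⟨T.par v, par_lt hv⟩) := by
  have h := (T.exists_edge ⟨hv, h0⟩).choose_spec
  have e : (T.exists_edge ⟨hv, h0⟩).choose = ⟨T.edge v, edge_lt hv h0⟩ :=
    Fin.ext (dif_pos (c := v < n ∧ v ≠ 0) ⟨hv, h0⟩ : T.edge v = _).symm
  rw [e] at h
  rw [h, fin_par hv]

theorem edge_cases (hv : v < n) (h0 : v ≠ 0) :
    T.nsrc (T.edge v) = v ∧ T.ndst (T.edge v) = T.par v ∨
      T.nsrc (T.edge v) = T.par v ∧ T.ndst (T.edge v) = v := by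
  have he := edge_lt (T := T) hv h0
  rw [nsrc, dif_pos he, ndst, dif_pos he]
  rcases Sym2.eq_iff.1 (edge_spec (T := T) hv h0) with ⟨h1, h2⟩ | ⟨h1, h2⟩ <;> rw [h1, h2] <;> simp

/-- Two different nodes with the same edge to their parents would be parents of each other, contrary
to the decrease of the level. -/
theorem edge_injOn : Set.InjOn T.edge ((Finset.range n).erase 0) := by
  intro v hv v' hv' e
  rw [Finset.mem_coe, Finset.mem_erase, Finset.mem_range] at hv hv'
  have h1 := edge_cases (T := T) hv.2 hv.1
  have h2 := edge_cases (T := T) hv'.2 hv'.1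
  have l1 := lev_par (T := T) hv.2 hv.1
  have l2 := lev_par (T := T) hv'.2 hv'.1
  rw [e] at h1
  rcases h1 with h1 | h1 <;> rcases h2 with h2 | h2
  · omega
  · rw [← h1.2, h2.2] at l1
    rw [← h2.1, h1.1] at l2
    omega
  · rw [← h1.1, h2.1] at l1
    rw [← h2.2, h1.2] at l2
    omega
  · omega

/-- There are as many edges as nodes other than the root. So every edge is the one above exactly one
node, and sums over edges become sums over nodes. -/
theorem image_edge (hn : 0 < n) : ((Finset.range n).erase 0).image T.edge = Finset.range (n - 1) := by
  refine Finset.eq_of_subset_of_card_le ?_ ?_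
  · intro e he
    obtain ⟨v, hv, rfl⟩ := Finset.mem_image.1 he
    rw [Finset.mem_erase, Finset.mem_range] at hv
    exact Finset.mem_range.2 (edge_lt hv.2 hv.1)
  · rw [Finset.card_image_of_injOn edge_injOn, Finset.card_erase_of_mem (Finset.mem_range.2 hn),
      Finset.card_range, Finset.card_range]

theorem exists_child {e : ℕ} (he : e < n - 1) : ∃ v < n, v ≠ 0 ∧ T.edge v = e := by
  have : e ∈ ((Finset.range n).erase 0).image T.edge := by
    rw [image_edge (by omega)]
    exact Finset.mem_range.2 he
  obtain ⟨v, hv, rfl⟩ := Finset.mem_image.1 this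
  rw [Finset.mem_erase, Finset.mem_range] at hv
  exact ⟨v, hv.2, hv.1, rfl⟩

theorem sum_edge {M : Type*} [AddCommMonoid M] (hn : 0 < n) (f : ℕ → M) :
    ∑ e ∈ Finset.range (n - 1), f e = ∑ v ∈ (Finset.range n).erase 0, f (T.edge v) := by
  rw [← image_edge (T := T) hn, Finset.sum_image edge_injOn]

theorem nlen_edge (hv : v < n) (h0 : v ≠ 0) : T.nlen (T.edge v) = T.lenUp v := by
  have he := edge_lt (T := T) hv h0
  rw [nlen, dif_pos he, ← T.dist_edge, lenUp, ndist_eq hv (par_lt hv)]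
  rcases Sym2.eq_iff.1 (edge_spec (T := T) hv h0) with ⟨h1, h2⟩ | ⟨h1, h2⟩
  · rw [h1, h2]
  · rw [h1, h2, T.dist_comm]

/-- The distance from an interior point of an edge, as a location above a node. -/
theorem pointDist_inner (hv : v < n) (h0 : v ≠ 0) {t : ℝ} (h1 : 0 < t)
    (h2 : t < T.len ⟨T.edge v, edge_lt hv h0⟩) (u : Fin n) :
    T.pointDist u (.inner ⟨T.edge v, edge_lt hv h0⟩ t h1 h2) =
      locDist T.par T.ndist v (if T.nsrc (T.edge v) = v then t else T.lenUp v - t) u := by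
  have hn : 0 < n := by omega
  have hR := T.rootedMetric hn
  have hl : T.len ⟨T.edge v, edge_lt hv h0⟩ = T.lenUp v := by
    rw [← nlen_edge hv h0, nlen, dif_pos]
  -- For a point at height `t` above `v`, the minimum in the distance is attained at `v` for nodes
  -- below `v` and at the parent for all others.
  have hd : ∀ t : ℝ, 0 < t → t < T.lenUp v → min (T.ndist u v + t) (T.ndist u (T.par v) +
      (T.lenUp v - t)) = locDist T.par T.ndist v t u := by
    intro t h1 h2
    rw [locDist]
    split_ifs with hs
    · rw [hR.to_par u.2 hs h0, ndist_comm, min_eq_left]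
      linarith
    · rw [ndist_comm (u := v), ndist_comm (v := v), hR.up v hv u u.2 hs, ndist_comm (u := u),
        min_eq_right]
      · ring
      · linarith
  rw [hl] at h2
  rw [pointDist, hl]
  have he := edge_lt (T := T) hv h0
  rcases Sym2.eq_iff.1 (edge_spec (T := T) hv h0) with ⟨e1, e2⟩ | ⟨e1, e2⟩
  · rw [e1, e2, if_pos (by rw [nsrc, dif_pos he, e1]), ← hd t h1 h2, ndist_eq u.2 hv,
      ndist_eq u.2 (par_lt hv)]
  · rw [e1, e2, if_neg (by rw [nsrc, dif_pos he, e1]; exact par_ne hv h0),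
      ← hd (T.lenUp v - t) (by linarith) (by linarith), ndist_eq u.2 hv,
      ndist_eq u.2 (par_lt hv), min_comm, sub_sub_cancel]

theorem pointDist_node (v u : Fin n) :
    T.pointDist u (.node v) = locDist T.par T.ndist v 0 u := by
  rw [pointDist, locDist]
  split_ifs
  · rw [add_zero, ndist_fin, T.dist_comm]
  · rw [sub_zero, ndist_fin, T.dist_comm]

/-- Every point is a location above a node. -/
theorem exists_locDist (y : T.Point) : ∃ c < n, ∃ s : ℝ, 0 ≤ s ∧
    (s = 0 ∨ c ≠ 0 ∧ s ≤ T.lenUp c) ∧ ∀ u : Fin n,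
      T.pointDist u y = locDist T.par T.ndist c s u := by
  cases y with
  | node v => exact ⟨v, v.2, 0, le_rfl, Or.inl rfl, pointDist_node v⟩
  | inner e t h1 h2 =>
    obtain ⟨e, he⟩ := e
    obtain ⟨v, hv, h0, rfl⟩ := exists_child (T := T) he
    have hl : T.len ⟨T.edge v, edge_lt hv h0⟩ = T.lenUp v := by
      rw [← nlen_edge hv h0, nlen, dif_pos]
    refine ⟨v, hv, if T.nsrc (T.edge v) = v then t else T.lenUp v - t, ?_, Or.inr ⟨h0, ?_⟩,
      pointDist_inner hv h0 h1 h2⟩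
    · rw [hl] at h2
      split_ifs <;> linarith
    · rw [hl] at h2
      split_ifs <;> linarith

end WeightedTree

end TreeLocation

/-! ### Distances from the given points, and scores of candidates -/

namespace TreeLocation

/-- A function that changes along each edge by at most its length is 1-Lipschitz. -/
theorem RootedMetric.lipschitz {n ρ : ℕ} {par : ℕ → ℕ} {len : ℕ → ℝ} {d : ℕ → ℕ → ℝ}
    (h : RootedMetric n ρ par len d) {g : ℕ → ℝ}
    (h1 : ∀ v < n, v ≠ ρ → g v ≤ g (par v) + len v)
    (h2 : ∀ v < n, v ≠ ρ → g (par v) ≤ g v + len v) {u v : ℕ} (hu : u < n) (hv : v < n) :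
    g v ≤ g u + d u v := by
  obtain ⟨lev, hlev⟩ := h.rank
  induction hk : lev u + lev v using Nat.strong_induction_on generalizing u v with
  | _ k ih =>
    by_cases hvu : v ∈ Sub par u
    · by_cases huv : u ∈ Sub par v
      · rw [h.sub_antisymm hu huv hvu, h.self v hv, add_zero]
      · have hv0 : v ≠ ρ := fun e => huv (e ▸ h.mem_sub_root hu)
        have := ih _ (by have := hlev v hv hv0; omega) hu (h.par_lt v hv) rfl
        have e := h.up v hv u hu huv
        rw [h.symm u hu v hv, e, h.symm _ (h.par_lt v hv) u hu]
        linarith [h1 v hv hv0]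
    · have hu0 : u ≠ ρ := fun e => hvu (e ▸ h.mem_sub_root hv)
      have := ih _ (by have := hlev u hu hu0; omega) (h.par_lt u hu) hv rfl
      rw [h.up u hu v hv hvu]
      linarith [h2 u hu hu0]

/-- The distance from a fixed node changes along an edge by at most its length, so it is
1-Lipschitz. -/
theorem RootedMetric.triangle {n ρ : ℕ} {par : ℕ → ℕ} {len : ℕ → ℝ} {d : ℕ → ℕ → ℝ}
    (h : RootedMetric n ρ par len d) (hd : ∀ u v, 0 ≤ d u v) {u v w : ℕ} (hu : u < n)
    (hv : v < n) (hw : w < n) : d u w ≤ d u v + d v w := by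
  have key : ∀ x < n, x ≠ ρ → len x = d x (par x) := fun x hx hx0 => by
    rw [h.up x hx _ (h.par_lt x hx) (h.par_notMem_sub hx hx0), h.self _ (h.par_lt x hx), add_zero]
  refine h.lipschitz (g := d u) (fun x hx hx0 => ?_) (fun x hx hx0 => ?_) hv hw
  · by_cases hux : u ∈ Sub par x
    · have := h.to_par hu hux hx0
      linarith [key x hx hx0, hd x (par x)]
    · have := h.up x hx u hu hux
      rw [h.symm u hu x hx, this, h.symm _ (h.par_lt x hx) u hu]
      linarith
  · by_cases hux : u ∈ Sub par x
    · exact (h.to_par hu hux hx0).le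
    · have := h.up x hx u hu hux
      rw [h.symm u hu x hx, this, h.symm _ (h.par_lt x hx) u hu]
      linarith [key x hx hx0, hd x (par x)]

namespace WeightedTree

variable {n : ℕ} {T : WeightedTree n}

theorem ndist_triangle {u v w : ℕ} (hu : u < n) (hv : v < n) (hw : w < n) :
    T.ndist u w ≤ T.ndist u v + T.ndist v w :=
  (T.rootedMetric (by omega)).triangle (fun _ _ => ndist_nonneg) hu hv hw

theorem pointDist_le (u v : Fin n) (y : T.Point) :
    T.pointDist v y ≤ T.pointDist u y + T.dist u v := by
  have key : ∀ w : Fin n, T.dist v w ≤ T.dist u w + T.dist u v := fun w => by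
    have := ndist_triangle (T := T) v.2 u.2 w.2
    rw [ndist_fin, ndist_fin, ndist_fin, T.dist_comm v u] at this
    linarith
  cases y with
  | node w => exact key w
  | inner e t h1 h2 =>
    rw [pointDist, pointDist, ← min_add_add_right]
    exact min_le_min (by linarith [key (T.src e)]) (by linarith [key (T.dst e)])

/-- The factor `2` covers interior points: the distance to an end node and the offset are each at
most the total length. -/
theorem pointDist_le_sum (u : Fin n) (y : T.Point) : T.pointDist u y ≤ 2 * ∑ e, T.len e := by
  have h0 : ∀ e, T.len e ≤ ∑ e, T.len e := fun e =>
    Finset.single_le_sum (f := T.len) (fun e _ => T.len_nonneg e) (Finset.mem_univ e)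
  cases y with
  | node w =>
    have := T.dist_le_sum u w
    have h1 := Finset.sum_nonneg fun e (_ : e ∈ Finset.univ) => T.len_nonneg e
    rw [pointDist]
    linarith
  | inner e t h1 h2 =>
    refine (min_le_left _ _).trans ?_
    linarith [T.dist_le_sum u (T.src e), h0 e]

theorem setDist_singleton (u : Fin n) (y : T.Point) : T.setDist u {y} = T.pointDist u y := by
  rw [setDist, Set.image_singleton, csInf_singleton]

variable {p : ℕ} (x : Fin p → T.Point)

/-- The distance of a node from the points of a list. -/
noncomputable def listDist (v : ℕ) : ℝ :=
  if h : v < n then T.setDist ⟨v, h⟩ (Set.range x) else 0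

theorem listDist_le {v : ℕ} (hv : v < n) (j : Fin p) :
    listDist x v ≤ T.pointDist ⟨v, hv⟩ (x j) := by
  rw [listDist, dif_pos hv]
  exact csInf_le (Set.toFinite _).bddBelow ⟨x j, ⟨j, rfl⟩, rfl⟩

theorem exists_listDist (hp : 0 < p) {v : ℕ} (hv : v < n) :
    ∃ j, listDist x v = T.pointDist ⟨v, hv⟩ (x j) := by
  rw [listDist, dif_pos hv]
  have hne : (T.pointDist ⟨v, hv⟩ '' Set.range x).Nonempty := ⟨_, x ⟨0, hp⟩, ⟨_, rfl⟩, rfl⟩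
  obtain ⟨_, ⟨j, rfl⟩, h⟩ := hne.csInf_mem (Set.toFinite _)
  exact ⟨j, h.symm⟩

/-- The initial values, from which the distances from the points of a list arise by adding
distances of nodes. -/
structure IsSeed (x : Fin p → T.Point) (f : ℕ → ℝ) : Prop where
  lower : ∀ (u : ℕ) (hu : u < n), ∃ j, T.pointDist ⟨u, hu⟩ (x j) ≤ f u
  node : ∀ j v, x j = .node v → f v ≤ 0
  inner : ∀ j e t h1 h2, x j = .inner e t h1 h2 → f (T.src e) ≤ t ∧ f (T.dst e) ≤ T.len e - t

/-- A path from a node to an interior point enters its edge through one of the two end nodes, so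
lowering the entries of the end nodes captures all distances. Conversely every initial value is at
least a true distance from some point of the list, so `g` is not too small. -/
theorem IsSeed.listDist_eq {x : Fin p → T.Point} {f g : ℕ → ℝ} (h : IsSeed x f) (hp : 0 < p)
    (h1 : ∀ v < n, ∃ u < n, f u + T.ndist u v ≤ g v)
    (h2 : ∀ v < n, ∀ u < n, g v ≤ f u + T.ndist u v) {v : ℕ} (hv : v < n) :
    g v = listDist x v := by
  refine le_antisymm ?_ ?_
  · obtain ⟨j, hj⟩ := exists_listDist x hp hv
    rw [hj]
    cases hx : x j with
    | node w =>
      have := h2 v hv w w.2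
      have := h.node j w hx
      rw [pointDist, ← ndist_eq, ndist_comm]
      linarith
    | inner e t e1 e2 =>
      obtain ⟨i1, i2⟩ := h.inner j e t e1 e2 hx
      have i3 := h2 v hv _ (T.src e).2
      have i4 := h2 v hv _ (T.dst e).2
      rw [ndist_comm, ndist_eq hv (Fin.is_lt _)] at i3 i4
      refine le_min ?_ ?_
      · linarith
      · linarith
  · obtain ⟨u, hu, h3⟩ := h1 v hv
    obtain ⟨j, hj⟩ := h.lower u hu
    have := listDist_le x hv j
    have := pointDist_le ⟨u, hu⟩ ⟨v, hv⟩ (x j)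
    rw [ndist_eq hu hv] at h3
    linarith

open Classical in
/-- The total weight of the nodes for which a candidate wins. -/
noncomputable def score (T : WeightedTree n) (r : ℕ → ℝ) (a : ℕ) (H E : ℝ) : ℝ :=
  ∑ v ∈ Finset.range n, if Wins T.par T.ndist r a H E v then T.nweight v else 0

theorem nweight_nonneg (v : ℕ) : 0 ≤ T.nweight v := by
  rw [nweight]
  split_ifs
  exacts [T.weight_nonneg _, le_rfl]

open Classical in
theorem gain_eq (y : T.Point) : T.gain {y} (Set.range x) =
    ∑ v : Fin n, if T.pointDist v y < listDist x v then T.nweight v else 0 := by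
  refine Finset.sum_congr rfl fun v _ => ?_
  rw [setDist_singleton, listDist, dif_pos v.2, nweight, dif_pos v.2]

/-- Weights are non-negative, so a larger set of won nodes has at least the same total weight. -/
theorem gain_le_score {y : T.Point} {a : ℕ} {H E : ℝ}
    (h : ∀ v : Fin n, T.pointDist v y < listDist x v →
      Wins T.par T.ndist (listDist x) a H E v) :
    T.gain {y} (Set.range x) ≤ T.score (listDist x) a H E := by
  classical
  rw [gain_eq, score, Finset.sum_range]
  refine Finset.sum_le_sum fun v _ => ?_
  split_ifs with h1 h2 h2
  exacts [le_rfl, absurd (h v h1) h2, nweight_nonneg _, le_rfl]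

theorem score_le_gain {y : T.Point} {a : ℕ} {H E : ℝ}
    (h : ∀ v : Fin n, Wins T.par T.ndist (listDist x) a H E v →
      T.pointDist v y < listDist x v) :
    T.score (listDist x) a H E ≤ T.gain {y} (Set.range x) := by
  classical
  rw [gain_eq, score, Finset.sum_range]
  refine Finset.sum_le_sum fun v _ => ?_
  split_ifs with h1 h2 h2
  exacts [le_rfl, absurd (h v h1) h2, nweight_nonneg _, le_rfl]

theorem isMedianoid_one {C : Set T.Point} {X : Set T.Point} {y : T.Point} (hy : y ∈ C)
    (h : ∀ y' ∈ C, T.gain {y'} X ≤ T.gain {y} X) : T.IsMedianoid C 1 X {y} := by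
  refine ⟨⟨Set.singleton_subset_iff.2 hy, by simp⟩, fun Y' hY' h1 => ?_⟩
  rw [Nat.cast_one, Set.encard_eq_one] at h1
  obtain ⟨y', rfl⟩ := h1
  exact h y' (Set.singleton_subset_iff.1 hY')

/-- A best candidate yields a solution of the absolute problem. -/
theorem isAbsoluteMedianoid_of_best {A : ℕ → ℕ} {H E : ℕ → ℝ} (hn : 0 < n)
    (hA : ∀ u < n, IsCandidate T.par T.ndist (listDist x) u (A u) (H u) (E u)) {b : ℕ}
    (hb : ∀ u < n, T.score (listDist x) (A u) (H u) (E u) ≤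
      T.score (listDist x) (A b) (H b) (E b)) {y : T.Point}
    (hy : ∀ v : Fin n, Wins T.par T.ndist (listDist x) (A b) (H b) (E b) v →
      T.pointDist v y < listDist x v) :
    T.gain {y} (Set.range x) = T.score (listDist x) (A b) (H b) (E b) ∧
      T.IsAbsoluteMedianoid 1 (Set.range x) {y} := by
  have key : ∀ y' : T.Point, T.gain {y'} (Set.range x) ≤
      T.score (listDist x) (A b) (H b) (E b) := by
    intro y'
    obtain ⟨c, hc, s, hs, hs', h⟩ := exists_locDist y'
    obtain ⟨u, hu, hw⟩ := (T.rootedMetric hn).exists_candidate (fun _ _ => ndist_nonneg) hA hc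
      hs hs'
    exact (gain_le_score x fun v hv => hw v v.2 (h v ▸ hv)).trans (hb u hu)
  have hge := score_le_gain x hy
  exact ⟨le_antisymm (key y) hge, isMedianoid_one (Set.mem_univ _)
    fun y' _ => (key y').trans hge⟩

/-- Without height and infinitesimal part a candidate is just the node, so the discrete problem is
covered by the same evaluation. -/
theorem score_node (v : Fin n) :
    T.score (listDist x) v 0 0 = T.gain {.node v} (Set.range x) := by
  have h : ∀ u : Fin n, Wins T.par T.ndist (listDist x) v 0 0 u ↔
      T.pointDist u (.node v) < listDist x u := fun u => by
    rw [wins_zero, pointDist, ndist_fin, T.dist_comm]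
  exact le_antisymm (score_le_gain x fun u => (h u).1) (gain_le_score x fun u => (h u).2)

/-- A best node is a solution of the discrete problem. -/
theorem isDiscreteMedianoid_of_best {b : Fin n}
    (hb : ∀ u < n, T.score (listDist x) u 0 0 ≤ T.score (listDist x) b 0 0) :
    T.IsDiscreteMedianoid 1 (Set.range x) {.node b} := by
  refine isMedianoid_one ⟨b, rfl⟩ ?_
  rintro _ ⟨v, rfl⟩
  rw [← score_node, ← score_node]
  exact hb v v.2

end WeightedTree

end TreeLocation

/-! ### A binary tree that contains copies of the candidates -/

namespace TreeLocation

/-- The array with the initial contents `init` after the assignments `g i` to the cells `f i`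
for `i < k`. -/
def assigned (f g init : ℕ → ℕ) : ℕ → ℕ → ℕ
  | 0 => init
  | k + 1 => Function.update (assigned f g init k) (f k) (g k)

section assigned

variable {f g init : ℕ → ℕ} {k v : ℕ}

theorem assigned_of_ne (h : ∀ i < k, f i ≠ v) : assigned f g init k v = init v := by
  induction k with
  | zero => rfl
  | succ k ih =>
    rw [assigned, Function.update_of_ne (h k (Nat.lt_succ_self k)).symm]
    exact ih fun i hi => h i (by omega)

theorem assigned_of_eq {i : ℕ} (hi : i < k) (hf : f i = v) (h : ∀ j, i < j → j < k → f j ≠ v) :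
    assigned f g init k v = g i := by
  induction k with
  | zero => omega
  | succ k ih =>
    rw [assigned]
    by_cases e : i = k
    · rw [← hf, e, Function.update_self]
    · rw [Function.update_of_ne (h k (by omega) (Nat.lt_succ_self k)).symm]
      exact ih (by omega) fun j h1 h2 => h j h1 (by omega)

/-- A cell holds its initial contents or the last value assigned to it. -/
theorem assigned_cases : (∀ i < k, f i ≠ v) ∧ assigned f g init k v = init v ∨
    ∃ i < k, f i = v ∧ (∀ j, i < j → j < k → f j ≠ v) ∧ assigned f g init k v = g i := by
  by_cases h : ∃ i, i < k ∧ f i = v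
  · right
    obtain ⟨i0, hi0, hf0⟩ := h
    have hne : ((Finset.range k).filter fun i => f i = v).Nonempty :=
      ⟨i0, by simp [hi0, hf0]⟩
    obtain ⟨i, hi, hmax⟩ := Finset.exists_max_image _ id hne
    simp only [Finset.mem_filter, Finset.mem_range, id] at hi hmax
    have hlast : ∀ j, i < j → j < k → f j ≠ v := fun j h1 h2 e =>
      absurd (hmax j ⟨h2, e⟩) (by omega)
    exact ⟨i, hi.1, hi.2, hlast, assigned_of_eq hi.1 hi.2 hlast⟩
  · push Not at h
    exact Or.inl ⟨h, assigned_of_ne h⟩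

end assigned

/-- The parent function `P` of a binary tree on `3 * n` nodes that represents the tree on `n`
nodes with the parent function `par`: the node `n + v` separates `v` from its parent, and the
node `2 * n + u` is a copy of `A u`. The copies of `v` form a chain from `v` to `n + v`, and the
separators of the children of a node form a chain from that node. -/
structure Binary (n : ℕ) (par A P : ℕ → ℕ) : Prop where
  node : ∀ v < n, P v = assigned A (2 * n + ·) (n + ·) n v
  copy : ∀ u < n, P (2 * n + u) = assigned A (2 * n + ·) (n + ·) u (A u)
  separator : ∀ c, c + 1 < n → P (n + (c + 1)) =
    assigned (fun c => par (c + 1)) (fun c => n + (c + 1)) id c (par (c + 1))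
  root : P n = n

/-- The node of the original tree represented by a node of the binary tree. -/
def location (n : ℕ) (par A : ℕ → ℕ) (x : ℕ) : ℕ :=
  if x < n then x else if x < 2 * n then par (x - n) else A (x - 2 * n)

section location

variable {n : ℕ} {par A : ℕ → ℕ} {v : ℕ}

theorem location_node (hv : v < n) : location n par A v = v := if_pos hv

theorem location_separator (hv : v < n) : location n par A (n + v) = par v := by
  rw [location, if_neg (by omega), if_pos (by omega), Nat.add_sub_cancel_left]

theorem location_copy : location n par A (2 * n + v) = A v := by
  rw [location, if_neg (by omega), if_neg (by omega), Nat.add_sub_cancel_left]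

end location

namespace Binary

variable {n : ℕ} {par A P : ℕ → ℕ} {len : ℕ → ℝ} {d : ℕ → ℕ → ℝ} {a c u v w x y z k : ℕ}

theorem cases_lt (hx : x < 3 * n) : x < n ∨ (∃ v < n, x = n + v) ∨ ∃ u < n, x = 2 * n + u := by
  rcases lt_or_ge x n with h | h
  · exact Or.inl h
  · rcases lt_or_ge x (2 * n) with h' | h'
    · exact Or.inr (Or.inl ⟨x - n, by omega, by omega⟩)
    · exact Or.inr (Or.inr ⟨x - 2 * n, by omega, by omega⟩)

/-- The members of the chain of copies of `v`, with the time at which they are added to it. -/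
def Member (n : ℕ) (A : ℕ → ℕ) (v k x : ℕ) : Prop :=
  x = v ∧ v < n ∧ k = n ∨ x = 2 * n + k ∧ k < n ∧ A k = v

theorem Member.location_eq (h : Member n A v k x) : location n par A x = v := by
  rcases h with ⟨rfl, hv, -⟩ | ⟨rfl, -, rfl⟩
  · exact location_node hv
  · exact location_copy

theorem Member.le (h : Member n A v k x) : k ≤ n := by
  rcases h with ⟨-, -, h⟩ | ⟨-, h, -⟩ <;> omega

/-- A node is a member of a chain, the root, or a separator. -/
theorem kinds (hA : ∀ u < n, A u < n) (hx : x < 3 * n) :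
    (∃ v < n, ∃ k, Member n A v k x) ∨ x = n ∨ ∃ c, c + 1 < n ∧ x = n + (c + 1) := by
  rcases cases_lt hx with h | ⟨v, hv, rfl⟩ | ⟨u, hu, rfl⟩
  · exact Or.inl ⟨x, h, n, Or.inl ⟨rfl, h, rfl⟩⟩
  · by_cases h : v = 0
    · exact Or.inr (Or.inl (by omega))
    · exact Or.inr (Or.inr ⟨v - 1, by omega, by omega⟩)
  · exact Or.inl ⟨A u, hA u hu, u, Or.inr ⟨rfl, hu, rfl⟩⟩

theorem location_lt (h : RootedMetric n 0 par len d) (hA : ∀ u < n, A u < n) (hx : x < 3 * n) : location n par A x < n := by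
  rcases cases_lt hx with e | ⟨v, hv, rfl⟩ | ⟨u, hu, rfl⟩
  · rwa [location_node e]
  · rw [location_separator hv]
    exact h.par_lt v hv
  · rw [location_copy]
    exact hA u hu

variable (hB : Binary n par A P)

include hB

theorem parent (h : Member n A v k x) : P x = assigned A (2 * n + ·) (n + ·) k v := by
  rcases h with ⟨rfl, hv, rfl⟩ | ⟨rfl, hk, rfl⟩
  · exact hB.node x hv
  · exact hB.copy k hk

/-- The parent of a member of a chain is the separator or an earlier copy. -/
theorem parent_cases (h : Member n A v k x) :
    (∀ i < k, A i ≠ v) ∧ P x = n + v ∨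
      ∃ i < k, A i = v ∧ (∀ j, i < j → j < k → A j ≠ v) ∧ P x = 2 * n + i ∧
        Member n A v i (2 * n + i) := by
  rw [hB.parent h]
  rcases assigned_cases (f := A) (g := (2 * n + ·)) (init := (n + ·)) (k := k) (v := v) with
    e | ⟨i, hi, hf, hl, e⟩
  · exact Or.inl e
  · exact Or.inr ⟨i, hi, hf, hl, e, Or.inr ⟨rfl, hi.trans_le h.le, hf⟩⟩

/-- Members with a common parent belong to the same chain. If `x` was added at time `k` and `x'`
later, then `x` is a copy, so the parent of `x'` is this copy or one added still later. But the
parent of `x` was in place before time `k`. -/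
theorem parent_inj {v' k' x' : ℕ} (hA : ∀ u < n, A u < n) (h : Member n A v k x)
    (h' : Member n A v' k' x') (e : P x = P x') : x = x' := by
  have hlt : ∀ {v k x}, Member n A v k x → v < n := fun {v k x} h => by
    rcases h with ⟨-, h, -⟩ | ⟨-, h, rfl⟩
    exacts [h, hA _ h]
  have hkey : ∀ {v k x v' k' x'}, Member n A v k x → Member n A v' k' x' → k < k' → v = v' →
      (∀ j, j < k' → A j = v' → P x' = 2 * n + j → j < k) → P x' = P x →
      (∀ j < k', A j ≠ v') ∨ (∃ i < k', A i = v' ∧ (∀ j, i < j → j < k' → A j ≠ v') ∧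
        P x' = 2 * n + i) → False := by
    intro v k x v' k' x' h h' hk hv hc he hor
    have hAk : A k = v' := by
      rcases h with ⟨-, -, rfl⟩ | ⟨-, -, h⟩
      · have := h'.le
        omega
      · exact h.trans hv
    rcases hor with h1 | ⟨i, hi, h1, h2, h3⟩
    · exact h1 k hk hAk
    · exact h2 k (hc i hi h1 h3) hk hAk
  have hvv : v = v' := by
    have l := hlt h
    have l' := hlt h'
    rcases hB.parent_cases h with ⟨-, h1⟩ | ⟨i, hi, h1, -, h2, -⟩ <;>
      rcases hB.parent_cases h' with ⟨-, h1'⟩ | ⟨i', hi', h1', -, h2', -⟩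
    · omega
    · omega
    · omega
    · have : i = i' := by omega
      rw [← h1, ← h1', this]
  have hbound : ∀ {v k x}, Member n A v k x → ∀ j, P x = 2 * n + j → j < k := by
    intro v k x h j hj
    rcases hB.parent_cases h with ⟨-, h1⟩ | ⟨i, hi, -, -, h1, -⟩
    · have := hlt h
      omega
    · omega
  have hweak : ∀ {v k x}, Member n A v k x → (∀ j < k, A j ≠ v) ∨ (∃ i < k, A i = v ∧
      (∀ j, i < j → j < k → A j ≠ v) ∧ P x = 2 * n + i) := by
    intro v k x h
    rcases hB.parent_cases h with ⟨h1, -⟩ | ⟨i, h1, h2, h3, h4, -⟩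
    · exact Or.inl h1
    · exact Or.inr ⟨i, h1, h2, h3, h4⟩
  rcases lt_trichotomy k k' with hk | hk | hk
  · exact (hkey h h' hk hvv (fun j _ _ hj => hbound h j (e.trans hj)) e.symm (hweak h')).elim
  · subst hk
    subst hvv
    rcases h with ⟨rfl, -, h1⟩ | ⟨rfl, h1, -⟩ <;> rcases h' with ⟨rfl, -, h2⟩ | ⟨rfl, h2, -⟩ <;>
      omega
  · exact (hkey h' h hk hvv.symm (fun j _ _ hj => hbound h' j (e.symm.trans hj)) e
      (hweak h)).elim

theorem separator_cases (hc : c + 1 < n) :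
    P (n + (c + 1)) = par (c + 1) ∨ ∃ i < c, par (i + 1) = par (c + 1) ∧
      (∀ j, i < j → j < c → par (j + 1) ≠ par (c + 1)) ∧ P (n + (c + 1)) = n + (i + 1) := by
  rw [hB.separator c hc]
  rcases assigned_cases (f := fun c => par (c + 1)) (g := fun c => n + (c + 1)) (init := id)
    (k := c) (v := par (c + 1)) with ⟨-, e⟩ | ⟨i, hi, hf, hl, e⟩
  · exact Or.inl e
  · exact Or.inr ⟨i, hi, hf, hl, e⟩

/-- The argument of `parent_inj` for the chains of separators, which start at the common parent in
the original tree. -/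
theorem separator_inj {c' : ℕ} (hpar : ∀ v < n, par v < n) (hc : c + 1 < n) (hc' : c' + 1 < n)
    (e : P (n + (c + 1)) = P (n + (c' + 1))) : c = c' := by
  have key : ∀ {c c'}, c + 1 < n → c' + 1 < n → c < c' → P (n + (c + 1)) ≠ P (n + (c' + 1)) := by
    intro c c' hc hc' hlt e
    have l := hpar _ hc
    have l' := hpar _ hc'
    rw [hB.separator c hc, hB.separator c' hc'] at e
    rcases assigned_cases (f := fun c => par (c + 1)) (g := fun c => n + (c + 1)) (init := id)
      (k := c) (v := par (c + 1)) with ⟨-, h1⟩ | ⟨i, hi, hf, -, h1⟩ <;>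
      rcases assigned_cases (f := fun c => par (c + 1)) (g := fun c => n + (c + 1)) (init := id)
        (k := c') (v := par (c' + 1)) with ⟨h2, h3⟩ | ⟨i', hi', hf', h2, h3⟩ <;>
      rw [h1, h3] at e <;> try simp only [id] at e
    · exact h2 c hlt e
    · omega
    · omega
    · have hii : i = i' := by omega
      subst hii
      exact h2 c hi hlt (hf.symm.trans hf')
  rcases lt_trichotomy c c' with h | h | h
  · exact absurd e (key hc hc' h)
  · exact h
  · exact absurd e.symm (key hc' hc h)

/-- Among the children of a node there are at most one member of a chain and at most one separator.
-/
theorem card_children_le (hA : ∀ u < n, A u < n) (hpar : ∀ v < n, par v < n) (y : ℕ) :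
    ((Finset.range (3 * n)).filter fun x => x ≠ n ∧ P x = y).card ≤ 2 := by
  classical
  set F := (Finset.range (3 * n)).filter fun x => x ≠ n ∧ P x = y with hF
  have h1 : (F.filter fun x => ∃ v < n, ∃ k, Member n A v k x).card ≤ 1 := by
    rw [Finset.card_le_one]
    intro x hx x' hx'
    simp only [hF, Finset.mem_filter] at hx hx'
    obtain ⟨⟨-, -, e⟩, v, -, k, h⟩ := hx
    obtain ⟨⟨-, -, e'⟩, v', -, k', h'⟩ := hx'
    exact hB.parent_inj hA h h' (e.trans e'.symm)
  have h2 : (F.filter fun x => ¬ ∃ v < n, ∃ k, Member n A v k x).card ≤ 1 := by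
    rw [Finset.card_le_one]
    intro x hx x' hx'
    simp only [hF, Finset.mem_filter, Finset.mem_range] at hx hx'
    obtain ⟨⟨l, hn, e⟩, h⟩ := hx
    obtain ⟨⟨l', hn', e'⟩, h'⟩ := hx'
    obtain ⟨c, hc, rfl⟩ := ((kinds hA l).resolve_left h).resolve_left hn
    obtain ⟨c', hc', rfl⟩ := ((kinds hA l').resolve_left h').resolve_left hn'
    rw [hB.separator_inj hpar hc hc' (e.trans e'.symm)]
  have := Finset.card_filter_add_card_filter_not (s := F)
    (fun x => ∃ v < n, ∃ k, Member n A v k x)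
  omega

variable (h : RootedMetric n 0 par len d) (hA : ∀ u < n, A u < n)

include h hA

theorem parent_lt (hx : x < 3 * n) : P x < 3 * n := by
  rcases kinds hA hx with ⟨v, hv, k, hm⟩ | rfl | ⟨c, hc, rfl⟩
  · have := hm.le
    rcases hB.parent_cases hm with ⟨-, e⟩ | ⟨i, hi, -, -, e, -⟩ <;> omega
  · rw [hB.root]
    exact hx
  · have := h.par_lt _ hc
    rcases hB.separator_cases hc with e | ⟨i, hi, -, -, e⟩ <;> omega

/-- The level of the original tree, refined inside each level by the position in the chains. -/
theorem exists_rank : ∃ lev : ℕ → ℕ, ∀ x < 3 * n, x ≠ n → lev (P x) < lev x := by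
  obtain ⟨lev, hlev⟩ := h.rank
  have hmul : ∀ a b : ℕ, a < b → a * (2 * n + 1) + (2 * n + 1) ≤ b * (2 * n + 1) := by
    intro a b hab
    have := Nat.mul_le_mul_right (2 * n + 1) (Nat.succ_le_of_lt hab)
    rwa [Nat.succ_mul] at this
  -- One level of the original tree is stretched to `2 * n + 1` values. The separator of a child `c
  -- + 1` of `v` gets offset `c + 1` in the level after that of `v`, members of chains get offset
  -- `n` plus the time at which they are added, and the root `n` gets rank `0`.
  set L : ℕ → ℕ := fun x => if x < n then lev x * (2 * n + 1) + 2 * n else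
    if x < 2 * n then (if x = n then 0 else (lev (par (x - n)) + 1) * (2 * n + 1) + (x - n)) else
      lev (A (x - 2 * n)) * (2 * n + 1) + n + (x - 2 * n) with hL
  have hs0 : ∀ c, c + 1 < n →
      L (n + (c + 1)) = (lev (par (c + 1)) + 1) * (2 * n + 1) + (c + 1) := fun v hv => by
    simp only [hL]
    rw [if_neg (by omega), if_pos (by omega), if_neg (by omega), Nat.add_sub_cancel_left]
  have hs : ∀ v < n, L (n + v) ≤ lev v * (2 * n + 1) + v := fun v hv => by
    by_cases h0 : v = 0
    · have : L n = 0 := by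
        simp only [hL]
        rw [if_neg (by omega), if_pos (by omega), if_pos trivial]
      rw [h0, add_zero, this]
      exact Nat.zero_le _
    · obtain ⟨c, rfl⟩ := Nat.exists_eq_succ_of_ne_zero h0
      rw [hs0 c hv]
      exact Nat.add_le_add_right (Nat.mul_le_mul_right _ (hlev _ hv h0)) _
  have hc : ∀ u, L (2 * n + u) = lev (A u) * (2 * n + 1) + n + u := fun u => by
    simp only [hL]
    rw [if_neg (by omega), if_neg (by omega), Nat.add_sub_cancel_left]
  have hv : ∀ v < n, L v = lev v * (2 * n + 1) + 2 * n := fun v hv => by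
    simp only [hL]
    rw [if_pos hv]
  refine ⟨L, fun x hx hn => ?_⟩
  rcases kinds hA hx with ⟨v, hvn, k, hm⟩ | e | ⟨c, hcn, rfl⟩
  · have hLx : L x = lev v * (2 * n + 1) + n + k := by
      rcases hm with ⟨rfl, -, rfl⟩ | ⟨rfl, -, rfl⟩
      · rw [hv _ hvn]
        ring
      · rw [hc]
    rcases hB.parent_cases hm with ⟨-, e⟩ | ⟨i, hi, e1, -, e, -⟩
    · have := hs v hvn
      rw [e, hLx]
      omega
    · rw [e, hc, e1, hLx]
      omega
  · exact absurd e hn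
  · rw [hs0 _ hcn]
    rcases hB.separator_cases hcn with e | ⟨i, hi, e1, -, e⟩
    · have := add_mul (lev (par (c + 1))) 1 (2 * n + 1)
      rw [e, hv _ (h.par_lt _ hcn)]
      omega
    · rw [e, hs0 _ (by omega), e1]
      omega

omit h hA in
/-- A copy that is added to a chain later lies below the earlier ones. -/
theorem mem_sub_copy (hm : Member n A v k x) {i : ℕ} (hi : i < k) (hv : A i = v) :
    x ∈ Sub P (2 * n + i) := by
  induction k using Nat.strong_induction_on generalizing x with
  | _ k ih =>
    rcases hB.parent_cases hm with ⟨e, -⟩ | ⟨j, hj, e1, e2, e3, e4⟩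
    · exact absurd hv (e i hi)
    · refine mem_sub_of_par (e3 ▸ ?_)
      rcases lt_trichotomy i j with hij | rfl | hij
      · exact ih j hj e4 hij
      · exact mem_sub_self _
      · exact absurd hv (e2 i hij hi)

omit h hA in
/-- Every chain has a top, which hangs below the separator. -/
theorem exists_top (hm : Member n A v k x) :
    ∃ y k', Member n A v k' y ∧ P y = n + v ∧ x ∈ Sub P y := by
  induction k using Nat.strong_induction_on generalizing x with
  | _ k ih =>
    rcases hB.parent_cases hm with ⟨-, e⟩ | ⟨j, hj, e1, e2, e3, e4⟩
    · exact ⟨x, k, hm, e, mem_sub_self _⟩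
    · obtain ⟨y, k', h1, h2, h3⟩ := ih j hj e4
      exact ⟨y, k', h1, h2, mem_sub_of_par (e3 ▸ h3)⟩

-- The chain of separators of the children of a node starts at that node.
omit h hA in
theorem separator_mem_sub (hc : c + 1 < n) : n + (c + 1) ∈ Sub P (par (c + 1)) := by
  induction c using Nat.strong_induction_on with
  | _ c ih =>
    rcases hB.separator_cases hc with e | ⟨i, hi, e1, -, e⟩
    · exact mem_sub_of_par (e ▸ mem_sub_self _)
    · exact mem_sub_of_par (e ▸ e1 ▸ ih i hi (by omega))

/-- What is located at a node lies below the top of its chain, unless it is the root. -/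
theorem mem_sub_top (hx : x < 3 * n) (hn : x ≠ n) (hv : location n par A x = v) (hy : P y = n + v)
    (hm : Member n A v k y) : x ∈ Sub P y := by
  have hmem : ∀ z i, Member n A v i z → z ∈ Sub P y := by
    intro z i hz
    obtain ⟨y', k', h1, h2, h3⟩ := hB.exists_top hz
    rwa [hB.parent_inj hA hm h1 (hy.trans h2.symm)]
  rcases kinds hA hx with ⟨v', hv', i, hz⟩ | e | ⟨c, hc, rfl⟩
  · rw [hz.location_eq] at hv
    exact hmem x i (hv ▸ hz)
  · exact absurd e hn
  · rw [location_separator hc] at hv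
    have hvn : v < n := hv ▸ h.par_lt _ hc
    exact mem_sub_trans (hv ▸ hB.separator_mem_sub hc) (hmem v n (Or.inl ⟨rfl, hvn, rfl⟩))

omit hA in
/-- A node lies below the nodes of the original tree above it. -/
theorem node_mem_sub (hu : u < n) (huv : u ∈ Sub par v) : u ∈ Sub P v := by
  refine sub_induction (p := fun x => x < n → x ∈ Sub P v) huv (fun _ => mem_sub_self _)
    (fun x hx hne ih hxn => ?_) hu
  have hx0 : x ≠ 0 := fun e => hne (by subst e; exact (h.root_mem_sub hx).symm)
  obtain ⟨c, rfl⟩ := Nat.exists_eq_succ_of_ne_zero hx0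
  obtain ⟨y, k', h1, h2, h3⟩ := hB.exists_top (Or.inl ⟨rfl, hxn, rfl⟩ : Member n A (c + 1) n (c + 1))
  refine mem_sub_trans h3 (mem_sub_of_par ?_)
  rw [h2]
  exact mem_sub_trans (hB.separator_mem_sub hxn) (ih (h.par_lt _ hxn))

/-- Locations of descendants are descendants of the location. -/
theorem location_mem_sub (hx : x < 3 * n) (hxy : x ∈ Sub P y) :
    location n par A x ∈ Sub par (location n par A y) := by
  refine sub_induction (p := fun x => x < 3 * n →
    location n par A x ∈ Sub par (location n par A y)) hxy (fun _ => mem_sub_self _)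
    (fun z _ _ ih hz => ?_) hx
  have ih := ih (hB.parent_lt h hA hz)
  rcases kinds hA hz with ⟨v, hv, k, hm⟩ | rfl | ⟨c, hc, rfl⟩
  · rw [hm.location_eq]
    rcases hB.parent_cases hm with ⟨-, e⟩ | ⟨i, hi, e1, -, e, hm'⟩
    · rw [e, location_separator hv] at ih
      exact mem_sub_of_par ih
    · rwa [e, hm'.location_eq] at ih
  · rwa [hB.root] at ih
  · rw [location_separator hc]
    rcases hB.separator_cases hc with e | ⟨i, hi, e1, -, e⟩
    · rwa [e, location_node (h.par_lt _ hc)] at ih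
    · rwa [e, location_separator (by omega), e1] at ih

/-- This makes the side terms of the binary tree agree with those of the original tree. A node is
added to its chain after all of its copies and so lies below them; conversely, descending in the
binary tree never leaves the subtree of the location. -/
theorem node_mem_sub_copy (hu : u < n) (hv : v < n) :
    v ∈ Sub P (2 * n + u) ↔ v ∈ Sub par (A u) := by
  constructor
  · intro e
    have := hB.location_mem_sub h hA (by omega) e
    rwa [location_node hv, location_copy] at this
  · intro e
    exact mem_sub_trans (hB.node_mem_sub h hv e)
      (hB.mem_sub_copy (Or.inl ⟨rfl, hA u hu, rfl⟩) hu rfl)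

/-- The lengths of the edges of the binary tree. -/
theorem rootedMetric {plen : ℕ → ℝ} (hlen : ∀ x < 3 * n, x ≠ n →
    plen x = d (location n par A x) (location n par A (P x))) :
    RootedMetric (3 * n) n P plen fun x y => d (location n par A x) (location n par A y) where
  root_lt := by have := h.root_lt; omega
  par_lt x hx := hB.parent_lt h hA hx
  par_root := hB.root
  rank := hB.exists_rank h hA
  self x hx := h.self _ (location_lt h hA hx)
  symm x hx y hy := h.symm _ (location_lt h hA hx) _ (location_lt h hA hy)
  up x hx y hy hxy := by
    have hroot : ∀ z < 3 * n, z ∈ Sub P n := by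
      obtain ⟨lev, hlev⟩ := hB.exists_rank h hA
      intro z hz
      induction hk : lev z using Nat.strong_induction_on generalizing z with
      | _ k ih =>
        by_cases e : z = n
        · exact e ▸ mem_sub_self _
        · exact mem_sub_of_par (ih _ (hk ▸ hlev z hz e) _ (hB.parent_lt h hA hz) rfl)
    have hxn : x ≠ n := fun e => hxy (e ▸ hroot y hy)
    rw [hlen x hx hxn]
    have hly := location_lt h hA hy
    -- Edges inside chains do not change the location, and have length zero.
    have hsame : location n par A (P x) = location n par A x →
        d (location n par A x) (location n par A y) = d (location n par A x)
          (location n par A (P x)) + d (location n par A (P x)) (location n par A y) := by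
      intro e
      rw [e, h.self _ (location_lt h hA hx), zero_add]
    rcases kinds hA hx with ⟨v, hv, k, hm⟩ | e | ⟨c, hc, rfl⟩
    · rcases hB.parent_cases hm with ⟨-, e⟩ | ⟨i, hi, e1, -, e, hm'⟩
      · by_cases h0 : v = 0
        · refine hsame ?_
          rw [e, location_separator hv, hm.location_eq, h0, h.par_root]
        · rw [e, location_separator hv, hm.location_eq]
          -- The edge from the top of the chain of `v` to the separator `n + v` stands for the edge
          -- above `v`. If the location of `y` were below `v`, then `y` would lie below this top,
          -- which is `x`.
          refine h.sep (i := v) (c := v) h0 hv hly (mem_sub_self _) fun hs => hxy ?_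
          by_cases hyn : y = n
          · have h1 := location_separator (par := par) (A := A) h.root_lt
            rw [add_zero, h.par_root] at h1
            rw [hyn, h1] at hs
            exact absurd (h.root_mem_sub hs) h0
          · obtain ⟨y', k', h1, h2, h3⟩ := hB.exists_top
              (Or.inl ⟨rfl, hly, rfl⟩ : Member n A _ n (location n par A y))
            have hy' := hB.mem_sub_top h hA hy hyn rfl h2 h1
            by_cases hb : location n par A y = v
            · exact hB.mem_sub_top h hA hy hyn hb e hm
            · have hb0 : location n par A y ≠ 0 := fun e0 => by
                rw [e0] at hs
                exact h0 (h.root_mem_sub hs)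
              obtain ⟨c, hc⟩ := Nat.exists_eq_succ_of_ne_zero hb0
              have hsep := hB.separator_mem_sub (c := c) (by omega)
              have hp := par_mem_sub hs hb
              rw [hc] at h2 hly hp
              refine mem_sub_trans hy' (mem_sub_of_par ?_)
              rw [h2]
              exact mem_sub_trans hsep (mem_sub_trans
                (hB.node_mem_sub h (h.par_lt _ hly) hp)
                (hB.mem_sub_top h hA (by omega) (by omega) (location_node hv) e hm))
      · exact hsame (by rw [e, hm'.location_eq, hm.location_eq])
    · exact absurd e hxn
    · refine hsame ?_
      rcases hB.separator_cases hc with e | ⟨i, hi, e1, -, e⟩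
      · rw [e, location_node (h.par_lt _ hc), location_separator hc]
      · rw [e, location_separator (by omega), e1, location_separator hc]

end Binary

end TreeLocation

/-! ### Loop rules with frames -/

namespace RealRAM

theorem Frame.refl (c : Cmd) (σ : Store) : Frame c σ σ :=
  ⟨fun _ _ => rfl, fun _ _ => rfl, fun _ _ => rfl, fun _ _ => rfl⟩

theorem Frame.trans {c : Cmd} {σ τ υ : Store} (h : Frame c σ τ) (h' : Frame c τ υ) : Frame c σ υ :=
  ⟨fun x e => (h'.idx x e).trans (h.idx x e), fun x e => (h'.real x e).trans (h.real x e),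
    fun x e => (h'.idxArr x e).trans (h.idxArr x e),
    fun x e => (h'.realArr x e).trans (h.realArr x e)⟩

theorem Frame.weaken {c d : Cmd} {σ τ : Store} (h : Frame c σ τ)
    (hd : ∀ k x, d.touches k x = false → c.touches k x = false) : Frame d σ τ :=
  ⟨fun x e => h.idx x (hd 0 x e), fun x e => h.real x (hd 1 x e),
    fun x e => h.idxArr x (hd 2 x e), fun x e => h.realArr x (hd 3 x e)⟩

theorem Frame.setI {c : Cmd} {σ τ : Store} (h : Frame c σ τ) {x v : ℕ}
    (hx : c.touches 0 x = true) : Frame c σ (τ.setI x v) := by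
  refine ⟨fun y e => ?_, fun y e => h.real y e, fun y e => h.idxArr y e, fun y e => h.realArr y e⟩
  rw [Store.setI_idx, if_neg, h.idx y e]
  rintro rfl
  rw [hx] at e
  cases e

/-- The rule for upward loops, with the frame as part of the invariant. -/
theorem Runs.forUp_frame {x : ℕ} {m : IExp} {c : Cmd} (M T : ℕ) (I : ℕ → Store → Prop) (σ : Store)
    (hx : c.touches 0 x = false) (hm : ∀ τ, Frame (.forUp x m c) σ τ → m.eval τ = M)
    (hI : ∀ k τ j, I k τ → I k (τ.setI x j))
    (step : ∀ k τ, k < M → τ.idx x = k → Frame (.forUp x m c) σ τ → I k τ →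
      Runs c τ T (I (k + 1))) (h : I 0 σ) :
    Runs (.forUp x m c) σ ((T + m.cost + 10) * (M + 1))
      fun τ => I M τ ∧ Frame (.forUp x m c) σ τ := by
  have ht : (Cmd.forUp x m c).touches 0 x = true := by simp [Cmd.forUp, Cmd.touches]
  have hw : ∀ k y, (Cmd.forUp x m c).touches k y = false → c.touches k y = false := by
    intro k y e
    simp only [Cmd.forUp, Cmd.touches, Bool.or_eq_false_iff] at e
    exact e.2.1
  refine Runs.forUp M T (fun k τ => I k τ ∧ Frame (.forUp x m c) σ τ)
    (fun k τ _ h => hm τ h.2) (fun k τ hk hτ hh => ?_) σ ⟨hI _ _ _ h, (Frame.refl _ _).setI ht⟩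
  refine (step k τ hk hτ hh.2 hh.1).frame.mono le_rfl fun υ hυ => ⟨?_, hI _ _ _ hυ.1, ?_⟩
  · rw [hυ.2.idx x hx, hτ]
  · exact (hh.2.trans (hυ.2.weaken hw)).setI ht

/-- The rule for downward loops, with the frame as part of the invariant. -/
theorem Runs.forDown_frame {x : ℕ} {m : IExp} {c : Cmd} (M T : ℕ) (I : ℕ → Store → Prop)
    (σ : Store) (hx : c.touches 0 x = false) (hm : m.eval σ = M)
    (hI : ∀ k τ j, I k τ → I k (τ.setI x j))
    (step : ∀ k τ, k < M → τ.idx x = k → Frame (.forDown x m c) σ τ → I (k + 1) τ →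
      Runs c τ T (I k)) (h : I M σ) :
    Runs (.forDown x m c) σ ((T + m.cost + 10) * (M + 1))
      fun τ => I 0 τ ∧ Frame (.forDown x m c) σ τ := by
  have ht : (Cmd.forDown x m c).touches 0 x = true := by simp [Cmd.forDown, Cmd.touches]
  have hw : ∀ k y, (Cmd.forDown x m c).touches k y = false → c.touches k y = false := by
    intro k y e
    simp only [Cmd.forDown, Cmd.touches, Bool.or_eq_false_iff] at e
    exact e.2.2
  refine Runs.forDown M T (fun k τ => I k τ ∧ Frame (.forDown x m c) σ τ) σ hm
    (fun k τ hk hτ hh => ?_) ⟨hI _ _ _ h, (Frame.refl _ _).setI ht⟩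
  -- The body sees the counter at `k`, while the rule provides the invariant for the counter at `k +
  -- 1`; as the invariant ignores the counter, it can be transferred.
  have hback : (τ.setI x (k + 1)).setI x k = τ := by
    rw [← hτ]
    simp [Store.setI]
  have h1 := hI _ _ k hh.1
  have h2 := hh.2.setI (v := k) ht
  rw [hback] at h1 h2
  refine (step k τ hk hτ h2 h1).frame.mono le_rfl fun υ hυ => ⟨?_, hυ.1, ?_⟩
  · rw [hυ.2.idx x hx, hτ]
  · exact h2.trans (hυ.2.weaken hw)

/-- An upward loop with a loop-free body. -/
theorem Runs.forUp_wp {x : ℕ} {m : IExp} {c : Cmd} (M : ℕ) (I : ℕ → Store → Prop) {σ : Store}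
    (hx : c.touches 0 x = false) (hm : ∀ τ, Frame (.forUp x m c) σ τ → m.eval τ = M)
    (hI : ∀ k τ j, I k τ → I k (τ.setI x j))
    (step : ∀ k τ, k < M → τ.idx x = k → Frame (.forUp x m c) σ τ → I k τ → c.wp (I (k + 1)) τ)
    (h : I 0 σ) :
    Runs (.forUp x m c) σ ((c.bound + m.cost + 10) * (M + 1))
      fun τ => I M τ ∧ Frame (.forUp x m c) σ τ :=
  Runs.forUp_frame M _ I σ hx hm hI (fun k τ h1 h2 h3 h4 => Runs.of_wp (step k τ h1 h2 h3 h4)) h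

/-- A downward loop with a loop-free body. -/
theorem Runs.forDown_wp {x : ℕ} {m : IExp} {c : Cmd} (M : ℕ) (I : ℕ → Store → Prop) {σ : Store}
    (hx : c.touches 0 x = false) (hm : m.eval σ = M)
    (hI : ∀ k τ j, I k τ → I k (τ.setI x j))
    (step : ∀ k τ, k < M → τ.idx x = k → Frame (.forDown x m c) σ τ → I (k + 1) τ → c.wp (I k) τ)
    (h : I M σ) :
    Runs (.forDown x m c) σ ((c.bound + m.cost + 10) * (M + 1))
      fun τ => I 0 τ ∧ Frame (.forDown x m c) σ τ :=
  Runs.forDown_frame M _ I σ hx hm hI (fun k τ h1 h2 h3 h4 => Runs.of_wp (step k τ h1 h2 h3 h4)) h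

end RealRAM

/-! ### Building the binary tree in memory, and computing the scores -/

namespace TreeLocation

/-- The gain of the copy of `A u` is the score of the candidate. -/
theorem Binary.sum_contrib {n : ℕ} {T : WeightedTree n} {A P : ℕ → ℕ} (hB : Binary n T.par A P)
    (hA : ∀ u < n, A u < n) {H E r : ℕ → ℝ} {α β : ℕ → Key} {wt : ℕ → ℝ}
    (hα : ∀ v < n, α v = -Key.ofReal (r v)) (hβ : ∀ v < n, β v = -Key.ofReal (r v))
    (hαc : ∀ u < n, α (2 * n + u) = toLex (H u, E u))
    (hβc : ∀ u < n, β (2 * n + u) = -toLex (H u, E u))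
    (hw : ∀ v < n, wt v = T.nweight v) (hw0 : ∀ x, n ≤ x → wt x = 0) {u : ℕ} (hu : u < n) :
    ∑ j ∈ Finset.range (3 * n), contrib P
        (fun x y => T.ndist (location n T.par A x) (location n T.par A y)) α β wt (2 * n + u) j =
      T.score r (A u) (H u) (E u) := by
  classical
  have hn : 0 < n := by omega
  -- Separators and copies have weight zero, so only the original nodes contribute. A node `v` has
  -- the key `-r v` on both sides, and a copy has its height with a sign that depends on the side.
  rw [WeightedTree.score, ← Finset.sum_subset (Finset.range_subset_range.2 (by omega : n ≤ 3 * n))]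
  · refine Finset.sum_congr rfl fun v hv => ?_
    rw [Finset.mem_range] at hv
    have hk : pairKey P (fun x y => T.ndist (location n T.par A x) (location n T.par A y)) α β
        (2 * n + u) v < 0 ↔ Wins T.par T.ndist r (A u) (H u) (E u) v := by
      have h1 : side P α β v (2 * n + u) = -Key.ofReal (r v) := by
        rw [side, hα v hv, hβ v hv, ite_self]
      have h2 : side P α β (2 * n + u) v =
          if v ∈ Sub T.par (A u) then toLex (H u, E u) else -toLex (H u, E u) := by
        rw [side, hαc u hu, hβc u hu]
        exact if_congr (hB.node_mem_sub_copy (T.rootedMetric hn) hA hu hv) rfl rfl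
      rw [pairKey, h1, h2, location_copy, location_node hv, Wins]
    rw [contrib, hw v hv]
    refine if_congr ?_ rfl rfl
    exact ⟨fun h => hk.1 h.2, fun h => ⟨by omega, hk.2 h⟩⟩
  · intro j _ hj
    rw [Finset.mem_range, not_lt] at hj
    rw [contrib, hw0 j hj, ite_self]

end TreeLocation

namespace RealRAM

open TreeLocation

namespace BuildCmd

/-- Clear the lists of the clusters. -/
def initLists : Cmd :=
  Cmd.forUp 28 (.var 2)
    (.writeIdx 13 (.var 28) (.var 28) ;; .writeIdx 14 (.var 28) (.var 28) ;;
      .writeIdx 15 (.var 28) (.var 2) ;; .writeIdx 16 (.var 28) (.var 2) ;;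
      .writeIdx 18 (.var 28) (.var 28))

theorem initLists_runs {σ : Store} {N : ℕ} (h2 : σ.idx 2 = N) :
    Runs initLists σ (40 * (N + 1)) fun τ => (∀ i < N, τ.idxArr 13 i = i ∧ τ.idxArr 14 i = i ∧
      τ.idxArr 15 i = N ∧ τ.idxArr 16 i = N ∧ τ.idxArr 18 i = i) ∧ Frame initLists σ τ := by
  refine (Runs.forUp_wp (σ := σ) N (fun k τ => ∀ i < k, τ.idxArr 13 i = i ∧ τ.idxArr 14 i = i ∧
      τ.idxArr 15 i = N ∧ τ.idxArr 16 i = N ∧ τ.idxArr 18 i = i) rfl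
      (fun τ hf => by exact (hf.idx 2 rfl).trans h2) (fun _ _ _ h => h) (fun k τ hk h28 hf h => ?_)
      (fun i hi => absurd hi (Nat.not_lt_zero i))).mono
      (Nat.mul_le_mul_right _ (by simp [Cmd.bound, IExp.cost])) fun _ h => h
  have e2 := (hf.idx 2 rfl).trans h2
  simp only [Cmd.wp, IExp.eval, Store.setIA_idx, h28, e2]
  intro i hi
  by_cases e : i = k
  · subst e
    simp
  · have := h i (by omega)
    simpa [Function.update_of_ne e] using this

/-- Initialize the keys of the nodes and of the candidates and the ends of the chains. -/
def initKeys : Cmd :=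
  Cmd.forUp 28 (.var 0)
    (.writeIdx 10 (.var 28) (.add (.var 0) (.var 28)) ;; .writeIdx 21 (.var 28) (.var 28) ;;
      .writeReal 14 (.var 28) (.read 1 (.var 28)) ;;
      .writeReal 10 (.var 28) (.sub (.lit 0) (.read 4 (.var 28))) ;;
      .writeReal 10 (.add (.var 3) (.var 28)) (.read 6 (.var 28)) ;;
      .writeReal 11 (.add (.var 3) (.var 28)) (.read 7 (.var 28)))

theorem initKeys_runs {σ : Store} {n : ℕ} (h0 : σ.idx 0 = n) (h3 : σ.idx 3 = 2 * n)
    (hz10 : ∀ i, σ.realArr 10 i = 0) (hz11 : ∀ i, σ.realArr 11 i = 0)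
    (hz14 : ∀ i, σ.realArr 14 i = 0) :
    Runs initKeys σ (60 * (n + 1)) fun τ => ((∀ i < n, τ.idxArr 10 i = n + i ∧ τ.idxArr 21 i = i ∧
      τ.realArr 14 i = σ.realArr 1 i ∧ τ.realArr 10 i = -σ.realArr 4 i ∧
      τ.realArr 10 (2 * n + i) = σ.realArr 6 i ∧ τ.realArr 11 (2 * n + i) = σ.realArr 7 i) ∧
      (∀ x, n ≤ x → τ.realArr 14 x = 0) ∧ (∀ x, n ≤ x → x < 2 * n → τ.realArr 10 x = 0) ∧
      ∀ x < 2 * n, τ.realArr 11 x = 0) ∧ Frame initKeys σ τ := by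
  refine (Runs.forUp_wp (σ := σ) n (fun k τ => (∀ i < k, τ.idxArr 10 i = n + i ∧
      τ.idxArr 21 i = i ∧
      τ.realArr 14 i = σ.realArr 1 i ∧ τ.realArr 10 i = -σ.realArr 4 i ∧
      τ.realArr 10 (2 * n + i) = σ.realArr 6 i ∧ τ.realArr 11 (2 * n + i) = σ.realArr 7 i) ∧
      (∀ x, n ≤ x → τ.realArr 14 x = 0) ∧ (∀ x, n ≤ x → x < 2 * n → τ.realArr 10 x = 0) ∧
      ∀ x < 2 * n, τ.realArr 11 x = 0) rfl
      (fun τ hf => by exact (hf.idx 0 rfl).trans h0) (fun _ _ _ h => h) (fun k τ hk h28 hf h => ?_)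
      ⟨fun i hi => absurd hi (Nat.not_lt_zero i), fun x _ => hz14 x, fun x _ _ => hz10 x,
        fun x _ => hz11 x⟩).mono
      (Nat.mul_le_mul_right _ (by simp [Cmd.bound, IExp.cost, RExp.cost])) fun _ h => h
  have e0 := (hf.idx 0 rfl).trans h0
  have e3 := (hf.idx 3 rfl).trans h3
  have f1 := hf.realArr 1 rfl
  have f4 := hf.realArr 4 rfl
  have f6 := hf.realArr 6 rfl
  have f7 := hf.realArr 7 rfl
  obtain ⟨h1, h2, h4, h5⟩ := h
  simp only [Cmd.wp, IExp.eval, RExp.eval, Store.setIA_idx, Store.setRA_idx, h28, e0, e3]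
  refine ⟨fun i hi => ?_, fun x hx => ?_, fun x hx hx' => ?_, fun x hx => ?_⟩
  · by_cases e : i = k
    · subst e
      have e1 : i ≠ 2 * n + i := by omega
      simp [f1, f4, f6, f7, Function.update_of_ne e1]
    · have := h1 i (by omega)
      have e1 : i ≠ 2 * n + k := by omega
      have e4 : 2 * n + i ≠ k := by omega
      have e5 : 2 * n + i ≠ 2 * n + k := by omega
      simpa [Function.update_of_ne e, Function.update_of_ne e1, Function.update_of_ne e4,
        Function.update_of_ne e5] using this
  · have e : x ≠ k := by omega
    simpa [Function.update_of_ne e] using h2 x hx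
  · have e : x ≠ k := by omega
    have e1 : x ≠ 2 * n + k := by omega
    simpa [Function.update_of_ne e, Function.update_of_ne e1] using h4 x hx hx'
  · have e1 : x ≠ 2 * n + k := by omega
    simpa [Function.update_of_ne e1] using h5 x hx

/-- Link the copies into chains. -/
def linkCopies : Cmd :=
  Cmd.forUp 28 (.var 0)
    (.setIdx 24 (.add (.var 3) (.var 28)) ;; .setIdx 25 (.read 9 (.var 28)) ;;
      .writeIdx 11 (.var 24) (.read 10 (.var 25)) ;; .writeIdx 10 (.var 25) (.var 24))

/-- Array `10` holds the current end of every chain, initially the separator; each copy is hung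
below the end of its chain and becomes the new end. -/
theorem linkCopies_runs {σ : Store} {n : ℕ} (h0 : σ.idx 0 = n) (h3 : σ.idx 3 = 2 * n)
    (hA : ∀ u < n, σ.idxArr 9 u < n) (h10 : ∀ i < n, σ.idxArr 10 i = n + i) :
    Runs linkCopies σ (40 * (n + 1)) fun τ =>
      ((∀ v < n, τ.idxArr 10 v = assigned (σ.idxArr 9) (2 * n + ·) (n + ·) n v) ∧
      (∀ u < n, τ.idxArr 11 (2 * n + u) =
        assigned (σ.idxArr 9) (2 * n + ·) (n + ·) u (σ.idxArr 9 u))) ∧ Frame linkCopies σ τ := by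
  refine (Runs.forUp_wp (σ := σ) n (fun k τ =>
      ((∀ v < n, τ.idxArr 10 v = assigned (σ.idxArr 9) (2 * n + ·) (n + ·) k v) ∧
      (∀ u < k, τ.idxArr 11 (2 * n + u) =
        assigned (σ.idxArr 9) (2 * n + ·) (n + ·) u (σ.idxArr 9 u)))) rfl
      (fun τ hf => by exact (hf.idx 0 rfl).trans h0) (fun _ _ _ h => h) (fun k τ hk h28 hf h => ?_)
      ⟨h10, fun i hi => absurd hi (Nat.not_lt_zero i)⟩).mono
      (Nat.mul_le_mul_right _ (by simp [Cmd.bound, IExp.cost])) fun _ h => h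
  have e3 := (hf.idx 3 rfl).trans h3
  have f9 := hf.idxArr 9 rfl
  obtain ⟨h1, h2⟩ := h
  simp only [Cmd.wp, IExp.eval, Store.setI_idx, Store.setIA_idx, Store.setI_idxArr, if_true,
    h28, e3, f9, show ((28 : ℕ) = 24) = False by simp, show ((24 : ℕ) = 25) = False by simp,
    if_false, Store.setIA_idxArr, show ((10 : ℕ) = 11) = False by simp,
    show ((11 : ℕ) = 10) = False by simp]
  refine ⟨fun v hv => ?_, fun u hu => ?_⟩
  · rw [assigned]
    by_cases e : v = σ.idxArr 9 k
    · rw [e, Function.update_self, Function.update_self]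
    · rw [Function.update_of_ne e, Function.update_of_ne e, h1 v hv]
  · by_cases e : u = k
    · rw [e, Function.update_self, h1 _ (hA k hk)]
    · rw [Function.update_of_ne (by omega), h2 u (by omega)]

/-- Attach the nodes to their chains. -/
def linkNodes : Cmd :=
  Cmd.forUp 28 (.var 0) (.writeIdx 11 (.var 28) (.read 10 (.var 28)))

/-- The nodes come last, so each of them lies below all of its copies. -/
theorem linkNodes_runs {σ : Store} {n : ℕ} (h0 : σ.idx 0 = n) :
    Runs linkNodes σ (20 * (n + 1)) fun τ => ((∀ v < n, τ.idxArr 11 v = σ.idxArr 10 v) ∧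
      (∀ x, n ≤ x → τ.idxArr 11 x = σ.idxArr 11 x)) ∧ Frame linkNodes σ τ := by
  refine (Runs.forUp_wp (σ := σ) n (fun k τ => (∀ v < k, τ.idxArr 11 v = σ.idxArr 10 v) ∧
      (∀ x, n ≤ x → τ.idxArr 11 x = σ.idxArr 11 x)) rfl
      (fun τ hf => by exact (hf.idx 0 rfl).trans h0) (fun _ _ _ h => h) (fun k τ hk h28 hf h => ?_)
      ⟨fun i hi => absurd hi (Nat.not_lt_zero i), fun _ _ => rfl⟩).mono
      (Nat.mul_le_mul_right _ (by simp [Cmd.bound, IExp.cost])) fun _ h => h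
  have f10 := hf.idxArr 10 rfl
  obtain ⟨h1, h2⟩ := h
  simp only [Cmd.wp, IExp.eval, Store.setIA_idxArr, if_true, h28, f10]
  refine ⟨fun v hv => ?_, fun x hx => ?_⟩
  · by_cases e : v = k
    · rw [e, Function.update_self]
    · rw [Function.update_of_ne e, h1 v (by omega)]
  · rw [Function.update_of_ne (by omega), h2 x hx]

/-- Link the separators into chains. -/
def linkSeparators : Cmd :=
  Cmd.forUp 28 (.sub (.var 0) (.lit 1))
    (.setIdx 24 (.add (.var 0) (.add (.var 28) (.lit 1))) ;;
      .setIdx 25 (.read 6 (.add (.var 28) (.lit 1))) ;;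
      .writeIdx 11 (.var 24) (.read 21 (.var 25)) ;; .writeIdx 21 (.var 25) (.var 24)) ;;
  .writeIdx 11 (.var 0) (.var 0)

/-- Array `21` holds the ends of the chains of separators, which start at the nodes themselves. The
separator of the root has no parent and becomes the root of the binary tree. -/
theorem linkSeparators_runs {σ : Store} {n : ℕ} {par : ℕ → ℕ} (hn : 0 < n) (h0 : σ.idx 0 = n)
    (hpar : ∀ v < n, σ.idxArr 6 v = par v) (hlt : ∀ v < n, par v < n)
    (h21 : ∀ i < n, σ.idxArr 21 i = i) :
    Runs linkSeparators σ (50 * (n + 1)) fun τ =>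
      ((∀ c, c + 1 < n → τ.idxArr 11 (n + (c + 1)) =
        assigned (fun c => par (c + 1)) (fun c => n + (c + 1)) id c (par (c + 1))) ∧
      τ.idxArr 11 n = n ∧
      (∀ x, x < n ∨ 2 * n ≤ x → τ.idxArr 11 x = σ.idxArr 11 x)) ∧ Frame linkSeparators σ τ := by
  have key := Runs.forUp_wp (x := 28) (m := .sub (.var 0) (.lit 1))
      (c := .setIdx 24 (.add (.var 0) (.add (.var 28) (.lit 1))) ;;
      .setIdx 25 (.read 6 (.add (.var 28) (.lit 1))) ;;
      .writeIdx 11 (.var 24) (.read 21 (.var 25)) ;; .writeIdx 21 (.var 25) (.var 24))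
      (σ := σ) (n - 1) (fun k τ =>
      (∀ v < n, τ.idxArr 21 v = assigned (fun c => par (c + 1)) (fun c => n + (c + 1)) id k v) ∧
      (∀ c < k, τ.idxArr 11 (n + (c + 1)) =
        assigned (fun c => par (c + 1)) (fun c => n + (c + 1)) id c (par (c + 1))) ∧
      (∀ x, x < n ∨ 2 * n ≤ x → τ.idxArr 11 x = σ.idxArr 11 x)) rfl
      (fun τ hf => by simp only [IExp.eval]; rw [hf.idx 0 rfl, h0]) (fun _ _ _ h => h)
      (fun k τ hk h28 hf h => by
        have e0 := (hf.idx 0 rfl).trans h0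
        have f6 := hf.idxArr 6 rfl
        obtain ⟨h1, h2, h3⟩ := h
        simp only [Cmd.wp, IExp.eval, Store.setI_idx, Store.setIA_idx, Store.setI_idxArr, if_true,
          h28, e0, f6, show ((28 : ℕ) = 24) = False by simp, show ((24 : ℕ) = 25) = False by simp,
          if_false, Store.setIA_idxArr, show ((21 : ℕ) = 11) = False by simp,
          show ((11 : ℕ) = 21) = False by simp]
        rw [hpar (k + 1) (by omega)]
        refine ⟨fun v hv => ?_, fun c hc => ?_, fun x hx => ?_⟩
        · rw [assigned]
          by_cases e : v = par (k + 1)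
          · rw [e, Function.update_self, Function.update_self]
          · rw [Function.update_of_ne e, Function.update_of_ne e, h1 v hv]
        · by_cases e : c = k
          · rw [e, Function.update_self, h1 _ (hlt _ (by omega))]
          · rw [Function.update_of_ne (by omega), h2 c (by omega)]
        · rw [Function.update_of_ne (by omega), h3 x hx])
      ⟨h21, fun i hi => absurd hi (Nat.not_lt_zero i), fun _ _ => rfl⟩
  refine Runs.mono (Runs.frame (key.seq (t' := 3)
    (Q := fun τ => (∀ c, c + 1 < n → τ.idxArr 11 (n + (c + 1)) =
        assigned (fun c => par (c + 1)) (fun c => n + (c + 1)) id c (par (c + 1))) ∧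
      τ.idxArr 11 n = n ∧
      (∀ x, x < n ∨ 2 * n ≤ x → τ.idxArr 11 x = σ.idxArr 11 x)) ?_)) ?_ fun _ h => h
  · rintro τ ⟨⟨-, h2, h3⟩, hf⟩
    refine Runs.of_wp' ?_ (by simp [Cmd.bound, IExp.cost])
    have e0 := (hf.idx 0 rfl).trans h0
    simp only [Cmd.wp, IExp.eval, e0, Store.setIA_idxArr, if_true]
    refine ⟨fun c hc => ?_, Function.update_self .., fun x hx => ?_⟩
    · rw [Function.update_of_ne (by omega), h2 c (by omega)]
    · rw [Function.update_of_ne (by omega), h3 x hx]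
  · rw [Nat.sub_add_cancel hn]
    simp only [Cmd.bound, IExp.cost]
    omega

/-- Compute the lengths of the edges of the binary tree and the keys with respect to the
parents. -/
def initTops : Cmd :=
  Cmd.forUp 28 (.var 0)
    (.ite (.idxLt (.read 11 (.var 28)) (.var 3))
      (.writeReal 9 (.var 28) (.read 3 (.var 28))) (.writeReal 9 (.var 28) (.lit 0)) ;;
    .writeReal 12 (.var 28) (.sub (.read 9 (.var 28)) (.read 4 (.var 28))) ;;
    .setIdx 24 (.add (.var 3) (.var 28)) ;;
    .ite (.idxLt (.read 11 (.var 24)) (.var 3))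
      (.writeReal 9 (.var 24) (.read 3 (.read 9 (.var 28)))) (.writeReal 9 (.var 24) (.lit 0)) ;;
    .writeReal 12 (.var 24) (.sub (.read 9 (.var 24)) (.read 6 (.var 28))) ;;
    .writeReal 13 (.var 24) (.sub (.lit 0) (.read 7 (.var 28))))

/-- The parent of a member of a chain is a copy, with a number of at least `2 * n`, or a separator,
with a smaller one. So one comparison tells whether the edge has length zero or that of the edge
above the location. -/
theorem initTops_runs {σ : Store} {n : ℕ} (h0 : σ.idx 0 = n) (h3 : σ.idx 3 = 2 * n)
    (hz9 : ∀ i, σ.realArr 9 i = 0) (hz12 : ∀ i, σ.realArr 12 i = 0)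
    (hz13 : ∀ i, σ.realArr 13 i = 0) :
    Runs initTops σ (100 * (n + 1)) fun τ => ((∀ i < n,
      τ.realArr 9 i = (if σ.idxArr 11 i < 2 * n then σ.realArr 3 i else 0) ∧
      τ.realArr 12 i = τ.realArr 9 i - σ.realArr 4 i ∧
      τ.realArr 9 (2 * n + i) =
        (if σ.idxArr 11 (2 * n + i) < 2 * n then σ.realArr 3 (σ.idxArr 9 i) else 0) ∧
      τ.realArr 12 (2 * n + i) = τ.realArr 9 (2 * n + i) - σ.realArr 6 i ∧
      τ.realArr 13 (2 * n + i) = -σ.realArr 7 i) ∧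
      (∀ x, n ≤ x → x < 2 * n → τ.realArr 9 x = 0 ∧ τ.realArr 12 x = 0) ∧
      ∀ x < 2 * n, τ.realArr 13 x = 0) ∧ Frame initTops σ τ := by
  refine (Runs.forUp_wp (σ := σ) n (fun k τ => (∀ i < n, i < k →
      τ.realArr 9 i = (if σ.idxArr 11 i < 2 * n then σ.realArr 3 i else 0) ∧
      τ.realArr 12 i = τ.realArr 9 i - σ.realArr 4 i ∧
      τ.realArr 9 (2 * n + i) =
        (if σ.idxArr 11 (2 * n + i) < 2 * n then σ.realArr 3 (σ.idxArr 9 i) else 0) ∧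
      τ.realArr 12 (2 * n + i) = τ.realArr 9 (2 * n + i) - σ.realArr 6 i ∧
      τ.realArr 13 (2 * n + i) = -σ.realArr 7 i) ∧
      (∀ x, n ≤ x → x < 2 * n → τ.realArr 9 x = 0 ∧ τ.realArr 12 x = 0) ∧
      ∀ x < 2 * n, τ.realArr 13 x = 0) rfl
      (fun τ hf => by exact (hf.idx 0 rfl).trans h0) (fun _ _ _ h => h) (fun k τ hk h28 hf h => ?_)
      ⟨fun i _ hi => absurd hi (Nat.not_lt_zero i),
        fun x _ _ => ⟨hz9 x, hz12 x⟩, fun x _ => hz13 x⟩).mono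
      (Nat.mul_le_mul_right _ (by simp [Cmd.bound, IExp.cost, RExp.cost, Test.cost]))
      fun _ h => ⟨⟨fun i hi => h.1.1 i hi hi, h.1.2.1, h.1.2.2⟩, h.2⟩
  have e0 := (hf.idx 0 rfl).trans h0
  have e3 := (hf.idx 3 rfl).trans h3
  have f3 := hf.realArr 3 rfl
  have f4 := hf.realArr 4 rfl
  have f6 := hf.realArr 6 rfl
  have f7 := hf.realArr 7 rfl
  have g9 := hf.idxArr 9 rfl
  have g11 := hf.idxArr 11 rfl
  obtain ⟨h1, h4, h5⟩ := h
  have n1 : 2 * n + k ≠ k := by omega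
  -- The two tests only select the values written; this form covers all four cases.
  have hgoal : ∀ υ : Store,
      υ.realArr 9 = Function.update (Function.update (τ.realArr 9) k
        (if σ.idxArr 11 k < 2 * n then σ.realArr 3 k else 0)) (2 * n + k)
        (if σ.idxArr 11 (2 * n + k) < 2 * n then σ.realArr 3 (σ.idxArr 9 k) else 0) →
      υ.realArr 12 = Function.update (Function.update (τ.realArr 12) k
        (υ.realArr 9 k - σ.realArr 4 k)) (2 * n + k) (υ.realArr 9 (2 * n + k) - σ.realArr 6 k) →
      υ.realArr 13 = Function.update (τ.realArr 13) (2 * n + k) (-σ.realArr 7 k) →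
      (∀ i < n, i < k + 1 →
      υ.realArr 9 i = (if σ.idxArr 11 i < 2 * n then σ.realArr 3 i else 0) ∧
      υ.realArr 12 i = υ.realArr 9 i - σ.realArr 4 i ∧
      υ.realArr 9 (2 * n + i) =
        (if σ.idxArr 11 (2 * n + i) < 2 * n then σ.realArr 3 (σ.idxArr 9 i) else 0) ∧
      υ.realArr 12 (2 * n + i) = υ.realArr 9 (2 * n + i) - σ.realArr 6 i ∧
      υ.realArr 13 (2 * n + i) = -σ.realArr 7 i) ∧
      (∀ x, n ≤ x → x < 2 * n → υ.realArr 9 x = 0 ∧ υ.realArr 12 x = 0) ∧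
      ∀ x < 2 * n, υ.realArr 13 x = 0 := by
    intro υ u9 u12 u13
    refine ⟨fun i hi hik => ?_, fun x hx hx' => ?_, fun x hx => ?_⟩
    · have m1 : i ≠ 2 * n + k := by omega
      have m2 : 2 * n + i ≠ k := by omega
      by_cases e : i = k
      · subst e
        rw [u12, u13, u9]
        simp [Function.update_of_ne m1]
      · have m3 : 2 * n + i ≠ 2 * n + k := by omega
        rw [u12, u13, Function.update_of_ne m1, Function.update_of_ne e, Function.update_of_ne m3,
          Function.update_of_ne m2, Function.update_of_ne m3, u9, Function.update_of_ne m1,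
          Function.update_of_ne e, Function.update_of_ne m3, Function.update_of_ne m2]
        exact h1 i hi (by omega)
    · rw [u12, Function.update_of_ne (by omega), Function.update_of_ne (by omega), u9,
        Function.update_of_ne (by omega), Function.update_of_ne (by omega)]
      exact h4 x hx hx'
    · rw [u13, Function.update_of_ne (by omega)]
      exact h5 x hx
  simp only [Cmd.wp, IExp.eval, RExp.eval, Test.Holds, Store.setI_idx, Store.setRA_idx,
    Store.setI_idxArr, Store.setRA_idxArr, Store.setI_realArr, h28, e3, f3, g9, g11,
    if_true, show ((3 : ℕ) = 24) = False by simp, show ((28 : ℕ) = 24) = False by simp, if_false]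
  refine ⟨fun c1 => ⟨fun c2 => hgoal _ ?_ ?_ ?_, fun c2 => hgoal _ ?_ ?_ ?_⟩,
    fun c1 => ⟨fun c2 => hgoal _ ?_ ?_ ?_, fun c2 => hgoal _ ?_ ?_ ?_⟩⟩
  all_goals simp [c1, c2, f3, f4, f6, f7, Function.update_of_ne n1.symm]

end BuildCmd

end RealRAM

namespace TreeLocation

theorem Key.neg_ofReal (x : ℝ) : -Key.ofReal x = toLex (-x, 0) := by
  change (toLex (-x, (-0 : ℝ)) : Key) = _
  rw [neg_zero]

/-- The lengths of the edges of the binary tree, by kinds of nodes. -/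
theorem Binary.length_eq {n : ℕ} {T : WeightedTree n} {A P : ℕ → ℕ} (hB : Binary n T.par A P)
    (hA : ∀ u < n, A u < n) {plen : ℕ → ℝ}
    (h1 : ∀ v < n, plen v = if P v < 2 * n then T.lenUp v else 0)
    (h2 : ∀ v, n ≤ v → v < 2 * n → plen v = 0)
    (h3 : ∀ u < n, plen (2 * n + u) = if P (2 * n + u) < 2 * n then T.lenUp (A u) else 0)
    {x : ℕ} (hx : x < 3 * n) (hn : x ≠ n) :
    plen x = T.ndist (location n T.par A x) (location n T.par A (P x)) := by
  rcases kinds hA hx with ⟨v, hv, k, hm⟩ | e | ⟨c, hc, rfl⟩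
  · have hp : plen x = if P x < 2 * n then T.lenUp v else 0 := by
      rcases hm with ⟨rfl, hv, -⟩ | ⟨rfl, hk, rfl⟩
      · exact h1 _ hv
      · exact h3 _ hk
    rw [hp, hm.location_eq]
    rcases hB.parent_cases hm with ⟨-, e⟩ | ⟨i, hi, e1, -, e, hm'⟩
    · rw [e, if_pos (by omega), location_separator hv, WeightedTree.lenUp]
    · rw [e, if_neg (by omega), hm'.location_eq, WeightedTree.ndist_self]
  · exact absurd e hn
  · have hp : T.par (c + 1) < n := WeightedTree.par_lt hc
    rw [h2 _ (by omega) (by omega), location_separator hc]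
    rcases hB.separator_cases hc with e | ⟨i, hi, e1, -, e⟩
    · rw [e, location_node hp, WeightedTree.ndist_self]
    · rw [e, location_separator (by omega), e1, WeightedTree.ndist_self]

end TreeLocation

namespace RealRAM

open TreeLocation

namespace BuildCmd

/-- Count the children of the nodes of the binary tree. -/
def countChildren : Cmd :=
  Cmd.forUp 28 (.var 2)
    (.ite (.idxEq (.var 28) (.var 0)) .skip
      (.setIdx 24 (.read 11 (.var 28)) ;;
        .writeIdx 12 (.var 24) (.add (.read 12 (.var 24)) (.lit 1))))

theorem countChildren_runs {σ : Store} {n N : ℕ} (h0 : σ.idx 0 = n) (h2 : σ.idx 2 = N)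
    (hz : ∀ i, σ.idxArr 12 i = 0) :
    Runs countChildren σ (30 * (N + 1)) fun τ => (∀ y, τ.idxArr 12 y =
      ((Finset.range N).filter fun c => c ≠ n ∧ σ.idxArr 11 c = y).card) ∧
      Frame countChildren σ τ := by
  refine (Runs.forUp_wp (σ := σ) N (fun k τ => ∀ y, τ.idxArr 12 y =
      ((Finset.range k).filter fun c => c ≠ n ∧ σ.idxArr 11 c = y).card) rfl
      (fun τ hf => by exact (hf.idx 2 rfl).trans h2) (fun _ _ _ h => h)
      (fun k τ hk h28 hf h => ?_) (fun y => by simp [hz])).mono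
      (Nat.mul_le_mul_right _ (by simp [Cmd.bound, IExp.cost, Test.cost])) fun _ h => h
  have e0 := (hf.idx 0 rfl).trans h0
  have f11 := hf.idxArr 11 rfl
  simp only [Cmd.wp, IExp.eval, Test.Holds, Store.setI_idx, Store.setI_idxArr, if_true, h28, e0,
    f11, Store.setIA_idxArr]
  refine ⟨fun e y => ?_, fun e y => ?_⟩
  · rw [Finset.range_add_one, Finset.filter_insert, if_neg (fun h => h.1 e), h]
  · rw [Finset.range_add_one, Finset.filter_insert]
    by_cases ey : y = σ.idxArr 11 k
    · rw [ey, Function.update_self, if_pos ⟨e, rfl⟩, Finset.card_insert_of_notMem (by simp), h]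
    · rw [Function.update_of_ne ey, if_neg fun h => ey h.2.symm, h]

/-- Set the sizes. -/
def setup : Cmd :=
  .setIdx 3 (.add (.var 0) (.var 0)) ;; .setIdx 2 (.add (.var 3) (.var 0)) ;;
    .setIdx 29 (.var 0) ;; .setIdx 27 (.var 2)

theorem setup_runs {σ : Store} {n : ℕ} (h0 : σ.idx 0 = n) : Runs setup σ 13 fun τ =>
    (τ.idx 2 = 3 * n ∧ τ.idx 3 = 2 * n ∧ τ.idx 27 = 3 * n ∧ τ.idx 29 = n) ∧ Frame setup σ τ := by
  refine (Runs.of_wp' ?_ (by simp [Cmd.bound, setup, IExp.cost])).frame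
  simp only [setup, Cmd.wp, IExp.eval, Store.setI_idx]
  simp [h0]
  omega

/-- Build the binary tree. -/
def build : Cmd :=
  setup ;; initKeys ;; linkCopies ;; linkNodes ;; linkSeparators ;; initTops ;; countChildren ;;
    initLists

end BuildCmd

open BuildCmd

/-- The memory holds the parents of the nodes, the lengths of the edges to them, the distances
`r` of the nodes, and candidates. -/
structure Located {n : ℕ} (T : WeightedTree n) (r : ℕ → ℝ) (σ : Store) : Prop where
  size : σ.idx 0 = n
  par : ∀ v < n, σ.idxArr 6 v = T.par v
  len : ∀ v < n, σ.realArr 3 v = T.lenUp v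
  weight : ∀ v < n, σ.realArr 1 v = T.nweight v
  dist : ∀ v < n, σ.realArr 4 v = r v
  lt : ∀ u < n, σ.idxArr 9 u < n
  idx_zero : ∀ a, a = 12 ∨ a = 19 ∨ a = 20 → ∀ i, σ.idxArr a i = 0
  real_zero : ∀ a, 9 ≤ a → a ≤ 15 → ∀ i, σ.realArr a i = 0

/-- The binary tree, its keys and the stage are existentially quantified: all that matters later is
that the contraction can start, and that the completed gains of the copies are the scores, by
`Binary.sum_contrib`. -/
theorem build_runs {n : ℕ} {T : WeightedTree n} {r : ℕ → ℝ} {σ : Store} (hn : 0 < n)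
    (hσ : Located T r σ) : Runs build σ (1000 * (n + 1)) fun τ => ∃ P α β wt C,
      ContractCmd.RoundInv (3 * n) n P (fun x y => T.ndist (location n T.par (σ.idxArr 9) x)
        (location n T.par (σ.idxArr 9) y)) α β wt C τ ∧
      (∃ plen, RootedMetric (3 * n) n P plen fun x y =>
        T.ndist (location n T.par (σ.idxArr 9) x) (location n T.par (σ.idxArr 9) y)) ∧
      ∀ u < n, ∑ j ∈ Finset.range (3 * n), contrib P (fun x y =>
        T.ndist (location n T.par (σ.idxArr 9) x) (location n T.par (σ.idxArr 9) y)) α β wt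
          (2 * n + u) j = T.score r (σ.idxArr 9 u) (σ.realArr 6 u) (σ.realArr 7 u) := by
  set A := σ.idxArr 9 with hA
  have hpl : ∀ v < n, T.par v < n := fun v hv => WeightedTree.par_lt hv
  have hR := T.rootedMetric hn
  refine Runs.mono (t := 13 + (60 * (n + 1) + (40 * (n + 1) + (20 * (n + 1) + (50 * (n + 1) +
    (100 * (n + 1) + (30 * (3 * n + 1) + 40 * (3 * n + 1)))))))) ?_ (by omega) fun _ h => h
  refine (setup_runs hσ.size).seq fun σ0 ⟨⟨i2, i3, i27, i29⟩, f0⟩ => ?_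
  have i0 : σ0.idx 0 = n := (f0.idx 0 rfl).trans hσ.size
  have hz : ∀ a, 9 ≤ a → a ≤ 15 → ∀ i, σ0.realArr a i = 0 := fun a h1 h2 i => by
    rw [f0.realArr a rfl]
    exact hσ.real_zero a h1 h2 i
  refine (initKeys_runs i0 i3 (hz 10 (by omega) (by omega)) (hz 11 (by omega) (by omega))
    (hz 14 (by omega) (by omega))).seq fun σ1 ⟨⟨k1, k2, k3, k4⟩, f1⟩ => ?_
  have a1 : σ1.idxArr 9 = A := (f1.idxArr 9 rfl).trans (f0.idxArr 9 rfl)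
  have j0 : σ1.idx 0 = n := (f1.idx 0 rfl).trans i0
  refine (linkCopies_runs j0 ((f1.idx 3 rfl).trans i3)
    (fun u hu => by rw [a1]; exact hσ.lt u hu) fun i hi => (k1 i hi).1).seq
    fun σ2 ⟨⟨l1, l2⟩, f2⟩ => ?_
  rw [a1] at l1 l2
  have m0 : σ2.idx 0 = n := (f2.idx 0 rfl).trans j0
  refine (linkNodes_runs m0).seq fun σ3 ⟨⟨p1, p2⟩, f3⟩ => ?_
  have q0 : σ3.idx 0 = n := (f3.idx 0 rfl).trans m0
  refine (linkSeparators_runs (par := T.par) hn q0 (fun v hv => by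
    rw [f3.idxArr 6 rfl, f2.idxArr 6 rfl, f1.idxArr 6 rfl, f0.idxArr 6 rfl]
    exact hσ.par v hv) hpl fun i hi => by
      rw [f3.idxArr 21 rfl, f2.idxArr 21 rfl]
      exact (k1 i hi).2.1).seq fun σ4 ⟨⟨s1, s2, s3⟩, f4⟩ => ?_
  have hB : Binary n T.par A (σ4.idxArr 11) :=
    ⟨fun v hv => by rw [s3 v (Or.inl hv), p1 v hv, l1 v hv],
      fun u hu => by rw [s3 _ (Or.inr (by omega)), p2 _ (by omega), l2 u hu], s1, s2⟩
  have r0 : σ4.idx 0 = n := (f4.idx 0 rfl).trans q0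
  have r3 : σ4.idx 3 = 2 * n := by
    rw [f4.idx 3 rfl, f3.idx 3 rfl, f2.idx 3 rfl, f1.idx 3 rfl, i3]
  have r2 : σ4.idx 2 = 3 * n := by
    rw [f4.idx 2 rfl, f3.idx 2 rfl, f2.idx 2 rfl, f1.idx 2 rfl, i2]
  have hz4 : ∀ a, a = 9 ∨ a = 12 ∨ a = 13 → ∀ i, σ4.realArr a i = 0 := by
    rintro a (rfl | rfl | rfl) i
    all_goals
      rw [f4.realArr _ rfl, f3.realArr _ rfl, f2.realArr _ rfl, f1.realArr _ rfl]
      exact hz _ (by omega) (by omega) i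
  have g : ∀ a, a = 3 ∨ a = 4 ∨ a = 6 ∨ a = 7 → σ4.realArr a = σ.realArr a := by
    rintro a (rfl | rfl | rfl | rfl)
    all_goals
      rw [f4.realArr _ rfl, f3.realArr _ rfl, f2.realArr _ rfl, f1.realArr _ rfl,
        f0.realArr _ rfl]
  have g9 : σ4.idxArr 9 = A := by
    rw [f4.idxArr 9 rfl, f3.idxArr 9 rfl, f2.idxArr 9 rfl, a1]
  refine (initTops_runs r0 r3 (hz4 9 (by omega)) (hz4 12 (by omega)) (hz4 13 (by omega))).seq
    fun σ5 ⟨⟨t1, t2, t3⟩, f5⟩ => ?_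
  simp only [g 3 (by omega), g 4 (by omega), g 6 (by omega), g 7 (by omega), g9] at t1
  refine (countChildren_runs ((f5.idx 0 rfl).trans r0) ((f5.idx 2 rfl).trans r2) fun i => by
    rw [f5.idxArr 12 rfl, f4.idxArr 12 rfl, f3.idxArr 12 rfl, f2.idxArr 12 rfl, f1.idxArr 12 rfl,
      f0.idxArr 12 rfl]
    exact hσ.idx_zero 12 (by omega) i).seq fun σ6 ⟨u1, f6⟩ => ?_
  refine (initLists_runs (N := 3 * n) (by rw [f6.idx 2 rfl, f5.idx 2 rfl, r2])).mono le_rfl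
    fun τ ⟨v1, f7⟩ => ?_
  have hP : τ.idxArr 11 = σ4.idxArr 11 := by
    rw [f7.idxArr 11 rfl, f6.idxArr 11 rfl, f5.idxArr 11 rfl]
  rw [f5.idxArr 11 rfl] at u1
  have e9 : τ.realArr 9 = σ5.realArr 9 := by rw [f7.realArr 9 rfl, f6.realArr 9 rfl]
  have e12 : τ.realArr 12 = σ5.realArr 12 := by rw [f7.realArr 12 rfl, f6.realArr 12 rfl]
  have e13 : τ.realArr 13 = σ5.realArr 13 := by rw [f7.realArr 13 rfl, f6.realArr 13 rfl]
  have e1 : ∀ a, a = 10 ∨ a = 11 ∨ a = 14 → τ.realArr a = σ1.realArr a := by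
    rintro a (rfl | rfl | rfl)
    all_goals
      rw [f7.realArr _ rfl, f6.realArr _ rfl, f5.realArr _ rfl, f4.realArr _ rfl,
        f3.realArr _ rfl, f2.realArr _ rfl]
  simp only [f0.realArr 1 rfl, f0.realArr 4 rfl, f0.realArr 6 rfl, f0.realArr 7 rfl] at k1
  have hAlt : ∀ u < n, A u < n := hσ.lt
  have hplen := fun x (hx : x < 3 * n) hxn => hB.length_eq (T := T) (plen := σ5.realArr 9) hAlt
    (fun v hv => by rw [(t1 v hv).1, hσ.len v hv]) (fun v h1 h2 => (t2 v h1 h2).1)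
    (fun u hu => by rw [(t1 u hu).2.2.1, hσ.len _ (hAlt u hu)]) hx hxn
  have hM := hB.rootedMetric hR hAlt hplen
  set α : ℕ → Key := τ.key 10 11 with hα
  -- The memory holds top keys, from which the length is subtracted because the first stage adds it
  -- to `β`.
  set β : ℕ → Key := fun i => τ.key 12 13 i - Key.ofReal (τ.realArr 9 i) with hβ
  refine ⟨σ4.idxArr 11, α, β, τ.realArr 14,
    Conf.init (3 * n) (σ4.idxArr 11) (σ5.realArr 9) (τ.idxArr 12) α β, ⟨?_, ?_, ?_, ?_, ?_, ?_⟩,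
    ⟨_, hM⟩, ?_⟩
  · refine Conf.init_valid hM (fun v _ => ?_) fun v _ => ?_
    · rw [f7.idxArr 12 rfl, u1 v]
    · rw [f7.idxArr 12 rfl, u1 v]
      exact hB.card_children_le hAlt hpl v
  · refine ⟨?_, hP, rfl, e9, rfl, ?_, fun v hv => ?_, fun v hv => ?_, rfl, ?_, fun v hv => ?_⟩
    · rw [f7.idx 2 rfl, f6.idx 2 rfl, f5.idx 2 rfl, r2]
    · funext i
      simp only [Conf.init, hβ]
      rw [← e9, sub_add_cancel]
    · have hv : v < 3 * n := Finset.mem_range.1 hv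
      exact ⟨(v1 v hv).1, hv.ne, (v1 v hv).2.2.1⟩
    · have hv : v < 3 * n := Finset.mem_range.1 hv
      exact ⟨(v1 v hv).2.1, hv.ne, (v1 v hv).2.2.2.1⟩
    · funext i
      rw [f7.realArr 15 rfl, f6.realArr 15 rfl, f5.realArr 15 rfl, f4.realArr 15 rfl,
        f3.realArr 15 rfl, f2.realArr 15 rfl, f1.realArr 15 rfl]
      exact hz 15 (by omega) (by omega) i
    · rw [f7.idxArr 20 rfl, f6.idxArr 20 rfl, f5.idxArr 20 rfl, f4.idxArr 20 rfl,
        f3.idxArr 20 rfl, f2.idxArr 20 rfl, f1.idxArr 20 rfl, f0.idxArr 20 rfl,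
        hσ.idx_zero 20 (by omega)]
      simp [Conf.init, hv]
  · rw [f7.idx 27 rfl, f6.idx 27 rfl, f5.idx 27 rfl, f4.idx 27 rfl, f3.idx 27 rfl, f2.idx 27 rfl,
      f1.idx 27 rfl, i27]
    simp [Conf.init]
  · rw [f7.idx 29 rfl, f6.idx 29 rfl, f5.idx 29 rfl, f4.idx 29 rfl, f3.idx 29 rfl, f2.idx 29 rfl,
      f1.idx 29 rfl, i29]
  · simp only [Conf.init, Finset.card_range]
    rw [Finset.image_congr (g := id) fun i hi =>
      (v1 i (Finset.mem_range.1 (Finset.mem_coe.1 hi))).2.2.2.2, Finset.image_id]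
  · intro v _
    rw [f7.idxArr 19 rfl, f6.idxArr 19 rfl, f5.idxArr 19 rfl, f4.idxArr 19 rfl,
      f3.idxArr 19 rfl, f2.idxArr 19 rfl, f1.idxArr 19 rfl, f0.idxArr 19 rfl,
      hσ.idx_zero 19 (by omega)]
  · intro u hu
    refine hB.sum_contrib hAlt (r := r) (H := σ.realArr 6) (E := σ.realArr 7) (fun v hv => ?_)
      (fun v hv => ?_) (fun v hv => ?_) (fun v hv => ?_) (fun v hv => ?_) (fun v hv => ?_) hu
    · rw [hα, Store.key, e1 10 (by omega), e1 11 (by omega), (k1 v hv).2.2.2.1,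
        k4 v (by omega), hσ.dist v hv, Key.neg_ofReal]
    · rw [Key.neg_ofReal]
      change (toLex (τ.realArr 12 v - τ.realArr 9 v, τ.realArr 13 v - 0) : Key) = _
      rw [e12, e13, e9, (t1 v hv).2.1, t3 v (by omega), hσ.dist v hv]
      congr 2 <;> ring
    · rw [hα, Store.key, e1 10 (by omega), e1 11 (by omega), (k1 v hv).2.2.2.2.1,
        (k1 v hv).2.2.2.2.2]
    · change (toLex (τ.realArr 12 _ - τ.realArr 9 _, τ.realArr 13 _ - 0) : Key) =
        toLex (-σ.realArr 6 v, -σ.realArr 7 v)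
      rw [e12, e13, e9, (t1 v hv).2.2.2.1, (t1 v hv).2.2.2.2]
      congr 2 <;> ring
    · rw [e1 14 (by omega), (k1 v hv).2.2.1, hσ.weight v hv]
    · rw [e1 14 (by omega), k2 v hv]

/-- Compute the scores of the candidates. -/
def computeScores : Cmd := build ;; ContractCmd.contract

theorem computeScores_runs {n : ℕ} {T : WeightedTree n} {r : ℕ → ℝ} {σ : Store} (hn : 0 < n)
    (hσ : Located T r σ) : Runs computeScores σ
      (1000 * (n + 1) + ((2200 * (3 * n + 1) + 4) * ⌊13 * Real.log (3 * n : ℕ)⌋₊ + 4))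
      fun τ => (∀ u < n, τ.realArr 15 (2 * n + u) =
        T.score r (σ.idxArr 9 u) (σ.realArr 6 u) (σ.realArr 7 u)) ∧ Frame computeScores σ τ := by
  refine ((build_runs hn hσ).seq ?_).frame
  rintro τ ⟨P, α, β, wt, C, hI, ⟨plen, hM⟩, hs⟩
  refine (ContractCmd.contract_runs hM hI).mono le_rfl fun υ hυ u hu => ?_
  rw [hυ _ (by omega), hs u hu]

end RealRAM

/-! ### Rooting the tree by elimination of leaves -/

namespace TreeLocation

open Finset

/-- The number of ends of the edge above `v` at the node `u`. -/
def ends (par : ℕ → ℕ) (v u : ℕ) : ℕ := (if v = u then 1 else 0) + if par v = u then 1 else 0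

/-- A list of the nodes other than the root, in which the children precede their parents. -/
structure IsOrder (n : ℕ) (par ord : ℕ → ℕ) : Prop where
  mem : ∀ i < n - 1, ord i < n ∧ ord i ≠ 0
  surj : ∀ v < n, v ≠ 0 → ∃ i < n - 1, ord i = v
  inj : ∀ i < n - 1, ∀ j < n - 1, ord i = ord j → i = j
  child : ∀ i < n - 1, ∀ c < n, c ≠ 0 → par c = ord i → ∃ j < i, ord j = c

/-- A state of the elimination of leaves: the nodes `ord i` for `i < k` have been removed, and
those for `i < t` have no other children. -/
structure Elim (n : ℕ) (par edge : ℕ → ℕ) (k t : ℕ) (deg sumE ord : ℕ → ℕ) : Prop where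
  deg_eq : ∀ u < n, (∀ j < k, ord j ≠ u) →
    deg u = ∑ v ∈ ((range n).erase 0).filter (fun v => ∀ j < k, ord j ≠ v), ends par v u
  sum_eq : ∀ u < n, (∀ j < k, ord j ≠ u) →
    sumE u = ∑ v ∈ ((range n).erase 0).filter (fun v => ∀ j < k, ord j ≠ v),
      ends par v u * edge v
  mem : ∀ i < t, ord i < n ∧ ord i ≠ 0
  inj : ∀ i < t, ∀ j < t, ord i = ord j → i = j
  le : k ≤ t
  child : ∀ i < t, ∀ c < n, c ≠ 0 → par c = ord i → ∃ j < i, j < k ∧ ord j = c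
  ready : ∀ u < n, u ≠ 0 → (∀ c < n, c ≠ 0 → par c = u → ∃ j < k, ord j = c) → ∃ i < t, ord i = u

section Elim

variable {n : ℕ} {par edge : ℕ → ℕ} {len : ℕ → ℝ} {d : ℕ → ℕ → ℝ} {k t : ℕ}
  {deg sumE ord : ℕ → ℕ}

theorem ends_self {u : ℕ} (h : par u ≠ u) : ends par u u = 1 := by
  rw [ends, if_pos rfl, if_neg h]

theorem ends_par {u v : ℕ} (h : v ≠ u) (h' : par v = u) : ends par v u = 1 := by
  rw [ends, if_neg h, if_pos h']

theorem ends_other {u v : ℕ} (h : v ≠ u) (h' : par v ≠ u) : ends par v u = 0 := by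
  rw [ends, if_neg h, if_neg h']

/-- A node has degree one if and only if all of its children have been removed. -/
theorem sum_ends_eq_one {S : Finset ℕ} {u : ℕ} (hu : u ∈ S) (h : par u ≠ u) :
    ∑ v ∈ S, ends par v u = 1 ↔ ∀ c ∈ S, par c ≠ u := by
  rw [← Finset.add_sum_erase _ _ hu, ends_self h, Nat.add_eq_left, Finset.sum_eq_zero_iff]
  constructor
  · intro hs c hc e
    by_cases hcu : c = u
    · exact h (hcu ▸ e)
    · have := hs c (Finset.mem_erase.2 ⟨hcu, hc⟩)
      rw [ends_par hcu e] at this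
      exact one_ne_zero this
  · intro hs c hc
    obtain ⟨hcu, hc⟩ := Finset.mem_erase.1 hc
    exact ends_other hcu (hs c hc)

namespace Elim

variable (hE : Elim n par edge k t deg sumE ord) (hR : RootedMetric n 0 par len d)

include hE hR

/-- The queue does not run empty: among the remaining nodes other than the root, one of maximal
level has lost all its children and so has been queued. -/
theorem lt (hk : k < n - 1) : k < t := by
  obtain ⟨lev, hlev⟩ := hR.rank
  have hne : (((range n).erase 0).filter (fun v => ∀ j < k, ord j ≠ v)).Nonempty := by
    by_contra hcon
    have hsub : (range n).erase 0 ⊆ (range k).image ord := by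
      intro v hv
      by_contra hv'
      refine hcon ⟨v, Finset.mem_filter.2 ⟨hv, fun j hj e => hv' ?_⟩⟩
      exact Finset.mem_image.2 ⟨j, Finset.mem_range.2 hj, e⟩
    have := Finset.card_le_card hsub
    rw [Finset.card_erase_of_mem (Finset.mem_range.2 hR.root_lt), Finset.card_range] at this
    have h2 := Finset.card_image_le (s := range k) (f := ord)
    rw [Finset.card_range] at h2
    omega
  obtain ⟨u, hu, hmax⟩ := Finset.exists_max_image _ lev hne
  simp only [Finset.mem_filter, Finset.mem_erase, Finset.mem_range] at hu hmax
  obtain ⟨i, hi, rfl⟩ := hE.ready u hu.1.2 hu.1.1 fun c hc hc0 e => by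
    by_contra hcon
    push Not at hcon
    have h1 := hmax c ⟨⟨hc0, hc⟩, hcon⟩
    have h2 := hlev c hc hc0
    rw [e] at h2
    omega
  by_contra hcon
  exact hu.2 i (by omega) rfl

omit hR in
theorem fresh (hk : k < t) : ∀ j < k, ord j ≠ ord k := fun j hj e => by
  have := hE.inj j (by omega) k hk e
  omega

omit hR in
-- A queued node has lost all its children, but `ord k` is only being removed now.
theorem par_fresh (hk : k < t) {i : ℕ} (hi : i < t) : ord i ≠ par (ord k) := fun e => by
  obtain ⟨hv, h0⟩ := hE.mem k hk
  obtain ⟨j, h1, h2, h3⟩ := hE.child i hi (ord k) hv h0 e.symm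
  exact hE.fresh hk j h2 h3

omit hE hR in
theorem mem_filter_iff {v : ℕ} : v ∈ ((range n).erase 0).filter (fun v => ∀ j < k, ord j ≠ v) ↔
    v < n ∧ v ≠ 0 ∧ ∀ j < k, ord j ≠ v := by
  simp only [Finset.mem_filter, Finset.mem_erase, Finset.mem_range]
  tauto

/-- All edges to children have been subtracted, so the sum of the numbers of the incident edges has
become the number of the edge to the parent. This finds the parent without adjacency lists. -/
theorem sumE_eq (hk : k < t) : sumE (ord k) = edge (ord k) := by
  obtain ⟨hv, h0⟩ := hE.mem k hk
  have hne : par (ord k) ≠ ord k := fun e => by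
    refine hR.par_notMem_sub hv h0 ?_
    rw [e]
    exact mem_sub_self _
  rw [hE.sum_eq _ hv (hE.fresh hk), Finset.sum_eq_single (ord k)]
  · rw [ends_self hne, one_mul]
  · intro c hc hck
    obtain ⟨h1, h2, h3⟩ := mem_filter_iff.1 hc
    rw [ends_other hck fun e => ?_, zero_mul]
    obtain ⟨j, -, h4, h5⟩ := hE.child k hk c h1 h2 e
    exact h3 j h4 h5
  · intro h
    exact absurd (mem_filter_iff.2 ⟨hv, h0, hE.fresh hk⟩) h

/-- The removal of the node `ord k`. -/
theorem step (hk : k < t) {t' : ℕ} {deg' sumE' ord' : ℕ → ℕ}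
    (hdeg : deg' = Function.update deg (par (ord k)) (deg (par (ord k)) - 1))
    (hsum : sumE' = Function.update sumE (par (ord k)) (sumE (par (ord k)) - edge (ord k)))
    (hpush : par (ord k) ≠ 0 ∧ deg' (par (ord k)) = 1 →
      t' = t + 1 ∧ ord' = Function.update ord t (par (ord k)))
    (hstay : ¬ (par (ord k) ≠ 0 ∧ deg' (par (ord k)) = 1) → t' = t ∧ ord' = ord) :
    Elim n par edge (k + 1) t' deg' sumE' ord' := by
  obtain ⟨hv, h0⟩ := hE.mem k hk
  set v := ord k with hvk
  set p := par v with hp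
  have hpn : p < n := hR.par_lt v hv
  have hpv : p ≠ v := fun e => by
    refine hR.par_notMem_sub hv h0 ?_
    rw [← hp, e]
    exact mem_sub_self _
  have hagree : ∀ i < t, ord' i = ord i := by
    intro i hi
    by_cases hc : p ≠ 0 ∧ deg' p = 1
    · rw [(hpush hc).2, Function.update_of_ne (by omega)]
    · rw [(hstay hc).2]
  have hrem : ∀ u, (∀ j < k + 1, ord' j ≠ u) ↔ (∀ j < k, ord j ≠ u) ∧ v ≠ u := by
    intro u
    constructor
    · intro h
      refine ⟨fun j hj => ?_, ?_⟩
      · rw [← hagree j (by omega)]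
        exact h j (by omega)
      · rw [hvk, ← hagree k hk]
        exact h k (by omega)
    · rintro ⟨h1, h2⟩ j hj
      rw [hagree j (by omega)]
      rcases Nat.lt_succ_iff_lt_or_eq.1 hj with h | rfl
      · exact h1 j h
      · exact h2
  have hvS : v ∈ ((range n).erase 0).filter (fun v => ∀ j < k, ord j ≠ v) :=
    mem_filter_iff.2 ⟨hv, h0, hE.fresh hk⟩
  have hS : ((range n).erase 0).filter (fun v => ∀ j < k + 1, ord' j ≠ v) =
      (((range n).erase 0).filter (fun v => ∀ j < k, ord j ≠ v)).erase v := by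
    ext u
    simp only [Finset.mem_filter, Finset.mem_erase, hrem]
    constructor
    · rintro ⟨h1, h2, h3⟩
      exact ⟨fun e => h3 e.symm, h1, h2⟩
    · rintro ⟨h1, h2, h3⟩
      exact ⟨h2, h3, fun e => h1 e.symm⟩
  have hdeg' : ∀ u < n, (∀ j < k + 1, ord' j ≠ u) →
      deg' u = ∑ v ∈ ((range n).erase 0).filter (fun v => ∀ j < k + 1, ord' j ≠ v),
        ends par v u := by
    intro u hu hu'
    obtain ⟨h1, h2⟩ := (hrem u).1 hu'
    have := hE.deg_eq u hu h1
    rw [← Finset.add_sum_erase _ _ hvS, ← hS] at this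
    rw [hdeg]
    by_cases e : u = p
    · rw [e, Function.update_self]
      rw [e, ends_par hpv.symm rfl] at this
      omega
    · rw [Function.update_of_ne e, this, ends_other h2 fun e' => e e'.symm, zero_add]
  have hpS : ∀ j < k + 1, ord' j ≠ p := (hrem p).2
    ⟨fun j hj => hE.par_fresh hk (by omega), hpv.symm⟩
  -- Degree one means that only the edge upwards is left; this is the moment at which the parent
  -- becomes a leaf and is queued.
  have hone : p ≠ 0 → (deg' p = 1 ↔ ∀ c < n, c ≠ 0 → par c = p → ∃ j < k + 1, ord' j = c) := by
    intro hp0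
    rw [hdeg' p hpn hpS, sum_ends_eq_one (Finset.mem_filter.2 ⟨Finset.mem_erase.2
      ⟨hp0, Finset.mem_range.2 hpn⟩, hpS⟩) (fun e => hR.par_notMem_sub hpn hp0 (by
        rw [e]
        exact mem_sub_self _))]
    constructor
    · intro h c hc hc0 e
      by_contra hcon
      push Not at hcon
      exact h c (Finset.mem_filter.2 ⟨Finset.mem_erase.2 ⟨hc0, Finset.mem_range.2 hc⟩, hcon⟩) e
    · intro h c hc e
      simp only [Finset.mem_filter, Finset.mem_erase, Finset.mem_range] at hc
      obtain ⟨j, hj, hj'⟩ := h c hc.1.2 hc.1.1 e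
      exact hc.2 j hj hj'
  have hready : ∀ u < n, u ≠ 0 → u ≠ p →
      (∀ c < n, c ≠ 0 → par c = u → ∃ j < k + 1, ord' j = c) → ∃ i < t, ord i = u := by
    intro u hu hu0 hup h
    refine hE.ready u hu hu0 fun c hc hc0 e => ?_
    obtain ⟨j, hj, hj'⟩ := h c hc hc0 e
    rw [hagree j (by omega)] at hj'
    rcases Nat.lt_succ_iff_lt_or_eq.1 hj with h' | rfl
    · exact ⟨j, h', hj'⟩
    · exact absurd (hj' ▸ e) fun e' => hup e'.symm
  have hchild : ∀ i < t, ∀ c < n, c ≠ 0 → par c = ord' i → ∃ j < i, j < k + 1 ∧ ord' j = c := by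
    intro i hi c hc hc0 e
    rw [hagree i hi] at e
    obtain ⟨j, h1, h2, h3⟩ := hE.child i hi c hc hc0 e
    exact ⟨j, h1, by omega, by rw [hagree j (by omega), h3]⟩
  refine ⟨hdeg', ?_, ?_, ?_, ?_, ?_, ?_⟩
  · intro u hu hu'
    obtain ⟨h1, h2⟩ := (hrem u).1 hu'
    have := hE.sum_eq u hu h1
    rw [← Finset.add_sum_erase _ _ hvS, ← hS] at this
    rw [hsum]
    by_cases e : u = p
    · rw [e, Function.update_self]
      rw [e, ends_par hpv.symm rfl] at this
      omega
    · rw [Function.update_of_ne e, this, ends_other h2 fun e' => e e'.symm, zero_mul, zero_add]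
  · intro i hi
    by_cases hc : p ≠ 0 ∧ deg' p = 1
    · obtain ⟨e1, e2⟩ := hpush hc
      by_cases e : i = t
      · rw [e2, e, Function.update_self]
        exact ⟨hpn, hc.1⟩
      · rw [hagree i (by omega)]
        exact hE.mem i (by omega)
    · obtain ⟨e1, e2⟩ := hstay hc
      rw [e2]
      exact hE.mem i (by omega)
  · intro i hi j hj e
    by_cases hc : p ≠ 0 ∧ deg' p = 1
    · obtain ⟨e1, e2⟩ := hpush hc
      have hpt : ord' t = p := by rw [e2, Function.update_self]
      by_cases ei : i = t
      · by_cases ej : j = t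
        · omega
        · rw [ei, hpt, hagree j (by omega)] at e
          exact absurd e.symm (hE.par_fresh hk (by omega))
      · by_cases ej : j = t
        · rw [ej, hpt, hagree i (by omega)] at e
          exact absurd e (hE.par_fresh hk (by omega))
        · rw [hagree i (by omega), hagree j (by omega)] at e
          exact hE.inj i (by omega) j (by omega) e
    · obtain ⟨e1, e2⟩ := hstay hc
      rw [e2] at e
      exact hE.inj i (by omega) j (by omega) e
  · by_cases hc : p ≠ 0 ∧ deg' p = 1
    · have := (hpush hc).1
      omega
    · have := (hstay hc).1
      omega
  · intro i hi c hc0 hcn e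
    by_cases hc : p ≠ 0 ∧ deg' p = 1
    · obtain ⟨e1, e2⟩ := hpush hc
      by_cases ei : i = t
      · rw [ei, e2, Function.update_self] at e
        obtain ⟨j, h1, h2⟩ := (hone hc.1).1 hc.2 c hc0 hcn e
        exact ⟨j, by omega, h1, h2⟩
      · exact hchild i (by omega) c hc0 hcn e
    · have := (hstay hc).1
      exact hchild i (by omega) c hc0 hcn e
  · intro u hu hu0 h
    by_cases hup : u = p
    · have hc : p ≠ 0 ∧ deg' p = 1 := ⟨hup ▸ hu0, (hone (hup ▸ hu0)).2 (hup ▸ h)⟩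
      obtain ⟨e1, e2⟩ := hpush hc
      exact ⟨t, by omega, by rw [e2, Function.update_self, hup]⟩
    · obtain ⟨i, hi, e⟩ := hready u hu hu0 hup h
      refine ⟨i, ?_, by rw [hagree i hi, e]⟩
      by_cases hc : p ≠ 0 ∧ deg' p = 1
      · have := (hpush hc).1
        omega
      · have := (hstay hc).1
        omega

/-- The `n - 1` removed nodes are distinct and differ from the root, so they are all the other
nodes. -/
theorem isOrder (hk : k = n - 1) : IsOrder n par ord := by
  have hle := hE.le
  have hinj : Set.InjOn ord (range (n - 1)) := fun i hi j hj e =>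
    hE.inj i (by have := Finset.mem_range.1 (Finset.mem_coe.1 hi); omega) j
      (by have := Finset.mem_range.1 (Finset.mem_coe.1 hj); omega) e
  have himg : (range (n - 1)).image ord = (range n).erase 0 := by
    refine Finset.eq_of_subset_of_card_le (fun v hv => ?_) ?_
    · obtain ⟨i, hi, rfl⟩ := Finset.mem_image.1 hv
      have := hE.mem i (by have := Finset.mem_range.1 hi; omega)
      exact Finset.mem_erase.2 ⟨this.2, Finset.mem_range.2 this.1⟩
    · rw [Finset.card_image_of_injOn hinj, Finset.card_erase_of_mem
        (Finset.mem_range.2 hR.root_lt), Finset.card_range, Finset.card_range]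
  refine ⟨fun i hi => hE.mem i (by omega), fun v hv h0 => ?_, fun i hi j hj e =>
    hE.inj i (by omega) j (by omega) e, fun i hi c hc h0 e => ?_⟩
  · have : v ∈ (range (n - 1)).image ord := by
      rw [himg]
      exact Finset.mem_erase.2 ⟨h0, Finset.mem_range.2 hv⟩
    obtain ⟨i, hi, e⟩ := Finset.mem_image.1 this
    exact ⟨i, Finset.mem_range.1 hi, e⟩
  · obtain ⟨j, h1, -, h2⟩ := hE.child i (by omega) c hc h0 e
    exact ⟨j, h1, h2⟩

end Elim

end Elim

end TreeLocation

namespace RealRAM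

open TreeLocation

/-- The memory holds the tree `T`. -/
structure Holds {n : ℕ} (T : WeightedTree n) (σ : Store) : Prop where
  size : σ.idx 0 = n
  src : ∀ e < n - 1, σ.idxArr 0 e = T.nsrc e
  dst : ∀ e < n - 1, σ.idxArr 1 e = T.ndst e
  len : ∀ e < n - 1, σ.realArr 0 e = T.nlen e

/-- The memory holds the parents of the nodes in `T`, the edges to them, their lengths, and a
list of the nodes in which the children precede their parents. -/
structure Rooted {n : ℕ} (T : WeightedTree n) (σ : Store) : Prop where
  par : ∀ v < n, σ.idxArr 6 v = T.par v
  edge : ∀ v < n, v ≠ 0 → σ.idxArr 7 v = T.edge v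
  len : ∀ v < n, σ.realArr 3 v = T.lenUp v
  order : IsOrder n T.par (σ.idxArr 5)

namespace RootCmd

/-- Compute the degrees of the nodes and the sums of the incident edges. -/
def countEdges : Cmd :=
  Cmd.forUp 28 (.sub (.var 0) (.lit 1))
    (.setIdx 24 (.read 0 (.var 28)) ;; .setIdx 25 (.read 1 (.var 28)) ;;
      .writeIdx 3 (.var 24) (.add (.read 3 (.var 24)) (.lit 1)) ;;
      .writeIdx 4 (.var 24) (.add (.read 4 (.var 24)) (.var 28)) ;;
      .writeIdx 3 (.var 25) (.add (.read 3 (.var 25)) (.lit 1)) ;;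
      .writeIdx 4 (.var 25) (.add (.read 4 (.var 25)) (.var 28)))

/-- Put the leaves other than the root into the queue. -/
def queueLeaves : Cmd :=
  .setIdx 31 (.lit 0) ;;
  Cmd.forUp 28 (.var 0)
    (.ite (.and (.not (.idxEq (.var 28) (.lit 0))) (.idxEq (.read 3 (.var 28)) (.lit 1)))
      (.writeIdx 5 (.var 31) (.var 28) ;; .setIdx 31 (.add (.var 31) (.lit 1))) .skip)

/-- Remove the nodes in the order of the queue. -/
def eliminate : Cmd :=
  Cmd.forUp 28 (.sub (.var 0) (.lit 1))
    (.setIdx 24 (.read 5 (.var 28)) ;; .setIdx 26 (.read 4 (.var 24)) ;;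
      .setIdx 25 (.sub (.add (.read 0 (.var 26)) (.read 1 (.var 26))) (.var 24)) ;;
      .writeIdx 6 (.var 24) (.var 25) ;; .writeIdx 7 (.var 24) (.var 26) ;;
      .writeReal 3 (.var 24) (.read 0 (.var 26)) ;;
      .writeIdx 3 (.var 25) (.sub (.read 3 (.var 25)) (.lit 1)) ;;
      .writeIdx 4 (.var 25) (.sub (.read 4 (.var 25)) (.var 26)) ;;
      .ite (.and (.not (.idxEq (.var 25) (.lit 0))) (.idxEq (.read 3 (.var 25)) (.lit 1)))
        (.writeIdx 5 (.var 31) (.var 25) ;; .setIdx 31 (.add (.var 31) (.lit 1))) .skip)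

variable {n : ℕ} {T : WeightedTree n} {σ : Store}

/-- Every edge is listed once, in one of two orientations, and is the edge above exactly one node;
the number of its ends at `u` does not depend on the orientation. -/
theorem sum_ends_edge (hn : 0 < n) (u : ℕ) (f : ℕ → ℕ) :
    ∑ e ∈ Finset.range (n - 1),
      ((if T.nsrc e = u then f e else 0) + if T.ndst e = u then f e else 0) =
    ∑ v ∈ (Finset.range n).erase 0, ends T.par v u * f (T.edge v) := by
  rw [WeightedTree.sum_edge (T := T) hn]
  refine Finset.sum_congr rfl fun v hv => ?_
  rw [Finset.mem_erase, Finset.mem_range] at hv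
  unfold ends
  rcases WeightedTree.edge_cases (T := T) hv.2 hv.1 with ⟨h1, h2⟩ | ⟨h1, h2⟩ <;> rw [h1, h2] <;>
    split_ifs <;> ring

theorem countEdges_runs (hn : 0 < n) (hT : Holds T σ) (hz3 : ∀ i, σ.idxArr 3 i = 0)
    (hz4 : ∀ i, σ.idxArr 4 i = 0) : Runs countEdges σ (60 * (n + 1)) fun τ =>
      (∀ u, τ.idxArr 3 u = ∑ v ∈ (Finset.range n).erase 0, ends T.par v u ∧
        τ.idxArr 4 u = ∑ v ∈ (Finset.range n).erase 0, ends T.par v u * T.edge v) ∧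
      Frame countEdges σ τ := by
  refine (Runs.forUp_wp (σ := σ) (n - 1) (fun k τ => ∀ u, τ.idxArr 3 u =
      ∑ e ∈ Finset.range k, ((if T.nsrc e = u then 1 else 0) + if T.ndst e = u then 1 else 0) ∧
      τ.idxArr 4 u =
      ∑ e ∈ Finset.range k, ((if T.nsrc e = u then e else 0) + if T.ndst e = u then e else 0)) rfl
      (fun τ hf => by simp only [IExp.eval]; rw [hf.idx 0 rfl, hT.size]) (fun _ _ _ h => h)
      (fun k τ hk h28 hf h => ?_) (fun u => by simp [hz3, hz4])).mono ?_ fun τ h => ?_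
  · have f0 := hf.idxArr 0 rfl
    have f1 := hf.idxArr 1 rfl
    simp only [Cmd.wp, IExp.eval, Store.setI_idx, Store.setIA_idx, Store.setI_idxArr, if_true,
      h28, f0, f1, show ((28 : ℕ) = 24) = False by simp, show ((24 : ℕ) = 25) = False by simp,
      show ((28 : ℕ) = 25) = False by simp, show ((3 : ℕ) = 4) = False by simp,
      show ((4 : ℕ) = 3) = False by simp, if_false, Store.setIA_idxArr, hT.src k hk, hT.dst k hk]
    intro u
    obtain ⟨h1, h2⟩ := h u
    rw [Finset.sum_range_succ, Finset.sum_range_succ, ← h1, ← h2]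
    by_cases e1 : u = T.nsrc k <;> by_cases e2 : u = T.ndst k
    · have e3 : T.nsrc k = T.ndst k := e1.symm.trans e2
      simp [e2, e3, add_assoc]
    · rw [Function.update_of_ne e2, Function.update_of_ne e2, e1, if_pos rfl, if_pos rfl,
        if_neg fun e => e2 (e1.trans e.symm), if_neg fun e => e2 (e1.trans e.symm)]
      simp
    · have e3 : T.ndst k ≠ T.nsrc k := fun e => e1 (e2.trans e)
      rw [e2, if_pos rfl, if_pos rfl, if_neg e3.symm, if_neg e3.symm]
      simp [e3]
    · simp [e1, e2, Ne.symm e1, Ne.symm e2]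
  · rw [Nat.sub_add_cancel hn]
    simp only [Cmd.bound, IExp.cost]
    omega
  · refine ⟨fun u => ?_, h.2⟩
    obtain ⟨h1, h2⟩ := h.1 u
    rw [h1, h2, sum_ends_edge hn u (fun e => e), sum_ends_edge hn u fun _ => 1]
    simp

theorem queueLeaves_runs (hn : 0 < n) (h0 : σ.idx 0 = n)
    (h3 : ∀ u, σ.idxArr 3 u = ∑ v ∈ (Finset.range n).erase 0, ends T.par v u)
    (h4 : ∀ u, σ.idxArr 4 u = ∑ v ∈ (Finset.range n).erase 0, ends T.par v u * T.edge v) :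
    Runs queueLeaves σ (40 * (n + 1)) fun τ =>
      Elim n T.par T.edge 0 (τ.idx 31) (τ.idxArr 3) (τ.idxArr 4) (τ.idxArr 5) ∧
      Frame queueLeaves σ τ := by
  have key := Runs.forUp_wp (x := 28) (m := .var 0)
    (c := .ite (.and (.not (.idxEq (.var 28) (.lit 0))) (.idxEq (.read 3 (.var 28)) (.lit 1)))
      (.writeIdx 5 (.var 31) (.var 28) ;; .setIdx 31 (.add (.var 31) (.lit 1))) .skip)
    (σ := σ.setI 31 0) n (fun k τ =>
      (∀ i < τ.idx 31, τ.idxArr 5 i < k ∧ τ.idxArr 5 i ≠ 0 ∧ σ.idxArr 3 (τ.idxArr 5 i) = 1) ∧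
      (∀ i < τ.idx 31, ∀ j < τ.idx 31, τ.idxArr 5 i = τ.idxArr 5 j → i = j) ∧
      ∀ u < k, u ≠ 0 → σ.idxArr 3 u = 1 → ∃ i < τ.idx 31, τ.idxArr 5 i = u) rfl
      (fun τ hf => by simp only [IExp.eval]; rw [hf.idx 0 rfl]; simp [h0]) (fun _ _ _ h => by
        simpa using h)
      (fun k τ hk h28 hf h => by
        have f3 : τ.idxArr 3 = σ.idxArr 3 := hf.idxArr 3 rfl
        obtain ⟨i1, i2, i3⟩ := h
        simp only [Cmd.wp, IExp.eval, Test.Holds, Store.setI_idx, Store.setIA_idx,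
          Store.setI_idxArr, if_true, h28, f3, Store.setIA_idxArr]
        refine ⟨fun hc => ⟨fun i hi => ?_, fun i hi j hj e => ?_, fun u hu hu0 hu1 => ?_⟩,
          fun hc => ⟨fun i hi => ?_, i2, fun u hu hu0 hu1 => ?_⟩⟩
        · by_cases e : i = τ.idx 31
          · rw [e, Function.update_self]
            exact ⟨Nat.lt_succ_self k, hc⟩
          · rw [Function.update_of_ne e]
            have := i1 i (by omega)
            exact ⟨by omega, this.2⟩
        · by_cases ei : i = τ.idx 31 <;> by_cases ej : j = τ.idx 31
          · omega
          · rw [ei, Function.update_self, Function.update_of_ne ej] at e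
            have := i1 j (by omega)
            omega
          · rw [ej, Function.update_self, Function.update_of_ne ei] at e
            have := i1 i (by omega)
            omega
          · rw [Function.update_of_ne ei, Function.update_of_ne ej] at e
            exact i2 i (by omega) j (by omega) e
        · by_cases e : u = k
          · exact ⟨τ.idx 31, Nat.lt_succ_self _, by rw [Function.update_self, e]⟩
          · obtain ⟨i, hi, hi'⟩ := i3 u (by omega) hu0 hu1
            exact ⟨i, by omega, by rw [Function.update_of_ne (by omega), hi']⟩
        · have := i1 i hi
          exact ⟨by omega, this.2⟩
        · by_cases e : u = k
          · exact absurd ⟨e ▸ hu0, e ▸ hu1⟩ hc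
          · exact i3 u (by omega) hu0 hu1)
      ⟨fun i hi => absurd hi (by simp), fun i hi => absurd hi (by simp), fun u hu =>
        absurd hu (Nat.not_lt_zero u)⟩
  refine Runs.mono (Runs.frame (Runs.wp_seq (s := 2) (by
    simp only [Cmd.wp, IExp.eval]
    refine key.mono le_rfl fun τ ⟨⟨i1, i2, i3⟩, hf⟩ => ?_
    have f3 : τ.idxArr 3 = σ.idxArr 3 := hf.idxArr 3 rfl
    have f4 : τ.idxArr 4 = σ.idxArr 4 := hf.idxArr 4 rfl
    have hone : ∀ u < n, u ≠ 0 → (σ.idxArr 3 u = 1 ↔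
        ∀ c ∈ (Finset.range n).erase 0, T.par c ≠ u) := fun u hu hu0 => by
      rw [h3, sum_ends_eq_one (Finset.mem_erase.2 ⟨hu0, Finset.mem_range.2 hu⟩)
        (WeightedTree.par_ne hu hu0)]
    refine (⟨fun u _ _ => by rw [f3, h3]; simp, fun u _ _ => by rw [f4, h4]; simp, fun i hi =>
      ⟨(i1 i hi).1, (i1 i hi).2.1⟩, i2, Nat.zero_le _, fun i hi c hc hc0 e => ?_,
      fun u hu hu0 h => i3 u hu hu0 ?_⟩ :
        Elim n T.par T.edge 0 (τ.idx 31) (τ.idxArr 3) (τ.idxArr 4) (τ.idxArr 5))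
    · obtain ⟨l1, l2, l3⟩ := i1 i hi
      exact absurd e ((hone _ l1 l2).1 l3 c (Finset.mem_erase.2 ⟨hc0, Finset.mem_range.2 hc⟩))
    · rw [hone u hu hu0]
      intro c hc e
      obtain ⟨hc0, hc⟩ := Finset.mem_erase.1 hc
      obtain ⟨j, hj, -⟩ := h c (Finset.mem_range.1 hc) hc0 e
      exact absurd hj (Nat.not_lt_zero j)) (by simp [Cmd.bound, IExp.cost]))) ?_ fun _ h => h
  simp only [Cmd.bound, IExp.cost, Test.cost]
  omega

theorem eliminate_runs (hn : 0 < n) (hT : Holds T σ) (hz6 : σ.idxArr 6 0 = 0)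
    (hz3 : σ.realArr 3 0 = 0)
    (hE : Elim n T.par T.edge 0 (σ.idx 31) (σ.idxArr 3) (σ.idxArr 4) (σ.idxArr 5)) :
    Runs eliminate σ (80 * (n + 1)) fun τ => Rooted T τ ∧ Frame eliminate σ τ := by
  have hR := T.rootedMetric hn
  refine (Runs.forUp_wp (σ := σ) (n - 1) (fun k τ =>
      Elim n T.par T.edge k (τ.idx 31) (τ.idxArr 3) (τ.idxArr 4) (τ.idxArr 5) ∧
      (∀ i < k, τ.idxArr 6 (τ.idxArr 5 i) = T.par (τ.idxArr 5 i) ∧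
        τ.idxArr 7 (τ.idxArr 5 i) = T.edge (τ.idxArr 5 i) ∧
        τ.realArr 3 (τ.idxArr 5 i) = T.lenUp (τ.idxArr 5 i)) ∧
      τ.idxArr 6 0 = 0 ∧ τ.realArr 3 0 = 0) rfl
      (fun τ hf => by simp only [IExp.eval]; rw [hf.idx 0 rfl, hT.size])
      (fun _ _ _ h => by simpa using h)
      (fun k τ hk h28 hf h => ?_)
      ⟨hE, fun i hi => absurd hi (Nat.not_lt_zero i), hz6, hz3⟩).mono ?_ fun τ h => ⟨?_, h.2⟩
  · have f0 := hf.idxArr 0 rfl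
    have f1 := hf.idxArr 1 rfl
    have g0 := hf.realArr 0 rfl
    obtain ⟨hE, h1, h6, h3⟩ := h
    have hkt := hE.lt hR hk
    obtain ⟨hv, hv0⟩ := hE.mem k hkt
    have hs := hE.sumE_eq hR hkt
    set v := τ.idxArr 5 k with hvdef
    have he := WeightedTree.edge_lt (T := T) hv hv0
    -- The other end of the edge is the sum of the two ends minus `v`, whichever orientation is
    -- listed.
    have hp : σ.idxArr 0 (T.edge v) + σ.idxArr 1 (T.edge v) - v = T.par v := by
      rw [hT.src _ he, hT.dst _ he]
      rcases WeightedTree.edge_cases (T := T) hv hv0 with ⟨e1, e2⟩ | ⟨e1, e2⟩ <;> rw [e1, e2] <;>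
        omega
    have hl : σ.realArr 0 (T.edge v) = T.lenUp v := by
      rw [hT.len _ he, WeightedTree.nlen_edge hv hv0]
    have hkeep : ∀ (ord' : ℕ → ℕ), (∀ i < τ.idx 31, ord' i = τ.idxArr 5 i) →
        (∀ i < k + 1, Function.update (τ.idxArr 6) v (T.par v) (ord' i) = T.par (ord' i) ∧
        Function.update (τ.idxArr 7) v (T.edge v) (ord' i) = T.edge (ord' i) ∧
        Function.update (τ.realArr 3) v (T.lenUp v) (ord' i) = T.lenUp (ord' i)) ∧
        Function.update (τ.idxArr 6) v (T.par v) 0 = 0 ∧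
        Function.update (τ.realArr 3) v (T.lenUp v) 0 = 0 := by
      intro ord' ho
      refine ⟨fun i hi => ?_, ?_, ?_⟩
      · rw [ho i (by omega)]
        by_cases e : i = k
        · rw [e, ← hvdef]
          simp
        · have : τ.idxArr 5 i ≠ v := hE.fresh hkt i (by omega)
          rw [Function.update_of_ne this, Function.update_of_ne this, Function.update_of_ne this]
          exact h1 i (by omega)
      · rw [Function.update_of_ne hv0.symm, h6]
      · rw [Function.update_of_ne hv0.symm, h3]
    simp only [Cmd.wp, IExp.eval, RExp.eval, Test.Holds, Store.setI_idx, Store.setIA_idx,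
      Store.setI_idxArr, Store.setRA_idx, Store.setRA_idxArr, Store.setIA_realArr,
      Store.setI_realArr, Store.setRA_realArr, if_true, h28, ← hvdef, hs, f0, f1, g0, hp, hl,
      Store.setIA_idxArr,
      show ((24 : ℕ) = 26) = False by simp, show ((24 : ℕ) = 25) = False by simp,
      show ((26 : ℕ) = 25) = False by simp, show ((31 : ℕ) = 24) = False by simp,
      show ((31 : ℕ) = 25) = False by simp, show ((31 : ℕ) = 26) = False by simp, if_false]
    simp only [show ((3 : ℕ) = 4) = False by simp, show ((4 : ℕ) = 3) = False by simp,
      show ((3 : ℕ) = 5) = False by simp, show ((4 : ℕ) = 5) = False by simp,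
      show ((6 : ℕ) = 5) = False by simp, show ((7 : ℕ) = 5) = False by simp,
      show ((6 : ℕ) = 4) = False by simp, show ((7 : ℕ) = 4) = False by simp,
      show ((6 : ℕ) = 3) = False by simp, show ((7 : ℕ) = 3) = False by simp,
      show ((6 : ℕ) = 7) = False by simp, show ((7 : ℕ) = 6) = False by simp,
      show ((5 : ℕ) = 4) = False by simp, show ((5 : ℕ) = 3) = False by simp,
      show ((5 : ℕ) = 7) = False by simp, show ((5 : ℕ) = 6) = False by simp,
      show ((3 : ℕ) = 7) = False by simp, show ((3 : ℕ) = 6) = False by simp,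
      show ((4 : ℕ) = 7) = False by simp, show ((4 : ℕ) = 6) = False by simp, if_false]
    refine ⟨fun hc => ⟨hE.step hR hkt rfl rfl (fun _ => ⟨rfl, rfl⟩) (fun hc' => ?_),
      hkeep _ fun i hi => Function.update_of_ne (by omega) _ _⟩,
      fun hc => ⟨hE.step hR hkt rfl rfl (fun hc' => ?_) fun _ => ⟨rfl, rfl⟩,
      hkeep _ fun i hi => rfl⟩⟩
    · exact absurd hc hc'
    · exact absurd hc' hc
  · rw [Nat.sub_add_cancel hn]
    simp only [Cmd.bound, IExp.cost, RExp.cost, Test.cost]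
    omega
  · obtain ⟨⟨hE, h1, h6, h3⟩, hf⟩ := h
    have hO := hE.isOrder hR rfl
    refine ⟨fun v hv => ?_, fun v hv h0 => ?_, fun v hv => ?_, hO⟩
    · by_cases h0 : v = 0
      · rw [h0, h6, WeightedTree.par_zero]
      · obtain ⟨i, hi, rfl⟩ := hO.surj v hv h0
        exact (h1 i hi).1
    · obtain ⟨i, hi, rfl⟩ := hO.surj v hv h0
      exact (h1 i hi).2.1
    · by_cases h0 : v = 0
      · rw [h0, h3, WeightedTree.lenUp, WeightedTree.par_zero, WeightedTree.ndist_self]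
      · obtain ⟨i, hi, rfl⟩ := hO.surj v hv h0
        exact (h1 i hi).2.2

/-- Compute the parents of the nodes. -/
def root : Cmd := countEdges ;; queueLeaves ;; eliminate

theorem root_runs (hn : 0 < n) (hT : Holds T σ)
    (hz : ∀ a, a = 3 ∨ a = 4 ∨ a = 6 → ∀ i, σ.idxArr a i = 0) (hz3 : σ.realArr 3 0 = 0) :
    Runs root σ (180 * (n + 1)) fun τ => Rooted T τ ∧ Frame root σ τ := by
  refine Runs.mono (Runs.frame ((countEdges_runs hn hT (hz 3 (by omega))
    (hz 4 (by omega))).seq (t' := 40 * (n + 1) + 80 * (n + 1)) (Q := fun τ => Rooted T τ)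
    fun σ1 ⟨h1, f1⟩ => ?_)) (by omega) fun _ h => h
  have s1 := (f1.idx 0 rfl).trans hT.size
  refine (queueLeaves_runs (T := T) hn s1 (fun u => (h1 u).1) (fun u => (h1 u).2)).seq
    fun σ2 ⟨hE, f2⟩ => ?_
  refine (eliminate_runs hn ⟨(f2.idx 0 rfl).trans s1, fun e he => ?_, fun e he => ?_,
    fun e he => ?_⟩ ?_ ?_ hE).mono le_rfl fun _ h => h.1
  · rw [f2.idxArr 0 rfl, f1.idxArr 0 rfl, hT.src e he]
  · rw [f2.idxArr 1 rfl, f1.idxArr 1 rfl, hT.dst e he]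
  · rw [f2.realArr 0 rfl, f1.realArr 0 rfl, hT.len e he]
  · rw [f2.idxArr 6 rfl, f1.idxArr 6 rfl]
    exact hz 6 (by omega) 0
  · rw [f2.realArr 3 rfl, f1.realArr 3 rfl, hz3]

end RootCmd

end RealRAM

/-! ### Distances by relaxation along the edges -/

namespace TreeLocation

/-- The function `g` is at most `f`, and at least the distance function with initial values `f`. -/
structure Relaxed {n : ℕ} (T : WeightedTree n) (f g : ℕ → ℝ) : Prop where
  le : ∀ v < n, g v ≤ f v
  reach : ∀ v < n, ∃ u < n, f u + T.ndist u v ≤ g v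

theorem Relaxed.refl {n : ℕ} (T : WeightedTree n) (f : ℕ → ℝ) : Relaxed T f f :=
  ⟨fun _ _ => le_rfl, fun v hv => ⟨v, hv, by rw [WeightedTree.ndist_self, add_zero]⟩⟩

theorem update_min_le (g : ℕ → ℝ) (p : ℕ) (c : ℝ) (v : ℕ) :
    Function.update g p (min (g p) c) v ≤ g v := by
  by_cases e : v = p
  · rw [e, Function.update_self]
    exact min_le_left _ _
  · rw [Function.update_of_ne e]

theorem Relaxed.update {n : ℕ} {T : WeightedTree n} {f g : ℕ → ℝ} (h : Relaxed T f g) {v p : ℕ}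
    (hv : v < n) (hp : p < n) :
    Relaxed T f (Function.update g p (min (g p) (g v + T.ndist v p))) := by
  refine ⟨fun w hw => (update_min_le g p _ w).trans (h.le w hw), fun w hw => ?_⟩
  by_cases e : w = p
  · rw [e, Function.update_self]
    rcases min_choice (g p) (g v + T.ndist v p) with e | e <;> rw [e]
    · exact h.reach p hp
    · obtain ⟨u, hu, h1⟩ := h.reach v hv
      exact ⟨u, hu, by linarith [WeightedTree.ndist_triangle (T := T) hu hv hp]⟩
  · rw [Function.update_of_ne e]
    exact h.reach w hw

end TreeLocation

namespace RealRAM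

open TreeLocation

/-- Replace the entry of a real array by its minimum with a number. -/
def Cmd.lower (g : ℕ) (i : IExp) (e : RExp) : Cmd :=
  .ite (.realLt e (.read g i)) (.writeReal g i e) .skip

theorem Cmd.wp_lower {g : ℕ} {i : IExp} {e : RExp} {σ : Store} {Q : Store → Prop}
    (h : Q (σ.setRA g (i.eval σ) (min (σ.realArr g (i.eval σ)) (e.eval σ)))) :
    (Cmd.lower g i e).wp Q σ := by
  refine ⟨fun hb => ?_, fun hb => ?_⟩
  · simp only [Test.Holds, RExp.eval] at hb
    rwa [min_eq_right hb.le] at h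
  · simp only [Test.Holds, RExp.eval, not_lt] at hb
    rw [min_eq_left hb] at h
    simpa [Store.setRA, Cmd.wp] using h

theorem Rooted.congr {n : ℕ} {T : WeightedTree n} {σ τ : Store} (h : Rooted T σ) (h5 : τ.idxArr 5 = σ.idxArr 5)
    (h6 : τ.idxArr 6 = σ.idxArr 6) (h7 : τ.idxArr 7 = σ.idxArr 7)
    (h3 : τ.realArr 3 = σ.realArr 3) : Rooted T τ :=
  ⟨h6 ▸ h.par, h7 ▸ h.edge, h3 ▸ h.len, h5 ▸ h.order⟩

namespace DistCmd

/-- Propagate distances from the children to the parents. -/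
def relaxUp (g : ℕ) : Cmd :=
  Cmd.forUp 28 (.sub (.var 0) (.lit 1))
    (.setIdx 24 (.read 5 (.var 28)) ;; .setIdx 25 (.read 6 (.var 24)) ;;
      .lower g (.var 25) (.add (.read g (.var 24)) (.read 3 (.var 24))))

/-- Propagate distances from the parents to the children. -/
def relaxDown (g : ℕ) : Cmd :=
  Cmd.forDown 28 (.sub (.var 0) (.lit 1))
    (.setIdx 24 (.read 5 (.var 28)) ;; .setIdx 25 (.read 6 (.var 24)) ;;
      .lower g (.var 24) (.add (.read g (.var 25)) (.read 3 (.var 24))))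

variable {n g : ℕ} {T : WeightedTree n} {σ : Store} {f : ℕ → ℝ}

/-- With children before parents, an entry is final once its node is processed, so an inequality
that has been established for an edge is never destroyed: afterwards only its upper end can
decrease. -/
theorem relaxUp_runs (hn : 0 < n) (h0 : σ.idx 0 = n) (hT : Rooted T σ) (hg : g ≠ 3)
    (hf : Relaxed T f (σ.realArr g)) :
    Runs (relaxUp g) σ (40 * (n + 1)) fun τ => (Relaxed T f (τ.realArr g) ∧
      ∀ j < n - 1, τ.realArr g (T.par (σ.idxArr 5 j)) ≤
        τ.realArr g (σ.idxArr 5 j) + T.lenUp (σ.idxArr 5 j)) ∧ Frame (relaxUp g) σ τ := by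
  refine (Runs.forUp_wp (σ := σ) (n - 1) (fun k τ => Relaxed T f (τ.realArr g) ∧
      ∀ j < k, τ.realArr g (T.par (σ.idxArr 5 j)) ≤
        τ.realArr g (σ.idxArr 5 j) + T.lenUp (σ.idxArr 5 j)) rfl
      (fun τ hf => by simp only [IExp.eval]; rw [hf.idx 0 rfl, h0])
      (fun _ _ _ h => h) (fun k τ hk h28 hF h => ?_)
      ⟨hf, fun j hj => absurd hj (Nat.not_lt_zero j)⟩).mono ?_ fun _ h => h
  · have f5 := hF.idxArr 5 rfl
    have f6 := hF.idxArr 6 rfl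
    have f3 := hF.realArr 3 (by simp [Cmd.forUp, Cmd.touches, Cmd.lower, hg.symm])
    obtain ⟨hv, hv0⟩ := hT.order.mem k hk
    have hp := WeightedTree.par_lt (T := T) hv
    refine Cmd.wp_lower ?_
    simp only [IExp.eval, RExp.eval, Store.setI_idx, Store.setI_idxArr, Store.setI_realArr,
      if_true, h28, f5, f6, f3, hT.par _ hv, hT.len _ hv,
      show ((24 : ℕ) = 25) = False by simp, if_false, Store.setRA_realArr]
    obtain ⟨h1, h2⟩ := h
    refine ⟨h1.update hv hp, fun j hj => ?_⟩
    by_cases e : j = k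
    · rw [e, Function.update_self, Function.update_of_ne (WeightedTree.par_ne hv hv0).symm]
      exact min_le_right _ _
    -- The node `ord j` is not lowered later, because all of its children precede it.
    · have hne : σ.idxArr 5 j ≠ T.par (σ.idxArr 5 k) := by
        intro e'
        obtain ⟨i, hi, hi'⟩ := hT.order.child j (by omega) _ hv hv0 e'.symm
        have := hT.order.inj i (by omega) k hk hi'
        omega
      rw [Function.update_of_ne hne]
      exact (update_min_le _ _ _ _).trans (h2 j (by omega))
  · rw [Nat.sub_add_cancel hn]
    simp only [Cmd.bound, Cmd.lower, IExp.cost, RExp.cost, Test.cost]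
    omega

/-- With parents before children, the inequalities in the other direction are established and
persist, and those of the upward pass survive: a lowered entry is that of the parent plus a
non-negative length. -/
theorem relaxDown_runs (hn : 0 < n) (h0 : σ.idx 0 = n) (hT : Rooted T σ) (hg : g ≠ 3)
    (hf : Relaxed T f (σ.realArr g)) (hU : ∀ j < n - 1, σ.realArr g (T.par (σ.idxArr 5 j)) ≤
        σ.realArr g (σ.idxArr 5 j) + T.lenUp (σ.idxArr 5 j)) :
    Runs (relaxDown g) σ (40 * (n + 1)) fun τ => (Relaxed T f (τ.realArr g) ∧
      (∀ j < n - 1, τ.realArr g (T.par (σ.idxArr 5 j)) ≤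
        τ.realArr g (σ.idxArr 5 j) + T.lenUp (σ.idxArr 5 j)) ∧
      ∀ j < n - 1, τ.realArr g (σ.idxArr 5 j) ≤ τ.realArr g (T.par (σ.idxArr 5 j)) +
        T.lenUp (σ.idxArr 5 j)) ∧ Frame (relaxDown g) σ τ := by
  refine (Runs.forDown_wp (σ := σ) (n - 1) (fun k τ => Relaxed T f (τ.realArr g) ∧
      (∀ j < n - 1, τ.realArr g (T.par (σ.idxArr 5 j)) ≤
        τ.realArr g (σ.idxArr 5 j) + T.lenUp (σ.idxArr 5 j)) ∧
      ∀ j < n - 1, k ≤ j → τ.realArr g (σ.idxArr 5 j) ≤ τ.realArr g (T.par (σ.idxArr 5 j)) +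
        T.lenUp (σ.idxArr 5 j)) rfl (by simp only [IExp.eval]; rw [h0])
      (fun _ _ _ h => h) (fun k τ hk h28 hF h => ?_)
      ⟨hf, hU, fun j hj hj' => absurd hj (by omega)⟩).mono ?_ fun _ h =>
        ⟨⟨h.1.1, h.1.2.1, fun j hj => h.1.2.2 j hj (Nat.zero_le j)⟩, h.2⟩
  · have f5 := hF.idxArr 5 rfl
    have f6 := hF.idxArr 6 rfl
    have f3 := hF.realArr 3 (by simp [Cmd.forDown, Cmd.touches, Cmd.lower, hg.symm])
    obtain ⟨hv, hv0⟩ := hT.order.mem k hk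
    have hp := WeightedTree.par_lt (T := T) hv
    refine Cmd.wp_lower ?_
    simp only [IExp.eval, RExp.eval, Store.setI_idx, Store.setI_idxArr, Store.setI_realArr,
      if_true, h28, f5, f6, f3, hT.par _ hv, hT.len _ hv,
      show ((24 : ℕ) = 25) = False by simp, if_false, Store.setRA_realArr]
    obtain ⟨h1, h2, h3⟩ := h
    have hup : T.lenUp (σ.idxArr 5 k) = T.ndist (T.par (σ.idxArr 5 k)) (σ.idxArr 5 k) :=
      WeightedTree.ndist_comm
    refine ⟨hup ▸ h1.update hp hv, fun j hj => ?_, fun j hj hkj => ?_⟩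
    · by_cases e : j = k
      · rw [e, Function.update_self, Function.update_of_ne (WeightedTree.par_ne hv hv0)]
        rcases min_choice (τ.realArr g (σ.idxArr 5 k)) (τ.realArr g (T.par (σ.idxArr 5 k)) +
          T.lenUp (σ.idxArr 5 k)) with e' | e' <;> rw [e']
        · exact h2 k hk
        · linarith [WeightedTree.lenUp_nonneg (T := T) (v := σ.idxArr 5 k)]
      · rw [Function.update_of_ne fun e' => e (hT.order.inj j hj k hk e')]
        exact (update_min_le _ _ _ _).trans (h2 j hj)
    · by_cases e : j = k
      · rw [e, Function.update_self, Function.update_of_ne (WeightedTree.par_ne hv hv0)]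
        exact min_le_right _ _
      · have hne : T.par (σ.idxArr 5 j) ≠ σ.idxArr 5 k := by
          intro e'
          obtain ⟨hj1, hj0⟩ := hT.order.mem j hj
          obtain ⟨i, hi, hi'⟩ := hT.order.child k hk _ hj1 hj0 e'
          have := hT.order.inj i (by omega) j hj hi'
          omega
        rw [Function.update_of_ne hne]
        exact (update_min_le _ _ _ _).trans (h3 j hj (by omega))
  · rw [Nat.sub_add_cancel hn]
    simp only [Cmd.bound, Cmd.lower, IExp.cost, RExp.cost, Test.cost]
    omega

/-- Propagate distances through the tree. -/
def relax (g : ℕ) : Cmd := relaxUp g ;; relaxDown g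

/-- After both passes the entries are 1-Lipschitz along edges, hence for the tree metric, and do not
exceed the initial values. This bounds them by the distances with these initial values; `Relaxed`
gives the other bound. -/
theorem relax_runs (hn : 0 < n) (h0 : σ.idx 0 = n) (hT : Rooted T σ) (hg : g ≠ 3) :
    Runs (relax g) σ (80 * (n + 1)) fun τ => (∀ v < n,
      (∃ u < n, σ.realArr g u + T.ndist u v ≤ τ.realArr g v) ∧
      ∀ u < n, τ.realArr g v ≤ σ.realArr g u + T.ndist u v) ∧ Frame (relax g) σ τ := by
  refine Runs.mono (Runs.frame ((relaxUp_runs hn h0 hT hg (Relaxed.refl T _)).seq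
    (t' := 40 * (n + 1)) (Q := fun τ => ∀ v < n,
      (∃ u < n, σ.realArr g u + T.ndist u v ≤ τ.realArr g v) ∧
      ∀ u < n, τ.realArr g v ≤ σ.realArr g u + T.ndist u v) fun τ ⟨⟨h1, h2⟩, h3⟩ => ?_))
    (by omega) fun _ h => h
  have f5 := h3.idxArr 5 rfl
  have hT' : Rooted T τ := Rooted.congr hT f5 (h3.idxArr 6 rfl) (h3.idxArr 7 rfl)
    (h3.realArr 3 (by simp [relaxUp, Cmd.forUp, Cmd.touches, Cmd.lower, hg.symm]))
  rw [← f5] at h2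
  refine (relaxDown_runs hn ((h3.idx 0 rfl).trans h0) hT' hg h1 h2).mono le_rfl
    fun υ ⟨⟨i1, i2, i3⟩, _⟩ v hv => ⟨i1.reach v hv, fun u hu => ?_⟩
  have hl := (T.rootedMetric hn).lipschitz (g := υ.realArr g) (fun w hw hw0 => ?_)
    (fun w hw hw0 => ?_) hu hv
  · exact hl.trans (by linarith [i1.le u hu])
  · obtain ⟨j, hj, rfl⟩ := hT'.order.surj w hw hw0
    exact i3 j hj
  · obtain ⟨j, hj, rfl⟩ := hT'.order.surj w hw hw0
    exact i2 j hj

/-- Set the first entries of a real array to the value of a real variable. -/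
def fill (g : ℕ) : Cmd := Cmd.forUp 28 (.var 0) (.writeReal g (.var 28) (.var 12))

theorem fill_runs (h0 : σ.idx 0 = n) : Runs (fill g) σ (20 * (n + 1)) fun τ =>
    (∀ v < n, τ.realArr g v = σ.real 12) ∧ Frame (fill g) σ τ := by
  refine (Runs.forUp_wp (σ := σ) n (fun k τ => ∀ v < k, τ.realArr g v = σ.real 12) rfl
      (fun τ hf => by exact (hf.idx 0 rfl).trans h0) (fun _ _ _ h => h) (fun k τ hk h28 hF h => ?_)
      fun j hj => absurd hj (Nat.not_lt_zero j)).mono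
      (Nat.mul_le_mul_right _ (by simp [Cmd.bound, IExp.cost, RExp.cost])) fun _ h => h
  have f12 := hF.real 12 rfl
  simp only [Cmd.wp, IExp.eval, RExp.eval, h28, f12, Store.setRA_realArr, if_true]
  intro v hv
  by_cases e : v = k
  · rw [e, Function.update_self]
  · rw [Function.update_of_ne e]
    exact h v (by omega)

/-- Compute the distances from a node. -/
def distFrom (g : ℕ) (a : IExp) : Cmd := fill g ;; .writeReal g a (.lit 0) ;; relax g

/-- The real variable holds a number that exceeds all distances. -/
def Large {n : ℕ} (T : WeightedTree n) (σ : Store) : Prop := 2 * ∑ e, T.len e ≤ σ.real 12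

theorem Large.ndist_le (h : Large T σ) {u v : ℕ} (hu : u < n) (hv : v < n) :
    T.ndist u v ≤ σ.real 12 := by
  have := T.pointDist_le_sum ⟨u, hu⟩ (.node ⟨v, hv⟩)
  rw [WeightedTree.pointDist, ← WeightedTree.ndist_eq hu hv] at this
  exact this.trans h

/-- The initial values are zero at `c` and, elsewhere, a number that no distance exceeds. -/
theorem distFrom_runs (hT : Rooted T σ) (h0 : σ.idx 0 = n) (hL : Large T σ) (hg : g ≠ 3)
    {a : IExp} {c : ℕ} (hc : c < n) (ha : ∀ τ, Frame (fill g) σ τ → a.eval τ = c)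
    (hac : a.cost ≤ 10) :
    Runs (distFrom g a) σ (120 * (n + 1)) fun τ => (∀ v < n, τ.realArr g v = T.ndist c v) ∧
      Frame (distFrom g a) σ τ := by
  refine Runs.mono (Runs.frame ((fill_runs h0).seq (t' := 12 + 80 * (n + 1))
    (Q := fun τ => ∀ v < n, τ.realArr g v = T.ndist c v) fun τ ⟨h1, h2⟩ => Runs.wp_seq ?_
    (by simp only [Cmd.bound, RExp.cost]; omega))) (by omega) fun _ h => h
  simp only [Cmd.wp, ha τ h2, RExp.eval, Nat.cast_zero]
  have hT' : Rooted T (τ.setRA g c 0) := Rooted.congr hT (h2.idxArr 5 rfl) (h2.idxArr 6 rfl)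
    (h2.idxArr 7 rfl) (by
      rw [Store.setRA_realArr, if_neg hg.symm]
      exact h2.realArr 3 (by simp [fill, Cmd.forUp, Cmd.touches, hg.symm]))
  refine (relax_runs (σ := τ.setRA g c 0) (by omega) ((h2.idx 0 rfl).trans h0) hT' hg).mono le_rfl
    fun υ ⟨h3, _⟩ v hv => ?_
  simp only [Store.setRA_realArr, if_true] at h3
  obtain ⟨⟨u, hu, h4⟩, h5⟩ := h3 v hv
  refine le_antisymm ?_ (le_trans ?_ h4)
  · have := h5 c hc
    rwa [Function.update_self, zero_add] at this
  · by_cases e : u = c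
    · rw [e, Function.update_self, zero_add]
    · rw [Function.update_of_ne e, h1 u hu]
      -- A start at another node costs at least the distance from `c`.
      have := hL.ndist_le hc hv
      linarith [WeightedTree.ndist_nonneg (T := T) (u := u) (v := v)]

/-- Compute a number that exceeds all distances. -/
def large : Cmd :=
  Cmd.forUp 28 (.sub (.var 0) (.lit 1))
    (.setReal 12 (.add (.var 12) (.mul (.lit 2) (.read 0 (.var 28)))))

theorem large_runs (hn : 0 < n) (hT : Holds T σ) (h12 : σ.real 12 = 0) :
    Runs large σ (20 * (n + 1)) fun τ => Large T τ ∧ Frame large σ τ := by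
  refine (Runs.forUp_wp (σ := σ) (n - 1)
      (fun k τ => τ.real 12 = 2 * ∑ e ∈ Finset.range k, T.nlen e) rfl
      (fun τ hf => by simp only [IExp.eval]; rw [hf.idx 0 rfl, hT.size])
      (fun _ _ _ h => h) (fun k τ hk h28 hF h => ?_) (by simp [h12])).mono ?_ fun τ h => ⟨?_, h.2⟩
  · have f0 := hF.realArr 0 rfl
    simp only [Cmd.wp, IExp.eval, RExp.eval, h28, f0, hT.len k hk, Store.setR_real, if_true, h,
      Finset.sum_range_succ]
    push_cast
    ring
  · rw [Nat.sub_add_cancel hn]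
    simp only [Cmd.bound, IExp.cost, RExp.cost]
    omega
  · rw [Large, h.1, Finset.sum_range]
    refine le_of_eq ?_
    congr 1
    exact Finset.sum_congr rfl fun e _ => by rw [WeightedTree.nlen, dif_pos e.2]

end DistCmd

end RealRAM

namespace TreeLocation

namespace WeightedTree

variable {n p : ℕ} {T : WeightedTree n} {x : Fin p → T.Point} {f g : ℕ → ℝ}

/-- The initial values for the first points of a list. -/
structure IsSeedUpTo (x : Fin p → T.Point) (k : ℕ) (f : ℕ → ℝ) : Prop where
  lower : ∀ (u : ℕ) (hu : u < n), ∃ j, T.pointDist ⟨u, hu⟩ (x j) ≤ f u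
  node : ∀ j : Fin p, j < k → ∀ v, x j = .node v → f v ≤ 0
  inner : ∀ j : Fin p, j < k → ∀ e t h1 h2, x j = .inner e t h1 h2 →
    f (T.src e) ≤ t ∧ f (T.dst e) ≤ T.len e - t

theorem IsSeedUpTo.isSeed (h : IsSeedUpTo x p f) : IsSeed x f :=
  ⟨h.lower, fun j => h.node j j.2, fun j => h.inner j j.2⟩

theorem IsSeedUpTo.update {k : ℕ} (h : IsSeedUpTo x k f) (j : Fin p) {u : Fin n} {c : ℝ}
    (hc : T.pointDist u (x j) ≤ c) : IsSeedUpTo x k (Function.update f u (min (f u) c)) := by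
  refine ⟨fun v hv => ?_, fun i hi v e => (update_min_le _ _ _ _).trans (h.node i hi v e),
    fun i hi e t h1 h2 hx => ⟨(update_min_le _ _ _ _).trans (h.inner i hi e t h1 h2 hx).1,
      (update_min_le _ _ _ _).trans (h.inner i hi e t h1 h2 hx).2⟩⟩
  by_cases e : v = u
  · subst e
    rw [Function.update_self]
    rcases min_choice (f u) c with e | e <;> rw [e]
    exacts [h.lower u hv, ⟨j, hc⟩]
  · rw [Function.update_of_ne e]
    exact h.lower v hv

theorem IsSeedUpTo.succ {k : Fin p} (h : IsSeedUpTo x k f) (h1 : ∀ v, x k = .node v → f v ≤ 0)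
    (h2 : ∀ e t h1 h2, x k = .inner e t h1 h2 → f (T.src e) ≤ t ∧ f (T.dst e) ≤ T.len e - t) :
    IsSeedUpTo x (k + 1) f := by
  refine ⟨h.lower, fun j hj => ?_, fun j hj => ?_⟩
  all_goals
    rcases Nat.lt_succ_iff_lt_or_eq.1 hj with hj | hj
  exacts [h.node j hj, Fin.ext hj ▸ h1, h.inner j hj, Fin.ext hj ▸ h2]

end WeightedTree

end TreeLocation

namespace RealRAM

open TreeLocation WeightedTree

/-- The memory holds the list `x` of points. -/
structure HoldsPoints {n p : ℕ} {T : WeightedTree n} (x : Fin p → T.Point) (σ : Store) : Prop where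
  count : σ.idx 1 = p
  code : ∀ j : Fin p, σ.idxArr 2 j = (x j).code
  offset : ∀ j : Fin p, σ.realArr 2 j = (x j).offset

namespace DistCmd

/-- Compute the initial values for the distances from the points. -/
def seeds : Cmd :=
  Cmd.forUp 28 (.var 1)
    (.setIdx 24 (.read 2 (.var 28)) ;;
      .ite (.idxLt (.var 24) (.var 0)) (.lower 4 (.var 24) (.lit 0))
        (.setIdx 25 (.sub (.var 24) (.var 0)) ;;
          .lower 4 (.read 0 (.var 25)) (.read 2 (.var 28)) ;;
          .lower 4 (.read 1 (.var 25)) (.sub (.read 0 (.var 25)) (.read 2 (.var 28)))))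

variable {n p : ℕ} {T : WeightedTree n} {x : Fin p → T.Point} {σ : Store}

/-- Entries are only lowered to numbers that are at least the distance of the node from the current
point, so they stay above true distances. The offset in an edge may exceed the distance from an end
node only in that harmless direction. The bound `p ≤ n` makes the loop linear in `n`. -/
theorem seeds_runs (hT : Holds T σ) (hx : HoldsPoints x σ) (hp : p ≤ n)
    (hs : IsSeedUpTo x 0 (σ.realArr 4)) : Runs seeds σ (70 * (n + 1)) fun τ =>
      IsSeed x (τ.realArr 4) ∧ Frame seeds σ τ := by
  refine (Runs.forUp_wp (σ := σ) p (fun k τ => IsSeedUpTo x k (τ.realArr 4)) rfl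
      (fun τ hf => by exact (hf.idx 1 rfl).trans hx.count)
      (fun _ _ _ h => h) (fun k τ hk h28 hF h => ?_) hs).mono ?_
      fun τ h => ⟨h.1.isSeed, h.2⟩
  · have f0 := hF.idxArr 0 rfl
    have f1 := hF.idxArr 1 rfl
    have f2 := hF.idxArr 2 rfl
    have g0 := hF.realArr 0 rfl
    have g2 := hF.realArr 2 rfl
    have e0 := (hF.idx 0 rfl).trans hT.size
    have hc := hx.code ⟨k, hk⟩
    have ho := hx.offset ⟨k, hk⟩
    simp only at hc ho
    refine ⟨fun hlt => ?_, fun hlt => ?_⟩ <;>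
      simp only [Test.Holds, IExp.eval, Store.setI_idx, if_true, h28, f2, hc,
        show ((0 : ℕ) = 24) = False by simp, if_false, e0] at hlt
    · refine Cmd.wp_lower ?_
      simp only [IExp.eval, RExp.eval, Store.setI_idx, Store.setI_realArr,
        if_true, h28, f2, hc, Store.setRA_realArr, Nat.cast_zero]
      cases hxk : x ⟨k, hk⟩ with
      | node v =>
        rw [Point.code]
        refine IsSeedUpTo.succ (k := ⟨k, hk⟩) (h.update ⟨k, hk⟩ (u := v) ?_) (fun w e => ?_)
          fun e t h1 h2 e' => ?_
        · rw [hxk, pointDist, T.dist_self]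
        · rw [hxk, Point.node.injEq] at e
          rw [e, Function.update_self]
          exact min_le_right _ _
        · rw [hxk] at e'
          cases e'
      | inner e t h1 h2 =>
        rw [hxk, Point.code] at hlt
        omega
    · cases hxk : x ⟨k, hk⟩ with
      | node v =>
        rw [hxk, Point.code] at hlt
        exact absurd v.2 hlt
      | inner e t h1 h2 =>
        rw [hxk, Point.code] at hc
        rw [hxk, Point.offset] at ho
        have he := e.2
        refine Cmd.wp_lower (Cmd.wp_lower ?_)
        simp only [IExp.eval, RExp.eval, Store.setI_idx, Store.setI_idxArr, Store.setI_realArr,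
          Store.setRA_idx, Store.setRA_idxArr,
          if_true, h28, f2, hc, Store.setRA_realArr, f0, f1, g0, g2, ho, e0,
          show ((28 : ℕ) = 24) = False by simp, show ((28 : ℕ) = 25) = False by simp,
          show ((0 : ℕ) = 24) = False by simp, show ((0 : ℕ) = 4) = False by simp,
          show ((2 : ℕ) = 4) = False by simp, if_false, Nat.add_sub_cancel_left,
          hT.src _ he, hT.dst _ he, hT.len _ he, nsrc, ndst, nlen, dif_pos he]
        refine IsSeedUpTo.succ (k := ⟨k, hk⟩) (IsSeedUpTo.update (IsSeedUpTo.update h ⟨k, hk⟩ ?_)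
          ⟨k, hk⟩ ?_) (fun w e => ?_) fun e' t' h1' h2' e'' => ?_
        · rw [hxk, pointDist, T.dist_self, zero_add]
          exact min_le_left _ _
        · rw [hxk, pointDist, T.dist_self, zero_add]
          exact min_le_right _ _
        · rw [hxk] at e
          cases e
        · rw [hxk, Point.inner.injEq] at e''
          obtain ⟨rfl, rfl⟩ := e''
          refine ⟨(update_min_le _ _ _ _).trans ?_, ?_⟩ <;> rw [Function.update_self] <;>
            exact min_le_right _ _
  · refine (Nat.mul_le_mul_left _ (Nat.succ_le_succ hp)).trans (Nat.mul_le_mul_right _ ?_)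
    simp [Cmd.bound, Cmd.lower, IExp.cost, RExp.cost, Test.cost]

/-- Compute the distances of the nodes from the points. -/
def nearest : Cmd := fill 4 ;; seeds ;; relax 4

theorem nearest_runs (hp : 0 < p) (hpn : p ≤ n) (hT : Holds T σ) (hR : Rooted T σ)
    (hx : HoldsPoints x σ) (hL : Large T σ) : Runs nearest σ (170 * (n + 1)) fun τ =>
      (∀ v < n, τ.realArr 4 v = listDist x v) ∧ Frame nearest σ τ := by
  refine Runs.mono (Runs.frame ((fill_runs hT.size).seq (t' := 70 * (n + 1) + 80 * (n + 1))
    (Q := fun τ => ∀ v < n, τ.realArr 4 v = listDist x v) fun τ ⟨h1, F1⟩ => ?_)) (by omega)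
    fun _ h => h
  have hT1 : Holds T τ := ⟨(F1.idx 0 rfl).trans hT.size, F1.idxArr 0 rfl ▸ hT.src,
    F1.idxArr 1 rfl ▸ hT.dst, F1.realArr 0 rfl ▸ hT.len⟩
  have hx1 : HoldsPoints x τ := ⟨(F1.idx 1 rfl).trans hx.count, F1.idxArr 2 rfl ▸ hx.code,
    F1.realArr 2 rfl ▸ hx.offset⟩
  refine (seeds_runs hT1 hx1 hpn ⟨fun u hu => ⟨⟨0, hp⟩, ?_⟩, fun j hj => absurd hj (by simp),
    fun j hj => absurd hj (by simp)⟩).seq fun υ ⟨h2, F2⟩ => ?_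
  · rw [h1 u hu]
    exact (T.pointDist_le_sum _ _).trans hL
  · refine (relax_runs (T := T) (by omega) ((F2.idx 0 rfl).trans hT1.size) (Rooted.congr hR
      ((F2.idxArr 5 rfl).trans (F1.idxArr 5 rfl)) ((F2.idxArr 6 rfl).trans (F1.idxArr 6 rfl))
      ((F2.idxArr 7 rfl).trans (F1.idxArr 7 rfl)) ((F2.realArr 3 rfl).trans (F1.realArr 3 rfl)))
      (by decide)).mono le_rfl fun ω ⟨h3, _⟩ v hv => ?_
    exact h2.listDist_eq hp (fun v hv => (h3 v hv).1) (fun v hv => (h3 v hv).2) hv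

end DistCmd

end RealRAM

/-! ### Finding the candidates by binary lifting -/

namespace TreeLocation

namespace WeightedTree

variable {n : ℕ} {T : WeightedTree n} {u v : ℕ}

theorem lev_zero : T.lev 0 = 0 := by
  rw [lev]
  split_ifs
  · rw [path_self]
    rfl
  · rfl

theorem eq_zero_of_lev (hv : v < n) (h : T.lev v = 0) : v = 0 := by
  by_contra h0
  have := lev_par (T := T) hv h0
  omega

theorem iterate_par_lt (hv : v < n) (k : ℕ) : T.par^[k] v < n := by
  induction k with
  | zero => exact hv
  | succ k ih =>
    rw [Function.iterate_succ_apply']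
    exact par_lt ih

theorem lev_iterate_par (hv : v < n) (k : ℕ) : T.lev (T.par^[k] v) ≤ T.lev v - k := by
  induction k with
  | zero => exact le_rfl
  | succ k ih =>
    rw [Function.iterate_succ_apply']
    by_cases h0 : T.par^[k] v = 0
    · rw [h0, par_zero, lev_zero]
      exact Nat.zero_le _
    · have := lev_par (T := T) (iterate_par_lt hv k) h0
      omega

end WeightedTree

end TreeLocation

namespace RealRAM

open TreeLocation WeightedTree

/-- The rule for loops, with the frame as part of the invariant. -/
theorem Runs.loop_frame {G : Type*} {b : Test} {c : Cmd} {σ : Store} (I : G → Store → Prop)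
    (μ : G → ℕ) (T : ℕ) (step : ∀ g τ, I g τ → b.Holds τ → Frame (.loop b c) σ τ →
      Runs c τ T fun υ => ∃ g', I g' υ ∧ μ g' < μ g) (g : G) (h : I g σ) :
    Runs (.loop b c) σ ((T + b.cost + 1) * μ g + b.cost + 1)
      fun τ => (∃ g', I g' τ ∧ ¬ b.Holds τ) ∧ Frame (.loop b c) σ τ := by
  refine (Runs.loop_const (fun g τ => I g τ ∧ Frame (.loop b c) σ τ) μ T
    (fun g τ hI hb => ?_) g σ ⟨h, Frame.refl _ _⟩).mono le_rfl
    fun τ ⟨g', h1, h2⟩ => ⟨⟨g', h1.1, h2⟩, h1.2⟩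
  refine (step g τ hI.1 hb hI.2).frame.mono le_rfl fun υ ⟨⟨g', h1, h2⟩, h3⟩ =>
    ⟨g', ⟨h1, hI.2.trans (h3.weaken fun _ _ h => h)⟩, h2⟩

/-- Row `k` of the table contains the iterates of order `2 ^ k` of the map to the parents. -/
def IsTable {n : ℕ} (T : WeightedTree n) (K : ℕ) (tab : ℕ → ℕ) : Prop :=
  ∀ k ≤ K, ∀ v < n, tab (k * n + v) = T.par^[2 ^ k] v

namespace LiftCmd

/-- The first row of the table. -/
def firstRow : Cmd :=
  Cmd.forUp 28 (.var 0) (.writeIdx 8 (.var 28) (.read 6 (.var 28))) ;;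
    .setIdx 29 (.lit 0) ;; .setIdx 30 (.lit 1)

/-- Append a row to the table. -/
def nextRow : Cmd :=
  Cmd.forUp 28 (.var 0)
    (.setIdx 24 (.read 8 (.add (.var 29) (.var 28))) ;;
      .writeIdx 8 (.add (.add (.var 29) (.var 0)) (.var 28)) (.read 8 (.add (.var 29) (.var 24)))) ;;
    .setIdx 29 (.add (.var 29) (.var 0)) ;; .setIdx 30 (.add (.var 30) (.var 30))

/-- Compute the table of the iterates. -/
def table : Cmd := firstRow ;; .loop (.idxLt (.var 30) (.var 0)) nextRow

variable {n : ℕ} {T : WeightedTree n} {σ : Store}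

theorem firstRow_runs (h0 : σ.idx 0 = n) (hR : Rooted T σ) : Runs firstRow σ (30 * (n + 1))
    fun τ => IsTable T 0 (τ.idxArr 8) ∧ τ.idx 29 = 0 ∧ τ.idx 30 = 1 := by
  refine Runs.mono (Runs.seq (Runs.forUp_wp (σ := σ) n (fun k τ => ∀ v < k, τ.idxArr 8 v = T.par v)
      rfl (fun τ hf => by exact (hf.idx 0 rfl).trans h0) (fun _ _ _ h => h)
      (fun k τ hk h28 hF h => ?_) fun j hj => absurd hj (Nat.not_lt_zero j))
      (t' := 4) (fun τ h => Runs.of_wp' ?_ (by simp [Cmd.bound, IExp.cost]))) ?_ fun _ h => h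
  · have f6 := hF.idxArr 6 rfl
    simp only [Cmd.wp, IExp.eval, h28, f6, Store.setIA_idxArr, if_true]
    intro v hv
    by_cases e : v = k
    · rw [e, Function.update_self, hR.par k hk]
    · rw [Function.update_of_ne e]
      exact h v (by omega)
  · refine ⟨fun k hk v hv => ?_, by simp [IExp.eval], by simp [IExp.eval]⟩
    obtain rfl := Nat.le_zero.1 hk
    simpa using h.1 v hv
  · simp only [Cmd.bound, IExp.cost]
    omega

/-- Two jumps of `2 ^ K` steps make one of `2 ^ (K + 1)`. The new row occupies cells behind all rows
that are read. -/
theorem nextRow_runs {K : ℕ} (h0 : σ.idx 0 = n) (h29 : σ.idx 29 = K * n) (h30 : σ.idx 30 = 2 ^ K)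
    (hK : IsTable T K (σ.idxArr 8)) : Runs nextRow σ (40 * (n + 1)) fun τ =>
      IsTable T (K + 1) (τ.idxArr 8) ∧ τ.idx 29 = (K + 1) * n ∧ τ.idx 30 = 2 ^ (K + 1) := by
  refine Runs.mono (Runs.seq (Runs.forUp_wp (σ := σ) n (fun j τ => IsTable T K (τ.idxArr 8) ∧
      ∀ v < j, τ.idxArr 8 (K * n + n + v) = T.par^[2 ^ (K + 1)] v)
      rfl (fun τ hf => by exact (hf.idx 0 rfl).trans h0) (fun _ _ _ h => h)
      (fun j τ hj h28 hF h => ?_) ⟨hK, fun j hj => absurd hj (Nat.not_lt_zero j)⟩)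
      (t' := 8) (fun τ ⟨h, hF⟩ => Runs.of_wp' ?_ (by simp [Cmd.bound, IExp.cost]))) ?_ fun _ h => h
  · have e0 := (hF.idx 0 rfl).trans h0
    have e29 := (hF.idx 29 rfl).trans h29
    obtain ⟨h1, h2⟩ := h
    simp only [Cmd.wp, IExp.eval, Store.setI_idx, Store.setI_idxArr, h28, e0, e29,
      Store.setIA_idxArr, if_true, show ((28 : ℕ) = 24) = False by simp,
      show ((29 : ℕ) = 24) = False by simp, show ((0 : ℕ) = 24) = False by simp, if_false]
    rw [h1 K le_rfl j hj, h1 K le_rfl _ (iterate_par_lt hj _), ← Function.iterate_add_apply,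
      ← two_mul, ← pow_succ']
    refine ⟨fun k hk v hv => ?_, fun v hv => ?_⟩
    · have := Nat.mul_le_mul_right n hk
      rw [Function.update_of_ne (by omega)]
      exact h1 k hk v hv
    · by_cases e : v = j
      · rw [e, Function.update_self]
      · rw [Function.update_of_ne (by omega)]
        exact h2 v (by omega)
  · have e0 := (hF.idx 0 rfl).trans h0
    have e29 := (hF.idx 29 rfl).trans h29
    have e30 := (hF.idx 30 rfl).trans h30
    simp only [Cmd.wp, IExp.eval, Store.setI_idx, Store.setI_idxArr, e0, e29, e30, if_true,
      show ((29 : ℕ) = 30) = False by simp, show ((30 : ℕ) = 29) = False by simp, if_false]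
    refine ⟨fun k hk v hv => ?_, by ring, by ring⟩
    rcases Nat.le_succ_iff.1 hk with hk | rfl
    · exact h.1 k hk v hv
    · rw [Nat.succ_mul]
      exact h.2 v hv
  · simp only [Cmd.bound, IExp.cost]
    omega

/-- Rows are appended until `2 ^ K` reaches `n`, which is more than any level; this takes at most
`Nat.clog 2 n` doublings. -/
theorem table_runs (hn : 0 < n) (h0 : σ.idx 0 = n) (hR : Rooted T σ) :
    Runs table σ (50 * (n + 1) * (Nat.clog 2 n + 1)) fun τ => (∃ K, K ≤ Nat.clog 2 n ∧ n ≤ 2 ^ K ∧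
      IsTable T K (τ.idxArr 8) ∧ τ.idx 29 = K * n ∧ τ.idx 30 = 2 ^ K) ∧ Frame table σ τ := by
  refine Runs.mono (Runs.frame (Runs.seq (firstRow_runs h0 hR).frame (fun τ ⟨⟨h1, h2, h3⟩, hF⟩ =>
    (Runs.loop_frame (σ := τ) (fun K υ => K ≤ Nat.clog 2 n ∧ IsTable T K (υ.idxArr 8) ∧
      υ.idx 29 = K * n ∧ υ.idx 30 = 2 ^ K) (fun K => Nat.clog 2 n - K) (40 * (n + 1))
      (fun K υ hI hb hF' => ?_) 0 ⟨Nat.zero_le _, h1, by simpa using h2, by simpa using h3⟩).mono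
      le_rfl fun υ hυ => ?_))) ?_ fun _ h => h
  · have e0 := ((hF'.idx 0 rfl).trans (hF.idx 0 rfl)).trans h0
    simp only [Test.Holds, IExp.eval, hI.2.2.2, e0] at hb
    have hlt : K < Nat.clog 2 n := (Nat.lt_clog_iff_pow_lt one_lt_two).2 hb
    exact (nextRow_runs e0 hI.2.2.1 hI.2.2.2 hI.2.1).mono le_rfl fun ω hω =>
      ⟨K + 1, ⟨hlt, hω⟩, by omega⟩
  · obtain ⟨⟨K, ⟨i1, i2, i3, i4⟩, hb⟩, hF'⟩ := hυ
    have e0 := ((hF'.idx 0 rfl).trans (hF.idx 0 rfl)).trans h0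
    simp only [Test.Holds, IExp.eval, i4, e0, not_lt] at hb
    exact ⟨K, i1, hb, i2, i3, i4⟩
  · simp only [Test.cost, IExp.cost, Nat.sub_zero]
    nlinarith [Nat.zero_le (n * Nat.clog 2 n)]

end LiftCmd

end RealRAM

namespace TreeLocation

/-- The node `a` is an ancestor of `u` at distance less than `r u`, and less than `2 ^ g` steps
lead from `a` to the highest such node. -/
structure IsClimb {n : ℕ} (T : WeightedTree n) (r : ℕ → ℝ) (u g a : ℕ) : Prop where
  mem : u ∈ Sub T.par a
  close : 0 < r u → T.ndist u a < r u
  high : 0 < r u → T.lev a < 2 ^ g ∨ r u ≤ T.ndist u (T.par^[2 ^ g] a)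

namespace IsClimb

open WeightedTree

variable {n : ℕ} {T : WeightedTree n} {r : ℕ → ℝ} {u g a : ℕ}

theorem start (hu : u < n) (hg : n ≤ 2 ^ g) : IsClimb T r u g u :=
  ⟨mem_sub_self u, fun h => by rwa [ndist_self], fun _ => Or.inl ((lev_lt hu).trans_le hg)⟩

/-- A jump that stays within the bound is made; it uses up `2 ^ g` of the less than `2 ^ (g + 1)`
steps that remain. If instead it would go too far, `stay` records this as the new upper limit. The
search relies on distances to ancestors growing with height only through this limit. -/
theorem up (h : IsClimb T r u (g + 1) a) (hu : u < n)
    (hr : T.ndist u (T.par^[2 ^ g] a) < r u) : IsClimb T r u g (T.par^[2 ^ g] a) := by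
  have ha := (T.rootedMetric (by omega)).sub_lt hu h.mem
  refine ⟨mem_sub_trans h.mem ⟨_, rfl⟩, fun _ => hr, fun h0 => ?_⟩
  rcases h.high h0 with h1 | h1
  · left
    have h2 := lev_iterate_par (T := T) ha (2 ^ g)
    have := Nat.pos_of_ne_zero (pow_ne_zero g two_ne_zero)
    rw [pow_succ] at h1
    omega
  · right
    rwa [← Function.iterate_add_apply, ← two_mul, ← pow_succ']

theorem stay (h : IsClimb T r u (g + 1) a) (hr : r u ≤ T.ndist u (T.par^[2 ^ g] a)) :
    IsClimb T r u g a :=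
  ⟨h.mem, h.close, fun _ => Or.inr hr⟩

/-- With less than `2 ^ 0` steps left, `a` is the root, or already its parent is at distance at
least `r u`. -/
theorem isCandidate (h : IsClimb T r u 0 a) (hu : u < n) {H E : ℝ}
    (h1 : a ≠ 0 ∧ 0 < r u → H = r u - T.ndist u a ∧ E = -1)
    (h2 : ¬ (a ≠ 0 ∧ 0 < r u) → H = 0 ∧ E = 0) : IsCandidate T.par T.ndist r u a H E := by
  have ha := (T.rootedMetric (by omega)).sub_lt hu h.mem
  refine ⟨h.mem, fun ha0 hr => ?_, fun h0 => h2 fun h' => ?_, h.close⟩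
  · obtain ⟨e1, e2⟩ := h1 ⟨ha0, hr⟩
    refine ⟨e1, e2, ?_, by rw [e1]; linarith [h.close hr]⟩
    refine (h.high hr).resolve_left fun h3 => ha0 (eq_zero_of_lev (T := T) ha ?_)
    simpa using h3
  · rcases h0 with h0 | h0
    exacts [h'.1 h0, absurd h'.2 (not_lt.2 h0)]

/-- Distances to ancestors are differences of depths, so one array of depths suffices for all
comparisons during the search. -/
theorem ndist_eq_sub {b : ℕ} (hu : u < n) (h : u ∈ Sub T.par b) :
    T.ndist u b = T.ndist 0 u - T.ndist 0 b := by
  have hR := T.rootedMetric (show 0 < n by omega)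
  by_cases hb : b = 0
  · rw [hb, ndist_self, sub_zero, ndist_comm]
  · have := hR.through hu hR.root_lt h fun e => hb (hR.root_mem_sub e)
    rw [ndist_comm (u := 0), ndist_comm (u := 0), this, add_sub_cancel_right]

end IsClimb

end TreeLocation

namespace RealRAM

open TreeLocation WeightedTree

namespace LiftCmd

/-- Climb by one row of the table, where this is possible. -/
def climb : Cmd :=
  Cmd.forUp 28 (.var 0)
    (.setIdx 24 (.read 8 (.add (.var 29) (.read 9 (.var 28)))) ;;
      .ite (.realLt (.sub (.read 5 (.var 28)) (.read 5 (.var 24))) (.read 4 (.var 28)))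
        (.writeIdx 9 (.var 28) (.var 24)) .skip) ;;
    .setIdx 29 (.sub (.var 29) (.var 0)) ;; .setIdx 30 (.half (.var 30))

/-- Find the highest ancestors at distances below the bounds. -/
def ascend : Cmd :=
  Cmd.forUp 28 (.var 0) (.writeIdx 9 (.var 28) (.var 28)) ;;
    .loop (.idxLt (.lit 0) (.var 30)) climb

/-- Compute the heights of the candidates. -/
def heights : Cmd :=
  Cmd.forUp 28 (.var 0)
    (.setIdx 24 (.read 9 (.var 28)) ;;
      .ite (.and (.not (.idxEq (.var 24) (.lit 0))) (.realLt (.lit 0) (.read 4 (.var 28))))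
        (.writeReal 6 (.var 28)
            (.sub (.read 4 (.var 28)) (.sub (.read 5 (.var 28)) (.read 5 (.var 24)))) ;;
          .writeReal 7 (.var 28) (.sub (.lit 0) (.lit 1)))
        (.writeReal 6 (.var 28) (.lit 0) ;; .writeReal 7 (.var 28) (.lit 0)))

variable {n : ℕ} {T : WeightedTree n} {σ : Store} {r : ℕ → ℝ}

theorem climb_runs {K g : ℕ} (hg : g ≤ K) (h0 : σ.idx 0 = n) (h29 : σ.idx 29 = g * n)
    (h30 : σ.idx 30 = 2 ^ g) (hK : IsTable T K (σ.idxArr 8)) (h4 : ∀ v < n, σ.realArr 4 v = r v)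
    (h5 : ∀ v < n, σ.realArr 5 v = T.ndist 0 v)
    (hA : ∀ u < n, IsClimb T r u (g + 1) (σ.idxArr 9 u)) :
    Runs climb σ (60 * (n + 1)) fun τ => (∀ u < n, IsClimb T r u g (τ.idxArr 9 u)) ∧
      τ.idx 29 = (g - 1) * n ∧ τ.idx 30 = 2 ^ g / 2 := by
  refine Runs.mono (Runs.seq (Runs.forUp_wp (σ := σ) n (fun j τ =>
      (∀ u < j, IsClimb T r u g (τ.idxArr 9 u)) ∧
      ∀ u < n, j ≤ u → IsClimb T r u (g + 1) (τ.idxArr 9 u))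
      rfl (fun τ hf => by exact (hf.idx 0 rfl).trans h0) (fun _ _ _ h => h)
      (fun j τ hj h28 hF h => ?_)
      ⟨fun j hj => absurd hj (Nat.not_lt_zero j), fun u hu _ => hA u hu⟩)
      (t' := 7) (fun τ ⟨h, hF⟩ => Runs.of_wp' ?_ (by simp [Cmd.bound, IExp.cost]))) ?_ fun _ h => h
  · have e29 := (hF.idx 29 rfl).trans h29
    have f8 := hF.idxArr 8 rfl
    have f4 := hF.realArr 4 rfl
    have f5 := hF.realArr 5 rfl
    obtain ⟨h1, h2⟩ := h
    have hc := h2 j hj le_rfl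
    have ha := (T.rootedMetric (by omega)).sub_lt hj hc.mem
    have hb := iterate_par_lt (T := T) ha (2 ^ g)
    have hm : j ∈ Sub T.par (T.par^[2 ^ g] (τ.idxArr 9 j)) := mem_sub_trans hc.mem ⟨_, rfl⟩
    simp only [Cmd.wp, Test.Holds, IExp.eval, RExp.eval, Store.setI_idx, Store.setI_idxArr,
      Store.setI_realArr, h28, e29, f8, f4, f5, if_true, show ((28 : ℕ) = 24) = False by simp,
      if_false, Store.setIA_idxArr, hK g hg _ ha, h4 j hj, h5 j hj, h5 _ hb,
      ← IsClimb.ndist_eq_sub hj hm]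
    refine ⟨fun hr => ⟨fun u hu => ?_, fun u hu hju => ?_⟩,
      fun hr => ⟨fun u hu => ?_, fun u hu hju => h2 u hu (by omega)⟩⟩
    · by_cases e : u = j
      · rw [e, Function.update_self]
        exact hc.up hj hr
      · rw [Function.update_of_ne e]
        exact h1 u (by omega)
    · rw [Function.update_of_ne (by omega)]
      exact h2 u hu (by omega)
    · by_cases e : u = j
      · rw [e]
        exact hc.stay (not_lt.1 hr)
      · exact h1 u (by omega)
  · have e0 := (hF.idx 0 rfl).trans h0
    have e29 := (hF.idx 29 rfl).trans h29
    have e30 := (hF.idx 30 rfl).trans h30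
    simp only [Cmd.wp, IExp.eval, Store.setI_idx, Store.setI_idxArr, e0, e29, e30, if_true,
      show ((29 : ℕ) = 30) = False by simp, show ((30 : ℕ) = 29) = False by simp, if_false]
    exact ⟨h.1, by rw [Nat.sub_mul, one_mul], trivial⟩
  · simp only [Cmd.bound, IExp.cost, RExp.cost, Test.cost]
    omega

theorem ascend_runs {K : ℕ} (hK1 : K ≤ Nat.clog 2 n) (hK2 : n ≤ 2 ^ K) (h0 : σ.idx 0 = n)
    (h29 : σ.idx 29 = K * n) (h30 : σ.idx 30 = 2 ^ K) (hK : IsTable T K (σ.idxArr 8))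
    (h4 : ∀ v < n, σ.realArr 4 v = r v) (h5 : ∀ v < n, σ.realArr 5 v = T.ndist 0 v) :
    Runs ascend σ (100 * (n + 1) * (Nat.clog 2 n + 1)) fun τ =>
      (∀ u < n, IsClimb T r u 0 (τ.idxArr 9 u)) ∧ Frame ascend σ τ := by
  refine Runs.mono (Runs.frame (Runs.seq (Runs.forUp_wp (σ := σ) n
      (fun j τ => ∀ u < j, τ.idxArr 9 u = u)
      rfl (fun τ hf => by exact (hf.idx 0 rfl).trans h0) (fun _ _ _ h => h)
      (fun j τ hj h28 hF h => ?_) fun j hj => absurd hj (Nat.not_lt_zero j))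
      -- The ghost number `g` counts the rows still to be used. Variable `30` holds `2 ^ g / 2`,
      -- which becomes `0` exactly when no row is left; the row offset `(g - 1) * n` is truncated
      -- there.
      (fun τ ⟨h, hF⟩ => (Runs.loop_frame (σ := τ) (fun g υ => g ≤ K + 1 ∧
        (∀ u < n, IsClimb T r u g (υ.idxArr 9 u)) ∧ υ.idx 29 = (g - 1) * n ∧
        υ.idx 30 = 2 ^ g / 2) id (60 * (n + 1)) (fun g υ hI hb hF' => ?_) (K + 1)
        ⟨le_rfl, fun u hu => ?_, ?_, ?_⟩).mono le_rfl fun υ hυ => ?_))) ?_ fun _ h => h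
  · simp only [Cmd.wp, IExp.eval, h28, Store.setIA_idxArr, if_true]
    intro u hu
    by_cases e : u = j
    · rw [e, Function.update_self]
    · rw [Function.update_of_ne e]
      exact h u (by omega)
  · obtain ⟨i1, i2, i3, i4⟩ := hI
    cases g with
    | zero =>
      simp [Test.Holds, IExp.eval, i4] at hb
    | succ g =>
      refine (climb_runs (T := T) (r := r) (K := K) (g := g) (by omega)
        ((hF'.idx 0 rfl).trans ((hF.idx 0 rfl).trans h0)) (by simpa using i3)
        (by rw [i4, pow_succ, Nat.mul_div_cancel _ two_pos])
        ((hF'.idxArr 8 rfl).trans (hF.idxArr 8 rfl) ▸ hK)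
        ((hF'.realArr 4 rfl).trans (hF.realArr 4 rfl) ▸ h4)
        ((hF'.realArr 5 rfl).trans (hF.realArr 5 rfl) ▸ h5) i2).mono le_rfl fun ω hω =>
          ⟨g, ⟨by omega, hω⟩, Nat.lt_succ_self g⟩
  · rw [h u hu]
    exact IsClimb.start hu (hK2.trans (Nat.pow_le_pow_right two_pos (Nat.le_succ K)))
  · rw [Nat.add_sub_cancel]
    exact (hF.idx 29 rfl).trans h29
  · rw [pow_succ, Nat.mul_div_cancel _ two_pos]
    exact (hF.idx 30 rfl).trans h30
  · obtain ⟨⟨g, ⟨i1, i2, i3, i4⟩, hb⟩, -⟩ := hυ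
    cases g with
    | zero => exact i2
    | succ g =>
      refine absurd ?_ hb
      simp only [Test.Holds, IExp.eval, i4]
      rw [pow_succ, Nat.mul_div_cancel _ two_pos]
      exact Nat.pos_of_ne_zero (pow_ne_zero g two_ne_zero)
  · simp only [Test.cost, IExp.cost, Cmd.bound, id]
    have := Nat.mul_le_mul_left (60 * (n + 1) + 4) hK1
    nlinarith [Nat.zero_le (n * Nat.clog 2 n)]

theorem heights_runs (h0 : σ.idx 0 = n) (h4 : ∀ v < n, σ.realArr 4 v = r v)
    (h5 : ∀ v < n, σ.realArr 5 v = T.ndist 0 v)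
    (hA : ∀ u < n, IsClimb T r u 0 (σ.idxArr 9 u)) : Runs heights σ (60 * (n + 1)) fun τ =>
      (∀ u < n, IsCandidate T.par T.ndist r u (σ.idxArr 9 u) (τ.realArr 6 u) (τ.realArr 7 u)) ∧
      Frame heights σ τ := by
  refine (Runs.forUp_wp (σ := σ) n (fun j τ => ∀ u < j, IsCandidate T.par T.ndist r u
      (σ.idxArr 9 u) (τ.realArr 6 u) (τ.realArr 7 u))
      rfl (fun τ hf => by exact (hf.idx 0 rfl).trans h0) (fun _ _ _ h => h)
      (fun j τ hj h28 hF h => ?_) fun j hj => absurd hj (Nat.not_lt_zero j)).mono ?_ fun _ h => h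
  · have f9 := hF.idxArr 9 rfl
    have f4 := hF.realArr 4 rfl
    have f5 := hF.realArr 5 rfl
    have hc := hA j hj
    have ha := (T.rootedMetric (by omega)).sub_lt hj hc.mem
    simp only [Cmd.wp, Test.Holds, IExp.eval, RExp.eval, Store.setI_idx,
      Store.setI_realArr, Store.setRA_idx, Store.setRA_realArr, h28, f9, f4, f5, if_true,
      show ((28 : ℕ) = 24) = False by simp,
      show ((6 : ℕ) = 7) = False by simp,
      show ((7 : ℕ) = 6) = False by simp,
      if_false, Nat.cast_zero, h4 j hj, h5 j hj, h5 _ ha,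
      ← IsClimb.ndist_eq_sub hj hc.mem]
    refine ⟨fun hr u hu => ?_, fun hr u hu => ?_⟩ <;> by_cases e : u = j
    · rw [e, Function.update_self, Function.update_self]
      exact hc.isCandidate hj (fun _ => ⟨rfl, by norm_num⟩) fun h => absurd hr h
    · rw [Function.update_of_ne e, Function.update_of_ne e]
      exact h u (by omega)
    · rw [e, Function.update_self, Function.update_self]
      exact hc.isCandidate hj (fun h => absurd h hr) fun _ => ⟨rfl, rfl⟩
    · rw [Function.update_of_ne e, Function.update_of_ne e]
      exact h u (by omega)
  · simp only [Cmd.bound, IExp.cost, RExp.cost, Test.cost]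
    omega

/-- Compute the candidates. -/
def candidates : Cmd := DistCmd.distFrom 5 (.lit 0) ;; table ;; ascend ;; heights

theorem candidates_runs (hn : 0 < n) (h0 : σ.idx 0 = n) (hR : Rooted T σ)
    (hL : DistCmd.Large T σ) (h4 : ∀ v < n, σ.realArr 4 v = r v) :
    Runs candidates σ (330 * (n + 1) * (Nat.clog 2 n + 1)) fun τ =>
      (∀ u < n, IsCandidate T.par T.ndist r u (τ.idxArr 9 u) (τ.realArr 6 u) (τ.realArr 7 u)) ∧
      Frame candidates σ τ := by
  refine Runs.mono (Runs.frame ((DistCmd.distFrom_runs hR h0 hL (g := 5) (a := .lit 0) (by decide)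
    hn (fun _ _ => rfl) (by simp [IExp.cost])).seq (t' := 50 * (n + 1) * (Nat.clog 2 n + 1) +
      (100 * (n + 1) * (Nat.clog 2 n + 1) + 60 * (n + 1))) (Q := fun τ => ∀ u < n,
      IsCandidate T.par T.ndist r u (τ.idxArr 9 u) (τ.realArr 6 u) (τ.realArr 7 u))
    fun τ ⟨h1, F1⟩ => (table_runs (T := T) hn ((F1.idx 0 rfl).trans h0) (Rooted.congr hR
      (F1.idxArr 5 rfl) (F1.idxArr 6 rfl) (F1.idxArr 7 rfl) (F1.realArr 3 rfl))).seq
    fun υ ⟨⟨K, i1, i2, i3, i4, i5⟩, F2⟩ => ?_)) ?_ fun _ h => h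
  · have e0 := (F2.idx 0 rfl).trans ((F1.idx 0 rfl).trans h0)
    have e4 := ((F2.realArr 4 rfl).trans (F1.realArr 4 rfl)) ▸ h4
    have e5 := (F2.realArr 5 rfl) ▸ h1
    refine (ascend_runs i1 i2 e0 i4 i5 i3 e4 e5).seq fun ω ⟨h3, F3⟩ => ?_
    refine (heights_runs ((F3.idx 0 rfl).trans e0) (F3.realArr 4 rfl ▸ e4)
      (F3.realArr 5 rfl ▸ e5) h3).mono le_rfl fun χ ⟨h6, F4⟩ u hu => ?_
    rw [F4.idxArr 9 rfl]
    exact h6 u hu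
  · nlinarith [Nat.zero_le (n * Nat.clog 2 n)]

end LiftCmd

end RealRAM

/-! ### The best candidate as a point of the tree -/

namespace RealRAM

open TreeLocation WeightedTree

namespace OutputCmd

/-- Find the candidate with the highest score. -/
def argmax : Cmd :=
  .setIdx 31 (.lit 0) ;;
    Cmd.forUp 28 (.var 0)
      (.ite (.realLt (.read 15 (.add (.add (.var 0) (.var 0)) (.var 31)))
          (.read 15 (.add (.add (.var 0) (.var 0)) (.var 28))))
        (.setIdx 31 (.var 28)) .skip)

variable {n : ℕ} {T : WeightedTree n} {σ : Store} {r s : ℕ → ℝ}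

theorem argmax_runs (hn : 0 < n) (h0 : σ.idx 0 = n) (hs : ∀ u < n, σ.realArr 15 (2 * n + u) = s u) :
    Runs argmax σ (40 * (n + 1)) fun τ => (τ.idx 31 < n ∧ ∀ u < n, s u ≤ s (τ.idx 31)) ∧
      Frame argmax σ τ := by
  refine Runs.mono (Runs.frame (Runs.wp_seq (s := 2) (t := 32 * (n + 1)) (Q := fun τ =>
    τ.idx 31 < n ∧ ∀ u < n, s u ≤ s (τ.idx 31)) ?_ (by simp [Cmd.bound, IExp.cost])))
    (by omega) fun _ h => h
  simp only [Cmd.wp, IExp.eval]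
  refine (Runs.forUp_wp (σ := σ.setI 31 0) n (fun j τ => τ.idx 31 < n ∧
      ∀ u < j, s u ≤ s (τ.idx 31))
      rfl (fun τ hf => by exact (hf.idx 0 rfl).trans h0) (fun k τ j h => by simpa using h)
      (fun j τ hj h28 hF h => ?_) ⟨by simpa using hn, fun j hj => absurd hj (Nat.not_lt_zero j)⟩
      ).mono (by simp only [Cmd.bound, IExp.cost, RExp.cost, Test.cost]; omega) fun _ h => h.1
  have f15 : τ.realArr 15 = σ.realArr 15 := hF.realArr 15 rfl
  have e0 : τ.idx 0 = n := (hF.idx 0 rfl).trans h0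
  obtain ⟨h1, h2⟩ := h
  simp only [Cmd.wp, Test.Holds, IExp.eval, RExp.eval, Store.setI_idx, if_true, h28, f15, e0,
    ← two_mul, hs j hj, hs _ h1]
  refine ⟨fun hlt => ⟨hj, fun u hu => ?_⟩, fun hle => ⟨h1, fun u hu => ?_⟩⟩ <;>
    rcases Nat.lt_succ_iff_lt_or_eq.1 hu with hu | rfl
  exacts [(h2 u hu).trans hlt.le, le_rfl, h2 u hu, not_lt.1 hle]

/-- Find half the least gap by which the supremum of the heights at which a node wins exceeds
zero or the height of the candidate. -/
def gap : Cmd :=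
  .setReal 13 (.read 6 (.var 31)) ;; .setReal 14 (.var 13) ;;
    Cmd.forUp 28 (.var 0)
      (.setReal 15 (.add (.sub (.read 4 (.var 28)) (.read 16 (.var 28))) (.var 13)) ;;
        .ite (.and (.realLt (.lit 0) (.var 15)) (.realLt (.var 15) (.var 14)))
          (.setReal 14 (.var 15)) .skip)

/-- Lowering an infinitesimal candidate to an actual point must not lose a node outside the subtree
of `a`. Each such node allows a positive slack, and the least of these and `H` is computed. -/
theorem gap_runs {a b : ℕ} {H : ℝ} (h0 : σ.idx 0 = n) (h31 : σ.idx 31 = b)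
    (h6 : σ.realArr 6 b = H) (hH : 0 < H) (h4 : ∀ v < n, σ.realArr 4 v = r v)
    (h16 : ∀ v < n, σ.realArr 16 v = T.ndist a v) : Runs gap σ (50 * (n + 1)) fun τ =>
      (0 < τ.real 14 ∧ τ.real 14 ≤ H ∧ ∀ v < n, 0 < r v - T.ndist a v + H →
        τ.real 14 ≤ r v - T.ndist a v + H) ∧ τ.real 13 = H ∧ Frame gap σ τ := by
  refine Runs.mono (Runs.frame (Runs.wp_seq (s := 3) (t := 43 * (n + 1)) (Q := fun τ =>
    (0 < τ.real 14 ∧ τ.real 14 ≤ H ∧ ∀ v < n, 0 < r v - T.ndist a v + H →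
        τ.real 14 ≤ r v - T.ndist a v + H) ∧ τ.real 13 = H)
    ?_ (by simp [Cmd.bound, IExp.cost, RExp.cost])))
    (by omega) fun _ h => ⟨h.1.1, h.1.2, h.2⟩
  simp only [Cmd.wp, IExp.eval, RExp.eval, h31, h6]
  refine (Runs.wp_seq (s := 2) (t := 41 * (n + 1)) ?_ (by simp [Cmd.bound, RExp.cost])).mono
    (by omega) fun _ h => h
  simp only [Cmd.wp, RExp.eval]
  refine (Runs.forUp_wp (σ := _) n (fun j τ => 0 < τ.real 14 ∧ τ.real 14 ≤ H ∧
      ∀ v < j, 0 < r v - T.ndist a v + H → τ.real 14 ≤ r v - T.ndist a v + H)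
      rfl (fun τ hf => by exact (hf.idx 0 rfl).trans h0) (fun _ _ _ h => h)
      (fun j τ hj h28 hF h => ?_) ⟨by simpa using hH, by simp, fun j hj =>
        absurd hj (Nat.not_lt_zero j)⟩).mono
      (by simp only [Cmd.bound, IExp.cost, RExp.cost, Test.cost]; omega) fun τ h =>
        ⟨h.1, by rw [h.2.real 13 rfl]; simp⟩
  have f4 : τ.realArr 4 = σ.realArr 4 := hF.realArr 4 rfl
  have f16 : τ.realArr 16 = σ.realArr 16 := hF.realArr 16 rfl
  have e13 : τ.real 13 = H := by rw [hF.real 13 rfl]; simp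
  obtain ⟨h1, h2, h3⟩ := h
  simp only [Cmd.wp, Test.Holds, IExp.eval, RExp.eval, Store.setR_real, if_true,
    h28, f4, f16, e13, h4 j hj, h16 j hj, Nat.cast_zero, show ((14 : ℕ) = 15) = False by simp,
    if_false]
  refine ⟨fun ⟨l1, l2⟩ => ⟨l1, by linarith, fun v hv h => ?_⟩, fun hl => ⟨h1, h2, fun v hv h => ?_⟩⟩
    <;> rcases Nat.lt_succ_iff_lt_or_eq.1 hv with hv | rfl
  · exact l2.le.trans (h3 v hv h)
  · exact le_rfl
  · exact h3 v hv h
  · exact not_lt.1 fun h' => hl ⟨h, h'⟩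

/-- Write the location that belongs to a candidate above a node. -/
def inner : Cmd :=
  DistCmd.distFrom 16 (.var 32) ;; gap ;;
    .setReal 0 (.sub (.var 13) (.div (.var 14) (.lit 2))) ;; .setIdx 24 (.read 7 (.var 32)) ;;
    .ite (.idxEq (.read 0 (.var 24)) (.var 32)) .skip
      (.setReal 0 (.sub (.read 0 (.var 24)) (.var 0))) ;;
    .setIdx 0 (.add (.var 0) (.var 24))

/-- Write the location that belongs to the best candidate. -/
def write : Cmd :=
  .setIdx 32 (.read 9 (.var 31)) ;;
    .ite (.realLt (.lit 0) (.read 6 (.var 31))) inner (.setReal 0 (.lit 0) ;; .setIdx 0 (.var 32))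

/-- The candidate is realized at height `H - ε` above `a`. As `0 < ε < H ≤ T.lenUp a`, this is an
interior point of the edge above `a`. -/
theorem inner_runs {a b : ℕ} {H : ℝ} (hT : Holds T σ) (hR : Rooted T σ) (hL : DistCmd.Large T σ)
    (h4 : ∀ v < n, σ.realArr 4 v = r v) (h31 : σ.idx 31 = b) (h32 : σ.idx 32 = a)
    (h6 : σ.realArr 6 b = H) (hH : 0 < H) (ha : a < n) (ha0 : a ≠ 0) (hHa : H ≤ T.lenUp a) :
    Runs inner σ (200 * (n + 1)) fun τ => ∃ y : T.Point, τ.idx 0 = y.code ∧ τ.real 0 = y.offset ∧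
      ∀ v : Fin n, Wins T.par T.ndist r a H (-1) v → T.pointDist v y < r v := by
  refine ((DistCmd.distFrom_runs hR hT.size hL (g := 16) (a := .var 32) (by decide) ha
    (fun τ hf => by exact (hf.idx 32 rfl).trans h32) (by simp [IExp.cost])).seq
    (t' := 50 * (n + 1) + 28) fun τ ⟨h1, F1⟩ =>
    (gap_runs (T := T) (r := r) (a := a) ((F1.idx 0 rfl).trans hT.size) ((F1.idx 31 rfl).trans h31)
      (F1.realArr 6 rfl ▸ h6) hH (F1.realArr 4 rfl ▸ h4) h1).seq fun υ ⟨⟨i1, i2, i3⟩, i4, F2⟩ =>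
    Runs.of_wp' ?_ (by simp [Cmd.bound, IExp.cost, RExp.cost, Test.cost])).mono (by omega)
    fun _ h => h
  have he := edge_lt (T := T) ha ha0
  have e0 := (F2.idx 0 rfl).trans ((F1.idx 0 rfl).trans hT.size)
  have e32 := (F2.idx 32 rfl).trans ((F1.idx 32 rfl).trans h32)
  have f7 := (F2.idxArr 7 rfl).trans (F1.idxArr 7 rfl)
  have f0 := (F2.idxArr 0 rfl).trans (F1.idxArr 0 rfl)
  have g0 := (F2.realArr 0 rfl).trans (F1.realArr 0 rfl)
  have hl : T.len ⟨T.edge a, he⟩ = T.lenUp a := by rw [← nlen_edge ha ha0, nlen, dif_pos]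
  -- Half of the gap, as the slack has to exceed `ε` strictly.
  set ε := υ.real 14 / 2 with hε
  have hwin : ∀ y : T.Point, (∀ v : Fin n, T.pointDist v y = locDist T.par T.ndist a (H - ε) v) →
      ∀ v : Fin n, Wins T.par T.ndist r a H (-1) v → T.pointDist v y < r v := fun y hy v hv => by
    rw [hy v]
    refine locDist_lt_of_wins (by linarith) (fun h => ?_) hv
    have := i3 v v.2 (by linarith)
    linarith
  simp only [Cmd.wp, Test.Holds, IExp.eval, RExp.eval, Store.setR_idx, Store.setR_idxArr,
    Store.setR_realArr, Store.setI_idx, Store.setI_idxArr, Store.setI_real, Store.setI_realArr,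
    Store.setR_real, if_true, e0, e32, f7, f0, g0, i4, hR.edge a ha ha0, hT.src _ he, hT.len _ he,
    nlen_edge ha ha0, Nat.cast_ofNat, ← hε, show ((32 : ℕ) = 24) = False by simp,
    show ((0 : ℕ) = 24) = False by simp, if_false]
  -- Offsets are measured from the first end node of the edge, which may be `a` or its parent.
  refine ⟨fun hs => ⟨.inner ⟨T.edge a, he⟩ (H - ε) (by linarith) (by linarith), rfl, rfl,
    hwin _ fun v => ?_⟩, fun hs => ⟨.inner ⟨T.edge a, he⟩ (T.lenUp a - (H - ε)) (by linarith)
    (by linarith), rfl, rfl, hwin _ fun v => ?_⟩⟩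
  · rw [pointDist_inner ha ha0, if_pos hs]
  · rw [pointDist_inner ha ha0, if_neg hs, sub_sub_cancel]

theorem write_runs (hT : Holds T σ) (hR : Rooted T σ) (hL : DistCmd.Large T σ)
    (h4 : ∀ v < n, σ.realArr 4 v = r v) {b : ℕ} (h31 : σ.idx 31 = b) (hb : b < n) {a : ℕ} {H E : ℝ}
    (h9 : σ.idxArr 9 b = a) (h6 : σ.realArr 6 b = H)
    (hc : IsCandidate T.par T.ndist r b a H E) :
    Runs write σ (210 * (n + 1)) fun τ => (∃ y : T.Point, τ.idx 0 = y.code ∧ τ.real 0 = y.offset ∧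
      ∀ v : Fin n, Wins T.par T.ndist r a H E v → T.pointDist v y < r v) ∧ Frame write σ τ := by
  have hM := T.rootedMetric (show 0 < n by omega)
  have ha := hM.sub_lt hb hc.mem
  refine Runs.mono (Runs.frame (Runs.wp_seq (s := 3) (t := 5 + 1 + 200 * (n + 1)) (Q := fun τ =>
    ∃ y : T.Point, τ.idx 0 = y.code ∧ τ.real 0 = y.offset ∧
      ∀ v : Fin n, Wins T.par T.ndist r a H E v → T.pointDist v y < r v) ?_
    (by simp [Cmd.bound, IExp.cost]))) (by omega) fun _ h => h
  simp only [Cmd.wp, IExp.eval, h31, h9]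
  refine (Runs.ite (t := 200 * (n + 1)) (fun h => ?_) fun h => Runs.of_wp' ?_ ?_).mono
    (by simp [Test.cost, RExp.cost, IExp.cost]) fun _ h => h
  all_goals
    simp only [Test.Holds, IExp.eval, RExp.eval, Store.setI_idx, Store.setI_realArr, h31, h6,
      show ((31 : ℕ) = 32) = False by simp, if_false, Nat.cast_zero] at h
  -- A positive height occurs only for candidates with the infinitesimal part `-1`; all others are
  -- nodes.
  · have hin : ¬ (a = 0 ∨ r b ≤ 0) := fun h' => by
      have := (hc.outer h').1
      linarith
    push Not at hin
    obtain ⟨l1, l2, l3, l4⟩ := hc.inner hin.1 hin.2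
    rw [hM.to_par hb hc.mem hin.1] at l3
    rw [l2]
    exact inner_runs ⟨hT.size, hT.src, hT.dst, hT.len⟩ (Rooted.congr hR rfl rfl rfl rfl) hL h4
      h31 rfl h6 h ha hin.1 (by linarith)
  · obtain ⟨l1, l2⟩ : H = 0 ∧ E = 0 := by
      by_cases h' : a = 0 ∨ r b ≤ 0
      · exact hc.outer h'
      · push Not at h'
        exact absurd (hc.inner h'.1 h'.2).2.2.2 h
    refine ⟨.node ⟨a, ha⟩, by simp [IExp.eval, Point.code], by simp [RExp.eval, Point.offset],
      fun v hv => ?_⟩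
    rw [l1, l2, wins_zero] at hv
    rwa [pointDist, ← ndist_eq v.2 ha, ndist_comm]
  · simp only [Cmd.bound, RExp.cost, IExp.cost]
    omega

end OutputCmd

end RealRAM

/-! ### The two programs and their running time -/

namespace RealRAM

open TreeLocation WeightedTree

namespace MedianoidCmd

/-- Root the tree and compute the distances from the points. -/
def prepare : Cmd := RootCmd.root ;; DistCmd.large ;; DistCmd.nearest

/-- Take each node as its own candidate. -/
def nodeCandidates : Cmd := Cmd.forUp 28 (.var 0) (.writeIdx 9 (.var 28) (.var 28))

/-- The highest score. -/
def bestScore : RExp := .read 15 (.add (.add (.var 0) (.var 0)) (.var 31))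

/-- The program for the discrete problem. -/
def discrete : Cmd :=
  prepare ;; nodeCandidates ;; computeScores ;; OutputCmd.argmax ;;
    .setReal 1 bestScore ;; .setIdx 0 (.var 31)

/-- The program for the absolute problem. -/
def absolute : Cmd :=
  prepare ;; LiftCmd.candidates ;; computeScores ;; OutputCmd.argmax ;;
    .setReal 1 bestScore ;; OutputCmd.write

variable {n p : ℕ} {T : WeightedTree n} {x : Fin p → T.Point} {σ : Store}

theorem holds_input : Holds T (T.input x) := ⟨rfl, fun _ _ => rfl, fun _ _ => rfl, fun _ _ => rfl⟩

theorem holdsPoints_input : HoldsPoints x (T.input x) :=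
  ⟨rfl, fun j => dif_pos j.2, fun j => dif_pos j.2⟩

theorem input_idxArr (a i : ℕ) (ha : 3 ≤ a) : (T.input x).idxArr a i = 0 := by
  simp only [input]
  rw [if_neg (by omega), if_neg (by omega), if_neg (by omega)]

theorem input_realArr (a i : ℕ) (ha : 3 ≤ a) : (T.input x).realArr a i = 0 := by
  simp only [input]
  rw [if_neg (by omega), if_neg (by omega), if_neg (by omega)]

/-- The memory holds a rooted tree and the distances of its nodes from the points `x`. -/
structure Prepared (x : Fin p → T.Point) (σ : Store) : Prop where
  holds : Holds T σ
  rooted : Rooted T σ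
  large : DistCmd.Large T σ
  dist : ∀ v < n, σ.realArr 4 v = listDist x v

theorem prepare_runs (hp : 0 < p) (hpn : p ≤ n) : Runs prepare (T.input x) (370 * (n + 1))
    fun τ => Prepared x τ ∧ Frame prepare (T.input x) τ := by
  have hn : 0 < n := by omega
  refine Runs.mono (Runs.frame ((RootCmd.root_runs (T := T) (σ := T.input x) hn holds_input
    (fun a ha i => input_idxArr a i (by omega)) (input_realArr 3 0 le_rfl)).seq
    (t' := 20 * (n + 1) + 170 * (n + 1)) (Q := Prepared x) fun τ1 ⟨h1, F1⟩ => ?_)) (by omega)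
    fun _ h => h
  have H1 : Holds T τ1 := ⟨(F1.idx 0 rfl).trans holds_input.size,
    F1.idxArr 0 rfl ▸ holds_input.src, F1.idxArr 1 rfl ▸ holds_input.dst,
    F1.realArr 0 rfl ▸ holds_input.len⟩
  refine (DistCmd.large_runs hn H1 (F1.real 12 rfl)).seq fun τ2 ⟨h2, F2⟩ => ?_
  have H2 : Holds T τ2 := ⟨(F2.idx 0 rfl).trans H1.size,
    F2.idxArr 0 rfl ▸ H1.src, F2.idxArr 1 rfl ▸ H1.dst, F2.realArr 0 rfl ▸ H1.len⟩
  have R2 : Rooted T τ2 := h1.congr (F2.idxArr 5 rfl) (F2.idxArr 6 rfl) (F2.idxArr 7 rfl)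
    (F2.realArr 3 rfl)
  have hx := holdsPoints_input (x := x)
  refine (DistCmd.nearest_runs hp hpn H2 R2 ⟨(F2.idx 1 rfl).trans ((F1.idx 1 rfl).trans hx.count),
    (F2.idxArr 2 rfl).trans (F1.idxArr 2 rfl) ▸ hx.code,
    (F2.realArr 2 rfl).trans (F1.realArr 2 rfl) ▸ hx.offset⟩ h2).mono le_rfl
    fun τ3 ⟨h3, F3⟩ => ⟨⟨(F3.idx 0 rfl).trans H2.size,
    F3.idxArr 0 rfl ▸ H2.src, F3.idxArr 1 rfl ▸ H2.dst, F3.realArr 0 rfl ▸ H2.len⟩,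
    R2.congr (F3.idxArr 5 rfl) (F3.idxArr 6 rfl) (F3.idxArr 7 rfl) (F3.realArr 3 rfl), ?_, h3⟩
  rw [DistCmd.Large, F3.real 12 rfl]
  exact h2

/-- A bound for the running time of the evaluation of the candidates. -/
noncomputable def scoreTime (n : ℕ) : ℕ :=
  1000 * (n + 1) + ((2200 * (3 * n + 1) + 4) * ⌊13 * Real.log (3 * n : ℕ)⌋₊ + 4)

/-- Evaluate the candidates and determine the best one. -/
theorem best_runs (hn : 0 < n) (h : Prepared x σ) (hw : σ.realArr 1 = (T.input x).realArr 1)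
    (hlt : ∀ u < n, σ.idxArr 9 u < n)
    (hz : ∀ a, a = 12 ∨ a = 19 ∨ a = 20 → σ.idxArr a = (T.input x).idxArr a)
    (hz' : ∀ a, 9 ≤ a → a ≤ 15 → σ.realArr a = (T.input x).realArr a) {d : Cmd} {t : ℕ}
    {Q : Store → Prop} (hd : ∀ τ b, Prepared x τ → τ.idxArr 9 = σ.idxArr 9 →
      τ.realArr 6 = σ.realArr 6 → τ.realArr 7 = σ.realArr 7 → τ.real 0 = σ.real 0 →
      τ.idx 31 = b → b < n →
      (∀ u < n, T.score (listDist x) (σ.idxArr 9 u) (σ.realArr 6 u) (σ.realArr 7 u) ≤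
        T.score (listDist x) (σ.idxArr 9 b) (σ.realArr 6 b) (σ.realArr 7 b)) →
      τ.real 1 = T.score (listDist x) (σ.idxArr 9 b) (σ.realArr 6 b) (σ.realArr 7 b) →
      Runs d τ t Q) :
    Runs (computeScores ;; OutputCmd.argmax ;; .setReal 1 bestScore ;; d) σ
      (scoreTime n + (40 * (n + 1) + (7 + t))) Q := by
  refine (computeScores_runs (r := listDist x) hn ⟨h.holds.size, h.rooted.par,
    h.rooted.len, fun v hv => by rw [hw]; rfl, h.dist, hlt, fun a ha i => ?_,
    fun a h1 h2 i => ?_⟩).seq fun τ ⟨h1, F1⟩ => (OutputCmd.argmax_runs hn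
      ((F1.idx 0 rfl).trans h.holds.size) h1).seq fun υ ⟨⟨i1, i2⟩, F2⟩ => Runs.wp_seq ?_ (by
        simp [Cmd.bound, RExp.cost, IExp.cost, bestScore])
  · rw [hz a ha, input_idxArr a i (by omega)]
  · rw [hz' a h1 h2, input_realArr a i (by omega)]
  have e0 := (F2.idx 0 rfl).trans ((F1.idx 0 rfl).trans h.holds.size)
  simp only [Cmd.wp, RExp.eval, IExp.eval, e0, bestScore]
  have e15 : υ.realArr 15 (n + n + υ.idx 31) = T.score (listDist x) (σ.idxArr 9 (υ.idx 31))
      (σ.realArr 6 (υ.idx 31)) (σ.realArr 7 (υ.idx 31)) := by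
    rw [F2.realArr 15 rfl, ← two_mul, h1 _ i1]
  rw [e15]
  have k5 := (F2.idxArr 5 rfl).trans (F1.idxArr 5 rfl)
  refine hd _ (υ.idx 31) ⟨⟨e0, (F2.idxArr 0 rfl).trans (F1.idxArr 0 rfl) ▸ h.holds.src,
    (F2.idxArr 1 rfl).trans (F1.idxArr 1 rfl) ▸ h.holds.dst,
    (F2.realArr 0 rfl).trans (F1.realArr 0 rfl) ▸ h.holds.len⟩, h.rooted.congr k5
    ((F2.idxArr 6 rfl).trans (F1.idxArr 6 rfl)) ((F2.idxArr 7 rfl).trans (F1.idxArr 7 rfl))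
    ((F2.realArr 3 rfl).trans (F1.realArr 3 rfl)), ?_,
    (F2.realArr 4 rfl).trans (F1.realArr 4 rfl) ▸ h.dist⟩
    ((F2.idxArr 9 rfl).trans (F1.idxArr 9 rfl)) ((F2.realArr 6 rfl).trans (F1.realArr 6 rfl))
    ((F2.realArr 7 rfl).trans (F1.realArr 7 rfl)) ?_ rfl i1 i2 (by simp)
  · rw [DistCmd.Large, Store.setR_real, if_neg (by decide), F2.real 12 rfl, F1.real 12 rfl]
    exact h.large
  · rw [Store.setR_real, if_neg (by decide), F2.real 0 rfl, F1.real 0 rfl]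

/-- A bound for the running time of the two programs. -/
noncomputable def time (n : ℕ) : ℕ := 1000 * (n + 1) * (Nat.clog 2 n + 1) + scoreTime n

/-- The nodes are their own candidates, with heights and infinitesimal parts zero; `score_node`
identifies their scores with the gains. -/
theorem discrete_solves : SolvesMedianoid
    (fun T r X Y => TreeLocation.WeightedTree.IsDiscreteMedianoid T r X Y) discrete time := by
  intro n p T x hp hpn
  have hn : 0 < n := by omega
  have key : Runs discrete (T.input x) (time n) fun τ => ∃ y : T.Point,
      T.Reports τ y (T.gain {y} (Set.range x)) ∧
      T.IsDiscreteMedianoid 1 (Set.range x) {y} := by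
    refine ((prepare_runs (x := x) hp hpn).seq fun τ ⟨h1, F1⟩ => (Runs.forUp_wp (σ := τ) n
      (fun j υ => ∀ u < j, υ.idxArr 9 u = u)
      rfl (fun υ hf => by exact (hf.idx 0 rfl).trans h1.holds.size) (fun _ _ _ h => h)
      (fun j υ hj h28 hF h => ?_) fun j hj => absurd hj (Nat.not_lt_zero j)).seq
      fun υ ⟨h2, F2⟩ => best_runs (x := x) (t := 2) hn ?_ ?_ (fun u hu => (h2 u hu).trans_lt hu)
        (fun a ha => ?_) (fun a ha ha' => ?_)
        fun ω b h3 e9 e6 e7 e0 e31 hb hmax e1 => Runs.of_wp' ?_ (by simp [Cmd.bound, IExp.cost])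
      ).mono ?_ fun _ h => h
    · simp only [Cmd.wp, IExp.eval, h28, Store.setIA_idxArr, if_true]
      intro u hu
      by_cases e : u = j
      · rw [e, Function.update_self]
      · rw [Function.update_of_ne e]
        exact h u (by omega)
    · simp only [Cmd.bound, IExp.cost, time]
      nlinarith [Nat.zero_le (n * Nat.clog 2 n)]
    · refine ⟨⟨(F2.idx 0 rfl).trans h1.holds.size, F2.idxArr 0 rfl ▸ h1.holds.src,
        F2.idxArr 1 rfl ▸ h1.holds.dst, F2.realArr 0 rfl ▸ h1.holds.len⟩,
        h1.rooted.congr (F2.idxArr 5 rfl) (F2.idxArr 6 rfl) (F2.idxArr 7 rfl) (F2.realArr 3 rfl),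
        ?_, F2.realArr 4 rfl ▸ h1.dist⟩
      rw [DistCmd.Large, F2.real 12 rfl]
      exact h1.large
    · exact (F2.realArr 1 rfl).trans (F1.realArr 1 rfl)
    · rcases ha with rfl | rfl | rfl
      exacts [(F2.idxArr 12 rfl).trans (F1.idxArr 12 rfl),
        (F2.idxArr 19 rfl).trans (F1.idxArr 19 rfl), (F2.idxArr 20 rfl).trans (F1.idxArr 20 rfl)]
    · interval_cases a <;> exact (F2.realArr _ rfl).trans (F1.realArr _ rfl)
    -- The arrays of heights and infinitesimal parts and the reported offset have not been written
    -- yet and still contain the initial zeros.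
    · have z6 : ∀ u, υ.realArr 6 u = 0 := fun u => by
        rw [F2.realArr 6 rfl, F1.realArr 6 rfl, input_realArr 6 u (by omega)]
      have z7 : ∀ u, υ.realArr 7 u = 0 := fun u => by
        rw [F2.realArr 7 rfl, F1.realArr 7 rfl, input_realArr 7 u (by omega)]
      have z0 : υ.real 0 = 0 := by
        rw [F2.real 0 rfl, F1.real 0 rfl]
        rfl
      simp only [z6, z7] at hmax e1
      rw [h2 b hb] at hmax e1
      simp only [Cmd.wp, IExp.eval, e31]
      refine ⟨.node ⟨b, hb⟩, ⟨by simp [Point.code], ?_, ?_⟩,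
        isDiscreteMedianoid_of_best x fun u hu => ?_⟩
      · rw [Store.setI_real, e0, z0, Point.offset]
      · rw [Store.setI_real, e1, ← score_node]
      · have := hmax u hu
        rwa [h2 u hu] at this
  obtain ⟨t, τ, h1, h2, y, h3, h4⟩ := key
  exact ⟨t, τ, y, h1, h2, h3, h4⟩

/-- The best score is an upper bound for the gain of every point, by domination, and the point
written by `OutputCmd.write` wins every node that the best candidate wins. So its gain is the score,
which was stored before. -/
theorem absolute_solves : SolvesMedianoid
    (fun T r X Y => TreeLocation.WeightedTree.IsAbsoluteMedianoid T r X Y) absolute time := by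
  intro n p T x hp hpn
  have hn : 0 < n := by omega
  have key : Runs absolute (T.input x) (time n) fun τ => ∃ y : T.Point,
      T.Reports τ y (T.gain {y} (Set.range x)) ∧
      T.IsAbsoluteMedianoid 1 (Set.range x) {y} := by
    refine ((prepare_runs (x := x) hp hpn).seq fun τ ⟨h1, F1⟩ => (LiftCmd.candidates_runs hn
      h1.holds.size h1.rooted h1.large h1.dist).seq fun υ ⟨h2, F2⟩ => best_runs (x := x) hn ?_ ?_
        (fun u hu => (T.rootedMetric hn).sub_lt hu (h2 u hu).mem) (fun a ha => ?_)
        (fun a ha ha' => ?_)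
        fun ω b h3 e9 e6 e7 e0 e31 hb hmax e1 => (OutputCmd.write_runs h3.holds h3.rooted h3.large
          h3.dist e31 hb (congrFun e9 b) (congrFun e6 b) (h2 b hb)).mono le_rfl
          fun χ ⟨⟨y, hy1, hy2, hy3⟩, F4⟩ => ?_).mono ?_ fun _ h => h
    · refine ⟨⟨(F2.idx 0 rfl).trans h1.holds.size, F2.idxArr 0 rfl ▸ h1.holds.src,
        F2.idxArr 1 rfl ▸ h1.holds.dst, F2.realArr 0 rfl ▸ h1.holds.len⟩,
        h1.rooted.congr (F2.idxArr 5 rfl) (F2.idxArr 6 rfl) (F2.idxArr 7 rfl) (F2.realArr 3 rfl),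
        ?_, F2.realArr 4 rfl ▸ h1.dist⟩
      rw [DistCmd.Large, F2.real 12 rfl]
      exact h1.large
    · exact (F2.realArr 1 rfl).trans (F1.realArr 1 rfl)
    · rcases ha with rfl | rfl | rfl
      exacts [(F2.idxArr 12 rfl).trans (F1.idxArr 12 rfl),
        (F2.idxArr 19 rfl).trans (F1.idxArr 19 rfl), (F2.idxArr 20 rfl).trans (F1.idxArr 20 rfl)]
    · interval_cases a <;> exact (F2.realArr _ rfl).trans (F1.realArr _ rfl)
    · simp only [time]
      nlinarith [Nat.zero_le (n * Nat.clog 2 n)]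
    · obtain ⟨g1, g2⟩ := isAbsoluteMedianoid_of_best x hn h2 hmax hy3
      exact ⟨y, ⟨hy1, hy2, by rw [F4.real 1 rfl, e1, g1]⟩, g2⟩
  obtain ⟨t, τ, h1, h2, y, h3, h4⟩ := key
  exact ⟨t, τ, y, h1, h2, h3, h4⟩

/-- The logarithms in `time` are taken of `n` to base `2` and of `3 * n`; both are constant
multiples of `log n`, up to an additive constant that is absorbed because `log n ≥ 1` for `n ≥ 3`.
-/
theorem time_isBigO : Asymptotics.IsBigO Filter.atTop (fun n : ℕ => (time n : ℝ))
    fun n : ℕ => (n : ℝ) * Real.log (n : ℝ) := by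
  -- The table and the passes contribute at most `8000`, the contraction `208000` times `n * log n`;
  -- the rest is linear with a small factor.
  refine Asymptotics.IsBigO.of_bound 300000 ?_
  filter_upwards [Filter.eventually_ge_atTop 3] with n hn
  have hn' : (3 : ℝ) ≤ n := by exact_mod_cast hn
  have h1 : 1 ≤ Real.log n := by
    rw [Real.le_log_iff_exp_le (by linarith)]
    linarith [Real.exp_one_lt_d9]
  have h3 : Real.log (3 * n : ℕ) ≤ 2 * Real.log n := by
    push_cast
    rw [Real.log_mul (by norm_num) (by positivity)]
    linarith [Real.log_le_log (by norm_num) hn']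
  have h2 : (Nat.clog 2 n : ℝ) ≤ 3 * Real.log n := by
    have e := Nat.pow_pred_clog_lt_self one_lt_two (show 1 < n by omega)
    have hc := Nat.clog_pos one_lt_two (show 1 < n by omega)
    have e' : ((2 : ℝ) ^ (Nat.clog 2 n).pred) ≤ n := by exact_mod_cast e.le
    have e2 := Real.log_le_log (by positivity) e'
    rw [Real.log_pow, Nat.pred_eq_sub_one, Nat.cast_sub hc, Nat.cast_one] at e2
    have hc' : (1 : ℝ) ≤ Nat.clog 2 n := by exact_mod_cast hc
    nlinarith [Real.log_two_gt_d9]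
  have h4 : (⌊13 * Real.log (3 * n : ℕ)⌋₊ : ℝ) ≤ 26 * Real.log n :=
    (Nat.floor_le (by have := Real.log_natCast_nonneg (3 * n); positivity)).trans (by linarith)
  have h5 : 0 ≤ (n : ℝ) * (Real.log n - 1) := mul_nonneg (by linarith) (by linarith)
  rw [Real.norm_of_nonneg (Nat.cast_nonneg _), Real.norm_of_nonneg (by positivity), time, scoreTime]
  push_cast at h4 ⊢
  have h6 : ((1000 : ℝ) * (n + 1) * (Nat.clog 2 n + 1)) ≤ 1000 * (2 * n) * (4 * Real.log n) := by
    gcongr <;> linarith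
  have h7 : ((2200 : ℝ) * (3 * n + 1) + 4) * ⌊13 * Real.log (3 * (n : ℝ))⌋₊ ≤
      8000 * n * (26 * Real.log n) := by
    gcongr
    linarith
  nlinarith

end MedianoidCmd

end RealRAM

theorem mainTheorem3 :
    (∃ (c : RealRAM.Cmd) (time : ℕ → ℕ),
      TreeLocation.SolvesMedianoid
        (fun T r X Y => TreeLocation.WeightedTree.IsDiscreteMedianoid T r X Y) c time ∧
      Asymptotics.IsBigO Filter.atTop
        (fun n : ℕ => (time n : ℝ)) (fun n : ℕ => (n : ℝ) * Real.log (n : ℝ))) ∧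
    (∃ (c : RealRAM.Cmd) (time : ℕ → ℕ),
      TreeLocation.SolvesMedianoid
        (fun T r X Y => TreeLocation.WeightedTree.IsAbsoluteMedianoid T r X Y) c time ∧
      Asymptotics.IsBigO Filter.atTop
        (fun n : ℕ => (time n : ℝ)) (fun n : ℕ => (n : ℝ) * Real.log (n : ℝ))) :=
  ⟨⟨_, _, RealRAM.MedianoidCmd.discrete_solves, RealRAM.MedianoidCmd.time_isBigO⟩,
    _, _, RealRAM.MedianoidCmd.absolute_solves, RealRAM.MedianoidCmd.time_isBigO⟩
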